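/- **Setting.** Let $(N,h,J,\sigma)$ be a Kähler manifold of real dimension $6$, with $\sigma=h(J\cdot,\cdot)$, endowed with a compatible $SU(3)$ structure $\psi^++i\psi^-$: smooth real 3-forms $\psi^\pm$ such that at every point there is an $h$-orthonormal coframe $e^1,\dots,e^6$ with $\sigma=e^{12}+e^{34}+e^{56}$ and $\psi^++i\psi^-=(e^1+ie^2)\wedge(e^3+ie^4)\wedge(e^5+ie^6)$. On functions put $d^cf=J\,df$, where $J\gamma=-\gamma\circ J$ on 1-forms. Let $Y$ be a 7-manifold with a torsion-free $G_2$ structure $\varphi$ (with metric $k$ and $d\varphi=0$, $d{*\varphi}=0$) and a nowhere zero infinitesimal isometry $V$ of it (so $\mathcal L_Vk=0$ and $\mathcal L_V\varphi=0$). We say that the $SU(3)$ structure on an open set $W\subseteq N$ is the *quotient* of $(Y,\varphi)$ by $V$, with function $t$, if there is a surjective smooth submersion $\pi:Y\to W$ whose fibres are the orbits of $V$ such that, up to pullback by $\pi$ and with $\eta=k(\cdot,t^2V)$, $$t=k(V,V)^{-1/2},\quad k=t\,h+t^{-2}\eta\otimes\eta,\quad \sigma=\iota_V\varphi,\quad \varphi=\sigma\wedge\eta+t\,\Psi^+,\quad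 \Psi^-=-\iota_V({*\varphi}),\quad \psi^\pm=t^{-1/2}\Psi^\pm .$$ For an open set $W\subseteq N$ and a function $t$ on $W$, consider the conditions (i) $t$ is smooth and positive, $d\psi^+=-\tfrac12(d^c\log t)\wedge\psi^-$ and $d\psi^-=\tfrac12(d^c\log t)\wedge\psi^+$ on $W$; (ii) the Hamiltonian vector field $U$ of $-t$ on $(W,\sigma)$, i.e. $\iota_U\sigma=-dt$, is an infinitesimal isometry of the $SU(3)$ structure: $\mathcal L_Uh=0$, $\mathcal L_U\sigma=0$, $\mathcal L_U\psi^\pm=0$. **Proposition.** 1. For every open $W\subseteq N$ (in particular $W=N$) and every function $t$ on $W$: each point of $W$ has an open neighbourhood in $W$ on which the $SU(3)$ structure is the quotient, with function $t$, of a 7-manifold with a torsion-free $G_2$ structure by a nowhere zero infinitesimal isometry, if and only if $t$ satisfies (i) and (ii) on $W$. 2. If the $SU(3)$ structure on $W\subseteq N$ is the quotient of $(Y,\varphi)$ by $V$ with function $t$, then $t$ satisfies (i) and (ii) on $W$, and each point of $Y$ has a neighbourhood that is diffeomorphic to a product $(a,b)\times W'$, with $W'\subseteq W$ open, in such a way that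 $\pi$ is the projection to $W'$ and $$k=t\,h+t^{-2}\eta\otimes\eta,\qquad V=\frac{\partial}{\partial v},\qquad \varphi=\sigma\wedge\eta+t^{3/2}\psi^+,\qquad {*\varphi}=t^{1/2}\psi^-\wedge\eta+\tfrac12t^2\,\sigma\wedge\sigma,\tag{$*$}$$ where $v$ is the coordinate on $(a,b)$ and $\eta=dv+\eta_N$ for a smooth 1-form $\eta_N$ on $W'$ with $$d\eta_N=-t^{1/2}\,\iota_U\psi^+ .\tag{$**$}$$ 3. If $t$ satisfies (i) and (ii) on an open set $W\subseteq N$, then each point of $W$ has an open neighbourhood $W'\subseteq W$ carrying a smooth 1-form $\eta_N$ with $(**)$; and for every open $W'\subseteq W$ and every smooth 1-form $\eta_N$ on $W'$ with $(**)$, the formulas $(*)$ with $\eta=dv+\eta_N$ define on $\mathbb R\times W'$ a torsion-free $G_2$ structure $\varphi$ with metric $k$ and dual form ${*\varphi}$, for which $V=\partial/\partial v$ is an infinitesimal isometry, and the quotient of $\mathbb R\times W'$ by $V$, with function $t$ and the projection to $W'$, is the $SU(3)$ structure on $W'$. -/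

import Mathlib

universe u w

open Set
open scoped Manifold ContDiff Bundle Topology

/-! ## Exterior algebra of a topological vector space -/

section Linear

variable {E : Type*} [AddCommGroup E] [Module ℝ E] [TopologicalSpace E]

/-- The continuous multilinear form `(v₁, …, v_{p+q}) ↦ α(v₁, …, v_p) β(v_{p+1}, …, v_{p+q})`. -/
def tensorForm {p q : ℕ} (α : E [⋀^Fin p]→L[ℝ] ℝ) (β : E [⋀^Fin q]→L[ℝ] ℝ) :
    ContinuousMultilinearMap ℝ (fun _ : Fin (p + q) => E) ℝ where
  toFun v := α (fun i => v (Fin.castAdd q i)) * β (fun j => v (Fin.natAdd p j))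
  map_update_add' := by
    intro d v i x y
    have hd : d = instDecidableEqFin (p + q) := Subsingleton.elim _ _
    subst hd
    refine Fin.addCases (fun i => ?_) (fun j => ?_) i
    · have h1 : ∀ z : E, (fun k => Function.update v (Fin.castAdd q i) z (Fin.castAdd q k))
          = Function.update (fun k => v (Fin.castAdd q k)) i z := by
        intro z; funext k
        by_cases h : k = i
        · subst h; simp
        · simp [h]
      have h2 : ∀ z : E, (fun k => Function.update v (Fin.castAdd q i) z (Fin.natAdd p k))
          = fun k => v (Fin.natAdd p k) := by
        intro z; funext k
        have : Fin.natAdd p k ≠ Fin.castAdd q i := by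
          intro h; have := congrArg Fin.val h; simp at this; omega
        simp [Function.update_of_ne this]
      simp only [h1, h2, ContinuousAlternatingMap.map_update_add, add_mul]
    · have h1 : ∀ z : E, (fun k => Function.update v (Fin.natAdd p j) z (Fin.natAdd p k))
          = Function.update (fun k => v (Fin.natAdd p k)) j z := by
        intro z; funext k
        by_cases h : k = j
        · subst h; simp
        · simp [h]
      have h2 : ∀ z : E, (fun k => Function.update v (Fin.natAdd p j) z (Fin.castAdd q k))
          = fun k => v (Fin.castAdd q k) := by
        intro z; funext k
        have : Fin.castAdd q k ≠ Fin.natAdd p j := by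
          intro h; have := congrArg Fin.val h; simp at this; omega
        simp [Function.update_of_ne this]
      simp only [h1, h2, ContinuousAlternatingMap.map_update_add, mul_add]
  map_update_smul' := by
    intro d v i c x
    have hd : d = instDecidableEqFin (p + q) := Subsingleton.elim _ _
    subst hd
    refine Fin.addCases (fun i => ?_) (fun j => ?_) i
    · have h1 : ∀ z : E, (fun k => Function.update v (Fin.castAdd q i) z (Fin.castAdd q k))
          = Function.update (fun k => v (Fin.castAdd q k)) i z := by
        intro z; funext k
        by_cases h : k = i
        · subst h; simp
        · simp [h]
      have h2 : ∀ z : E, (fun k => Function.update v (Fin.castAdd q i) z (Fin.natAdd p k))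
          = fun k => v (Fin.natAdd p k) := by
        intro z; funext k
        have : Fin.natAdd p k ≠ Fin.castAdd q i := by
          intro h; have := congrArg Fin.val h; simp at this; omega
        simp [Function.update_of_ne this]
      simp only [h1, h2, ContinuousAlternatingMap.map_update_smul, smul_eq_mul, mul_assoc]
    · have h1 : ∀ z : E, (fun k => Function.update v (Fin.natAdd p j) z (Fin.natAdd p k))
          = Function.update (fun k => v (Fin.natAdd p k)) j z := by
        intro z; funext k
        by_cases h : k = j
        · subst h; simp
        · simp [h]
      have h2 : ∀ z : E, (fun k => Function.update v (Fin.natAdd p j) z (Fin.castAdd q k))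
          = fun k => v (Fin.castAdd q k) := by
        intro z; funext k
        have : Fin.castAdd q k ≠ Fin.natAdd p j := by
          intro h; have := congrArg Fin.val h; simp at this; omega
        simp [Function.update_of_ne this]
      simp only [h1, h2, ContinuousAlternatingMap.map_update_smul, smul_eq_mul, mul_left_comm]
  cont := by
    refine Continuous.mul ?_ ?_
    · exact α.cont.comp (continuous_pi fun i => continuous_apply _)
    · exact β.cont.comp (continuous_pi fun i => continuous_apply _)

/-- The wedge product, normalised by `(α ∧ β)(u, v) = α(u) β(v) - α(v) β(u)` for covectors. -/
noncomputable def wedge {p q : ℕ} (α : E [⋀^Fin p]→L[ℝ] ℝ) (β : E [⋀^Fin q]→L[ℝ] ℝ) :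
    E [⋀^Fin (p + q)]→L[ℝ] ℝ :=
  ((p.factorial * q.factorial : ℝ)⁻¹) • (tensorForm α β).alternatization

/-- A covector as an alternating `1`-form. -/
def oneForm (γ : E →L[ℝ] ℝ) : E [⋀^Fin 1]→L[ℝ] ℝ :=
  ContinuousAlternatingMap.ofSubsingleton ℝ E ℝ (0 : Fin 1) γ

/-- The interior product `ι_X α = α(X, ·, …, ·)`. -/
def interiorProd {k : ℕ} (X : E) (α : E [⋀^Fin (k + 1)]→L[ℝ] ℝ) : E [⋀^Fin k]→L[ℝ] ℝ where
  toFun v := α (Matrix.vecCons X v)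
  map_update_add' := by
    intro d v i x y
    have hd : d = instDecidableEqFin k := Subsingleton.elim _ _
    subst hd
    simp only [Matrix.vecCons, Fin.cons_update, ContinuousAlternatingMap.map_update_add]
  map_update_smul' := by
    intro d v i c x
    have hd : d = instDecidableEqFin k := Subsingleton.elim _ _
    subst hd
    simp only [Matrix.vecCons, Fin.cons_update, ContinuousAlternatingMap.map_update_smul]
  cont := by
    refine α.cont.comp (continuous_pi fun i => ?_)
    refine Fin.cases ?_ (fun j => ?_) i
    · exact continuous_const
    · exact continuous_apply j
  map_eq_zero_of_eq' := by
    intro v i j hij hne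
    exact α.map_eq_zero_of_eq (i := i.succ) (j := j.succ) _ (by simpa using hij)
      (fun h => hne (Fin.succ_injective _ h))

/-- The pullback `(u, v) ↦ b(pu, pv)` of a bilinear form by a linear map. -/
noncomputable def pullbackBilin {F : Type*} [AddCommGroup F] [Module ℝ F] [TopologicalSpace F]
    (b : F →L[ℝ] F →L[ℝ] ℝ) (p : E →L[ℝ] F) : E →L[ℝ] E →L[ℝ] ℝ :=
  (ContinuousLinearMap.precomp ℝ p).comp (b.comp p)

/-- The bilinear form `γ ⊗ γ`. -/
noncomputable def sqCovector (γ : E →L[ℝ] ℝ) : E →L[ℝ] E →L[ℝ] ℝ :=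
  γ.smulRight γ

/-- `a ∧ b ∧ c` for covectors. -/
noncomputable def wedge₃ (a b c : E →L[ℝ] ℝ) : E [⋀^Fin 3]→L[ℝ] ℝ :=
  wedge (wedge (oneForm a) (oneForm b)) (oneForm c)

/-- `σ₀ = e¹² + e³⁴ + e⁵⁶` for a coframe (numbered from `0`). -/
noncomputable def stdSigma (e : Fin 6 → (E →L[ℝ] ℝ)) : E [⋀^Fin 2]→L[ℝ] ℝ :=
  wedge (oneForm (e 0)) (oneForm (e 1)) + wedge (oneForm (e 2)) (oneForm (e 3))
    + wedge (oneForm (e 4)) (oneForm (e 5))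

/-- The real part of `(e¹ + i e²) ∧ (e³ + i e⁴) ∧ (e⁵ + i e⁶)`. -/
noncomputable def stdPsiPlus (e : Fin 6 → (E →L[ℝ] ℝ)) : E [⋀^Fin 3]→L[ℝ] ℝ :=
  wedge₃ (e 0) (e 2) (e 4) - wedge₃ (e 0) (e 3) (e 5)
    - wedge₃ (e 1) (e 2) (e 5) - wedge₃ (e 1) (e 3) (e 4)

/-- The imaginary part of `(e¹ + i e²) ∧ (e³ + i e⁴) ∧ (e⁵ + i e⁶)`. -/
noncomputable def stdPsiMinus (e : Fin 6 → (E →L[ℝ] ℝ)) : E [⋀^Fin 3]→L[ℝ] ℝ :=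
  wedge₃ (e 0) (e 2) (e 5) + wedge₃ (e 0) (e 3) (e 4)
    + wedge₃ (e 1) (e 2) (e 4) - wedge₃ (e 1) (e 3) (e 5)

/-- The coframe `e` of a 6-dimensional space is adapted to `(h, σ, ψ⁺, ψ⁻)`: it is orthonormal for
`h`, and `σ`, `ψ⁺ + iψ⁻` have the standard form of the `SU(3)`-invariant forms of `ℂ³`. -/
def IsSU3Coframe (e : Fin 6 → (E →L[ℝ] ℝ)) (h : E →L[ℝ] E →L[ℝ] ℝ)
    (σ : E [⋀^Fin 2]→L[ℝ] ℝ) (ψp ψm : E [⋀^Fin 3]→L[ℝ] ℝ) : Prop :=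
  LinearIndependent ℝ e ∧ (∀ u v, h u v = ∑ i, e i u * e i v) ∧
    σ = stdSigma e ∧ ψp = stdPsiPlus e ∧ ψm = stdPsiMinus e

/-- The coframe `e` of a 7-dimensional space is adapted to the admissible 3-form `φ`, which takes
the standard form with stabiliser `G₂`, and `k`, `χ` are the inner product and the 4-form `*φ` that
`φ` determines: `e` is orthonormal for `k`, and `χ` is the Hodge dual of the standard 3-form with
respect to the inner product and the orientation for which `e` is oriented and orthonormal. -/
def IsG2Coframe (e : Fin 7 → (E →L[ℝ] ℝ)) (k : E →L[ℝ] E →L[ℝ] ℝ)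
    (φ : E [⋀^Fin 3]→L[ℝ] ℝ) (χ : E [⋀^Fin 4]→L[ℝ] ℝ) : Prop :=
  LinearIndependent ℝ e ∧ (∀ u v, k u v = ∑ i, e i u * e i v) ∧
    φ = wedge (stdSigma fun i => e i.castSucc) (oneForm (e 6))
      + stdPsiPlus (fun i => e i.castSucc) ∧
    χ = wedge (stdPsiMinus fun i => e i.castSucc) (oneForm (e 6))
      + (1 / 2 : ℝ) • wedge (stdSigma fun i => e i.castSucc) (stdSigma fun i => e i.castSucc)

end Linear

/-! ## Differential forms, vector fields and metrics on manifolds -/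

section Manifold

variable {E : Type*} [NormedAddCommGroup E] [NormedSpace ℝ E] {H : Type*} [TopologicalSpace H]
  (I : ModelWithCorners ℝ E H) {M : Type*} [TopologicalSpace M] [ChartedSpace H M]
  {E' : Type*} [NormedAddCommGroup E'] [NormedSpace ℝ E'] {H' : Type*} [TopologicalSpace H']
  (I' : ModelWithCorners ℝ E' H') {M' : Type*} [TopologicalSpace M'] [ChartedSpace H' M']

/-- Differential `k`-forms (not necessarily smooth) on `M`. -/
abbrev DForm (M : Type*) [TopologicalSpace M] [ChartedSpace H M] (k : ℕ) : Type _ :=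
  ∀ x : M, TangentSpace I x [⋀^Fin k]→L[ℝ] ℝ

/-- Vector fields (not necessarily smooth) on `M`. -/
abbrev VField (M : Type*) [TopologicalSpace M] [ChartedSpace H M] : Type _ :=
  ∀ x : M, TangentSpace I x

/-- Fields of bilinear forms (not necessarily smooth) on the tangent spaces of `M`. -/
abbrev BForm (M : Type*) [TopologicalSpace M] [ChartedSpace H M] : Type _ :=
  ∀ x : M, TangentSpace I x →L[ℝ] TangentSpace I x →L[ℝ] ℝ

/-- Smoothness of a vector field at a point. -/
def FieldSmoothAt [IsManifold I ∞ M] (X : VField I M) (x : M) : Prop :=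
  ContMDiffAt I I.tangent ∞ (fun y => (⟨y, X y⟩ : TangentBundle I M)) x

/-- Smoothness of a field of bilinear forms at a point. -/
def MetricSmoothAt [IsManifold I ∞ M] (k : BForm I M) (x : M) : Prop :=
  ContMDiffAt I (I.prod 𝓘(ℝ, E →L[ℝ] E →L[ℝ] ℝ)) ∞
    (fun y => Bundle.TotalSpace.mk' (E →L[ℝ] E →L[ℝ] ℝ)
      (E := fun y : M => TangentSpace I y →L[ℝ] TangentSpace I y →L[ℝ] ℝ) y (k y)) x

/-- The pullback `f^*α` of a form by a map. -/
noncomputable def pullbackForm {k : ℕ} (f : M → M') (α : DForm I' M' k) : DForm I M k :=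
  fun x => (α (f x)).compContinuousLinearMap (mfderiv I I' f x)

/-- The expression of a form in the preferred chart at `x₀`, as a form on the model space
(meaningful on the target of the chart). -/
noncomputable def formInChart {k : ℕ} (α : DForm I M k) (x₀ : M) : E → E [⋀^Fin k]→L[ℝ] ℝ :=
  fun u => (α ((extChartAt I x₀).symm u)).compContinuousLinearMap
    (mfderiv 𝓘(ℝ, E) I (extChartAt I x₀).symm u)

/-- Smoothness of a form at a point (of a manifold without boundary): smooth coefficients in a
chart. -/
def FormSmoothAt {k : ℕ} (α : DForm I M k) (x : M) : Prop :=
  ContDiffAt ℝ ∞ (formInChart I α x) (extChartAt I x x)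

/-- The exterior derivative of a form on a manifold without boundary, computed at each point in the
preferred chart there. -/
noncomputable def extD {k : ℕ} (α : DForm I M k) : DForm I M (k + 1) :=
  fun x =>
    let β : E [⋀^Fin (k + 1)]→L[ℝ] ℝ := extDeriv (formInChart I α x) (extChartAt I x x)
    let β' : TangentSpace 𝓘(ℝ, E) (extChartAt I x x) [⋀^Fin (k + 1)]→L[ℝ] ℝ := β
    β'.compContinuousLinearMap (mfderiv I 𝓘(ℝ, E) (extChartAt I x) x)

/-- The differential `df` of a function, as a field of covectors. -/
noncomputable def dfun (f : M → ℝ) (x : M) : TangentSpace I x →L[ℝ] ℝ :=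
  mfderiv I 𝓘(ℝ, ℝ) f x

/-- The Lie derivative `ℒ_X α = d(ι_X α) + ι_X dα` of a form. -/
noncomputable def lieDerivForm {k : ℕ} (X : VField I M) (α : DForm I M (k + 1)) :
    DForm I M (k + 1) :=
  extD I (fun x => interiorProd (X x) (α x)) + fun x => interiorProd (X x) (extD I α x)

/-- `(ℒ_X k)_x = 0` for a field `k` of bilinear forms:
`X(k(Y, Z)) = k([X, Y], Z) + k(Y, [X, Z])` at `x` for all `Y`, `Z` that are smooth near `x`. -/
def IsKillingAt [IsManifold I ∞ M] (X : VField I M) (k : BForm I M) (x : M) : Prop :=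
  ∀ Y Z : VField I M, FieldSmoothAt I Y x → FieldSmoothAt I Z x →
    dfun I (fun y => k y (Y y) (Z y)) x (X x) =
      k x (VectorField.mlieBracket I X Y x) (Z x) + k x (Y x) (VectorField.mlieBracket I X Z x)

/-- `y` and `y'` lie on the same orbit of the vector field `V` restricted to the open set `O`: an
integral curve of `V` in `O` joins them. -/
def SameOrbit (V : VField I M) (O : Set M) (y y' : M) : Prop :=
  ∃ (γ : ℝ → M) (a b : ℝ), γ a = y ∧ γ b = y' ∧ (∀ s ∈ uIcc a b, γ s ∈ O) ∧
    IsMIntegralCurveOn (I := I) γ V (uIcc a b)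

end Manifold

/-! ## Kähler 6-manifolds with a compatible `SU(3)` structure -/

/-- The model space of 6-manifolds. -/
abbrev E6 : Type := EuclideanSpace ℝ (Fin 6)

/-- The model of 6-manifolds. -/
noncomputable abbrev I6 : ModelWithCorners ℝ E6 E6 := 𝓘(ℝ, E6)

/-- The model of 7-manifolds, which are modelled on `ℝ × ℝ⁶`. -/
noncomputable abbrev I7 : ModelWithCorners ℝ (ℝ × E6) (ModelProd ℝ E6) := 𝓘(ℝ, ℝ).prod I6

/-- An `SU(3)` structure on a 6-manifold: a Riemannian metric `h`, an almost complex structure `J`,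
a 2-form `σ` with `h(J·, ·) = σ`, and the real and imaginary parts `ψ⁺`, `ψ⁻` of a `(3,0)`-form,
with an adapted coframe at every point. -/
structure SU3Structure (N : Type*) [TopologicalSpace N] [ChartedSpace E6 N]
    [IsManifold I6 ∞ N] where
  h : Bundle.ContMDiffRiemannianMetric I6 ∞ E6 (fun x : N => TangentSpace I6 x)
  J : ∀ x : N, TangentSpace I6 x →L[ℝ] TangentSpace I6 x
  σ : DForm I6 N 2
  ψp : DForm I6 N 3
  ψm : DForm I6 N 3
  smooth_J : ContMDiff I6 (I6.prod 𝓘(ℝ, E6 →L[ℝ] E6)) ∞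
    (fun x => Bundle.TotalSpace.mk' (E6 →L[ℝ] E6)
      (E := fun x : N => TangentSpace I6 x →L[ℝ] TangentSpace I6 x) x (J x))
  smooth_σ : ∀ x, FormSmoothAt I6 σ x
  smooth_ψp : ∀ x, FormSmoothAt I6 ψp x
  smooth_ψm : ∀ x, FormSmoothAt I6 ψm x
  h_J : ∀ x u v, h.inner x (J x u) v = σ x ![u, v]
  coframe : ∀ x, ∃ e, IsSU3Coframe e (h.inner x) (σ x) (ψp x) (ψm x)

section Six

variable {N : Type*} [TopologicalSpace N] [ChartedSpace E6 N] [IsManifold I6 ∞ N]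
  (S : SU3Structure N)

/-- `(N, h, J, σ)` is Kähler: `σ` is closed and `J` is integrable, i.e. its Nijenhuis tensor
vanishes. -/
def SU3Structure.IsKaehler : Prop :=
  (∀ x, extD I6 S.σ x = 0) ∧
  ∀ (x : N) (X Y : VField I6 N), FieldSmoothAt I6 X x → FieldSmoothAt I6 Y x →
    VectorField.mlieBracket I6 (fun y => S.J y (X y)) (fun y => S.J y (Y y)) x
      - S.J x (VectorField.mlieBracket I6 (fun y => S.J y (X y)) Y x)
      - S.J x (VectorField.mlieBracket I6 X (fun y => S.J y (Y y)) x)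
      - VectorField.mlieBracket I6 X Y x = 0

/-- `d^c f = J df`, where `Jγ = -γ ∘ J` on covectors. -/
noncomputable def SU3Structure.dc (f : N → ℝ) (x : N) : TangentSpace I6 x →L[ℝ] ℝ :=
  -((dfun I6 f x).comp (S.J x))

/-- `X` is the Hamiltonian vector field of `f` on `(W, σ)`: it is smooth, and `ι_X σ = df`. -/
def SU3Structure.IsHamiltonianOn (f : N → ℝ) (X : VField I6 N) (W : Set N) : Prop :=
  ∀ x ∈ W, FieldSmoothAt I6 X x ∧ interiorProd (X x) (S.σ x) = oneForm (dfun I6 f x)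

/-- `X` is an infinitesimal isometry of the `SU(3)` structure on `W`: the flow of `X` preserves
`h`, `σ` and `ψ^±` (and hence `J`). -/
def SU3Structure.IsInfinitesimalIsometryOn (X : VField I6 N) (W : Set N) : Prop :=
  ∀ x ∈ W, IsKillingAt I6 X S.h.inner x ∧ lieDerivForm I6 X S.σ x = 0 ∧
    lieDerivForm I6 X S.ψp x = 0 ∧ lieDerivForm I6 X S.ψm x = 0

/-- The two conditions of the criterion on the open set `W`, for the function `t` and the
Hamiltonian vector field `U` of `-t`. -/
structure SU3Structure.CriterionOn (W : Set N) (t : N → ℝ) (U : VField I6 N) : Prop where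
  smooth : ContMDiffOn I6 𝓘(ℝ, ℝ) ∞ t W
  pos : ∀ x ∈ W, 0 < t x
  d_ψp : ∀ x ∈ W, extD I6 S.ψp x =
    -((1 / 2 : ℝ) • wedge (oneForm (S.dc (fun y => Real.log (t y)) x)) (S.ψm x))
  d_ψm : ∀ x ∈ W, extD I6 S.ψm x =
    (1 / 2 : ℝ) • wedge (oneForm (S.dc (fun y => Real.log (t y)) x)) (S.ψp x)
  hamiltonian : S.IsHamiltonianOn (fun y => -t y) U W
  isometry : S.IsInfinitesimalIsometryOn U W

end Six

/-! ## Torsion-free `G₂` structures and their quotients -/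

section Seven

variable {Y : Type*} [TopologicalSpace Y] [ChartedSpace (ModelProd ℝ E6) Y] [IsManifold I7 ∞ Y]

/-- `φ` is a torsion-free `G₂` structure on the open set `O`, with metric `k` and `*φ = χ`. -/
structure IsTorsionFreeG2On (O : Set Y) (k : BForm I7 Y) (φ : DForm I7 Y 3) (χ : DForm I7 Y 4) :
    Prop where
  smooth_k : ∀ y ∈ O, MetricSmoothAt I7 k y
  smooth_φ : ∀ y ∈ O, FormSmoothAt I7 φ y
  smooth_χ : ∀ y ∈ O, FormSmoothAt I7 χ y
  coframe : ∀ y ∈ O, ∃ e, IsG2Coframe e (k y) (φ y) (χ y)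
  closed : ∀ y ∈ O, extD I7 φ y = 0
  coclosed : ∀ y ∈ O, extD I7 χ y = 0

/-- The covector `η = k(·, t²V)`, where `t = k(V, V)^{-1/2}` (and `k` is symmetric). -/
noncomputable def connectionForm (k : BForm I7 Y) (V : VField I7 Y) (y : Y) :
    TangentSpace I7 y →L[ℝ] ℝ :=
  (k y (V y) (V y))⁻¹ • k y (V y)

variable {N : Type*} [TopologicalSpace N] [ChartedSpace E6 N] [IsManifold I6 ∞ N]

/-- The `SU(3)` structure `S` on the open set `W ⊆ N` is the quotient, with projection `pr`, of the
torsion-free `G₂` structure `φ` on the 7-manifold `O` (an open set of `Y`) by the nowhere zero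
infinitesimal isometry `V` (the flow of `V` preserves `k` and `φ`): the fibres of the submersion
`pr` are the orbits of `V` in `O`, and `t` is the function on `W` induced by `‖V‖⁻¹`. With
`η = k(·, t²V)` the quotient structure is given by
`k = t h + t⁻² η ⊗ η`, `σ = ι_V φ`, `φ = σ ∧ η + t Ψ⁺`, `Ψ⁻ = - ι_V *φ` and `ψ^± = t^{-1/2} Ψ^±`. -/
structure SU3Structure.IsG2QuotientOn (S : SU3Structure N) (W : Set N) (t : N → ℝ)
    (O : Set Y) (k : BForm I7 Y) (φ : DForm I7 Y 3) (χ : DForm I7 Y 4) (V : VField I7 Y)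
    (pr : Y → N) : Prop where
  isOpen : IsOpen O
  torsionFree : IsTorsionFreeG2On O k φ χ
  smooth_V : ∀ y ∈ O, FieldSmoothAt I7 V y
  V_ne_zero : ∀ y ∈ O, V y ≠ 0
  killing : ∀ y ∈ O, IsKillingAt I7 V k y
  lie_φ : ∀ y ∈ O, lieDerivForm I7 V φ y = 0
  smooth_pr : ContMDiffOn I7 I6 ∞ pr O
  submersion : ∀ y ∈ O, Function.Surjective (mfderiv I7 I6 pr y)
  image : pr '' O = W
  orbits : ∀ y ∈ O, ∀ y' ∈ O, pr y = pr y' ↔ SameOrbit I7 V O y y'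
  t_eq : ∀ y ∈ O, t (pr y) = (Real.sqrt (k y (V y) (V y)))⁻¹
  k_eq : ∀ y ∈ O, ∀ u v : TangentSpace I7 y, k y u v =
    t (pr y) * S.h.inner (pr y) (mfderiv I7 I6 pr y u) (mfderiv I7 I6 pr y v)
      + (t (pr y) ^ 2)⁻¹ * (connectionForm k V y u * connectionForm k V y v)
  σ_eq : ∀ y ∈ O, pullbackForm I7 I6 pr S.σ y = interiorProd (V y) (φ y)
  ψp_eq : ∀ y ∈ O, pullbackForm I7 I6 pr S.ψp y = (Real.sqrt (t (pr y)))⁻¹ • (t (pr y))⁻¹ •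
    (φ y - wedge (interiorProd (V y) (φ y)) (oneForm (connectionForm k V y)))
  ψm_eq : ∀ y ∈ O, pullbackForm I7 I6 pr S.ψm y =
    (Real.sqrt (t (pr y)))⁻¹ • (-interiorProd (V y) (χ y))

end Seven

/-- The `SU(3)` structure on `W` is the quotient of some 7-manifold with a torsion-free `G₂`
structure by a nowhere zero infinitesimal isometry whose inverse norm is given by `t`. -/
def SU3Structure.IsG2Quotient {N : Type u} [TopologicalSpace N]
    [ChartedSpace E6 N] [IsManifold I6 ∞ N] (S : SU3Structure N) (W : Set N) (t : N → ℝ) : Prop :=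
  ∃ (Y : Type u) (_ : TopologicalSpace Y) (_ : T2Space Y) (_ : SecondCountableTopology Y)
    (_ : ChartedSpace (ModelProd ℝ E6) Y) (_ : IsManifold I7 ∞ Y) (O : Set Y) (k : BForm I7 Y)
    (φ : DForm I7 Y 3) (χ : DForm I7 Y 4) (V : VField I7 Y) (pr : Y → N),
    S.IsG2QuotientOn W t O k φ χ V pr

/-- Each point of `W` has an open neighbourhood in `W` on which the `SU(3)` structure is the
quotient of a 7-manifold with a torsion-free `G₂` structure by a nowhere zero infinitesimal isometry
whose inverse norm is given by `t`. -/
def SU3Structure.IsLocallyG2Quotient {N : Type u} [TopologicalSpace N]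
    [ChartedSpace E6 N] [IsManifold I6 ∞ N] (S : SU3Structure N) (W : Set N) (t : N → ℝ) : Prop :=
  ∀ p ∈ W, ∃ W' : Set N, IsOpen W' ∧ p ∈ W' ∧ W' ⊆ W ∧ S.IsG2Quotient W' t

/-! ## The explicit structure on `ℝ × N` -/

section Model

variable {N : Type*} [TopologicalSpace N] [ChartedSpace E6 N] [IsManifold I6 ∞ N]
  (S : SU3Structure N) (t : N → ℝ) (ηN : DForm I6 N 1)

/-- `η = dv + η_N` on `ℝ × N`, where `v` is the coordinate of `ℝ`. -/
noncomputable def modelEta : DForm I7 (ℝ × N) 1 :=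
  fun y => oneForm (dfun I7 (fun z : ℝ × N => z.1) y)
    + pullbackForm I7 I6 (Prod.snd : ℝ × N → N) ηN y

/-- `k = t h + t⁻² η ⊗ η` on `ℝ × N`. -/
noncomputable def modelMetric : BForm I7 (ℝ × N) := fun y =>
  let p := mfderiv I7 I6 (Prod.snd : ℝ × N → N) y
  let η : TangentSpace I7 y →L[ℝ] ℝ :=
    (ContinuousAlternatingMap.ofSubsingleton ℝ (TangentSpace I7 y) ℝ (0 : Fin 1)).symm
      (modelEta ηN y)
  t y.2 • pullbackBilin (S.h.inner y.2) p + (t y.2 ^ 2)⁻¹ • sqCovector η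

/-- `V = ∂/∂v` on `ℝ × N`. -/
def modelField : VField I7 (ℝ × N) := fun _ => ((1, 0) : ℝ × E6)

/-- `φ = σ ∧ η + t^{3/2} ψ⁺` on `ℝ × N`. -/
noncomputable def modelPhi : DForm I7 (ℝ × N) 3 := fun y =>
  wedge (pullbackForm I7 I6 (Prod.snd : ℝ × N → N) S.σ y) (modelEta ηN y)
    + t y.2 ^ (3 / 2 : ℝ) • pullbackForm I7 I6 (Prod.snd : ℝ × N → N) S.ψp y

/-- `*φ = t^{1/2} ψ⁻ ∧ η + ½ t² σ ∧ σ` on `ℝ × N`. -/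
noncomputable def modelStarPhi : DForm I7 (ℝ × N) 4 := fun y =>
  t y.2 ^ (1 / 2 : ℝ) •
      wedge (pullbackForm I7 I6 (Prod.snd : ℝ × N → N) S.ψm y) (modelEta ηN y)
    + (1 / 2 * t y.2 ^ 2 : ℝ) •
      wedge (pullbackForm I7 I6 (Prod.snd : ℝ × N → N) S.σ y)
        (pullbackForm I7 I6 (Prod.snd : ℝ × N → N) S.σ y)

/-- `η_N` is a smooth 1-form on `W` with `dη_N = - t^{1/2} ι_U ψ⁺`. -/
def SU3Structure.IsConnectionOn (W : Set N) (U : VField I6 N) : Prop :=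
  ∀ x ∈ W, FormSmoothAt I6 ηN x ∧
    extD I6 ηN x = -(t x ^ (1 / 2 : ℝ) • interiorProd (U x) (S.ψp x))

/-- Near the point `y` of `O`, the data `(k, φ, *φ = χ, V, pr)` are isomorphic to the explicit
structure on a product of an open interval and an open set `W'` of `N`, for some 1-form `η_N` on
`W'` with `dη_N = - t^{1/2} ι_U ψ⁺`. -/
def SU3Structure.HasNormalFormAt {Y : Type*} [TopologicalSpace Y]
    [ChartedSpace (ModelProd ℝ E6) Y] [IsManifold I7 ∞ Y] (U : VField I6 N)
    (O : Set Y) (k : BForm I7 Y) (φ : DForm I7 Y 3) (χ : DForm I7 Y 4) (V : VField I7 Y)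
    (pr : Y → N) (y : Y) : Prop :=
  ∃ (F : OpenPartialHomeomorph Y (ℝ × N)) (a b : ℝ) (W' : Set N) (ηN : DForm I6 N 1),
    y ∈ F.source ∧ F.source ⊆ O ∧ IsOpen W' ∧ F.target = Ioo a b ×ˢ W' ∧
    ContMDiffOn I7 I7 ∞ F F.source ∧ ContMDiffOn I7 I7 ∞ F.symm F.target ∧
    S.IsConnectionOn t ηN W' U ∧
    ∀ z ∈ F.source, (F z).2 = pr z ∧
      mfderiv I7 I7 F z (V z) = modelField (F z) ∧
      (∀ u v, k z u v =
        modelMetric S t ηN (F z) (mfderiv I7 I7 F z u) (mfderiv I7 I7 F z v)) ∧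
      φ z = pullbackForm I7 I7 F (modelPhi S t ηN) z ∧
      χ z = pullbackForm I7 I7 F (modelStarPhi S t ηN) z

end Model

/-!
Everything happens at the level of the two forms `t^{1/2} ψ^±` and the 2-form `t^{1/2} ι_U ψ⁺`.

*The criterion as closedness.* Since `γ ∧ ψ⁺ = Jγ ∧ ψ⁻` for covectors `γ`, the two structure
equations in (i) say that `t^{1/2} ψ⁺` and `t^{1/2} ψ⁻` are closed (`extD_psiPlus_iff`,
`extD_psiMinus_iff`). They are the real and imaginary parts of a form of type `(3, 0)`, so, `J`
being integrable, the second closedness implies the first (`IsKaehler.extD_smul_psiPlus`). The field `U`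
preserves `σ`, being Hamiltonian, and `t`; and a field preserving `σ` and `ψ⁺` preserves `J`, hence
`h` and `ψ⁻` (`isKillingAt_and_lie_psiMinus`). By Cartan's formula (ii) is thus equivalent to
`d(t^{1/2} ι_U ψ⁺) = 0` (`lieDerivForm_psiPlus_iff`). The criterion is therefore
`d(t^{1/2} ψ⁻) = 0` and `d(t^{1/2} ι_U ψ⁺) = 0` (`IsKaehler.criterionOn`).

*From the base to the total space.* The second of these equations and the Poincaré lemma provide
`η_N` with `dη_N = -t^{1/2} ι_U ψ⁺` (`exists_isConnectionOn`). From an adapted coframe `e` of `N`,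
the coframe `t^{1/2} e₁, …, t^{1/2} e₆, t⁻¹ (dv + η_N)` makes the explicit tensors on `ℝ × N` a `G₂`
structure (`exists_isG2Coframe`), and `dφ = 0`, `d*φ = 0` follow from the algebraic identities
`σ ∧ ι_u ψ⁺ = -ι_u σ ∧ ψ⁺` and `ψ⁻ ∧ ι_u ψ⁺ = σ ∧ σ ∧ ι_u σ` with `ι_U σ = -dt`
(`isTorsionFreeG2On_model`, `isG2QuotientOn_model`).

*From the total space to the base.* By the inverse function theorem, `V` and the projection are
locally `∂/∂v` and the projection of a product (`exists_box`). In the contraction of `dφ = 0` with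
`∂/∂v` only `σ ∧ ι_{∂/∂v} dη = 0` remains, so `ι_{∂/∂v} dη = 0` and `η = dv + η_N`
(`extD_connectionForm_modelField`, `eq_modelEta`). As `*φ` is determined by `k` and `φ`
(`star_unique`), it too has its explicit form, and contracting `d*φ = 0` gives
`d(t^{1/2} ψ⁻) = 0`. What is left of `dφ = 0` is `σ ∧ (dη_N + t^{1/2} ι_U ψ⁺) = 0`, and `σ ∧ ·` is
injective on 2-forms in dimension 6, so `dη_N = -t^{1/2} ι_U ψ⁺`; then `d² = 0` gives the second
closedness condition.

Forms are handled through explicit shuffle formulas for the wedge products that occur, and the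
exterior derivative through charts, where it is `extDeriv`.
-/

/-! ### Wedge products and interior products -/

section Alternatization

/-- The permutations of `Fin (n + 1)`, sorted by the image of `0`. -/
def permSuccEquiv (n : ℕ) : Fin (n + 1) × Equiv.Perm (Fin n) ≃ Equiv.Perm (Fin (n + 1)) where
  toFun x := (Fin.cycleRange x.1).symm * Equiv.Perm.decomposeFin.symm (0, x.2)
  invFun s := (s 0, (Equiv.Perm.decomposeFin (Fin.cycleRange (s 0) * s)).2)
  left_inv := by
    rintro ⟨i, τ⟩
    have h0 : ((Fin.cycleRange i).symm * Equiv.Perm.decomposeFin.symm (0, τ)) 0 = i := by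
      simp [Equiv.Perm.mul_apply]
    simp only [h0]
    ext1
    · rfl
    · have : Fin.cycleRange i * ((Fin.cycleRange i).symm * Equiv.Perm.decomposeFin.symm (0, τ))
          = Equiv.Perm.decomposeFin.symm (0, τ) := by
        ext j; simp [Equiv.Perm.mul_apply]
      simp [this]
  right_inv := by
    intro s
    have h1 : (Equiv.Perm.decomposeFin (Fin.cycleRange (s 0) * s)).1 = 0 := by
      simp [Equiv.Perm.decomposeFin]
    generalize hs : Fin.cycleRange (s 0) * s = s' at h1
    have h2 : Equiv.Perm.decomposeFin.symm (0, (Equiv.Perm.decomposeFin s').2) = s' := by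
      rw [Equiv.symm_apply_eq]
      exact Prod.ext h1.symm rfl
    simp only [hs]
    rw [h2, ← hs]
    ext j; simp [Equiv.Perm.mul_apply]

lemma permSuccEquiv_zero {n : ℕ} (i : Fin (n + 1)) (τ : Equiv.Perm (Fin n)) :
    permSuccEquiv n (i, τ) 0 = i := by
  simp [permSuccEquiv, Equiv.Perm.mul_apply]

lemma permSuccEquiv_succ {n : ℕ} (i : Fin (n + 1)) (τ : Equiv.Perm (Fin n)) (j : Fin n) :
    permSuccEquiv n (i, τ) j.succ = i.succAbove (τ j) := by
  simp [permSuccEquiv, Equiv.Perm.mul_apply]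

lemma sign_permSuccEquiv {n : ℕ} (i : Fin (n + 1)) (τ : Equiv.Perm (Fin n)) :
    Equiv.Perm.sign (permSuccEquiv n (i, τ)) = (-1) ^ (i : ℕ) * Equiv.Perm.sign τ := by
  simp [permSuccEquiv, Equiv.Perm.sign_mul, Fin.sign_cycleRange]

variable {E : Type*}

/-- The antisymmetrisation `∑_s sign(s) f(v ∘ s)` of a function of `n` vectors. -/
def altSum {n : ℕ} (f : (Fin n → E) → ℝ) (v : Fin n → E) : ℝ :=
  ∑ s : Equiv.Perm (Fin n), ((Equiv.Perm.sign s : ℤ) : ℝ) * f (v ∘ s)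

/-- Expansion of an antisymmetrisation along the first slot. -/
lemma altSum_succ {n : ℕ} (f : (Fin (n + 1) → E) → ℝ) (v : Fin (n + 1) → E) :
    altSum f v = ∑ i : Fin (n + 1), (-1) ^ (i : ℕ) *
      altSum (fun w => f (Matrix.vecCons (v i) w)) (i.removeNth v) := by
  rw [altSum, ← (permSuccEquiv n).sum_comp, Fintype.sum_prod_type]
  refine Finset.sum_congr rfl fun i _ => ?_
  rw [altSum, Finset.mul_sum]
  refine Finset.sum_congr rfl fun τ _ => ?_
  have : v ∘ (permSuccEquiv n (i, τ)) = Matrix.vecCons (v i) (i.removeNth v ∘ τ) := by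
    funext j
    refine Fin.cases ?_ (fun j => ?_) j
    · simp [permSuccEquiv_zero]
    · simp [permSuccEquiv_succ, Fin.removeNth]
  rw [this, sign_permSuccEquiv]
  push_cast
  ring

/-- Expansion of an antisymmetrisation along the last slot. -/
lemma altSum_succ_last {n : ℕ} (f : (Fin (n + 1) → E) → ℝ) (v : Fin (n + 1) → E) :
    altSum f v = ∑ i : Fin (n + 1), (-1) ^ (n + i : ℕ) *
      altSum (fun w => f (Fin.snoc w (v i))) (i.removeNth v) := by
  have h : altSum f v = (-1) ^ n * altSum (fun w => f (w ∘ finRotate (n + 1))) v := by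
    rw [altSum, altSum, Finset.mul_sum, ← Equiv.sum_comp (Equiv.mulRight (finRotate (n + 1)))]
    refine Finset.sum_congr rfl fun s _ => ?_
    rw [Equiv.coe_mulRight, Equiv.Perm.sign_mul, sign_finRotate]
    have : v ∘ (s * finRotate (n + 1)) = (v ∘ s) ∘ finRotate (n + 1) := rfl
    rw [this]
    push_cast
    ring
  rw [h, altSum_succ, Finset.mul_sum]
  refine Finset.sum_congr rfl fun i _ => ?_
  have : (fun w : Fin n → E => f (Matrix.vecCons (v i) w ∘ finRotate (n + 1)))
      = fun w => f (Fin.snoc w (v i)) := by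
    funext w
    congr 1
    funext j
    refine Fin.lastCases ?_ (fun j => ?_) j
    · simp
    · simp only [Function.comp, Fin.snoc_castSucc]
      rw [finRotate_apply, Fin.coeSucc_eq_succ, Matrix.cons_val_succ]
  rw [this, pow_add]
  ring

variable [AddCommGroup E] [Module ℝ E] [TopologicalSpace E]

lemma altSum_const_mul {n : ℕ} (c : ℝ) (α : E [⋀^Fin n]→L[ℝ] ℝ) (v : Fin n → E) :
    altSum (fun w => c * α w) v = n.factorial * (c * α v) := by
  have : ∀ s : Equiv.Perm (Fin n), ((Equiv.Perm.sign s : ℤ) : ℝ) * (c * α (v ∘ s)) = c * α v := by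
    intro s
    have h := α.toAlternatingMap.map_perm v s
    have h' : α (v ∘ s) = (Equiv.Perm.sign s : ℤ) • α v := h
    rw [h', zsmul_eq_mul]
    have h2 : ((Equiv.Perm.sign s : ℤ) : ℝ) * ((Equiv.Perm.sign s : ℤ) : ℝ) = 1 := by
      exact_mod_cast Int.units_coe_mul_self _
    linear_combination (c * α v) * h2
  rw [altSum, Finset.sum_congr rfl fun s _ => this s]
  simp [Finset.sum_const, Finset.card_univ, Fintype.card_perm]

lemma altSum_mul_const {n : ℕ} (c : ℝ) (α : E [⋀^Fin n]→L[ℝ] ℝ) (v : Fin n → E) :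
    altSum (fun w => α w * c) v = n.factorial * (α v * c) := by
  simp_rw [mul_comm _ c]
  exact altSum_const_mul c α v

/-- The wedge product as an antisymmetrisation of the tensor product. -/
lemma wedge_apply {p q : ℕ} (α : E [⋀^Fin p]→L[ℝ] ℝ) (β : E [⋀^Fin q]→L[ℝ] ℝ)
    (v : Fin (p + q) → E) :
    wedge α β v = (p.factorial * q.factorial : ℝ)⁻¹ *
      altSum (fun w => α (fun i => w (Fin.castAdd q i)) * β (fun j => w (Fin.natAdd p j))) v := by
  rw [wedge, ContinuousAlternatingMap.smul_apply,
    ContinuousMultilinearMap.alternatization_apply_apply, smul_eq_mul, altSum]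
  congr 1
  refine Finset.sum_congr rfl fun s _ => ?_
  rw [Units.smul_def, zsmul_eq_mul]
  rfl

end Alternatization

section Wedge

variable {E : Type*} [AddCommGroup E] [Module ℝ E] [TopologicalSpace E]

@[simp] lemma oneForm_apply (γ : E →L[ℝ] ℝ) (v : Fin 1 → E) : oneForm γ v = γ (v 0) := rfl

@[simp] lemma interiorProd_apply {k : ℕ} (X : E) (α : E [⋀^Fin (k + 1)]→L[ℝ] ℝ) (v : Fin k → E) :
    interiorProd X α v = α (Matrix.vecCons X v) := rfl

lemma interiorProd_two_apply (X : E) (α : E [⋀^Fin 2]→L[ℝ] ℝ) (v : Fin 1 → E) :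
    interiorProd (k := 1) X α v = α ![X, v 0] := by
  rw [interiorProd_apply]
  congr 1
  funext i; fin_cases i <;> rfl

lemma interiorProd_three_apply (X : E) (α : E [⋀^Fin 3]→L[ℝ] ℝ) (v : Fin 2 → E) :
    interiorProd (k := 2) X α v = α ![X, v 0, v 1] := by
  rw [interiorProd_apply]
  congr 1
  funext i; fin_cases i <;> rfl

lemma interiorProd_four_apply (X : E) (α : E [⋀^Fin 4]→L[ℝ] ℝ) (v : Fin 3 → E) :
    interiorProd (k := 3) X α v = α ![X, v 0, v 1, v 2] := by
  rw [interiorProd_apply]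
  congr 1
  funext i; fin_cases i <;> rfl

lemma form_swap_two (β : E [⋀^Fin 2]→L[ℝ] ℝ) (a b : E) : β ![b, a] = -β ![a, b] := by
  have h := β.toAlternatingMap.map_swap ![a, b] (i := 0) (j := 1) (by decide)
  have h2 : (![a, b] ∘ Equiv.swap (0 : Fin 2) 1) = ![b, a] := by
    funext i; fin_cases i <;> simp
  rw [h2] at h
  exact h

/-- The wedge product with a covector on the right: the expansion along the last slot leaves only
`p + 1` terms. -/
lemma wedge_one_right {p : ℕ} (α : E [⋀^Fin p]→L[ℝ] ℝ) (γ : E [⋀^Fin 1]→L[ℝ] ℝ)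
    (v : Fin (p + 1) → E) :
    wedge α γ v = ∑ i : Fin (p + 1), (-1) ^ (p + i : ℕ) * (α (i.removeNth v) * γ ![v i]) := by
  rw [wedge_apply, altSum_succ_last, Finset.mul_sum]
  refine Finset.sum_congr rfl fun i _ => ?_
  have : (fun w : Fin p → E => α (fun j => (Fin.snoc w (v i) : Fin (p + 1) → E) (Fin.castAdd 1 j))
      * γ (fun j => (Fin.snoc w (v i) : Fin (p + 1) → E) (Fin.natAdd p j)))
      = fun w => α w * γ ![v i] := by
    funext w
    congr 2
    · funext j
      exact Fin.snoc_castSucc (α := fun _ => E) _ _ _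
    · funext j
      have hj : j = 0 := Subsingleton.elim _ _
      subst hj
      exact Fin.snoc_last (α := fun _ => E) _ _
  rw [this, altSum_mul_const]
  have := p.factorial_ne_zero
  field_simp
  simp

lemma wedge_one_one (α β : E [⋀^Fin 1]→L[ℝ] ℝ) (v : Fin 2 → E) :
    wedge α β v = α ![v 0] * β ![v 1] - α ![v 1] * β ![v 0] := by
  rw [wedge_one_right]
  have h0 : (0 : Fin 2).removeNth v = ![v 1] := by funext i; fin_cases i; rfl
  have h1 : (1 : Fin 2).removeNth v = ![v 0] := by funext i; fin_cases i; rfl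
  refine (Fin.sum_univ_two _).trans ?_
  simp only [h0, h1]
  norm_num
  ring

lemma wedge_two_one (α : E [⋀^Fin 2]→L[ℝ] ℝ) (β : E [⋀^Fin 1]→L[ℝ] ℝ) (v : Fin 3 → E) :
    wedge α β v = α ![v 1, v 2] * β ![v 0] - α ![v 0, v 2] * β ![v 1]
      + α ![v 0, v 1] * β ![v 2] := by
  rw [wedge_one_right]
  have h0 : (0 : Fin 3).removeNth v = ![v 1, v 2] := by funext i; fin_cases i <;> rfl
  have h1 : (1 : Fin 3).removeNth v = ![v 0, v 2] := by funext i; fin_cases i <;> rfl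
  have h2 : (2 : Fin 3).removeNth v = ![v 0, v 1] := by funext i; fin_cases i <;> rfl
  refine (Fin.sum_univ_three _).trans ?_
  simp only [h0, h1, h2]
  norm_num
  ring

lemma wedge_three_one (α : E [⋀^Fin 3]→L[ℝ] ℝ) (β : E [⋀^Fin 1]→L[ℝ] ℝ) (v : Fin 4 → E) :
    wedge α β v = -α ![v 1, v 2, v 3] * β ![v 0] + α ![v 0, v 2, v 3] * β ![v 1]
      - α ![v 0, v 1, v 3] * β ![v 2] + α ![v 0, v 1, v 2] * β ![v 3] := by
  rw [wedge_one_right]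
  have h0 : (0 : Fin 4).removeNth v = ![v 1, v 2, v 3] := by funext i; fin_cases i <;> rfl
  have h1 : (1 : Fin 4).removeNth v = ![v 0, v 2, v 3] := by funext i; fin_cases i <;> rfl
  have h2 : (2 : Fin 4).removeNth v = ![v 0, v 1, v 3] := by funext i; fin_cases i <;> rfl
  have h3 : (3 : Fin 4).removeNth v = ![v 0, v 1, v 2] := by funext i; fin_cases i <;> rfl
  refine (Fin.sum_univ_four _).trans ?_
  simp only [h0, h1, h2, h3]
  norm_num
  ring

lemma wedge_four_one (α : E [⋀^Fin 4]→L[ℝ] ℝ) (β : E [⋀^Fin 1]→L[ℝ] ℝ) (v : Fin 5 → E) :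
    wedge α β v = α ![v 1, v 2, v 3, v 4] * β ![v 0] - α ![v 0, v 2, v 3, v 4] * β ![v 1]
      + α ![v 0, v 1, v 3, v 4] * β ![v 2] - α ![v 0, v 1, v 2, v 4] * β ![v 3]
      + α ![v 0, v 1, v 2, v 3] * β ![v 4] := by
  rw [wedge_one_right]
  have h0 : (0 : Fin 5).removeNth v = ![v 1, v 2, v 3, v 4] := by funext i; fin_cases i <;> rfl
  have h1 : (1 : Fin 5).removeNth v = ![v 0, v 2, v 3, v 4] := by funext i; fin_cases i <;> rfl
  have h2 : (2 : Fin 5).removeNth v = ![v 0, v 1, v 3, v 4] := by funext i; fin_cases i <;> rfl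
  have h3 : (3 : Fin 5).removeNth v = ![v 0, v 1, v 2, v 4] := by funext i; fin_cases i <;> rfl
  have h4 : (4 : Fin 5).removeNth v = ![v 0, v 1, v 2, v 3] := by funext i; fin_cases i <;> rfl
  refine (Fin.sum_univ_five _).trans ?_
  simp only [h0, h1, h2, h3, h4]
  norm_num
  ring

lemma wedge_one_three (γ : E [⋀^Fin 1]→L[ℝ] ℝ) (α : E [⋀^Fin 3]→L[ℝ] ℝ) (v : Fin 4 → E) :
    wedge γ α v = γ ![v 0] * α ![v 1, v 2, v 3] - γ ![v 1] * α ![v 0, v 2, v 3]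
      + γ ![v 2] * α ![v 0, v 1, v 3] - γ ![v 3] * α ![v 0, v 1, v 2] := by
  rw [wedge_apply]
  have h0 : (0 : Fin 4).removeNth v = ![v 1, v 2, v 3] := by funext i; fin_cases i <;> rfl
  have h1 : (1 : Fin 4).removeNth v = ![v 0, v 2, v 3] := by funext i; fin_cases i <;> rfl
  have h2 : (2 : Fin 4).removeNth v = ![v 0, v 1, v 3] := by funext i; fin_cases i <;> rfl
  have h3 : (3 : Fin 4).removeNth v = ![v 0, v 1, v 2] := by funext i; fin_cases i <;> rfl
  rw [altSum_succ (n := 3)]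
  have : ∀ i : Fin 4, (fun w : Fin 3 → E =>
      γ (fun j => (Matrix.vecCons (v i) w : Fin 4 → E) (Fin.castAdd 3 j))
      * α (fun j => (Matrix.vecCons (v i) w : Fin 4 → E) (Fin.natAdd 1 j)))
      = fun w => γ ![v i] * α w := by
    intro i
    funext w
    congr 2
    · funext j; fin_cases j; rfl
    · funext j; fin_cases j <;> rfl
  simp only [this, altSum_const_mul]
  rw [show ∀ f : Fin (3 + 1) → ℝ, ∑ i, f i = f 0 + f 1 + f 2 + f 3 from Fin.sum_univ_four]
  simp only [h0, h1, h2, h3]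
  norm_num [Nat.factorial]
  ring

lemma wedge_two_two (α β : E [⋀^Fin 2]→L[ℝ] ℝ) (v : Fin 4 → E) :
    wedge α β v = α ![v 0, v 1] * β ![v 2, v 3] - α ![v 0, v 2] * β ![v 1, v 3]
      + α ![v 0, v 3] * β ![v 1, v 2] + α ![v 1, v 2] * β ![v 0, v 3]
      - α ![v 1, v 3] * β ![v 0, v 2] + α ![v 2, v 3] * β ![v 0, v 1] := by
  rw [wedge_apply]
  rw [altSum_succ_last (n := 3)]
  simp only [altSum_succ_last (n := 2)]
  have : ∀ x y : E, (fun w : Fin 2 → E =>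
      α (fun j => (Fin.snoc (Fin.snoc w x : Fin 3 → E) y : Fin 4 → E) (Fin.castAdd 2 j))
      * β (fun j => (Fin.snoc (Fin.snoc w x : Fin 3 → E) y : Fin 4 → E) (Fin.natAdd 2 j)))
      = fun w => α w * β ![x, y] := by
    intro x y
    funext w
    congr 2
    · funext j; fin_cases j <;> rfl
    · funext j; fin_cases j <;> rfl
  simp only [this, altSum_mul_const]
  rw [show ∀ f : Fin (3 + 1) → ℝ, ∑ i, f i = f 0 + f 1 + f 2 + f 3 from Fin.sum_univ_four]
  simp only [show ∀ f : Fin (2 + 1) → ℝ, ∑ i, f i = f 0 + f 1 + f 2 from Fin.sum_univ_three]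
  have e : ∀ (i : Fin 4) (j : Fin 3), j.removeNth (i.removeNth v)
      = ![v (i.succAbove (j.succAbove 0)), v (i.succAbove (j.succAbove 1))] := by
    intro i j; funext k; fin_cases k <;> rfl
  simp only [e, Fin.removeNth]
  simp [Fin.succAbove]
  simp only [form_swap_two β (v 0), form_swap_two β (v 1) (v 2), form_swap_two β (v 1) (v 3),
    form_swap_two β (v 2) (v 3)]
  ring

lemma wedge_three_two (α : E [⋀^Fin 3]→L[ℝ] ℝ) (β : E [⋀^Fin 2]→L[ℝ] ℝ) (v : Fin 5 → E) :
    wedge α β v = α ![v 0, v 1, v 2] * β ![v 3, v 4] - α ![v 0, v 1, v 3] * β ![v 2, v 4]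
      + α ![v 0, v 1, v 4] * β ![v 2, v 3] + α ![v 0, v 2, v 3] * β ![v 1, v 4]
      - α ![v 0, v 2, v 4] * β ![v 1, v 3] + α ![v 0, v 3, v 4] * β ![v 1, v 2]
      - α ![v 1, v 2, v 3] * β ![v 0, v 4] + α ![v 1, v 2, v 4] * β ![v 0, v 3]
      - α ![v 1, v 3, v 4] * β ![v 0, v 2] + α ![v 2, v 3, v 4] * β ![v 0, v 1] := by
  rw [wedge_apply]
  rw [altSum_succ_last (n := 4)]
  simp only [altSum_succ_last (n := 3)]
  have : ∀ x y : E, (fun w : Fin 3 → E =>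
      α (fun j => (Fin.snoc (Fin.snoc w x : Fin 4 → E) y : Fin 5 → E) (Fin.castAdd 2 j))
      * β (fun j => (Fin.snoc (Fin.snoc w x : Fin 4 → E) y : Fin 5 → E) (Fin.natAdd 3 j)))
      = fun w => α w * β ![x, y] := by
    intro x y
    funext w
    congr 2
    · funext j; fin_cases j <;> rfl
    · funext j; fin_cases j <;> rfl
  simp only [this, altSum_mul_const]
  rw [show ∀ f : Fin (4 + 1) → ℝ, ∑ i, f i = f 0 + f 1 + f 2 + f 3 + f 4 from Fin.sum_univ_five]
  simp only [show ∀ f : Fin (3 + 1) → ℝ, ∑ i, f i = f 0 + f 1 + f 2 + f 3 from Fin.sum_univ_four]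
  have e : ∀ (i : Fin 5) (j : Fin 4), j.removeNth (i.removeNth v)
      = ![v (i.succAbove (j.succAbove 0)), v (i.succAbove (j.succAbove 1)),
        v (i.succAbove (j.succAbove 2))] := by
    intro i j; funext k; fin_cases k <;> rfl
  simp only [e, Fin.removeNth]
  simp [Fin.succAbove, Nat.factorial]
  simp only [form_swap_two β (v 0) (v 1), form_swap_two β (v 0) (v 2),
    form_swap_two β (v 0) (v 3), form_swap_two β (v 0) (v 4), form_swap_two β (v 1) (v 2),
      form_swap_two β (v 1) (v 3), form_swap_two β (v 1) (v 4), form_swap_two β (v 2) (v 3),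
        form_swap_two β (v 2) (v 4), form_swap_two β (v 3) (v 4)]
  ring

lemma wedge_add_right {p q : ℕ} (α : E [⋀^Fin p]→L[ℝ] ℝ) (β β' : E [⋀^Fin q]→L[ℝ] ℝ) :
    wedge α (β + β') = wedge α β + wedge α β' := by
  ext v
  simp only [wedge_apply, ContinuousAlternatingMap.add_apply, altSum, mul_add,
    Finset.sum_add_distrib]

lemma wedge_smul_left {p q : ℕ} (c : ℝ) (α : E [⋀^Fin p]→L[ℝ] ℝ) (β : E [⋀^Fin q]→L[ℝ] ℝ) :
    wedge (c • α) β = c • wedge α β := by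
  ext v
  simp only [wedge_apply, ContinuousAlternatingMap.smul_apply, altSum, smul_eq_mul,
    Finset.mul_sum]
  exact Finset.sum_congr rfl fun _ _ => by ring

lemma wedge_smul_right {p q : ℕ} (c : ℝ) (α : E [⋀^Fin p]→L[ℝ] ℝ) (β : E [⋀^Fin q]→L[ℝ] ℝ) :
    wedge α (c • β) = c • wedge α β := by
  ext v
  simp only [wedge_apply, ContinuousAlternatingMap.smul_apply, altSum, smul_eq_mul,
    Finset.mul_sum]
  exact Finset.sum_congr rfl fun _ _ => by ring

lemma wedge_comp {F : Type*} [AddCommGroup F] [Module ℝ F] [TopologicalSpace F] {p q : ℕ}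
    (α : F [⋀^Fin p]→L[ℝ] ℝ) (β : F [⋀^Fin q]→L[ℝ] ℝ) (f : E →L[ℝ] F) :
    (wedge α β).compContinuousLinearMap f
      = wedge (α.compContinuousLinearMap f) (β.compContinuousLinearMap f) := by
  ext v
  simp only [wedge_apply, ContinuousAlternatingMap.compContinuousLinearMap_apply, altSum]
  rfl

lemma interiorProd_comp {F : Type*} [AddCommGroup F] [Module ℝ F] [TopologicalSpace F] {k : ℕ}
    (α : F [⋀^Fin (k + 1)]→L[ℝ] ℝ) (f : E →L[ℝ] F) (X : E) :
    interiorProd X (α.compContinuousLinearMap f)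
      = (interiorProd (f X) α).compContinuousLinearMap f := by
  ext v
  simp only [interiorProd_apply, ContinuousAlternatingMap.compContinuousLinearMap_apply]
  congr 1
  funext i
  refine Fin.cases rfl (fun j => rfl) i

lemma oneForm_comp {F : Type*} [AddCommGroup F] [Module ℝ F] [TopologicalSpace F]
    (γ : F →L[ℝ] ℝ) (f : E →L[ℝ] F) :
    (oneForm γ).compContinuousLinearMap f = oneForm (γ.comp f) := rfl

end Wedge

/-! ### Linear algebra of `SU(3)` and `G₂` coframes -/

section Coframe

variable {E : Type*} [AddCommGroup E] [Module ℝ E] [TopologicalSpace E]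

/-- A linearly independent family of covectors has a dual family of vectors, in any dimension. -/
lemma exists_dual_vectors {n : ℕ} {e : Fin n → (E →L[ℝ] ℝ)} (he : LinearIndependent ℝ e) :
    ∃ f : Fin n → E, ∀ i j, e i (f j) = if i = j then 1 else 0 := by
  -- If the map `Φ = (e₁, …, eₙ)` were not onto, a functional vanishing on its range would be a
  -- linear relation between the covectors.
  let Φ : E →ₗ[ℝ] (Fin n → ℝ) := LinearMap.pi fun i => (e i).toLinearMap
  have hsurj : LinearMap.range Φ = ⊤ := by
    by_contra hne
    obtain ⟨l, hl0, hl⟩ := Submodule.exists_le_ker_of_lt_top _ (lt_top_iff_ne_top.2 hne)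
    have hz : ∑ i, l (Pi.single i 1) • e i = 0 := by
      ext v
      have h1 : l (Φ v) = 0 := hl (LinearMap.mem_range_self Φ v)
      rw [← Finset.univ_sum_single (Φ v), map_sum] at h1
      rw [sum_apply, zero_apply, ← h1]
      refine Finset.sum_congr rfl fun i _ => ?_
      have : (Pi.single i (Φ v i) : Fin n → ℝ) = (e i v) • Pi.single i 1 := by
        rw [← Pi.single_smul]; simp [Φ]
      rw [this, map_smul]
      simp [mul_comm]
    have h2 := Fintype.linearIndependent_iff.1 he _ hz
    apply hl0
    refine LinearMap.pi_ext' fun i => ?_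
    ext
    simpa using h2 i
  choose f hf using fun j : Fin n => LinearMap.range_eq_top.1 hsurj (Pi.single j 1)
  refine ⟨f, fun i j => ?_⟩
  have := congrFun (hf j) i
  simpa [Φ, Pi.single_apply] using this

/-- Vectors with the same components in a coframe are equal. -/
lemma coframe_ext {n : ℕ} {e : Fin n → (E →L[ℝ] ℝ)} (he : LinearIndependent ℝ e)
    [FiniteDimensional ℝ E] (hn : Module.finrank ℝ E = n) {u v : E} (h : ∀ i, e i u = e i v) :
    u = v := by
  obtain ⟨f, hf⟩ := exists_dual_vectors he
  let Φ : E →ₗ[ℝ] (Fin n → ℝ) := LinearMap.pi fun i => (e i).toLinearMap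
  have hs : Function.Surjective Φ := by
    intro a
    refine ⟨∑ j, a j • f j, ?_⟩
    funext i
    simp [Φ, hf]
  have hi : Function.Injective Φ :=
    (LinearMap.injective_iff_surjective_of_finrank_eq_finrank (by simp [hn])).2 hs
  exact hi (funext h)

lemma coframe_expand {n : ℕ} {e : Fin n → (E →L[ℝ] ℝ)} (he : LinearIndependent ℝ e)
    [FiniteDimensional ℝ E] (hn : Module.finrank ℝ E = n) {f : Fin n → E}
    (hf : ∀ i j, e i (f j) = if i = j then 1 else 0) (v : E) : v = ∑ j, e j v • f j :=
  coframe_ext he hn fun i => by simp [hf]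

lemma exists_basis_of_dual {n : ℕ} {e : Fin n → (E →L[ℝ] ℝ)} (he : LinearIndependent ℝ e)
    [FiniteDimensional ℝ E] (hn : Module.finrank ℝ E = n) {f : Fin n → E}
    (hf : ∀ i j, e i (f j) = if i = j then 1 else 0) :
    ∃ b : Module.Basis (Fin n) ℝ E, ⇑b = f := by
  refine ⟨Module.Basis.mk (v := f) ?_ ?_, Module.Basis.coe_mk _ _⟩
  · rw [Fintype.linearIndependent_iff]
    intro g hg i
    have := congrArg (e i) hg
    simpa [hf] using this
  · intro v _
    rw [coframe_expand he hn hf v]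
    exact Submodule.sum_mem _ fun j _ => Submodule.smul_mem _ _ (Submodule.subset_span ⟨j, rfl⟩)

/-- Forms of degree one less than the dimension agree if they agree on the tuples obtained from a
basis by omitting one vector. -/
lemma form_ext_codim_one {n : ℕ} (b : Module.Basis (Fin (n + 1)) ℝ E)
    {α β : E [⋀^Fin n]→L[ℝ] ℝ} (h : ∀ i : Fin (n + 1), α (i.removeNth b) = β (i.removeNth b)) :
    α = β := by
  apply ContinuousAlternatingMap.toAlternatingMap_injective
  refine Module.Basis.ext_alternating b fun v hv => ?_
  obtain ⟨i, hi⟩ : ∃ i, i ∉ Set.range v := by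
    by_contra hne
    push Not at hne
    have := Fintype.card_le_of_surjective v hne
    simp at this
  choose w hw using fun j => Fin.exists_succAbove_eq (x := v j) (y := i) (fun h => hi ⟨j, h⟩)
  have hwi : Function.Injective w := fun j k hjk => hv (by rw [← hw j, ← hw k, hjk])
  let s : Equiv.Perm (Fin n) := Equiv.ofBijective w (Finite.injective_iff_bijective.1 hwi)
  have hbv : (fun j => b (v j)) = i.removeNth b ∘ s := by
    funext j
    rw [← hw j]; rfl
  rw [hbv, AlternatingMap.map_perm, AlternatingMap.map_perm]
  congr 1
  exact h i

lemma stdSigma_apply (e : Fin 6 → (E →L[ℝ] ℝ)) (v : Fin 2 → E) :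
    stdSigma e v = e 0 (v 0) * e 1 (v 1) - e 0 (v 1) * e 1 (v 0)
      + (e 2 (v 0) * e 3 (v 1) - e 2 (v 1) * e 3 (v 0))
      + (e 4 (v 0) * e 5 (v 1) - e 4 (v 1) * e 5 (v 0)) := by
  simp only [stdSigma, ContinuousAlternatingMap.add_apply, wedge_one_one, oneForm_apply,
    Matrix.cons_val_zero]

lemma wedge₃_apply (a b c : E →L[ℝ] ℝ) (v : Fin 3 → E) :
    wedge₃ a b c v = (a (v 1) * b (v 2) - a (v 2) * b (v 1)) * c (v 0)
      - (a (v 0) * b (v 2) - a (v 2) * b (v 0)) * c (v 1)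
      + (a (v 0) * b (v 1) - a (v 1) * b (v 0)) * c (v 2) := by
  simp only [wedge₃, wedge_two_one, wedge_one_one, oneForm_apply, Matrix.cons_val_zero,
    Matrix.cons_val_one]

lemma stdPsiPlus_apply (e : Fin 6 → (E →L[ℝ] ℝ)) (v : Fin 3 → E) :
    stdPsiPlus e v = wedge₃ (e 0) (e 2) (e 4) v - wedge₃ (e 0) (e 3) (e 5) v
      - wedge₃ (e 1) (e 2) (e 5) v - wedge₃ (e 1) (e 3) (e 4) v := rfl

lemma stdPsiMinus_apply (e : Fin 6 → (E →L[ℝ] ℝ)) (v : Fin 3 → E) :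
    stdPsiMinus e v = wedge₃ (e 0) (e 2) (e 5) v + wedge₃ (e 0) (e 3) (e 4) v
      + wedge₃ (e 1) (e 2) (e 4) v - wedge₃ (e 1) (e 3) (e 5) v := rfl

end Coframe

section SU3

variable {E : Type*} [AddCommGroup E] [Module ℝ E] [TopologicalSpace E]
  {e : Fin 6 → (E →L[ℝ] ℝ)} {h : E →L[ℝ] E →L[ℝ] ℝ}
  {σ : E [⋀^Fin 2]→L[ℝ] ℝ} {ψp ψm : E [⋀^Fin 3]→L[ℝ] ℝ} {J : E →L[ℝ] E}

namespace IsSU3Coframe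

/-- The complex structure in an adapted coframe: `J` sends `e₁` to `e₂`, and so on. -/
lemma coframe_J (he : IsSU3Coframe e h σ ψp ψm) (hJ : ∀ u v, h (J u) v = σ ![u, v]) (u : E) :
    e 0 (J u) = -e 1 u ∧ e 1 (J u) = e 0 u ∧ e 2 (J u) = -e 3 u ∧ e 3 (J u) = e 2 u ∧
      e 4 (J u) = -e 5 u ∧ e 5 (J u) = e 4 u := by
  obtain ⟨f, hf⟩ := exists_dual_vectors he.1
  have key : ∀ j, e j (J u) = σ ![u, f j] := by
    intro j
    rw [← hJ, he.2.1]
    simp [hf]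
  simp only [key, he.2.2.1, stdSigma_apply, Matrix.cons_val_zero, Matrix.cons_val_one, hf]
  simp

lemma psiPlus_J_left (he : IsSU3Coframe e h σ ψp ψm) (hJ : ∀ u v, h (J u) v = σ ![u, v])
    (a b c : E) : ψp ![J a, b, c] = -ψm ![a, b, c] := by
  obtain ⟨h0, h1, h2, h3, h4, h5⟩ := he.coframe_J hJ a
  rw [he.2.2.2.1, he.2.2.2.2, stdPsiPlus_apply, stdPsiMinus_apply]
  simp only [wedge₃_apply, Matrix.cons_val, h0, h1, h2, h3, h4, h5]
  ring

lemma psiMinus_J_left (he : IsSU3Coframe e h σ ψp ψm) (hJ : ∀ u v, h (J u) v = σ ![u, v])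
    (a b c : E) : ψm ![J a, b, c] = ψp ![a, b, c] := by
  obtain ⟨h0, h1, h2, h3, h4, h5⟩ := he.coframe_J hJ a
  rw [he.2.2.2.1, he.2.2.2.2, stdPsiPlus_apply, stdPsiMinus_apply]
  simp only [wedge₃_apply, Matrix.cons_val, h0, h1, h2, h3, h4, h5]
  ring

variable [FiniteDimensional ℝ E]

lemma J_J (hE : Module.finrank ℝ E = 6) (he : IsSU3Coframe e h σ ψp ψm)
    (hJ : ∀ u v, h (J u) v = σ ![u, v]) (u : E) : J (J u) = -u := by
  obtain ⟨h0, h1, h2, h3, h4, h5⟩ := he.coframe_J hJ u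
  obtain ⟨k0, k1, k2, k3, k4, k5⟩ := he.coframe_J hJ (J u)
  refine coframe_ext he.1 hE fun i => ?_
  fin_cases i <;> simp [*]

/-- The metric is determined by `σ` and `J`. -/
lemma h_eq (hE : Module.finrank ℝ E = 6) (he : IsSU3Coframe e h σ ψp ψm)
    (hJ : ∀ u v, h (J u) v = σ ![u, v]) (u v : E) : h u v = -σ ![J u, v] := by
  rw [← hJ, he.J_J hE hJ]; simp

/-- A vector annihilated by `ψ⁺` is zero. -/
lemma eq_zero_of_psiPlus (hE : Module.finrank ℝ E = 6) (he : IsSU3Coframe e h σ ψp ψm) {u : E}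
    (hu : ∀ a b, ψp ![u, a, b] = 0) : u = 0 := by
  obtain ⟨f, hf⟩ := exists_dual_vectors he.1
  rw [he.2.2.2.1] at hu
  simp only [stdPsiPlus_apply, wedge₃_apply, Matrix.cons_val] at hu
  have h0 := hu (f 2) (f 4)
  have h1 := hu (f 2) (f 5)
  have h2 := hu (f 0) (f 4)
  have h3 := hu (f 0) (f 5)
  have h4 := hu (f 0) (f 2)
  have h5 := hu (f 0) (f 3)
  simp [hf] at h0 h1 h2 h3 h4 h5
  refine coframe_ext he.1 hE fun i => ?_
  fin_cases i <;> simp [*]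

/-- The form `σ` is nondegenerate. -/
lemma eq_zero_of_sigma (hE : Module.finrank ℝ E = 6) (he : IsSU3Coframe e h σ ψp ψm) {u : E}
    (hu : ∀ a, σ ![u, a] = 0) : u = 0 := by
  obtain ⟨f, hf⟩ := exists_dual_vectors he.1
  rw [he.2.2.1] at hu
  simp only [stdSigma_apply, Matrix.cons_val] at hu
  have h0 := hu (f 0)
  have h1 := hu (f 1)
  have h2 := hu (f 2)
  have h3 := hu (f 3)
  have h4 := hu (f 4)
  have h5 := hu (f 5)
  simp [hf] at h0 h1 h2 h3 h4 h5
  refine coframe_ext he.1 hE fun i => ?_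
  fin_cases i <;> simp [*]

lemma exists_sigma_eq (hE : Module.finrank ℝ E = 6) (he : IsSU3Coframe e h σ ψp ψm)
    (γ : E →L[ℝ] ℝ) : ∃ u, interiorProd u σ = oneForm γ := by
  obtain ⟨f, hf⟩ := exists_dual_vectors he.1
  refine ⟨γ (f 1) • f 0 - γ (f 0) • f 1 + (γ (f 3) • f 2 - γ (f 2) • f 3)
    + (γ (f 5) • f 4 - γ (f 4) • f 5), ?_⟩
  ext v
  have hv := coframe_expand he.1 hE hf (v 0)
  rw [oneForm_apply, interiorProd_apply, he.2.2.1, stdSigma_apply]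
  conv_rhs => rw [hv]
  simp only [Fin.sum_univ_six, map_add, map_sub, map_smul, smul_eq_mul, Matrix.cons_val, hf]
  simp
  ring

/-- The map `F ↦ σ ∧ F` is injective on 2-forms of a 6-dimensional space. -/
lemma eq_zero_of_sigma_wedge (hE : Module.finrank ℝ E = 6) (he : IsSU3Coframe e h σ ψp ψm)
    {F : E [⋀^Fin 2]→L[ℝ] ℝ} (hF : wedge σ F = 0) : F = 0 := by
  obtain ⟨f, hf⟩ := exists_dual_vectors he.1
  have H : ∀ i j k l : Fin 6, wedge σ F ![f i, f j, f k, f l] = 0 := by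
    intro i j k l; rw [hF]; rfl
  simp only [wedge_two_two, he.2.2.1, stdSigma_apply, Matrix.cons_val, hf] at H
  -- `σ ∧ F` on `(f₀, f₁, f₂, f₃)` and its two analogues are the sums of two of `F(f₀, f₁)`,
  -- `F(f₂, f₃)`, `F(f₄, f₅)`; the other values below are single components of `F`.
  have a1 := H 0 1 2 3
  have a2 := H 0 1 4 5
  have a3 := H 2 3 4 5
  have b1 := H 4 5 0 2
  have b2 := H 4 5 0 3
  have b3 := H 4 5 1 2
  have b4 := H 4 5 1 3
  have c1 := H 2 3 0 4
  have c2 := H 2 3 0 5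
  have c3 := H 2 3 1 4
  have c4 := H 2 3 1 5
  have d1 := H 0 1 2 4
  have d2 := H 0 1 2 5
  have d3 := H 0 1 3 4
  have d4 := H 0 1 3 5
  clear H
  simp at a1 a2 a3 b1 b2 b3 b4 c1 c2 c3 c4 d1 d2 d3 d4
  have e1 : F ![f 0, f 1] = 0 := by linarith
  have e2 : F ![f 2, f 3] = 0 := by linarith
  have e3 : F ![f 4, f 5] = 0 := by linarith
  have hsw : ∀ i j : Fin 6, F ![f i, f j] = -F ![f j, f i] := fun i j => form_swap_two F _ _
  have hself : ∀ i : Fin 6, F ![f i, f i] = 0 := fun i =>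
    F.map_eq_zero_of_eq _ (i := 0) (j := 1) rfl (by decide)
  have hall : ∀ i j : Fin 6, F ![f i, f j] = 0 := by
    have hlt : ∀ i j : Fin 6, i < j → F ![f i, f j] = 0 := by
      intro i j hij
      fin_cases i <;> fin_cases j <;> first | assumption | (exfalso; revert hij; decide)
    intro i j
    rcases lt_trichotomy i j with hij | rfl | hij
    · exact hlt i j hij
    · exact hself i
    · rw [hsw, hlt j i hij, neg_zero]
  obtain ⟨b, hb⟩ := exists_basis_of_dual he.1 hE hf
  have : F.toAlternatingMap = 0 := by
    refine Module.Basis.ext_alternating b fun v _ => ?_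
    have : (fun i => b (v i)) = ![f (v 0), f (v 1)] := by
      funext i; fin_cases i <;> simp [hb]
    rw [this]
    exact hall _ _
  exact ContinuousAlternatingMap.toAlternatingMap_injective this

omit [FiniteDimensional ℝ E] in
/-- The contraction with `u` of the identity `σ ∧ ψ⁺ = 0`. -/
lemma sigma_wedge_interior_psiPlus (he : IsSU3Coframe e h σ ψp ψm) (u : E) :
    wedge σ (interiorProd u ψp) = -wedge (interiorProd u σ) ψp := by
  ext v
  rw [ContinuousAlternatingMap.neg_apply]
  simp only [wedge_two_two, wedge_one_three, interiorProd_two_apply, interiorProd_three_apply,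
    he.2.2.1, he.2.2.2.1, stdSigma_apply, stdPsiPlus_apply, wedge₃_apply, Matrix.cons_val]
  ring

lemma psiMinus_wedge_interior_psiPlus (hE : Module.finrank ℝ E = 6)
    (he : IsSU3Coframe e h σ ψp ψm) (u : E) :
    wedge ψm (interiorProd u ψp) = wedge (wedge σ σ) (interiorProd u σ) := by
  obtain ⟨f, hf⟩ := exists_dual_vectors he.1
  obtain ⟨b, rfl⟩ := exists_basis_of_dual he.1 hE hf
  -- Both sides are 5-forms, so five of the six vectors of an adapted basis suffice.
  refine form_ext_codim_one b fun i => ?_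
  fin_cases i <;>
  · simp only [wedge_three_two, wedge_four_one, Fin.removeNth]
    simp only [wedge_two_two, interiorProd_two_apply, interiorProd_three_apply,
      he.2.2.1, he.2.2.2.1, he.2.2.2.2, stdSigma_apply, stdPsiPlus_apply, stdPsiMinus_apply,
      wedge₃_apply, Matrix.cons_val, hf]
    simp [Fin.succAbove]
    try ring

/-- `γ ∧ ψ⁺ = Jγ ∧ ψ⁻`, since `(γ - i Jγ) ∧ (ψ⁺ + iψ⁻) = 0`. -/
lemma wedge_psiPlus (hE : Module.finrank ℝ E = 6) (he : IsSU3Coframe e h σ ψp ψm)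
    (hJ : ∀ u v, h (J u) v = σ ![u, v]) (γ : E →L[ℝ] ℝ) :
    wedge (oneForm γ) ψp = wedge (oneForm (-(γ.comp J))) ψm := by
  obtain ⟨f, hf⟩ := exists_dual_vectors he.1
  have hγ : ∀ v, γ v = ∑ j, e j v * γ (f j) := by
    intro v
    conv_lhs => rw [coframe_expand he.1 hE hf v]
    simp
  ext v
  simp only [wedge_one_three, oneForm_apply, neg_apply, ContinuousLinearMap.comp_apply, hγ (v _),
    hγ (J _), Fin.sum_univ_six, fun x => (he.coframe_J hJ x).1, fun x => (he.coframe_J hJ x).2.1,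
    fun x => (he.coframe_J hJ x).2.2.1, fun x => (he.coframe_J hJ x).2.2.2.1,
    fun x => (he.coframe_J hJ x).2.2.2.2.1, fun x => (he.coframe_J hJ x).2.2.2.2.2,
    he.2.2.2.1, he.2.2.2.2, stdPsiPlus_apply, stdPsiMinus_apply, wedge₃_apply, Matrix.cons_val]
  ring

/-- `γ ∧ ψ⁻ = -Jγ ∧ ψ⁺`. -/
lemma wedge_psiMinus (hE : Module.finrank ℝ E = 6) (he : IsSU3Coframe e h σ ψp ψm)
    (hJ : ∀ u v, h (J u) v = σ ![u, v]) (γ : E →L[ℝ] ℝ) :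
    wedge (oneForm γ) ψm = -wedge (oneForm (-(γ.comp J))) ψp := by
  have h1 := he.wedge_psiPlus hE hJ (γ.comp J)
  have h2 : -((γ.comp J).comp J) = γ := by
    ext u
    simp [he.J_J hE hJ]
  rw [h2] at h1
  rw [← h1]
  ext v
  simp only [wedge_one_three, oneForm_apply, neg_apply, ContinuousAlternatingMap.neg_apply,
    ContinuousLinearMap.comp_apply]
  ring

end IsSU3Coframe

end SU3

section G2

variable {E : Type*} [AddCommGroup E] [Module ℝ E] [TopologicalSpace E]
  {e : Fin 7 → (E →L[ℝ] ℝ)} {k : E →L[ℝ] E →L[ℝ] ℝ}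
  {φ : E [⋀^Fin 3]→L[ℝ] ℝ} {χ : E [⋀^Fin 4]→L[ℝ] ℝ}

namespace IsG2Coframe

lemma phi_apply (he : IsG2Coframe e k φ χ) (v : Fin 3 → E) :
    φ v = stdSigma (fun i => e i.castSucc) ![v 1, v 2] * e 6 (v 0)
      - stdSigma (fun i => e i.castSucc) ![v 0, v 2] * e 6 (v 1)
      + stdSigma (fun i => e i.castSucc) ![v 0, v 1] * e 6 (v 2)
      + stdPsiPlus (fun i => e i.castSucc) v := by
  rw [he.2.2.1]
  exact congrArg (· + stdPsiPlus (fun i => e i.castSucc) v) (wedge_two_one _ _ v)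

lemma star_apply (he : IsG2Coframe e k φ χ) (v : Fin 4 → E) :
    χ v = wedge (stdPsiMinus (fun i => e i.castSucc)) (oneForm (e 6)) v
      + 1 / 2 * wedge (stdSigma fun i => e i.castSucc) (stdSigma fun i => e i.castSucc) v := by
  rw [he.2.2.2]
  rfl

/-- The contraction identity `∑ᵢ φ(a, b, fᵢ) φ(c, d, fᵢ) = k(a, c) k(b, d) - k(a, d) k(b, c)
+ (*φ)(a, b, c, d)`, with `z` the cross product of `a` and `b`. -/
lemma star_eq (he : IsG2Coframe e k φ χ) {a b z : E} (hz : ∀ w, k z w = φ ![a, b, w]) (c d : E) :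
    χ ![a, b, c, d] = φ ![c, d, z] - k a c * k b d + k a d * k b c := by
  obtain ⟨f, hf⟩ := exists_dual_vectors he.1
  have hez : ∀ i, e i z = φ ![a, b, f i] := by
    intro i
    rw [← hz, he.2.1]
    simp [hf]
  have h0 := hez 0
  have h1 := hez 1
  have h2 := hez 2
  have h3 := hez 3
  have h4 := hez 4
  have h5 := hez 5
  have h6 := hez 6
  have c0 : Fin.castSucc (0 : Fin 6) = 0 := rfl
  have c1 : Fin.castSucc (1 : Fin 6) = 1 := rfl
  have c2 : Fin.castSucc (2 : Fin 6) = 2 := rfl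
  have c3 : Fin.castSucc (3 : Fin 6) = 3 := rfl
  have c4 : Fin.castSucc (4 : Fin 6) = 4 := rfl
  have c5 : Fin.castSucc (5 : Fin 6) = 5 := rfl
  simp only [he.phi_apply, stdSigma_apply, stdPsiPlus_apply,
    wedge₃_apply, Matrix.cons_val, hf, c0, c1, c2, c3, c4, c5] at h0 h1 h2 h3 h4 h5 h6
  simp at h0 h1 h2 h3 h4 h5 h6
  rw [he.star_apply, he.phi_apply]
  simp only [wedge_three_one, wedge_two_two, stdSigma_apply,
    stdPsiPlus_apply, stdPsiMinus_apply, wedge₃_apply, Matrix.cons_val, oneForm_apply, he.2.1,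
    Fin.sum_univ_seven, c0, c1, c2, c3, c4, c5, h0, h1, h2, h3, h4, h5, h6]
  ring

/-- The cross product of `a` and `b`. -/
lemma exists_cross (he : IsG2Coframe e k φ χ) [FiniteDimensional ℝ E]
    (hE : Module.finrank ℝ E = 7) (a b : E) : ∃ z, ∀ w, k z w = φ ![a, b, w] := by
  obtain ⟨f, hf⟩ := exists_dual_vectors he.1
  refine ⟨∑ i, φ ![a, b, f i] • f i, fun w => ?_⟩
  have hw : φ ![a, b, w] = ∑ j, e j w * φ ![a, b, f j] := by
    have hu : ∀ x, ![a, b, x] = Function.update ![a, b, 0] 2 x := by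
      intro x; funext i; fin_cases i <;> rfl
    have hl : ∀ x, φ ![a, b, x] = φ.toMultilinearMap.toLinearMap ![a, b, 0] 2 x := by
      intro x; rw [hu]; rfl
    simp only [hl]
    conv_lhs => rw [coframe_expand he.1 hE hf w]
    simp
  rw [hw, he.2.1]
  simp [hf, mul_comm]

/-- The 4-form `*φ` is determined by the metric and `φ`: so is the cross product, and with it the
right hand side of the contraction identity. -/
lemma star_unique [FiniteDimensional ℝ E] (hE : Module.finrank ℝ E = 7)
    (he : IsG2Coframe e k φ χ) {e' : Fin 7 → (E →L[ℝ] ℝ)} {χ' : E [⋀^Fin 4]→L[ℝ] ℝ}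
    (he' : IsG2Coframe e' k φ χ') : χ = χ' := by
  ext v
  obtain ⟨z, hz⟩ := he.exists_cross hE (v 0) (v 1)
  have hv : v = ![v 0, v 1, v 2, v 3] := by funext i; fin_cases i <;> rfl
  rw [hv, he.star_eq hz, he'.star_eq hz]

end IsG2Coframe

end G2

/-! ### Differential forms on a vector space -/

section FlatForms

variable {E : Type*} [NormedAddCommGroup E] [NormedSpace ℝ E]

/-- A form on a finite-dimensional space is a continuous linear function of finitely many of its
values. So smoothness and differentiability of a field of forms can be tested on fixed vectors. -/
lemma exists_form_of_components [FiniteDimensional ℝ E] (k : ℕ) :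
    ∃ (d : ℕ) (c : (Fin k → Fin d) → Fin k → E)
      (L : ((Fin k → Fin d) → ℝ) →L[ℝ] (E [⋀^Fin k]→L[ℝ] ℝ)),
      ∀ θ : E [⋀^Fin k]→L[ℝ] ℝ, θ = L fun i => θ (c i) := by
  let b := Module.finBasis ℝ E
  let Φ : (E [⋀^Fin k]→L[ℝ] ℝ) →ₗ[ℝ] ((Fin k → Fin (Module.finrank ℝ E)) → ℝ) :=
    { toFun := fun θ i => θ fun j => b (i j)
      map_add' := fun _ _ => rfl
      map_smul' := fun _ _ => rfl }
  have hΦ : LinearMap.ker Φ = ⊥ := by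
    rw [LinearMap.ker_eq_bot']
    intro θ hθ
    apply ContinuousAlternatingMap.toAlternatingMap_injective
    exact Module.Basis.ext_alternating b fun v _ => congrFun hθ v
  obtain ⟨L, hL⟩ := LinearMap.exists_leftInverse_of_injective Φ hΦ
  refine ⟨_, fun i j => b (i j), LinearMap.toContinuousLinearMap L, fun θ => ?_⟩
  exact (LinearMap.congr_fun hL θ).symm

variable {X : Type*} [NormedAddCommGroup X] [NormedSpace ℝ X]

lemma contDiffAt_form_apply {k : ℕ} {n : WithTop ℕ∞} {θ : X → E [⋀^Fin k]→L[ℝ] ℝ} {x : X}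
    (h : ContDiffAt ℝ n θ x) (v : Fin k → E) : ContDiffAt ℝ n (fun y => θ y v) x :=
  (ContinuousAlternatingMap.apply ℝ E ℝ v).contDiff.contDiffAt.comp x h

lemma contDiffAt_form_iff [FiniteDimensional ℝ E] {k : ℕ} {n : WithTop ℕ∞}
    {θ : X → E [⋀^Fin k]→L[ℝ] ℝ} {x : X} :
    ContDiffAt ℝ n θ x ↔ ∀ v, ContDiffAt ℝ n (fun y => θ y v) x := by
  refine ⟨contDiffAt_form_apply, fun h => ?_⟩
  obtain ⟨d, c, L, hL⟩ := exists_form_of_components (E := E) k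
  have : θ = fun y => L fun i => θ y (c i) := funext fun y => hL (θ y)
  rw [this]
  exact L.contDiff.contDiffAt.comp x (contDiffAt_pi.2 fun i => h _)

lemma differentiableAt_form_apply {k : ℕ} {θ : X → E [⋀^Fin k]→L[ℝ] ℝ} {x : X}
    (h : DifferentiableAt ℝ θ x) (v : Fin k → E) : DifferentiableAt ℝ (fun y => θ y v) x :=
  (ContinuousAlternatingMap.apply ℝ E ℝ v).differentiableAt.comp x h

lemma fderiv_form_apply {k : ℕ} {θ : X → E [⋀^Fin k]→L[ℝ] ℝ} {x : X}
    (h : DifferentiableAt ℝ θ x) (v : Fin k → E) (u : X) :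
    fderiv ℝ (fun y => θ y v) x u = fderiv ℝ θ x u v :=
  fderiv_continuousAlternatingMap_apply_const_apply h v u

lemma differentiableAt_form_iff [FiniteDimensional ℝ E] {k : ℕ}
    {θ : X → E [⋀^Fin k]→L[ℝ] ℝ} {x : X} :
    DifferentiableAt ℝ θ x ↔ ∀ v, DifferentiableAt ℝ (fun y => θ y v) x := by
  refine ⟨differentiableAt_form_apply, fun h => ?_⟩
  obtain ⟨d, c, L, hL⟩ := exists_form_of_components (E := E) k
  have : θ = fun y => L fun i => θ y (c i) := funext fun y => hL (θ y)
  rw [this]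
  exact L.differentiableAt.comp x (differentiableAt_pi.2 fun i => h _)

variable [FiniteDimensional ℝ E]

lemma ContDiffAt.wedge {p q : ℕ} {n : WithTop ℕ∞} {α : X → E [⋀^Fin p]→L[ℝ] ℝ}
    {β : X → E [⋀^Fin q]→L[ℝ] ℝ} {x : X} (hα : ContDiffAt ℝ n α x) (hβ : ContDiffAt ℝ n β x) :
    ContDiffAt ℝ n (fun y => wedge (α y) (β y)) x := by
  rw [contDiffAt_form_iff]
  intro v
  simp only [wedge_apply, altSum]
  exact contDiffAt_const.mul (ContDiffAt.sum fun s _ => contDiffAt_const.mul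
    ((contDiffAt_form_apply hα _).mul (contDiffAt_form_apply hβ _)))

lemma DifferentiableAt.wedge {p q : ℕ} {α : X → E [⋀^Fin p]→L[ℝ] ℝ}
    {β : X → E [⋀^Fin q]→L[ℝ] ℝ} {x : X} (hα : DifferentiableAt ℝ α x)
    (hβ : DifferentiableAt ℝ β x) : DifferentiableAt ℝ (fun y => wedge (α y) (β y)) x := by
  rw [differentiableAt_form_iff]
  intro v
  simp only [wedge_apply, altSum]
  exact (differentiableAt_const _).mul (DifferentiableAt.fun_sum fun s _ =>
    (differentiableAt_const _).mul
      ((differentiableAt_form_apply hα _).mul (differentiableAt_form_apply hβ _)))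

lemma fderiv_wedge {p q : ℕ} {α : X → E [⋀^Fin p]→L[ℝ] ℝ}
    {β : X → E [⋀^Fin q]→L[ℝ] ℝ} {x : X} (hα : DifferentiableAt ℝ α x)
    (hβ : DifferentiableAt ℝ β x) (u : X) :
    fderiv ℝ (fun y => wedge (α y) (β y)) x u
      = wedge (fderiv ℝ α x u) (β x) + wedge (α x) (fderiv ℝ β x u) := by
  ext v
  rw [← fderiv_form_apply (hα.wedge hβ)]
  simp only [wedge_apply, altSum, ContinuousAlternatingMap.add_apply]
  have h : ∀ s : Equiv.Perm (Fin (p + q)), HasFDerivAt (fun y =>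
      ((Equiv.Perm.sign s : ℤ) : ℝ) * (α y (fun i => (v ∘ s) (Fin.castAdd q i))
        * β y (fun j => (v ∘ s) (Fin.natAdd p j))))
      (((Equiv.Perm.sign s : ℤ) : ℝ) •
        (α x (fun i => (v ∘ s) (Fin.castAdd q i)) •
          fderiv ℝ (fun y => β y (fun j => (v ∘ s) (Fin.natAdd p j))) x +
        β x (fun j => (v ∘ s) (Fin.natAdd p j)) •
          fderiv ℝ (fun y => α y (fun i => (v ∘ s) (Fin.castAdd q i))) x)) x := fun s =>
    ((differentiableAt_form_apply hα _).hasFDerivAt.mul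
      (differentiableAt_form_apply hβ _).hasFDerivAt).const_mul _
  have h2 := (HasFDerivAt.fun_sum (u := Finset.univ) fun s _ => h s).const_mul
    ((p.factorial * q.factorial : ℝ)⁻¹)
  rw [h2.fderiv, ← mul_add, ← Finset.sum_add_distrib]
  simp only [smul_apply, sum_apply, add_apply, smul_eq_mul, fderiv_form_apply hα,
    fderiv_form_apply hβ]
  congr 1
  refine Finset.sum_congr rfl fun s _ => ?_
  ring

omit [FiniteDimensional ℝ E] in
lemma ContDiffAt.interiorProd {k : ℕ} {n : WithTop ℕ∞} {α : X → E [⋀^Fin (k + 1)]→L[ℝ] ℝ}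
    {U : X → E} {x : X} (hα : ContDiffAt ℝ n α x) (hU : ContDiffAt ℝ n U x) :
    ContDiffAt ℝ n (fun y => interiorProd (U y) (α y)) x := by
  let C := (ContinuousAlternatingMap.curryLeftLI (𝕜 := ℝ) (E := E) (F := ℝ)
    (n := k)).toContinuousLinearMap
  have : (fun y => _root_.interiorProd (U y) (α y)) = fun y => (C (α y)) (U y) := by
    funext y; ext v; rfl
  rw [this]
  exact (C.contDiff.contDiffAt.comp x hα).clm_apply hU

omit [FiniteDimensional ℝ E] in
lemma fderiv_interiorProd {k : ℕ} {α : X → E [⋀^Fin (k + 1)]→L[ℝ] ℝ}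
    {U : X → E} {x : X} (hα : DifferentiableAt ℝ α x) (hU : DifferentiableAt ℝ U x) (u : X) :
    DifferentiableAt ℝ (fun y => interiorProd (U y) (α y)) x ∧
    fderiv ℝ (fun y => interiorProd (U y) (α y)) x u
      = interiorProd (U x) (fderiv ℝ α x u) + interiorProd (fderiv ℝ U x u) (α x) := by
  let C := (ContinuousAlternatingMap.curryLeftLI (𝕜 := ℝ) (E := E) (F := ℝ)
    (n := k)).toContinuousLinearMap
  have : (fun y => _root_.interiorProd (U y) (α y)) = fun y => (C (α y)) (U y) := by
    funext y; ext v; rfl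
  have h1 : HasFDerivAt (fun y => C (α y)) (C ∘L fderiv ℝ α x) x :=
    by
    have hC : HasFDerivAt (fun β => C β) C (α x) := C.hasFDerivAt
    exact HasFDerivAt.comp (𝕜 := ℝ) (E := X) (F := E [⋀^Fin (k + 1)]→L[ℝ] ℝ)
      (G := E →L[ℝ] E [⋀^Fin k]→L[ℝ] ℝ) x hC hα.hasFDerivAt
  have h2 := h1.clm_apply hU.hasFDerivAt
  rw [this]
  refine ⟨h2.differentiableAt, ?_⟩
  rw [h2.fderiv]
  ext v
  simp only [add_apply, ContinuousLinearMap.comp_apply, ContinuousAlternatingMap.add_apply,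
    ContinuousLinearMap.flip_apply]
  rw [add_comm]
  rfl

lemma ContDiffAt.form_apply {k : ℕ} {n : WithTop ℕ∞} {α : X → E [⋀^Fin k]→L[ℝ] ℝ}
    {Z : X → Fin k → E} {x : X} (hα : ContDiffAt ℝ n α x)
    (hZ : ∀ i, ContDiffAt ℝ n (fun y => Z y i) x) : ContDiffAt ℝ n (fun y => α y (Z y)) x := by
  classical
  let b := Module.finBasis ℝ E
  have h : (fun y => α y (Z y)) = fun y => ∑ r : Fin k → Fin (Module.finrank ℝ E),
      (∏ i, LinearMap.toContinuousLinearMap (b.coord (r i)) (Z y i)) * α y (fun i => b (r i)) := by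
    funext y
    have h1 : Z y = fun i => ∑ j, b.coord j (Z y i) • b j := by
      funext i
      exact (b.sum_repr (Z y i)).symm
    conv_lhs => rw [h1]
    have h2 := (α y).toMultilinearMap.map_sum (fun i j => b.coord j (Z y i) • b j)
    refine h2.trans (Finset.sum_congr rfl fun r _ => ?_)
    rw [MultilinearMap.map_smul_univ]
    rfl
  rw [h]
  refine ContDiffAt.sum fun r _ => ContDiffAt.mul ?_ (contDiffAt_form_apply hα _)
  exact contDiffAt_prod fun i _ => ContinuousLinearMap.contDiff _ |>.contDiffAt.comp x (hZ i)

lemma ContDiffAt.compForm {F : Type*} [NormedAddCommGroup F] [NormedSpace ℝ F]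
    [FiniteDimensional ℝ F] {k : ℕ} {n : WithTop ℕ∞} {α : X → F [⋀^Fin k]→L[ℝ] ℝ}
    {A : X → E →L[ℝ] F} {x : X} (hα : ContDiffAt ℝ n α x) (hA : ContDiffAt ℝ n A x) :
    ContDiffAt ℝ n (fun y => (α y).compContinuousLinearMap (A y)) x := by
  refine contDiffAt_form_iff.2 fun v => ?_
  change ContDiffAt ℝ n (fun y => α y (fun i => A y (v i))) x
  exact hα.form_apply fun _ => hA.clm_apply contDiffAt_const

end FlatForms

section ExtDeriv

variable {E : Type*} [NormedAddCommGroup E] [NormedSpace ℝ E]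

lemma extDeriv_one_apply (α : E → E [⋀^Fin 1]→L[ℝ] ℝ) (x : E) (v : Fin 2 → E) :
    extDeriv α x v = fderiv ℝ α x (v 0) ![v 1] - fderiv ℝ α x (v 1) ![v 0] := by
  rw [extDeriv, ContinuousAlternatingMap.alternatizeUncurryFin_apply]
  have h0 : (0 : Fin 2).removeNth v = ![v 1] := by funext i; fin_cases i; rfl
  have h1 : (1 : Fin 2).removeNth v = ![v 0] := by funext i; fin_cases i; rfl
  refine (Fin.sum_univ_two _).trans ?_
  simp only [h0, h1]
  norm_num
  ring

lemma extDeriv_two_apply (α : E → E [⋀^Fin 2]→L[ℝ] ℝ) (x : E) (v : Fin 3 → E) :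
    extDeriv α x v = fderiv ℝ α x (v 0) ![v 1, v 2] - fderiv ℝ α x (v 1) ![v 0, v 2]
      + fderiv ℝ α x (v 2) ![v 0, v 1] := by
  rw [extDeriv, ContinuousAlternatingMap.alternatizeUncurryFin_apply]
  have h0 : (0 : Fin 3).removeNth v = ![v 1, v 2] := by funext i; fin_cases i <;> rfl
  have h1 : (1 : Fin 3).removeNth v = ![v 0, v 2] := by funext i; fin_cases i <;> rfl
  have h2 : (2 : Fin 3).removeNth v = ![v 0, v 1] := by funext i; fin_cases i <;> rfl
  refine (Fin.sum_univ_three _).trans ?_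
  simp only [h0, h1, h2]
  norm_num
  ring

lemma extDeriv_three_apply (α : E → E [⋀^Fin 3]→L[ℝ] ℝ) (x : E) (v : Fin 4 → E) :
    extDeriv α x v = fderiv ℝ α x (v 0) ![v 1, v 2, v 3] - fderiv ℝ α x (v 1) ![v 0, v 2, v 3]
      + fderiv ℝ α x (v 2) ![v 0, v 1, v 3] - fderiv ℝ α x (v 3) ![v 0, v 1, v 2] := by
  rw [extDeriv, ContinuousAlternatingMap.alternatizeUncurryFin_apply]
  have h0 : (0 : Fin 4).removeNth v = ![v 1, v 2, v 3] := by funext i; fin_cases i <;> rfl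
  have h1 : (1 : Fin 4).removeNth v = ![v 0, v 2, v 3] := by funext i; fin_cases i <;> rfl
  have h2 : (2 : Fin 4).removeNth v = ![v 0, v 1, v 3] := by funext i; fin_cases i <;> rfl
  have h3 : (3 : Fin 4).removeNth v = ![v 0, v 1, v 2] := by funext i; fin_cases i <;> rfl
  refine (Fin.sum_univ_four _).trans ?_
  simp only [h0, h1, h2, h3]
  norm_num
  ring

lemma extDeriv_four_apply (α : E → E [⋀^Fin 4]→L[ℝ] ℝ) (x : E) (v : Fin 5 → E) :
    extDeriv α x v = fderiv ℝ α x (v 0) ![v 1, v 2, v 3, v 4]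
      - fderiv ℝ α x (v 1) ![v 0, v 2, v 3, v 4] + fderiv ℝ α x (v 2) ![v 0, v 1, v 3, v 4]
      - fderiv ℝ α x (v 3) ![v 0, v 1, v 2, v 4] + fderiv ℝ α x (v 4) ![v 0, v 1, v 2, v 3] := by
  rw [extDeriv, ContinuousAlternatingMap.alternatizeUncurryFin_apply]
  have h0 : (0 : Fin 5).removeNth v = ![v 1, v 2, v 3, v 4] := by funext i; fin_cases i <;> rfl
  have h1 : (1 : Fin 5).removeNth v = ![v 0, v 2, v 3, v 4] := by funext i; fin_cases i <;> rfl
  have h2 : (2 : Fin 5).removeNth v = ![v 0, v 1, v 3, v 4] := by funext i; fin_cases i <;> rfl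
  have h3 : (3 : Fin 5).removeNth v = ![v 0, v 1, v 2, v 4] := by funext i; fin_cases i <;> rfl
  have h4 : (4 : Fin 5).removeNth v = ![v 0, v 1, v 2, v 3] := by funext i; fin_cases i <;> rfl
  refine (Fin.sum_univ_five _).trans ?_
  simp only [h0, h1, h2, h3, h4]
  norm_num
  ring

variable [FiniteDimensional ℝ E]

lemma extDeriv_wedge_two_one {α : E → E [⋀^Fin 2]→L[ℝ] ℝ} {β : E → E [⋀^Fin 1]→L[ℝ] ℝ} {x : E}
    (hα : DifferentiableAt ℝ α x) (hβ : DifferentiableAt ℝ β x) (v : Fin 4 → E) :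
    extDeriv (fun y => wedge (α y) (β y)) x v
      = wedge (extDeriv α x) (β x) v + wedge (α x) (extDeriv β x) v := by
  refine (extDeriv_three_apply _ x v).trans ?_
  rw [wedge_three_one, wedge_two_two]
  simp only [extDeriv_two_apply, extDeriv_one_apply, fderiv_wedge hα hβ, Matrix.cons_val]
  have h : ∀ (u : E) (w : Fin 3 → E), (wedge (fderiv ℝ α x u) (β x)
      + wedge (α x) (fderiv ℝ β x u) : E [⋀^Fin 3]→L[ℝ] ℝ) w
      = wedge (fderiv ℝ α x u) (β x) w + wedge (α x) (fderiv ℝ β x u) w := fun _ _ => rfl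
  simp only [h, wedge_two_one, Matrix.cons_val]
  ring

lemma extDeriv_wedge_three_one {α : E → E [⋀^Fin 3]→L[ℝ] ℝ} {β : E → E [⋀^Fin 1]→L[ℝ] ℝ} {x : E}
    (hα : DifferentiableAt ℝ α x) (hβ : DifferentiableAt ℝ β x) (v : Fin 5 → E) :
    extDeriv (fun y => wedge (α y) (β y)) x v
      = wedge (extDeriv α x) (β x) v - wedge (α x) (extDeriv β x) v := by
  refine (extDeriv_four_apply _ x v).trans ?_
  rw [wedge_four_one, wedge_three_two]
  simp only [extDeriv_three_apply, extDeriv_one_apply, fderiv_wedge hα hβ, Matrix.cons_val]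
  have h : ∀ (u : E) (w : Fin 4 → E), (wedge (fderiv ℝ α x u) (β x)
      + wedge (α x) (fderiv ℝ β x u) : E [⋀^Fin 4]→L[ℝ] ℝ) w
      = wedge (fderiv ℝ α x u) (β x) w + wedge (α x) (fderiv ℝ β x u) w := fun _ _ => rfl
  simp only [h, wedge_three_one, Matrix.cons_val]
  ring

lemma extDeriv_wedge_two_two_of_closed {α : E → E [⋀^Fin 2]→L[ℝ] ℝ} {x : E}
    (hα : DifferentiableAt ℝ α x) (hd : extDeriv α x = 0) :
    extDeriv (fun y => wedge (α y) (α y)) x = 0 := by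
  -- `dα = 0` expresses the derivative in the direction `c` through those in the directions `a`,
  -- `b`.
  have hd' : ∀ a b c, fderiv ℝ α x c ![a, b] = -fderiv ℝ α x a ![b, c]
      + fderiv ℝ α x b ![a, c] := by
    intro a b c
    have := extDeriv_two_apply α x ![a, b, c]
    rw [hd] at this
    simp only [Matrix.cons_val] at this
    have h0 : (0 : E [⋀^Fin 3]→L[ℝ] ℝ) ![a, b, c] = 0 := rfl
    linarith [h0.symm.trans this]
  ext v
  refine (extDeriv_four_apply _ x v).trans ?_
  simp only [fderiv_wedge hα hα]
  have h : ∀ (u : E) (w : Fin 4 → E), (wedge (fderiv ℝ α x u) (α x)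
      + wedge (α x) (fderiv ℝ α x u) : E [⋀^Fin 4]→L[ℝ] ℝ) w
      = wedge (fderiv ℝ α x u) (α x) w + wedge (α x) (fderiv ℝ α x u) w := fun _ _ => rfl
  simp only [h, wedge_two_two, Matrix.cons_val]
  simp only [hd' (v 0) (v 1) (v 2), hd' (v 0) (v 1) (v 3), hd' (v 0) (v 2) (v 3),
    hd' (v 1) (v 2) (v 3), hd' (v 0) (v 1) (v 4), hd' (v 0) (v 2) (v 4), hd' (v 0) (v 3) (v 4),
    hd' (v 1) (v 2) (v 4), hd' (v 1) (v 3) (v 4), hd' (v 2) (v 3) (v 4)]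
  rw [show (0 : E [⋀^Fin (2 + 2 + 1)]→L[ℝ] ℝ) v = 0 from rfl]
  ring

omit [FiniteDimensional ℝ E] in
lemma fderiv_smul_form {k : ℕ} {f : E → ℝ} {θ : E → E [⋀^Fin k]→L[ℝ] ℝ} {x : E}
    (hf : DifferentiableAt ℝ f x) (hθ : DifferentiableAt ℝ θ x) (u : E) :
    fderiv ℝ (fun y => f y • θ y) x u = fderiv ℝ f x u • θ x + f x • fderiv ℝ θ x u := by
  rw [fderiv_fun_smul hf hθ]
  simp [add_comm]

omit [FiniteDimensional ℝ E] in
lemma extDeriv_smul_three {f : E → ℝ} {θ : E → E [⋀^Fin 3]→L[ℝ] ℝ} {x : E}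
    (hf : DifferentiableAt ℝ f x) (hθ : DifferentiableAt ℝ θ x) (v : Fin 4 → E) :
    extDeriv (fun y => f y • θ y) x v
      = wedge (oneForm (fderiv ℝ f x)) (θ x) v + f x * extDeriv θ x v := by
  rw [extDeriv_three_apply, extDeriv_three_apply, wedge_one_three]
  simp only [fderiv_smul_form hf hθ, ContinuousAlternatingMap.add_apply,
    ContinuousAlternatingMap.smul_apply, smul_eq_mul, oneForm_apply, Matrix.cons_val]
  ring

omit [FiniteDimensional ℝ E] in
lemma extDeriv_smul_four {f : E → ℝ} {θ : E → E [⋀^Fin 4]→L[ℝ] ℝ} {x : E}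
    (hf : DifferentiableAt ℝ f x) (hθ : DifferentiableAt ℝ θ x) (v : Fin 5 → E) :
    extDeriv (fun y => f y • θ y) x v
      = wedge (θ x) (oneForm (fderiv ℝ f x)) v + f x * extDeriv θ x v := by
  rw [extDeriv_four_apply, extDeriv_four_apply, wedge_four_one]
  simp only [fderiv_smul_form hf hθ, ContinuousAlternatingMap.add_apply,
    ContinuousAlternatingMap.smul_apply, smul_eq_mul, oneForm_apply, Matrix.cons_val]
  ring

/-- The exterior derivative of the differential of a function vanishes. -/
lemma extDeriv_oneForm_fderiv {f : E → ℝ} {x : E} (hf : ContDiffAt ℝ 2 f x) :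
    extDeriv (fun y => oneForm (fderiv ℝ f y)) x = 0 := by
  have hd : DifferentiableAt ℝ (fun y => fderiv ℝ f y) x :=
    (hf.fderiv_right (m := 1) le_rfl).differentiableAt one_ne_zero
  have hd1 : DifferentiableAt ℝ (fun y => oneForm (fderiv ℝ f y)) x :=
    differentiableAt_form_iff.2 fun v => hd.clm_apply (differentiableAt_const _)
  ext v
  refine (extDeriv_one_apply _ x v).trans ?_
  rw [← fderiv_form_apply hd1, ← fderiv_form_apply hd1]
  simp only [oneForm_apply, Matrix.cons_val]
  have h : ∀ a b, fderiv ℝ (fun y => fderiv ℝ f y a) x b = fderiv ℝ (fderiv ℝ f) x b a := by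
    intro a b
    rw [fderiv_clm_apply hd (differentiableAt_const _)]
    simp
  rw [h, h, (hf.isSymmSndFDerivAt (by simp)).eq]
  simp

omit [FiniteDimensional ℝ E] in
/-- Cartan's formula: the Lie derivative as a derivation. -/
lemma extDeriv_interiorProd_add {k : ℕ} {α : E → E [⋀^Fin (k + 1)]→L[ℝ] ℝ} {U : E → E} {x : E}
    (hα : DifferentiableAt ℝ α x) (hU : DifferentiableAt ℝ U x) (v : Fin (k + 1) → E) :
    extDeriv (fun y => interiorProd (U y) (α y)) x v + interiorProd (U x) (extDeriv α x) v
      = fderiv ℝ α x (U x) v + ∑ i : Fin (k + 1), (-1) ^ (i : ℕ) *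
          α x (Matrix.vecCons (fderiv ℝ U x (v i)) (i.removeNth v)) := by
  rw [interiorProd_apply, extDeriv, extDeriv,
    ContinuousAlternatingMap.alternatizeUncurryFin_apply,
    ContinuousAlternatingMap.alternatizeUncurryFin_apply, Fin.sum_univ_succ (n := k + 1)]
  have h0 : (0 : Fin (k + 2)).removeNth (Matrix.vecCons (U x) v) = v := by
    funext i; simp [Fin.removeNth]
  have hs : ∀ i : Fin (k + 1), (i.succ).removeNth (Matrix.vecCons (U x) v)
      = Matrix.vecCons (U x) (i.removeNth v) := by
    intro i
    funext j
    refine Fin.cases ?_ (fun j => ?_) j <;> simp [Fin.removeNth]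
  simp only [h0, hs, (fderiv_interiorProd hα hU _).2, ContinuousAlternatingMap.add_apply,
    interiorProd_apply, Fin.val_zero, pow_zero, one_smul, Matrix.cons_val_zero,
    Matrix.cons_val_succ, Fin.val_succ]
  rw [add_left_comm, ← Finset.sum_add_distrib]
  congr 1
  refine Finset.sum_congr rfl fun i _ => ?_
  rw [zsmul_eq_mul, zsmul_eq_mul]
  push_cast
  ring

end ExtDeriv

/-! ### Integrability and symmetries of `(3, 0)`-forms -/

section FormAlgebra

variable {E : Type*} [AddCommGroup E] [Module ℝ E] [TopologicalSpace E]

lemma form_three_swap_left (α : E [⋀^Fin 3]→L[ℝ] ℝ) (a b c : E) :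
    α ![b, a, c] = -α ![a, b, c] := by
  have h := α.toAlternatingMap.map_swap ![a, b, c] (i := 0) (j := 1) (by decide)
  have h2 : (![a, b, c] ∘ Equiv.swap (0 : Fin 3) 1) = ![b, a, c] := by
    funext i; fin_cases i <;> rfl
  rw [h2] at h
  exact h

lemma form_three_swap_right (α : E [⋀^Fin 3]→L[ℝ] ℝ) (a b c : E) :
    α ![a, c, b] = -α ![a, b, c] := by
  have h := α.toAlternatingMap.map_swap ![a, b, c] (i := 1) (j := 2) (by decide)
  have h2 : (![a, b, c] ∘ Equiv.swap (1 : Fin 3) 2) = ![a, c, b] := by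
    funext i; fin_cases i <;> rfl
  rw [h2] at h
  exact h

lemma form_four_swap_left (α : E [⋀^Fin 4]→L[ℝ] ℝ) (a b c d : E) :
    α ![b, a, c, d] = -α ![a, b, c, d] := by
  have h := α.toAlternatingMap.map_swap ![a, b, c, d] (i := 0) (j := 1) (by decide)
  have h2 : (![a, b, c, d] ∘ Equiv.swap (0 : Fin 4) 1) = ![b, a, c, d] := by
    funext i; fin_cases i <;> rfl
  rw [h2] at h
  exact h

lemma form_four_swap_middle (α : E [⋀^Fin 4]→L[ℝ] ℝ) (a b c d : E) :
    α ![a, c, b, d] = -α ![a, b, c, d] := by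
  have h := α.toAlternatingMap.map_swap ![a, b, c, d] (i := 1) (j := 2) (by decide)
  have h2 : (![a, b, c, d] ∘ Equiv.swap (1 : Fin 4) 2) = ![a, c, b, d] := by
    funext i; fin_cases i <;> rfl
  rw [h2] at h
  exact h

/-- The value of a form as a linear function of its first argument. -/
def formFirst {k : ℕ} (α : E [⋀^Fin (k + 1)]→L[ℝ] ℝ) (v : Fin k → E) : E →ₗ[ℝ] ℝ where
  toFun u := α (Matrix.vecCons u v)
  map_add' a b := by
    have h := α.map_update_add (Matrix.vecCons 0 v) 0 a b
    simpa [Matrix.vecCons, Fin.update_cons_zero] using h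
  map_smul' c a := by
    have h := α.map_update_smul (Matrix.vecCons 0 v) 0 c a
    simpa [Matrix.vecCons, Fin.update_cons_zero] using h

lemma form_vecCons_add {k : ℕ} (α : E [⋀^Fin (k + 1)]→L[ℝ] ℝ) (v : Fin k → E) (a b : E) :
    α (Matrix.vecCons (a + b) v) = α (Matrix.vecCons a v) + α (Matrix.vecCons b v) :=
  (formFirst α v).map_add a b

lemma form_vecCons_sub {k : ℕ} (α : E [⋀^Fin (k + 1)]→L[ℝ] ℝ) (v : Fin k → E) (a b : E) :
    α (Matrix.vecCons (a - b) v) = α (Matrix.vecCons a v) - α (Matrix.vecCons b v) :=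
  (formFirst α v).map_sub a b

lemma form_vecCons_neg {k : ℕ} (α : E [⋀^Fin (k + 1)]→L[ℝ] ℝ) (v : Fin k → E) (a : E) :
    α (Matrix.vecCons (-a) v) = -α (Matrix.vecCons a v) :=
  (formFirst α v).map_neg a

lemma form_vecCons_zero {k : ℕ} (α : E [⋀^Fin (k + 1)]→L[ℝ] ℝ) (v : Fin k → E) :
    α (Matrix.vecCons 0 v) = 0 :=
  (formFirst α v).map_zero

end FormAlgebra

section FlatSU3

variable {E : Type*} [NormedAddCommGroup E] [NormedSpace ℝ E]

lemma hasFDerivAt_form_first {k : ℕ} {α : E → E [⋀^Fin (k + 1)]→L[ℝ] ℝ} {Z : E → E} {x : E}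
    (hα : DifferentiableAt ℝ α x) (hZ : DifferentiableAt ℝ Z x) (v : Fin k → E) (u : E) :
    DifferentiableAt ℝ (fun y => α y (Matrix.vecCons (Z y) v)) x ∧
    fderiv ℝ (fun y => α y (Matrix.vecCons (Z y) v)) x u
      = fderiv ℝ α x u (Matrix.vecCons (Z x) v)
        + α x (Matrix.vecCons (fderiv ℝ Z x u) v) := by
  obtain ⟨h1, h2⟩ := fderiv_interiorProd hα hZ u
  refine ⟨differentiableAt_form_apply h1 v, ?_⟩
  have h3 := fderiv_form_apply h1 v u
  rw [h2] at h3
  exact h3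

lemma hasFDerivAt_form_endo {k : ℕ} {α : E → E [⋀^Fin (k + 1)]→L[ℝ] ℝ} {J : E → E →L[ℝ] E} {x : E}
    (hα : DifferentiableAt ℝ α x) (hJ : DifferentiableAt ℝ J x) (a : E) (v : Fin k → E) (u : E) :
    DifferentiableAt ℝ (fun y => α y (Matrix.vecCons (J y a) v)) x ∧
    fderiv ℝ (fun y => α y (Matrix.vecCons (J y a) v)) x u
      = fderiv ℝ α x u (Matrix.vecCons (J x a) v)
        + α x (Matrix.vecCons (fderiv ℝ J x u a) v) := by
  have hZ : DifferentiableAt ℝ (fun y => J y a) x := hJ.clm_apply (differentiableAt_const a)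
  have h := hasFDerivAt_form_first hα hZ v u
  rw [fderiv_clm_apply hJ (differentiableAt_const a)] at h
  simpa using h

lemma fderiv_J_J {J : E → E →L[ℝ] E} {x : E} (hJ : DifferentiableAt ℝ J x)
    (hJJ : ∀ᶠ y in 𝓝 x, ∀ a, J y (J y a) = -a) (u a : E) :
    fderiv ℝ J x u (J x a) + J x (fderiv ℝ J x u a) = 0 := by
  have h0 : (fun y => J y (J y a)) =ᶠ[𝓝 x] fun _ => -a := hJJ.mono fun y hy => hy a
  have h1 : fderiv ℝ (fun y => J y (J y a)) x u = 0 := by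
    rw [h0.fderiv_eq]; simp
  have hJa : DifferentiableAt ℝ (fun y => J y a) x := hJ.clm_apply (differentiableAt_const a)
  rw [fderiv_clm_apply hJ hJa, fderiv_clm_apply hJ (differentiableAt_const a)] at h1
  simp only [add_apply, ContinuousLinearMap.comp_apply, ContinuousLinearMap.flip_apply,
    fderiv_fun_const, Pi.zero_apply, map_zero, zero_apply] at h1
  simpa [add_comm] using h1

/-- An infinitesimal transformation that preserves `ψ⁺` preserves `J`. Here `w` and `A` are the
value and the derivative at `x` of the vector field. The defect `K` of `J` satisfies
`ψ⁺(Ka, b, c) = ψ⁺(a, Kb, c)` and `KJ = -JK`, and these force `K = 0`. -/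
lemma fderiv_J_of_preserves_psiPlus {J : E → E →L[ℝ] E} {ψ : E → E [⋀^Fin 3]→L[ℝ] ℝ} {x : E}
    (hψ : DifferentiableAt ℝ ψ x) (hJ : DifferentiableAt ℝ J x)
    (hJJ : ∀ᶠ y in 𝓝 x, ∀ a, J y (J y a) = -a)
    (hmid : ∀ᶠ y in 𝓝 x, ∀ a b c, ψ y ![J y a, b, c] = -ψ y ![J y b, a, c])
    (hnd : ∀ u, (∀ a b, ψ x ![u, a, b] = 0) → u = 0) (w : E) (A : E →L[ℝ] E)
    (hL : ∀ a b c, fderiv ℝ ψ x w ![a, b, c] + ψ x ![A a, b, c] - ψ x ![A b, a, c]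
      + ψ x ![A c, a, b] = 0) (a : E) :
    fderiv ℝ J x w a + J x (A a) - A (J x a) = 0 := by
  -- `K` is the value at `x` of the Lie derivative of `J`.
  let K : E → E := fun a => fderiv ℝ J x w a + J x (A a) - A (J x a)
  have hx := hmid.self_of_nhds
  have hJx := hJJ.self_of_nhds
  have hd : ∀ a b c, fderiv ℝ ψ x w ![J x a, b, c] + ψ x ![fderiv ℝ J x w a, b, c]
      = -(fderiv ℝ ψ x w ![J x b, a, c] + ψ x ![fderiv ℝ J x w b, a, c]) := by
    intro a b c
    have h0 : (fun y => ψ y ![J y a, b, c]) =ᶠ[𝓝 x] fun y => -ψ y ![J y b, a, c] :=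
      hmid.mono fun y hy => hy a b c
    have h1 := congrArg (fun L : E →L[ℝ] ℝ => L w) h0.fderiv_eq
    simp only [fderiv_fun_neg, neg_apply] at h1
    rw [(hasFDerivAt_form_endo hψ hJ a _ w).2, (hasFDerivAt_form_endo hψ hJ b _ w).2] at h1
    exact h1
  -- Lie derivative of the identity `ψ(Ja, b, c) = -ψ(Jb, a, c)`.
  have hK : ∀ a b c, ψ x ![K a, b, c] = -ψ x ![K b, a, c] := by
    intro a b c
    simp only [K, form_vecCons_add, form_vecCons_sub]
    have e1 := hL (J x a) b c
    have e2 := hL (J x b) a c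
    have e3 := hd a b c
    have e4 := hx (A a) b c
    have e5 := hx (A b) a c
    have e6 := hx a b (A c)
    have e7 := form_three_swap_left (ψ x) (A b) (J x a) c
    have e8 := form_three_swap_left (ψ x) (A a) (J x b) c
    have e9 := form_three_swap_left (ψ x) (A c) (J x a) b
    have e10 := form_three_swap_left (ψ x) (A c) (J x b) a
    have e11 := form_three_swap_right (ψ x) (J x a) (A c) b
    have e12 := form_three_swap_right (ψ x) (J x b) (A c) a
    linarith
  have hKJ : ∀ a, K (J x a) = -J x (K a) := by
    intro a
    have h1 := fderiv_J_J hJ hJJ w a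
    have h2 : fderiv ℝ J x w (J x a) = -J x (fderiv ℝ J x w a) := eq_neg_of_add_eq_zero_left h1
    simp only [K, map_add, map_sub, hJx, h2, map_neg]
    abel
  -- By `hK`, `β = ψ(K·, ·, ·)` is a 3-form, and `β(Ja, b, c) = -β(a, Jb, c)`. So `β(Ja, b, c)` is
  -- symmetric in `a, b` and skew in `b, c`, and vanishes.
  have hS : ∀ a b c, ψ x ![K (J x a), b, c] = -ψ x ![K a, J x b, c] := by
    intro a b c
    have h1 := hx (K a) b c
    have h2 := form_three_swap_left (ψ x) (K a) (J x b) c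
    rw [hKJ, form_vecCons_neg]
    linarith
  have hS0 : ∀ a b c, ψ x ![K (J x a), b, c] = 0 := by
    intro a b c
    have h1 := hS a b c
    have h2 := hS a c b
    have h3 := form_three_swap_right (ψ x) (K (J x a)) b c
    have h4 := form_three_swap_right (ψ x) (K a) b (J x c)
    have h5 := hK a (J x b) c
    have h6 := hS b a c
    have h7 := hK b a (J x c)
    have h8 := hS b c a
    have h9 := form_three_swap_right (ψ x) (K (J x b)) a c
    have h10 := form_three_swap_right (ψ x) (K b) a (J x c)
    linarith
  refine hnd _ fun b c => ?_
  have h1 := hS0 (-J x a) b c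
  rwa [map_neg, hJx, neg_neg] at h1

/-- If `J` is integrable and `ψ⁺ + iψ⁻` is of type `(3, 0)`, its exterior derivative has type
`(3, 1)`; so it vanishes once its imaginary part does. -/
lemma extDeriv_psiPlus_eq_zero {J : E → E →L[ℝ] E} {ψp ψm : E → E [⋀^Fin 3]→L[ℝ] ℝ} {x : E}
    (hp : DifferentiableAt ℝ ψp x) (hm : DifferentiableAt ℝ ψm x) (hJ : DifferentiableAt ℝ J x)
    (hJJ : ∀ᶠ y in 𝓝 x, ∀ a, J y (J y a) = -a)
    (hpJ : ∀ᶠ y in 𝓝 x, ∀ a b c, ψp y ![J y a, b, c] = -ψm y ![a, b, c])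
    (hmJ : ∀ᶠ y in 𝓝 x, ∀ a b c, ψm y ![J y a, b, c] = ψp y ![a, b, c])
    (hN : ∀ a b, fderiv ℝ J x (J x a) b - fderiv ℝ J x (J x b) a + J x (fderiv ℝ J x b a)
      - J x (fderiv ℝ J x a b) = 0)
    (hd : extDeriv ψm x = 0) : extDeriv ψp x = 0 := by
  have xp := hpJ.self_of_nhds
  have xm := hmJ.self_of_nhds
  have hJx := hJJ.self_of_nhds
  have Rp : ∀ v a b c, fderiv ℝ ψp x v ![J x a, b, c] + ψp x ![fderiv ℝ J x v a, b, c]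
      = -fderiv ℝ ψm x v ![a, b, c] := by
    intro v a b c
    have h0 : (fun y => ψp y ![J y a, b, c]) =ᶠ[𝓝 x] fun y => -ψm y ![a, b, c] :=
      hpJ.mono fun y hy => hy a b c
    have h1 := congrArg (fun L : E →L[ℝ] ℝ => L v) h0.fderiv_eq
    simp only [fderiv_fun_neg, neg_apply] at h1
    rw [(hasFDerivAt_form_endo hp hJ a _ v).2, fderiv_form_apply hm] at h1
    exact h1
  have Rm : ∀ v a b c, fderiv ℝ ψm x v ![J x a, b, c] + ψm x ![fderiv ℝ J x v a, b, c]
      = fderiv ℝ ψp x v ![a, b, c] := by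
    intro v a b c
    have h0 : (fun y => ψm y ![J y a, b, c]) =ᶠ[𝓝 x] fun y => ψp y ![a, b, c] :=
      hmJ.mono fun y hy => hy a b c
    have h1 := congrArg (fun L : E →L[ℝ] ℝ => L v) h0.fderiv_eq
    rw [(hasFDerivAt_form_endo hm hJ a _ v).2, fderiv_form_apply hp] at h1
    exact h1
  have hd0 : ∀ a b c d, extDeriv ψm x ![a, b, c, d] = 0 := by
    intro a b c d; rw [hd]; rfl
  -- With `ψ = ψ⁺ + iψ⁻` and `dψ⁻ = 0`, this is the imaginary part of
  -- `dψ(a + iJa, b + iJb, c, d) = 0`, which holds as `J` is integrable.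
  have key : ∀ a b c d, extDeriv ψp x ![J x a, b, c, d] + extDeriv ψp x ![a, J x b, c, d] = 0 := by
    intro a b c d
    have d1 := hd0 a b c d
    have d2 := hd0 (J x a) (J x b) c d
    simp only [extDeriv_three_apply, Matrix.cons_val] at d1 d2 ⊢
    have hc : ∀ u v, fderiv ℝ ψm x u ![a, b, v] - fderiv ℝ ψm x u ![J x a, J x b, v]
        + fderiv ℝ ψp x u ![J x a, b, v] + fderiv ℝ ψp x u ![a, J x b, v] = 0 := by
      intro u v
      have r1 := Rp u a b v
      have r2 := Rp u b a v
      have r3 := Rm u a (J x b) v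
      have s1 := form_three_swap_left (fderiv ℝ ψp x u) a (J x b) v
      have s2 := form_three_swap_left (fderiv ℝ ψm x u) a b v
      have p1 := xm b (fderiv ℝ J x u a) v
      have p2 := form_three_swap_left (ψm x) (fderiv ℝ J x u a) (J x b) v
      have p3 := form_three_swap_left (ψp x) (fderiv ℝ J x u a) b v
      linarith
    have hcc := hc c d
    have hcd := hc d c
    have n1 : ψp x ![J x (fderiv ℝ J x (J x a) b - fderiv ℝ J x (J x b) a
        + J x (fderiv ℝ J x b a) - J x (fderiv ℝ J x a b)), c, d] = 0 := by
      rw [hN, map_zero, form_vecCons_zero]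
    simp only [map_add, map_sub, hJx, form_vecCons_add, form_vecCons_sub, form_vecCons_neg] at n1
    have r1 := Rp a b c d
    have r2 := Rp b a c d
    have r3 := Rm (J x a) b c d
    have r4 := Rm (J x b) a c d
    have x1 := xp (fderiv ℝ J x (J x a) b) c d
    have x2 := xp (fderiv ℝ J x (J x b) a) c d
    linarith
  have sym : ∀ a b c d, extDeriv ψp x ![J x a, b, c, d] = extDeriv ψp x ![J x b, a, c, d] := by
    intro a b c d
    have h1 := key a b c d
    have h2 := form_four_swap_left (extDeriv ψp x) a (J x b) c d
    linarith
  -- A tensor that is symmetric in `a, b` and skew in `b, c` vanishes.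
  have zero : ∀ a b c d, extDeriv ψp x ![J x a, b, c, d] = 0 := by
    intro a b c d
    have h1 := sym a b c d
    have h2 := form_four_swap_middle (extDeriv ψp x) (J x b) a c d
    have h3 := sym b c a d
    have h4 := form_four_swap_middle (extDeriv ψp x) (J x c) b a d
    have h5 := sym c a b d
    have h6 := form_four_swap_middle (extDeriv ψp x) (J x a) c b d
    linarith
  ext v
  have hv : v = ![J x (-J x (v 0)), v 1, v 2, v 3] := by
    funext i; fin_cases i <;> simp [hJx]
  rw [hv]
  exact zero _ _ _ _

end FlatSU3

/-! ### The Poincaré lemma for 2-forms and smooth primitives -/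

section Integrals

variable {E F : Type u} [NormedAddCommGroup E] [NormedSpace ℝ E] [FiniteDimensional ℝ E]
  [NormedAddCommGroup F] [NormedSpace ℝ F]

/-- Differentiation under the integral sign, with a bound on the derivative that holds by
compactness. -/
lemma hasFDerivAt_integral_unit {F : Type*} [NormedAddCommGroup F] [NormedSpace ℝ F]
    [CompleteSpace F] {g : ℝ × E → F} (hg : ContDiff ℝ 1 g) (x₀ : E) :
    HasFDerivAt (fun x => ∫ τ in (0 : ℝ)..1, g (τ, x))
      (∫ τ in (0 : ℝ)..1, (fderiv ℝ g (τ, x₀)).comp (ContinuousLinearMap.inr ℝ ℝ E)) x₀ := by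
  have hG : Continuous fun p : ℝ × E =>
      (fderiv ℝ g p).comp (ContinuousLinearMap.inr ℝ ℝ E) :=
    (hg.continuous_fderiv (by norm_num)).clm_comp continuous_const
  obtain ⟨C, hC⟩ := (isCompact_Icc (a := (0 : ℝ)) (b := 1)).prod
    (isCompact_closedBall x₀ 1) |>.exists_bound_of_continuousOn hG.continuousOn
  refine intervalIntegral.hasFDerivAt_integral_of_dominated_of_fderiv_le
    (F := fun x τ => g (τ, x))
    (F' := fun x τ => (fderiv ℝ g (τ, x)).comp (ContinuousLinearMap.inr ℝ ℝ E))
    (bound := fun _ => C)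
    (Metric.closedBall_mem_nhds x₀ one_pos) ?_ ?_ ?_ ?_ ?_ ?_
  · refine Filter.Eventually.of_forall fun x => ?_
    exact (hg.continuous.comp (by fun_prop)).aestronglyMeasurable
  · exact (hg.continuous.comp (by fun_prop)).intervalIntegrable _ _
  · exact (hG.comp (f := fun τ : ℝ => (τ, x₀)) (by fun_prop)).aestronglyMeasurable
  · refine Filter.Eventually.of_forall fun τ hτ x hx => hC (τ, x) ⟨?_, hx⟩
    rw [uIoc_of_le zero_le_one] at hτ
    exact ⟨hτ.1.le, hτ.2⟩
  · exact intervalIntegrable_const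
  · refine Filter.Eventually.of_forall fun τ _ x _ => ?_
    have h1 : HasFDerivAt g (fderiv ℝ g (τ, x)) (τ, x) :=
      (hg.differentiable (by norm_num)).differentiableAt.hasFDerivAt
    exact h1.comp x (hasFDerivAt_prodMk_right τ x)

lemma contDiff_integral_unit_nat (n : ℕ) : ∀ {F : Type u} [NormedAddCommGroup F]
    [NormedSpace ℝ F] [CompleteSpace F] {g : ℝ × E → F}, ContDiff ℝ n g →
      ContDiff ℝ n (fun x => ∫ τ in (0 : ℝ)..1, g (τ, x)) := by
  induction n with
  | zero =>
    intro F _ _ _ g hg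
    rw [Nat.cast_zero, contDiff_zero] at hg ⊢
    exact intervalIntegral.continuous_parametric_intervalIntegral_of_continuous'
      (f := fun x τ => g (τ, x)) (hg.comp continuous_swap) 0 1
  | succ n ih =>
    intro F _ _ _ g hg
    have hg1 : ContDiff ℝ 1 g := hg.of_le (by simp)
    have hg' : ContDiff ℝ (n + 1) g := by exact_mod_cast hg
    refine contDiff_succ_iff_hasFDerivAt.2 ?_
    refine ⟨fun x => ∫ τ in (0 : ℝ)..1,
      (fderiv ℝ g (τ, x)).comp (ContinuousLinearMap.inr ℝ ℝ E), ?_,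
      fun x => hasFDerivAt_integral_unit hg1 x⟩
    exact ih (g := fun p : ℝ × E => (fderiv ℝ g p).comp (ContinuousLinearMap.inr ℝ ℝ E))
      ((hg'.fderiv_right le_rfl).clm_comp contDiff_const)

/-- Integrals over the unit interval depend smoothly on parameters. -/
lemma contDiff_integral_unit [CompleteSpace F] {g : ℝ × E → F} (hg : ContDiff ℝ ∞ g) :
    ContDiff ℝ ∞ (fun x => ∫ τ in (0 : ℝ)..1, g (τ, x)) := by
  rw [contDiff_infty] at hg ⊢
  exact fun n => contDiff_integral_unit_nat n (hg n)

/-- A map that is smooth near a point agrees near that point with a globally smooth one, its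
product with a bump function. -/
lemma exists_contDiff_eqOn_ball {s : Set E} (hs : IsOpen s) {x₀ : E} (hx : x₀ ∈ s) {g : E → F}
    (hg : ∀ x ∈ s, ContDiffAt ℝ ∞ g x) :
    ∃ r > 0, Metric.ball x₀ r ⊆ s ∧ ∃ g' : E → F, ContDiff ℝ ∞ g' ∧
      ∀ x ∈ Metric.ball x₀ r, g' x = g x := by
  obtain ⟨ε, hε, hsub⟩ := Metric.mem_nhds_iff.1 (hs.mem_nhds hx)
  let f : ContDiffBump x₀ := ⟨ε / 3, ε / 2, by positivity, by linarith⟩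
  refine ⟨ε / 3, by positivity, (Metric.ball_subset_ball (by linarith)).trans hsub,
    fun x => f x • g x, contDiff_iff_contDiffAt.2 fun x => ?_, fun x hx => ?_⟩
  · by_cases h : x ∈ s
    · exact f.contDiffAt.smul (hg x h)
    · have h0 : x ∉ tsupport f := by
        rw [f.tsupport_eq]
        intro h1
        exact h (hsub (Metric.closedBall_subset_ball (show ε / 2 < ε by linarith) h1))
      have h1 : (fun x => f x • g x) =ᶠ[𝓝 x] fun _ => 0 := by
        filter_upwards [notMem_tsupport_iff_eventuallyEq.1 h0] with y hy
        simp only [hy, Pi.zero_apply, zero_smul]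
      exact contDiffAt_const.congr_of_eventuallyEq h1
  · have : f x = 1 := f.one_of_mem_closedBall (Metric.ball_subset_closedBall hx)
    simp only [this, one_smul]

lemma contDiff_form_iff_apply {k : ℕ} {X : Type u} [NormedAddCommGroup X] [NormedSpace ℝ X]
    {θ : X → E [⋀^Fin k]→L[ℝ] ℝ} :
    ContDiff ℝ ∞ θ ↔ ∀ v, ContDiff ℝ ∞ fun x => θ x v := by
  simp only [contDiff_iff_contDiffAt, contDiffAt_form_iff]
  exact ⟨fun h v x => h x v, fun h x v => h v x⟩

/-- Poincaré's lemma for 2-forms, by the homotopy operator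
`η_x(v) = ∫₀¹ τ F_{x₀ + τ(x - x₀)}(x - x₀, v) dτ`. -/
lemma exists_extDeriv_eq {s : Set E} (hs : IsOpen s) {x₀ : E} (hx : x₀ ∈ s)
    {F : E → E [⋀^Fin 2]→L[ℝ] ℝ} (hF : ∀ x ∈ s, ContDiffAt ℝ ∞ F x)
    (hd : ∀ x ∈ s, extDeriv F x = 0) :
    ∃ r > 0, Metric.ball x₀ r ⊆ s ∧ ∃ η : E → E [⋀^Fin 1]→L[ℝ] ℝ, ContDiff ℝ ∞ η ∧
      ∀ x ∈ Metric.ball x₀ r, extDeriv η x = F x := by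
  obtain ⟨r, hr, hrs, G, hG, hGF⟩ := exists_contDiff_eqOn_ball hs hx hF
  have hGd : ∀ x ∈ Metric.ball x₀ r, extDeriv G x = 0 := by
    intro x hx
    have : G =ᶠ[𝓝 x] F := by
      filter_upwards [Metric.isOpen_ball.mem_nhds hx] with y hy using hGF y hy
    rw [this.extDeriv_eq, hd x (hrs hx)]
  have hGdiff : Differentiable ℝ G := hG.differentiable (by simp)
  let g : ℝ × E → E [⋀^Fin 1]→L[ℝ] ℝ := fun p =>
    p.1 • interiorProd (p.2 - x₀) (G (x₀ + p.1 • (p.2 - x₀)))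
  have hg : ContDiff ℝ ∞ g := by
    refine contDiff_fst.smul (contDiff_iff_contDiffAt.2 fun p => ?_)
    exact ContDiffAt.interiorProd (α := fun p : ℝ × E => G (x₀ + p.1 • (p.2 - x₀)))
      ((hG.comp (by fun_prop)).contDiffAt) (by fun_prop)
  refine ⟨r, hr, hrs, fun x => ∫ τ in (0 : ℝ)..1, g (τ, x), contDiff_integral_unit hg,
    fun x hx => ?_⟩
  -- the derivative of the integrand
  have hDg : ∀ (τ : ℝ) (a v : E), (fderiv ℝ g (τ, x)).comp (ContinuousLinearMap.inr ℝ ℝ E) a ![v]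
      = τ * G (x₀ + τ • (x - x₀)) ![a, v]
        + τ ^ 2 * fderiv ℝ G (x₀ + τ • (x - x₀)) a ![x - x₀, v] := by
    intro τ a v
    have h1 : HasFDerivAt (fun y => g (τ, y))
        ((fderiv ℝ g (τ, x)).comp (ContinuousLinearMap.inr ℝ ℝ E)) x :=
      ((hg.differentiable (by simp)).differentiableAt.hasFDerivAt).comp x
        (hasFDerivAt_prodMk_right τ x)
    have hline : HasFDerivAt (fun y : E => x₀ + τ • (y - x₀))
        (τ • ContinuousLinearMap.id ℝ E) x :=
      (((hasFDerivAt_id x).sub_const x₀).const_smul τ).const_add x₀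
    have hGl : HasFDerivAt (fun y : E => G (x₀ + τ • (y - x₀)))
        ((fderiv ℝ G (x₀ + τ • (x - x₀))).comp (τ • ContinuousLinearMap.id ℝ E)) x :=
      (hGdiff.differentiableAt.hasFDerivAt).comp x hline
    have hyd : DifferentiableAt ℝ (fun y : E => y - x₀) x := by fun_prop
    obtain ⟨hd1, hd2⟩ := fderiv_interiorProd (α := fun y : E => G (x₀ + τ • (y - x₀)))
      (U := fun y : E => y - x₀) hGl.differentiableAt hyd a
    have h3 : (fderiv ℝ g (τ, x)).comp (ContinuousLinearMap.inr ℝ ℝ E)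
        = τ • fderiv ℝ (fun y : E => interiorProd (y - x₀) (G (x₀ + τ • (y - x₀)))) x := by
      rw [← h1.fderiv]
      exact fderiv_const_smul hd1 τ
    rw [h3]
    have h4 := congrArg (fun θ => θ ![v]) hd2
    rw [hGl.fderiv] at h4
    have h5 : fderiv ℝ (fun y : E => y - x₀) x a = a := by
      rw [fderiv_sub_const]; simp
    rw [h5] at h4
    show τ • (fderiv ℝ (fun y : E => interiorProd (y - x₀) (G (x₀ + τ • (y - x₀)))) x a) ![v] = _
    refine (congrArg (fun c : ℝ => τ • c) h4).trans ?_
    simp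
    ring
  have hDη : ∀ a v : E, fderiv ℝ (fun x => ∫ τ in (0 : ℝ)..1, g (τ, x)) x a ![v]
      = ∫ τ in (0 : ℝ)..1, (τ * G (x₀ + τ • (x - x₀)) ![a, v]
        + τ ^ 2 * fderiv ℝ G (x₀ + τ • (x - x₀)) a ![x - x₀, v]) := by
    intro a v
    have hgv : ContDiff ℝ ∞ fun p => g p ![v] := contDiff_form_iff_apply.1 hg ![v]
    have h1 : (fun y => (∫ τ in (0 : ℝ)..1, g (τ, y)) ![v])
        = fun y => ∫ τ in (0 : ℝ)..1, g (τ, y) ![v] := by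
      funext y
      have hc : Continuous fun τ : ℝ => g (τ, y) := hg.continuous.comp (by fun_prop)
      exact ((ContinuousAlternatingMap.apply ℝ E ℝ ![v]).intervalIntegral_comp_comm
        (hc.intervalIntegrable 0 1)).symm
    have hcd := (contDiff_integral_unit hg).differentiable (by simp) x
    rw [← fderiv_form_apply hcd, h1, (hasFDerivAt_integral_unit (hgv.of_le (by simp)) x).fderiv]
    have hc : Continuous fun τ : ℝ =>
        (fderiv ℝ (fun p => g p ![v]) (τ, x)).comp (ContinuousLinearMap.inr ℝ ℝ E) :=
      ((hgv.continuous_fderiv (by simp)).clm_comp continuous_const).comp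
        (f := fun τ : ℝ => (τ, x)) (by fun_prop)
    have h6 := (ContinuousLinearMap.apply ℝ ℝ a).intervalIntegral_comp_comm
      (μ := MeasureTheory.volume) (hc.intervalIntegrable 0 1)
    refine Eq.trans h6.symm (intervalIntegral.integral_congr fun τ _ => ?_)
    rw [← hDg τ a v]
    show fderiv ℝ (fun p => g p ![v]) (τ, x) (0, a) = fderiv ℝ g (τ, x) (0, a) ![v]
    exact fderiv_form_apply ((hg.differentiable (by simp)).differentiableAt) _ _
  have hline : Continuous fun τ : ℝ => x₀ + τ • (x - x₀) := by fun_prop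
  have hc1 : ∀ v, Continuous fun τ : ℝ => τ * G (x₀ + τ • (x - x₀)) v := fun v =>
    continuous_id.mul (((contDiff_form_iff_apply.1 hG v).continuous).comp hline)
  have hc2 : ∀ a v, Continuous fun τ : ℝ => τ ^ 2 * fderiv ℝ G (x₀ + τ • (x - x₀)) a v := by
    intro a v
    refine (continuous_pow 2).mul ?_
    have h7 : ContDiff ℝ ∞ fun y => fderiv ℝ G y a :=
      (hG.fderiv_right (m := ∞) le_rfl).clm_apply contDiff_const
    exact (contDiff_form_iff_apply.1 h7 v).continuous.comp hline
  refine ContinuousAlternatingMap.ext fun v => ?_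
  have hv : v = ![v 0, v 1] := by ext i; fin_cases i <;> rfl
  have hc : ∀ u a v, Continuous fun τ : ℝ => τ * G (x₀ + τ • (x - x₀)) u
      + τ ^ 2 * fderiv ℝ G (x₀ + τ • (x - x₀)) a v := fun u a v => (hc1 u).add (hc2 a v)
  rw [extDeriv_one_apply, hDη, hDη, ← intervalIntegral.integral_sub
    ((hc _ _ _).intervalIntegrable _ _) ((hc _ _ _).intervalIntegrable _ _)]
  have hmem : ∀ τ ∈ Icc (0 : ℝ) 1, x₀ + τ • (x - x₀) ∈ Metric.ball x₀ r := by
    intro τ hτ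
    rw [mem_ball_iff_norm, add_sub_cancel_left, norm_smul, Real.norm_of_nonneg hτ.1]
    rw [mem_ball_iff_norm] at hx
    nlinarith [norm_nonneg (x - x₀), hτ.2]
  -- Since `dG = 0`, the integrand is the derivative of `τ² G(v₀, v₁)` along the ray.
  have hftc : ∀ τ ∈ uIcc (0 : ℝ) 1, HasDerivAt (fun τ : ℝ => τ ^ 2 * G (x₀ + τ • (x - x₀)) v)
      (τ * G (x₀ + τ • (x - x₀)) ![v 0, v 1]
        + τ ^ 2 * fderiv ℝ G (x₀ + τ • (x - x₀)) (v 0) ![x - x₀, v 1]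
        - (τ * G (x₀ + τ • (x - x₀)) ![v 1, v 0]
        + τ ^ 2 * fderiv ℝ G (x₀ + τ • (x - x₀)) (v 1) ![x - x₀, v 0])) τ := by
    intro τ hτ
    rw [uIcc_of_le zero_le_one] at hτ
    have h8 : HasDerivAt (fun τ : ℝ => x₀ + τ • (x - x₀)) ((1 : ℝ) • (x - x₀)) τ :=
      ((hasDerivAt_id τ).smul_const (x - x₀)).const_add x₀
    have h9 : HasFDerivAt (fun y => G y v) (fderiv ℝ (fun y => G y v) (x₀ + τ • (x - x₀)))
        (x₀ + τ • (x - x₀)) :=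
      (((contDiff_form_iff_apply.1 hG v).differentiable
        (by simp)).differentiableAt).hasFDerivAt
    have h10 := (hasDerivAt_pow 2 τ).mul (h9.comp_hasDerivAt τ h8)
    refine h10.congr_deriv ?_
    have h11 : extDeriv G (x₀ + τ • (x - x₀)) ![x - x₀, v 0, v 1] = 0 := by
      rw [hGd _ (hmem τ hτ)]; rfl
    rw [extDeriv_two_apply] at h11
    rw [fderiv_form_apply hGdiff.differentiableAt, form_swap_two _ (v 0) (v 1)]
    simp only [Matrix.cons_val_zero, Matrix.cons_val_one, Matrix.cons_val] at h11
    rw [← hv]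
    rw [← hv] at h11
    simp only [one_smul, Function.comp]
    push_cast
    linear_combination τ ^ 2 * h11
  rw [intervalIntegral.integral_eq_sub_of_hasDerivAt hftc
    (((hc _ _ _).sub (hc _ _ _)).intervalIntegrable _ _)]
  have : x₀ + (1 : ℝ) • (x - x₀) = x := by rw [one_smul]; abel
  simp only [this, hGF x hx]
  ring

/-- A smooth function on `ℝ × E` has, locally, a smooth primitive in the first variable, depending
smoothly on all variables. -/
lemma exists_primitive {E : Type} [NormedAddCommGroup E] [NormedSpace ℝ E] [FiniteDimensional ℝ E]
    {s : Set (ℝ × E)} (hs : IsOpen s) {p : ℝ × E} (hp : p ∈ s)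
    {g : ℝ × E → ℝ} (hg : ∀ x ∈ s, ContDiffAt ℝ ∞ g x) :
    ∃ r > 0, Metric.ball p r ⊆ s ∧ ∃ v : ℝ × E → ℝ, ContDiff ℝ ∞ v ∧
      ∀ z ∈ Metric.ball p r, fderiv ℝ v z (1, 0) = g z := by
  obtain ⟨r, hr, hrs, G, hG, hGg⟩ := exists_contDiff_eqOn_ball hs hp hg
  have hv : ContDiff ℝ ∞ fun z : ℝ × E =>
      ∫ τ in (0 : ℝ)..1, (z.1 - p.1) * G (p.1 + (z.1 - p.1) * τ, z.2) := by
    refine contDiff_integral_unit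
      (g := fun q : ℝ × (ℝ × E) => (q.2.1 - p.1) * G (p.1 + (q.2.1 - p.1) * q.1, q.2.2)) ?_
    exact ContDiff.mul (by fun_prop) (hG.comp (by fun_prop))
  refine ⟨r, hr, hrs, _, hv, fun z hz => ?_⟩
  rw [← hGg z hz]
  have h1 : HasDerivAt (fun c : ℝ => (c, z.2)) ((1 : ℝ), (0 : E)) z.1 :=
    (hasDerivAt_id z.1).prodMk (hasDerivAt_const z.1 z.2)
  have h2 := HasFDerivAt.comp_hasDerivAt (f := fun c : ℝ => (c, z.2)) z.1
    ((hv.differentiable (by simp)).differentiableAt (x := (z.1, z.2)).hasFDerivAt) h1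
  -- Rescaling the interval of integration gives the usual primitive.
  have h3 : ((fun z : ℝ × E => ∫ τ in (0 : ℝ)..1, (z.1 - p.1) * G (p.1 + (z.1 - p.1) * τ, z.2)) ∘
      fun c : ℝ => (c, z.2)) = fun c => ∫ r in p.1..c, G (r, z.2) := by
    funext c
    show ∫ τ in (0 : ℝ)..1, (c - p.1) * G (p.1 + (c - p.1) * τ, z.2) = _
    rw [intervalIntegral.integral_const_mul]
    have := intervalIntegral.smul_integral_comp_add_mul (a := 0) (b := 1)
      (fun r => G (r, z.2)) (c - p.1) p.1
    simpa using this
  rw [h3] at h2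
  have hc : Continuous fun r : ℝ => G (r, z.2) := hG.continuous.comp (by fun_prop)
  exact h2.unique (hc.integral_hasStrictDerivAt p.1 z.1).hasDerivAt

end Integrals

/-! ### Pullback of forms between manifolds -/

section Naturality

variable {E : Type*} [NormedAddCommGroup E] [NormedSpace ℝ E] {H : Type*} [TopologicalSpace H]
  {I : ModelWithCorners ℝ E H} {M : Type*} [TopologicalSpace M] [ChartedSpace H M]
  {E' : Type*} [NormedAddCommGroup E'] [NormedSpace ℝ E'] {H' : Type*} [TopologicalSpace H']
  {I' : ModelWithCorners ℝ E' H'} {M' : Type*} [TopologicalSpace M'] [ChartedSpace H' M']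
  {E'' : Type*} [NormedAddCommGroup E''] [NormedSpace ℝ E''] {H'' : Type*} [TopologicalSpace H'']
  {I'' : ModelWithCorners ℝ E'' H''} {M'' : Type*} [TopologicalSpace M''] [ChartedSpace H'' M'']

lemma pullbackForm_apply {k : ℕ} (f : M → M') (α : DForm I' M' k) (x : M)
    (v : Fin k → TangentSpace I x) :
    pullbackForm I I' f α x v = α (f x) (fun i => mfderiv I I' f x (v i)) := rfl

/-- Transport of the pullback of a form along an equality of base points. -/
lemma form_comp_congr {k : ℕ} (α : DForm I' M' k) {p q : M'} (hpq : p = q)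
    (L : E →L[ℝ] E') :
    ((α p).compContinuousLinearMap (show E →L[ℝ] TangentSpace I' p from L) : E [⋀^Fin k]→L[ℝ] ℝ)
      = (α q).compContinuousLinearMap (show E →L[ℝ] TangentSpace I' q from L) := by
  subst hpq; rfl

lemma pullbackForm_congr {k : ℕ} {f g : M → M'} {x : M} (h : f =ᶠ[𝓝 x] g) (α : DForm I' M' k) :
    pullbackForm I I' f α x = pullbackForm I I' g α x := by
  have h1 : (show E →L[ℝ] E' from mfderiv I I' f x) = (show E →L[ℝ] E' from mfderiv I I' g x) :=
    h.mfderiv_eq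
  exact (form_comp_congr α h.eq_of_nhds (show E →L[ℝ] E' from mfderiv I I' f x)).trans
    (congrArg (fun L : E →L[ℝ] E' => ((α (g x)).compContinuousLinearMap
      (show E →L[ℝ] TangentSpace I' (g x) from L) : E [⋀^Fin k]→L[ℝ] ℝ)) h1)

lemma pullbackForm_comp {k : ℕ} {f : M → M'} {g : M' → M''} {x : M}
    (hg : MDifferentiableAt I' I'' g (f x)) (hf : MDifferentiableAt I I' f x)
    (α : DForm I'' M'' k) :
    pullbackForm I I'' (g ∘ f) α x = pullbackForm I I' f (pullbackForm I' I'' g α) x := by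
  ext v
  simp only [pullbackForm_apply, mfderiv_comp x hg hf]
  rfl

lemma pullbackForm_id {k : ℕ} (α : DForm I M k) (x : M) : pullbackForm I I id α x = α x := by
  ext v
  simp only [pullbackForm_apply, mfderiv_id]
  rfl

/-- The preferred chart at `x` identifies the tangent space there with the model space. -/
lemma mfderiv_extChartAt_symm_self [I.Boundaryless] [IsManifold I 1 M] (x : M) :
    mfderiv 𝓘(ℝ, E) I (extChartAt I x).symm (extChartAt I x x) = ContinuousLinearMap.id ℝ E := by
  have := mfderivWithin_range_extChartAt_symm (I := I) (x := x)
  rwa [I.range_eq_univ, mfderivWithin_univ] at this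

lemma formInChart_self [I.Boundaryless] [IsManifold I 1 M] {k : ℕ} (α : DForm I M k) (x : M) :
    formInChart I α x (extChartAt I x x) = α x := by
  have h1 : (show E →L[ℝ] E from
    mfderiv 𝓘(ℝ, E) I (extChartAt I x).symm (extChartAt I x x)) = ContinuousLinearMap.id ℝ E :=
    mfderiv_extChartAt_symm_self x
  refine (form_comp_congr α (extChartAt_to_inv x) (show E →L[ℝ] E from
    mfderiv 𝓘(ℝ, E) I (extChartAt I x).symm (extChartAt I x x))).trans ?_
  rw [h1]
  rfl

/-- The exterior derivative at `x`, in terms of the preferred chart at `x`. -/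
lemma extD_eq [IsManifold I 1 M] {k : ℕ} (α : DForm I M k) (x : M) :
    extD I α x = extDeriv (formInChart I α x) (extChartAt I x x) := by
  have h1 := mfderiv_extChartAt_self (I := I) (x := x)
  ext v
  show extDeriv (formInChart I α x) (extChartAt I x x)
    (fun i => mfderiv I 𝓘(ℝ, E) (extChartAt I x) x (v i)) = _
  rw [h1]
  rfl

lemma mdifferentiableAt_extChartAt_symm [I.Boundaryless] [IsManifold I 1 M] {x : M} {z : E}
    (hz : z ∈ (extChartAt I x).target) :
    MDifferentiableAt 𝓘(ℝ, E) I (extChartAt I x).symm z := by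
  have := mdifferentiableWithinAt_extChartAt_symm (I := I) hz
  rwa [I.range_eq_univ, mdifferentiableWithinAt_univ] at this

lemma contMDiffAt_extChartAt_symm_apply [I.Boundaryless] [IsManifold I ∞ M] {x : M} {z : E}
    (hz : z ∈ (extChartAt I x).target) :
    ContMDiffAt 𝓘(ℝ, E) I ∞ (extChartAt I x).symm z :=
  (contMDiffOn_extChartAt_symm x).contMDiffAt ((isOpen_extChartAt_target x).mem_nhds hz)

/-- Pullback in charts: near the image of `x`, the expression of `f^*α` is the pullback of the
expression of `α` by the expression of `f`. -/
lemma formInChart_pullbackForm_eventuallyEq [I.Boundaryless] [I'.Boundaryless]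
    [IsManifold I ∞ M] [IsManifold I' ∞ M'] {k : ℕ}
    {f : M → M'} {x : M} (hf : ContMDiffAt I I' ∞ f x) (α : DForm I' M' k) :
    formInChart I (pullbackForm I I' f α) x =ᶠ[𝓝 (extChartAt I x x)] fun u =>
      (formInChart I' α (f x) (writtenInExtChartAt I I' x f u)).compContinuousLinearMap
        (fderiv ℝ (writtenInExtChartAt I I' x f) u) := by
  have : IsManifold I 1 M := IsManifold.of_le (m := 1) (n := ∞) (by simp)
  have : IsManifold I' 1 M' := IsManifold.of_le (m := 1) (n := ∞) (by simp)
  set φ := extChartAt I x with hφ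
  set φ' := extChartAt I' (f x) with hφ'
  have hsymm : ContinuousAt φ.symm (φ x) := continuousAt_extChartAt_symm x
  have hx : φ.symm (φ x) = x := extChartAt_to_inv x
  have h1 : ∀ᶠ y in 𝓝 x, ContMDiffAt I I' 1 f y :=
    (contMDiffAt_iff_contMDiffAt_nhds (by simp)).1 (hf.of_le (by simp))
  have h2 : ∀ᶠ y in 𝓝 x, f y ∈ φ'.source :=
    hf.continuousAt.eventually_mem (extChartAt_source_mem_nhds (f x))
  have h3 : ∀ᶠ u in 𝓝 (φ x), ContMDiffAt I I' 1 f (φ.symm u) ∧ f (φ.symm u) ∈ φ'.source := by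
    have := h1.and h2
    rw [← hx] at this
    exact hsymm.eventually this
  have h4 : ∀ᶠ u in 𝓝 (φ x), u ∈ φ.target :=
    (isOpen_extChartAt_target x).mem_nhds (mem_extChartAt_target x)
  filter_upwards [(h3.and h4).eventually_nhds] with u hu
  have hu0 := hu.self_of_nhds
  have hfd : MDifferentiableAt I I' f (φ.symm u) :=
    hu0.1.1.mdifferentiableAt (by simp)
  have hsd := mdifferentiableAt_extChartAt_symm (I := I) hu0.2
  have hgd : MDifferentiableAt 𝓘(ℝ, E) 𝓘(ℝ, E') (writtenInExtChartAt I I' x f) u :=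
    ((mdifferentiableAt_extChartAt
      (by rw [← extChartAt_source I']; exact hu0.1.2)).comp u (hfd.comp u hsd))
  have hg' : MDifferentiableAt 𝓘(ℝ, E') I' φ'.symm (writtenInExtChartAt I I' x f u) :=
    mdifferentiableAt_extChartAt_symm (φ'.map_source hu0.1.2)
  have e1 : formInChart I (pullbackForm I I' f α) x u
      = pullbackForm 𝓘(ℝ, E) I' (f ∘ φ.symm) α u := (pullbackForm_comp hfd hsd α).symm
  have e2 : f ∘ φ.symm =ᶠ[𝓝 u] φ'.symm ∘ writtenInExtChartAt I I' x f := by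
    filter_upwards [hu] with w hw
    exact (φ'.left_inv hw.1.2).symm
  rw [e1, pullbackForm_congr e2 α, pullbackForm_comp hg' hgd α]
  show ContinuousAlternatingMap.compContinuousLinearMap _
    (mfderiv 𝓘(ℝ, E) 𝓘(ℝ, E') (writtenInExtChartAt I I' x f) u) = _
  rw [mfderiv_eq_fderiv]
  rfl

lemma contDiffAt_writtenInExtChartAt [I.Boundaryless] [IsManifold I ∞ M] {f : M → M'} {x : M}
    (hf : ContMDiffAt I I' ∞ f x) :
    ContDiffAt ℝ ∞ (writtenInExtChartAt I I' x f) (extChartAt I x x) := by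
  have := (contMDiffAt_iff.1 hf).2
  rwa [I.range_eq_univ, contDiffWithinAt_univ] at this

lemma formSmoothAt_pullbackForm [FiniteDimensional ℝ E] [FiniteDimensional ℝ E']
    [I.Boundaryless] [I'.Boundaryless] [IsManifold I ∞ M]
    [IsManifold I' ∞ M'] {k : ℕ} {f : M → M'} {x : M} (hf : ContMDiffAt I I' ∞ f x)
    {α : DForm I' M' k} (hα : FormSmoothAt I' α (f x)) :
    FormSmoothAt I (pullbackForm I I' f α) x := by
  refine ContDiffAt.congr_of_eventuallyEq ?_ (formInChart_pullbackForm_eventuallyEq hf α)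
  have hg := contDiffAt_writtenInExtChartAt hf
  have hgx : writtenInExtChartAt I I' x f (extChartAt I x x) = extChartAt I' (f x) (f x) := by
    simp [writtenInExtChartAt]
  refine ContDiffAt.compForm ?_ (hg.fderiv_right (m := ∞) le_rfl)
  have hα' : ContDiffAt ℝ ∞ (formInChart I' α (f x))
      (writtenInExtChartAt I I' x f (extChartAt I x x)) := by
    rw [hgx]; exact hα
  exact ContDiffAt.comp (𝕜 := ℝ) (E := E) (F := E') (G := E' [⋀^Fin k]→L[ℝ] ℝ)
    (extChartAt I x x) hα' hg

/-- The exterior derivative commutes with pullback. -/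
lemma extD_pullbackForm [I.Boundaryless] [I'.Boundaryless] [IsManifold I ∞ M]
    [IsManifold I' ∞ M'] {k : ℕ} {f : M → M'} {x : M} (hf : ContMDiffAt I I' ∞ f x)
    {α : DForm I' M' k} (hα : FormSmoothAt I' α (f x)) :
    extD I (pullbackForm I I' f α) x = pullbackForm I I' f (extD I' α) x := by
  have : IsManifold I 1 M := IsManifold.of_le (m := 1) (n := ∞) (by simp)
  have : IsManifold I' 1 M' := IsManifold.of_le (m := 1) (n := ∞) (by simp)
  have hg := contDiffAt_writtenInExtChartAt hf
  have hgx : writtenInExtChartAt I I' x f (extChartAt I x x) = extChartAt I' (f x) (f x) := by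
    simp [writtenInExtChartAt]
  rw [extD_eq, (formInChart_pullbackForm_eventuallyEq hf α).extDeriv_eq]
  have hαd : DifferentiableAt ℝ (formInChart I' α (f x))
      (writtenInExtChartAt I I' x f (extChartAt I x x)) := by
    rw [hgx]; exact ContDiffAt.differentiableAt hα (by simp)
  rw [extDeriv_pullback (r := ∞) hαd hg
    (by
      rw [minSmoothness_of_isRCLikeNormedField]
      exact WithTop.coe_le_coe.2 (le_top : (2 : ℕ∞) ≤ ⊤)), hgx]
  have h1 : mfderiv I I' f x = fderiv ℝ (writtenInExtChartAt I I' x f) (extChartAt I x x) := by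
    rw [(hf.mdifferentiableAt (by simp)).mfderiv, I.range_eq_univ, fderivWithin_univ]
  ext v
  show _ = extD I' α (f x) (fun i => mfderiv I I' f x (v i))
  rw [extD_eq, h1]
  rfl

lemma formSmoothAt_iff_of_modelSpace {k : ℕ} {α : E → E [⋀^Fin k]→L[ℝ] ℝ} {x : E} :
    FormSmoothAt 𝓘(ℝ, E) (M := E) α x ↔ ContDiffAt ℝ ∞ α x := by
  have : formInChart 𝓘(ℝ, E) (M := E) α x = α := by
    funext u
    exact pullbackForm_id (I := 𝓘(ℝ, E)) (M := E) α u
  unfold FormSmoothAt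
  rw [this]
  rfl

lemma extD_modelSpace {k : ℕ} (α : E → E [⋀^Fin k]→L[ℝ] ℝ) (x : E) :
    extD 𝓘(ℝ, E) (M := E) α x = extDeriv α x := by
  have : formInChart 𝓘(ℝ, E) (M := E) α x = α := by
    funext u
    exact pullbackForm_id (I := 𝓘(ℝ, E)) (M := E) α u
  refine (extD_eq (I := 𝓘(ℝ, E)) (M := E) α x).trans ?_
  rw [this]
  rfl

/-- The expression of a form in a chart is smooth wherever the form is. -/
lemma contDiffAt_formInChart [FiniteDimensional ℝ E] [I.Boundaryless] [IsManifold I ∞ M] {k : ℕ}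
    {α : DForm I M k} {x : M} {z : E} (hz : z ∈ (extChartAt I x).target)
    (hα : FormSmoothAt I α ((extChartAt I x).symm z)) :
    ContDiffAt ℝ ∞ (formInChart I α x) z :=
  formSmoothAt_iff_of_modelSpace.1
    (formSmoothAt_pullbackForm (contMDiffAt_extChartAt_symm_apply hz) hα)

/-- The exterior derivative can be computed in any chart. -/
lemma formInChart_extD [I.Boundaryless] [IsManifold I ∞ M] {k : ℕ}
    {α : DForm I M k} {x : M} {z : E} (hz : z ∈ (extChartAt I x).target)
    (hα : FormSmoothAt I α ((extChartAt I x).symm z)) :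
    formInChart I (extD I α) x z = extDeriv (formInChart I α x) z := by
  rw [← extD_modelSpace]
  exact (extD_pullbackForm (contMDiffAt_extChartAt_symm_apply hz) hα).symm

lemma formInChart_congr [I.Boundaryless] {k : ℕ} {α β : DForm I M k} {x : M}
    (h : ∀ᶠ y in 𝓝 x, α y = β y) :
    formInChart I α x =ᶠ[𝓝 (extChartAt I x x)] formInChart I β x := by
  have h1 := continuousAt_extChartAt_symm (I := I) x
  have h2 : ∀ᶠ y in 𝓝 ((extChartAt I x).symm (extChartAt I x x)), α y = β y := by
    rwa [extChartAt_to_inv]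
  filter_upwards [h1.eventually h2] with u hu
  simp only [formInChart, hu]

lemma extD_congr [I.Boundaryless] {k : ℕ} {α β : DForm I M k} {x : M}
    (h : ∀ᶠ y in 𝓝 x, α y = β y) : extD I α x = extD I β x := by
  unfold extD
  rw [(formInChart_congr h).extDeriv_eq]

end Naturality

/-! ### Functions, vector fields and tensors in a chart -/

section ChartCalculus

variable {E : Type*} [NormedAddCommGroup E] [NormedSpace ℝ E] {H : Type*} [TopologicalSpace H]
  {I : ModelWithCorners ℝ E H} {M : Type*} [TopologicalSpace M] [ChartedSpace H M]

lemma contMDiffAt_iff_inChart [I.Boundaryless] [IsManifold I ∞ M]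
    {F : Type*} [NormedAddCommGroup F] [NormedSpace ℝ F] {g : M → F} {x : M} :
    ContMDiffAt I 𝓘(ℝ, F) ∞ g x ↔
      ContDiffAt ℝ ∞ (fun u => g ((extChartAt I x).symm u)) (extChartAt I x x) := by
  constructor
  · intro h
    have h1 := contMDiffAt_extChartAt_symm_apply (I := I) (mem_extChartAt_target (I := I) x)
    have h2 : ContMDiffAt I 𝓘(ℝ, F) ∞ g ((extChartAt I x).symm (extChartAt I x x)) := by
      rwa [extChartAt_to_inv]
    exact contMDiffAt_iff_contDiffAt.1 (h2.comp _ h1)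
  · intro h
    have h1 : ContMDiffAt I 𝓘(ℝ, E) ∞ (extChartAt I x) x := contMDiffAt_extChartAt
    refine ((contMDiffAt_iff_contDiffAt.2 h).comp x h1).congr_of_eventuallyEq ?_
    filter_upwards [extChartAt_source_mem_nhds (I := I) x] with y hy
    simp only [Function.comp, (extChartAt I x).left_inv hy]

lemma fderiv_comp_extChartAt_symm [I.Boundaryless] [IsManifold I ∞ M] {f : M → ℝ} {x : M} {z : E}
    (hz : z ∈ (extChartAt I x).target) (hf : ContMDiffAt I 𝓘(ℝ, ℝ) ∞ f ((extChartAt I x).symm z))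
    (v : E) :
    fderiv ℝ (fun u => f ((extChartAt I x).symm u)) z v
      = dfun I f ((extChartAt I x).symm z) (mfderiv 𝓘(ℝ, E) I (extChartAt I x).symm z v) := by
  have : IsManifold I 1 M := IsManifold.of_le (m := 1) (n := ∞) (by simp)
  have h := mfderiv_comp z (hf.mdifferentiableAt (by simp))
    (mdifferentiableAt_extChartAt_symm (I := I) hz)
  rw [← mfderiv_eq_fderiv]
  exact congrArg (fun L : E →L[ℝ] ℝ => L v) h

lemma formInChart_oneForm_dfun [I.Boundaryless] [IsManifold I ∞ M] {f : M → ℝ} {x : M} {z : E}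
    (hz : z ∈ (extChartAt I x).target)
    (hf : ContMDiffAt I 𝓘(ℝ, ℝ) ∞ f ((extChartAt I x).symm z)) :
    formInChart I (fun y => oneForm (dfun I f y)) x z
      = oneForm (fderiv ℝ (fun u => f ((extChartAt I x).symm u)) z) := by
  ext v
  rw [oneForm_apply, fderiv_comp_extChartAt_symm hz hf]
  rfl

lemma dfun_eq [I.Boundaryless] [IsManifold I ∞ M] {f : M → ℝ} {x : M}
    (hf : ContMDiffAt I 𝓘(ℝ, ℝ) ∞ f x) :
    dfun I f x = fderiv ℝ (fun u => f ((extChartAt I x).symm u)) (extChartAt I x x) := by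
  have : IsManifold I 1 M := IsManifold.of_le (m := 1) (n := ∞) (by simp)
  rw [dfun, (hf.mdifferentiableAt (by simp)).mfderiv, I.range_eq_univ, fderivWithin_univ]
  rfl

lemma formInChart_wedge {p q : ℕ} (α : DForm I M p) (β : DForm I M q) (x : M) (z : E) :
    formInChart I (fun y => wedge (α y) (β y)) x z
      = wedge (formInChart I α x z) (formInChart I β x z) :=
  wedge_comp _ _ _

lemma formInChart_smul {k : ℕ} (f : M → ℝ) (α : DForm I M k) (x : M) (z : E) :
    formInChart I (fun y => f y • α y) x z = f ((extChartAt I x).symm z) • formInChart I α x z :=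
  rfl

/-- The expression of a vector field in the preferred chart at `x`. -/
noncomputable def fieldInChart (I : ModelWithCorners ℝ E H) {M : Type*} [TopologicalSpace M]
    [ChartedSpace H M] (X : VField I M) (x : M) : E → E :=
  VectorField.mpullback 𝓘(ℝ, E) I (extChartAt I x).symm X

lemma isInvertible_mfderiv_extChartAt_symm [I.Boundaryless] [IsManifold I ∞ M] {x : M} {z : E}
    (hz : z ∈ (extChartAt I x).target) :
    (mfderiv 𝓘(ℝ, E) I (extChartAt I x).symm z).IsInvertible := by
  have : IsManifold I 1 M := IsManifold.of_le (m := 1) (n := ∞) (by simp)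
  have h := isInvertible_mfderivWithin_extChartAt_symm (I := I) hz
  rwa [I.range_eq_univ, mfderivWithin_univ] at h

lemma mfderiv_fieldInChart [I.Boundaryless] [IsManifold I ∞ M] (X : VField I M) {x : M} {z : E}
    (hz : z ∈ (extChartAt I x).target) :
    mfderiv 𝓘(ℝ, E) I (extChartAt I x).symm z (fieldInChart (E := E) I X x z)
      = X ((extChartAt I x).symm z) := by
  obtain ⟨e, he⟩ := isInvertible_mfderiv_extChartAt_symm (I := I) hz
  unfold fieldInChart
  rw [VectorField.mpullback_apply, ← he, ContinuousLinearMap.inverse_equiv]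
  exact e.apply_symm_apply _

lemma fieldInChart_self [I.Boundaryless] [IsManifold I ∞ M] (X : VField I M) (x : M) :
    fieldInChart I X x (extChartAt I x x) = X x := by
  have : IsManifold I 1 M := IsManifold.of_le (m := 1) (n := ∞) (by simp)
  have h := mfderiv_fieldInChart X (mem_extChartAt_target (I := I) x)
  have h1 : (show E →L[ℝ] E from
    mfderiv 𝓘(ℝ, E) I (extChartAt I x).symm (extChartAt I x x)) = ContinuousLinearMap.id ℝ E :=
    mfderiv_extChartAt_symm_self x
  have h2 : (show E from X ((extChartAt I x).symm (extChartAt I x x))) = (show E from X x) := by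
    rw [extChartAt_to_inv]
  refine Eq.trans ?_ (h.trans h2)
  exact (congrArg (fun L : E →L[ℝ] E => L (fieldInChart (E := E) I X x (extChartAt I x x))) h1).symm

lemma eq_fieldInChart [I.Boundaryless] [IsManifold I ∞ M] {X : VField I M} {x : M} {z w : E}
    (hz : z ∈ (extChartAt I x).target)
    (h : mfderiv 𝓘(ℝ, E) I (extChartAt I x).symm z w = X ((extChartAt I x).symm z)) :
    fieldInChart I X x z = w := by
  unfold fieldInChart
  rw [VectorField.mpullback_apply, ← h]
  obtain ⟨e, he⟩ := isInvertible_mfderiv_extChartAt_symm (I := I) hz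
  rw [← he, ContinuousLinearMap.inverse_equiv]
  exact e.symm_apply_apply _

lemma fieldInChart_eq_mfderiv [I.Boundaryless] [IsManifold I ∞ M] {X : VField I M} {x : M} {z : E}
    (hz : z ∈ (extChartAt I x).target) :
    fieldInChart I X x z
      = mfderiv I 𝓘(ℝ, E) (extChartAt I x) ((extChartAt I x).symm z)
          (X ((extChartAt I x).symm z)) := by
  have : IsManifold I 1 M := IsManifold.of_le (m := 1) (n := ∞) (by simp)
  refine eq_fieldInChart hz ?_
  have h := mfderivWithin_extChartAt_symm_comp_mfderiv_extChartAt (I := I) hz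
  rw [I.range_eq_univ, mfderivWithin_univ] at h
  exact congrArg (fun L => L (X ((extChartAt I x).symm z))) h

/-- The Lie bracket at `x`, in terms of the preferred chart at `x`. -/
lemma mlieBracket_eq [I.Boundaryless] [IsManifold I ∞ M] (X Y : VField I M) (x : M) :
    VectorField.mlieBracket I X Y x
      = fderiv ℝ (fieldInChart (E := E) I Y x) (extChartAt I x x) (X x)
        - fderiv ℝ (fieldInChart (E := E) I X x) (extChartAt I x x) (Y x) := by
  have : IsManifold I 1 M := IsManifold.of_le (m := 1) (n := ∞) (by simp)
  have e1 : ∀ Z : VField I M, VectorField.mpullbackWithin 𝓘(ℝ, E) I (extChartAt I x).symm Z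
      (range I) = fieldInChart I Z x := by
    intro Z
    rw [I.range_eq_univ]
    exact VectorField.mpullbackWithin_univ
  have e2 : VectorField.mlieBracket I X Y x = (mfderiv I 𝓘(ℝ, E) (extChartAt I x) x).inverse
      (VectorField.lieBracketWithin (E := E) ℝ (fieldInChart (E := E) I X x)
        (fieldInChart (E := E) I Y x)
        ((extChartAt I x).symm ⁻¹' univ ∩ range I) (extChartAt I x x)) := by
    rw [← e1, ← e1]; rfl
  have e3 : ∀ L : E →L[ℝ] E, L = ContinuousLinearMap.id ℝ E → ∀ w, L.inverse w = w := by
    rintro _ rfl w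
    rw [ContinuousLinearMap.inverse_id]
    rfl
  refine e2.trans ((e3 _ mfderiv_extChartAt_self _).trans ?_)
  rw [I.range_eq_univ, preimage_univ, univ_inter, VectorField.lieBracketWithin_univ]
  have h6 : fieldInChart I X x (extChartAt I x x) = X x := fieldInChart_self X x
  have h7 : fieldInChart I Y x (extChartAt I x x) = Y x := fieldInChart_self Y x
  show VectorField.lieBracket (E := E) ℝ (fieldInChart (E := E) I X x)
    (fieldInChart (E := E) I Y x) (extChartAt I x x) = _
  rw [VectorField.lieBracket, h6, h7]

lemma fieldSmoothAt_iff [I.Boundaryless] [IsManifold I ∞ M] {X : VField I M} {x : M} :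
    FieldSmoothAt I X x ↔ ContDiffAt ℝ ∞ (fieldInChart (E := E) I X x) (extChartAt I x x) := by
  have : IsManifold I 1 M := IsManifold.of_le (m := 1) (n := ∞) (by simp)
  unfold FieldSmoothAt
  have h0 := Bundle.contMDiffAt_section (IB := I) (n := ∞) (F := E)
    (E := (TangentSpace I : M → Type _)) (s := X) x
  refine h0.trans ?_
  rw [contMDiffAt_iff_inChart]
  have key : (fun u => ((trivializationAt E (TangentSpace I) x)
      ⟨(extChartAt I x).symm u, X ((extChartAt I x).symm u)⟩).2) =ᶠ[𝓝 (extChartAt I x x)]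
      fieldInChart I X x := by
    filter_upwards [(isOpen_extChartAt_target (I := I) x).mem_nhds
      (mem_extChartAt_target (I := I) x)] with z hz
    have hs : (extChartAt I x).symm z ∈ (chartAt H x).source := by
      rw [← extChartAt_source I]; exact (extChartAt I x).map_target hz
    rw [fieldInChart_eq_mfderiv hz, ← TangentBundle.continuousLinearMapAt_trivializationAt hs]
    exact ((trivializationAt E (TangentSpace I) x).continuousLinearMapAt_apply_of_mem (R := ℝ)
      (by simpa using hs) _).symm
  exact ⟨fun h => h.congr_of_eventuallyEq key.symm, fun h => h.congr_of_eventuallyEq key⟩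

lemma formInChart_interiorProd [I.Boundaryless] [IsManifold I ∞ M] {k : ℕ}
    (X : VField I M) (α : DForm I M (k + 1)) {x : M} {z : E}
    (hz : z ∈ (extChartAt I x).target) :
    formInChart I (fun y => interiorProd (X y) (α y)) x z
      = interiorProd (fieldInChart (E := E) I X x z) (formInChart I α x z) := by
  have h := mfderiv_fieldInChart X hz
  show (interiorProd _ _).compContinuousLinearMap _ = _
  refine Eq.trans ?_ (interiorProd_comp (α ((extChartAt I x).symm z))
    (mfderiv 𝓘(ℝ, E) I (extChartAt I x).symm z) (fieldInChart (E := E) I X x z)).symm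
  rw [h]
  rfl

/-- The expression of a field of bilinear forms in the preferred chart at `x`. -/
noncomputable def bilinInChart (I : ModelWithCorners ℝ E H) {M : Type*} [TopologicalSpace M]
    [ChartedSpace H M] (k : BForm I M) (x : M) : E → E →L[ℝ] E →L[ℝ] ℝ :=
  fun z => pullbackBilin (k ((extChartAt I x).symm z))
    (mfderiv 𝓘(ℝ, E) I (extChartAt I x).symm z)

lemma bilinInChart_apply (k : BForm I M) (x : M) (z a b : E) :
    bilinInChart I k x z a b = k ((extChartAt I x).symm z)
      (mfderiv 𝓘(ℝ, E) I (extChartAt I x).symm z a)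
      (mfderiv 𝓘(ℝ, E) I (extChartAt I x).symm z b) := rfl

lemma bilinInChart_self [I.Boundaryless] [IsManifold I ∞ M] (k : BForm I M) (x : M) :
    bilinInChart I k x (extChartAt I x x) = k x := by
  have : IsManifold I 1 M := IsManifold.of_le (m := 1) (n := ∞) (by simp)
  have h1 : (show E →L[ℝ] E from
    mfderiv 𝓘(ℝ, E) I (extChartAt I x).symm (extChartAt I x x)) = ContinuousLinearMap.id ℝ E :=
    mfderiv_extChartAt_symm_self x
  have h2 : ∀ (p q : M) (hpq : p = q) (a b : E), k p (show TangentSpace I p from a)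
      (show TangentSpace I p from b) = k q (show TangentSpace I q from a)
      (show TangentSpace I q from b) := by
    intro p q hpq; subst hpq; intros; rfl
  refine ContinuousLinearMap.ext fun a => ContinuousLinearMap.ext fun b => ?_
  refine Eq.trans ?_ (h2 _ _ (extChartAt_to_inv (I := I) x) a b)
  exact congrArg (fun L : E →L[ℝ] E => k ((extChartAt I x).symm (extChartAt I x x))
    (show TangentSpace I _ from L a) (show TangentSpace I _ from L b)) h1

lemma metricSmoothAt_iff [FiniteDimensional ℝ E] [I.Boundaryless] [IsManifold I ∞ M]
    {k : BForm I M} {x : M} :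
    MetricSmoothAt I k x ↔ ContDiffAt ℝ ∞ (bilinInChart I k x) (extChartAt I x x) := by
  have : IsManifold I 1 M := IsManifold.of_le (m := 1) (n := ∞) (by simp)
  unfold MetricSmoothAt
  rw [contMDiffAt_hom_bundle]
  have h0 : ContMDiffAt I I ∞ (fun y : M => y) x := contMDiffAt_id
  refine (and_iff_right h0).trans ?_
  rw [contMDiffAt_iff_inChart]
  have key : (fun u => ContinuousLinearMap.inCoordinates E (TangentSpace I) (E →L[ℝ] ℝ)
      (fun y : M => TangentSpace I y →L[ℝ] ℝ) x ((extChartAt I x).symm u) x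
      ((extChartAt I x).symm u) (k ((extChartAt I x).symm u))) =ᶠ[𝓝 (extChartAt I x x)]
      bilinInChart I k x := by
    filter_upwards [(isOpen_extChartAt_target (I := I) x).mem_nhds
      (mem_extChartAt_target (I := I) x)] with z hz
    have hs : (extChartAt I x).symm z ∈ (chartAt H x).source := by
      rw [← extChartAt_source I]; exact (extChartAt I x).map_target hz
    refine ContinuousLinearMap.ext fun a => ContinuousLinearMap.ext fun b => ?_
    have h1 := inCoordinates_apply_eq₂ (𝕜 := ℝ) (F₁ := E) (F₂ := E) (F₃ := ℝ)
      (E₁ := (TangentSpace I : M → Type _)) (E₂ := (TangentSpace I : M → Type _))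
      (E₃ := Bundle.Trivial M ℝ) (x₀ := x) (x := (extChartAt I x).symm z)
      (ϕ := k ((extChartAt I x).symm z)) (v := a) (w := b) (by simpa using hs) (by simpa using hs)
      (Set.mem_univ _)
    refine h1.trans ?_
    have h2 := TangentBundle.symmL_trivializationAt (I := I) hs
    rw [(extChartAt I x).right_inv hz, I.range_eq_univ, mfderivWithin_univ] at h2
    rw [bilinInChart_apply, ← h2]
    simp only [Bundle.Trivial.fiberBundle_trivializationAt',
      Bundle.Trivial.linearMapAt_trivialization, LinearMap.id_coe, id_eq]
    have hb : (extChartAt I x).symm z ∈ (trivializationAt E (TangentSpace I) x).baseSet := by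
      simpa using hs
    have h5 : ∀ c : E, (trivializationAt E (TangentSpace I) x).symmL ℝ ((extChartAt I x).symm z) c
        = (trivializationAt E (TangentSpace I) x).symm ((extChartAt I x).symm z) c := fun c =>
      Bundle.Trivialization.symmₗ_apply (R := ℝ) (trivializationAt E (TangentSpace I) x) hb c
    exact congrArg₂ (fun a b => k ((extChartAt I x).symm z) a b) (h5 a).symm (h5 b).symm
  exact ⟨fun h => h.congr_of_eventuallyEq key.symm, fun h => h.congr_of_eventuallyEq key⟩

/-- The expression of a field of endomorphisms in the preferred chart at `x`. -/
noncomputable def endoInChart (I : ModelWithCorners ℝ E H) {M : Type*} [TopologicalSpace M]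
    [ChartedSpace H M] (J : ∀ x : M, TangentSpace I x →L[ℝ] TangentSpace I x) (x : M) :
    E → E →L[ℝ] E :=
  fun z => (mfderiv I 𝓘(ℝ, E) (extChartAt I x) ((extChartAt I x).symm z)).comp
    ((J ((extChartAt I x).symm z)).comp (mfderiv 𝓘(ℝ, E) I (extChartAt I x).symm z))

lemma mfderiv_endoInChart [I.Boundaryless] [IsManifold I ∞ M]
    (J : ∀ x : M, TangentSpace I x →L[ℝ] TangentSpace I x) {x : M} {z : E}
    (hz : z ∈ (extChartAt I x).target) (a : E) :
    mfderiv 𝓘(ℝ, E) I (extChartAt I x).symm z (endoInChart I J x z a)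
      = J ((extChartAt I x).symm z) (mfderiv 𝓘(ℝ, E) I (extChartAt I x).symm z a) := by
  have : IsManifold I 1 M := IsManifold.of_le (m := 1) (n := ∞) (by simp)
  have h := mfderivWithin_extChartAt_symm_comp_mfderiv_extChartAt (I := I) hz
  rw [I.range_eq_univ, mfderivWithin_univ] at h
  exact congrArg (fun L => L (J ((extChartAt I x).symm z)
    (mfderiv 𝓘(ℝ, E) I (extChartAt I x).symm z a))) h

lemma endoInChart_fieldInChart [I.Boundaryless] [IsManifold I ∞ M]
    (J : ∀ x : M, TangentSpace I x →L[ℝ] TangentSpace I x) (X : VField I M) {x : M} {z : E}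
    (hz : z ∈ (extChartAt I x).target) :
    fieldInChart I (fun y => J y (X y)) x z
      = endoInChart I J x z (fieldInChart (E := E) I X x z) := by
  refine eq_fieldInChart hz ?_
  rw [mfderiv_endoInChart J hz, mfderiv_fieldInChart X hz]

lemma endoInChart_self [I.Boundaryless] [IsManifold I ∞ M]
    (J : ∀ x : M, TangentSpace I x →L[ℝ] TangentSpace I x) (x : M) (a : E) :
    endoInChart I J x (extChartAt I x x) a = J x a := by
  have h := endoInChart_fieldInChart J (fun _ => a) (mem_extChartAt_target (I := I) x)
  have h1 : fieldInChart I (fun _ : M => a) x (extChartAt I x x) = a :=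
    fieldInChart_self (I := I) (fun _ => a) x
  rw [h1] at h
  exact h.symm.trans (fieldInChart_self (I := I) (fun y => J y a) x)

lemma contDiffAt_endoInChart [I.Boundaryless] [IsManifold I ∞ M]
    {J : ∀ x : M, TangentSpace I x →L[ℝ] TangentSpace I x} {x : M}
    (hJ : ContMDiffAt I (I.prod 𝓘(ℝ, E →L[ℝ] E)) ∞
      (fun x => Bundle.TotalSpace.mk' (E →L[ℝ] E)
        (E := fun x : M => TangentSpace I x →L[ℝ] TangentSpace I x) x (J x)) x) :
    ContDiffAt ℝ ∞ (endoInChart I J x) (extChartAt I x x) := by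
  have : IsManifold I 1 M := IsManifold.of_le (m := 1) (n := ∞) (by simp)
  rw [contMDiffAt_hom_bundle] at hJ
  have h2 := contMDiffAt_iff_inChart.1 hJ.2
  refine h2.congr_of_eventuallyEq ?_
  filter_upwards [(isOpen_extChartAt_target (I := I) x).mem_nhds
    (mem_extChartAt_target (I := I) x)] with z hz
  have hs : (extChartAt I x).symm z ∈ (chartAt H x).source := by
    rw [← extChartAt_source I]; exact (extChartAt I x).map_target hz
  have h3 := TangentBundle.symmL_trivializationAt (I := I) hs
  rw [(extChartAt I x).right_inv hz, I.range_eq_univ, mfderivWithin_univ] at h3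
  have h4 := TangentBundle.continuousLinearMapAt_trivializationAt (I := I) hs
  unfold endoInChart ContinuousLinearMap.inCoordinates
  rw [h3, h4]
  rfl

/-- A smooth field of bilinear forms takes smooth values on smooth vector fields. -/
lemma contMDiffAt_bilin_apply [FiniteDimensional ℝ E] [I.Boundaryless] [IsManifold I ∞ M]
    {k : BForm I M} {X Y : VField I M} {x : M} (hk : MetricSmoothAt I k x)
    (hX : FieldSmoothAt I X x) (hY : FieldSmoothAt I Y x) :
    ContMDiffAt I 𝓘(ℝ, ℝ) ∞ (fun y => k y (X y) (Y y)) x := by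
  rw [contMDiffAt_iff_inChart]
  have h := ((metricSmoothAt_iff.1 hk).clm_apply (fieldSmoothAt_iff.1 hX)).clm_apply
    (fieldSmoothAt_iff.1 hY)
  refine h.congr_of_eventuallyEq ?_
  filter_upwards [(isOpen_extChartAt_target (I := I) x).mem_nhds
    (mem_extChartAt_target (I := I) x)] with z hz
  rw [bilinInChart_apply, mfderiv_fieldInChart X hz, mfderiv_fieldInChart Y hz]

/-- The Killing equation at `x` in the preferred chart at `x`. -/
lemma isKillingAt_of_inChart [FiniteDimensional ℝ E] [I.Boundaryless] [IsManifold I ∞ M]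
    {k : BForm I M} {X : VField I M} {x : M} (hk : MetricSmoothAt I k x)
    (h : ∀ a b : E, fderiv ℝ (bilinInChart I k x) (extChartAt I x x) (X x) a b
      + bilinInChart I k x (extChartAt I x x)
        (fderiv ℝ (fieldInChart (E := E) I X x) (extChartAt I x x) a) b
      + bilinInChart I k x (extChartAt I x x) a
        (fderiv ℝ (fieldInChart (E := E) I X x) (extChartAt I x x) b) = 0) :
    IsKillingAt I X k x := by
  intro Y Z hY hZ
  rw [mlieBracket_eq, mlieBracket_eq, dfun_eq (contMDiffAt_bilin_apply hk hY hZ)]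
  set z₀ := extChartAt I x x with hz₀
  have hk' := (metricSmoothAt_iff.1 hk).differentiableAt (by simp)
  have hY' := (fieldSmoothAt_iff.1 hY).differentiableAt (by simp)
  have hZ' := (fieldSmoothAt_iff.1 hZ).differentiableAt (by simp)
  have h1 : (fun u => k ((extChartAt I x).symm u) (Y ((extChartAt I x).symm u))
      (Z ((extChartAt I x).symm u))) =ᶠ[𝓝 z₀] fun u => bilinInChart I k x u
        (fieldInChart (E := E) I Y x u) (fieldInChart (E := E) I Z x u) := by
    filter_upwards [(isOpen_extChartAt_target (I := I) x).mem_nhds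
      (mem_extChartAt_target (I := I) x)] with z hz
    rw [bilinInChart_apply, mfderiv_fieldInChart Y hz, mfderiv_fieldInChart Z hz]
  have h2 := (hk'.hasFDerivAt.clm_apply hY'.hasFDerivAt).clm_apply hZ'.hasFDerivAt
  have h3 := (h2.congr_of_eventuallyEq h1).fderiv
  have h4 := h (Y x) (Z x)
  have h5 : (show E →L[ℝ] E →L[ℝ] ℝ from k x) = bilinInChart I k x z₀ :=
    (bilinInChart_self k x).symm
  have h6 : fieldInChart I Y x z₀ = Y x := fieldInChart_self Y x
  have h7 : fieldInChart I Z x z₀ = Z x := fieldInChart_self Z x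
  have h8 : ∀ a b : E, (show E →L[ℝ] E →L[ℝ] ℝ from k x) a b = bilinInChart I k x z₀ a b := by
    intro a b; rw [h5]
  have h9 : fderiv ℝ (fun u => k ((extChartAt I x).symm u) (Y ((extChartAt I x).symm u))
      (Z ((extChartAt I x).symm u))) z₀ (X x)
      = bilinInChart I k x z₀ (fieldInChart (E := E) I Y x z₀)
          (fderiv ℝ (fieldInChart (E := E) I Z x) z₀ (X x))
        + (bilinInChart I k x z₀ (fderiv ℝ (fieldInChart (E := E) I Y x) z₀ (X x))
            (fieldInChart (E := E) I Z x z₀)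
          + fderiv ℝ (bilinInChart I k x) z₀ (X x) (fieldInChart (E := E) I Y x z₀)
            (fieldInChart (E := E) I Z x z₀)) :=
    congrArg (fun L : E →L[ℝ] ℝ => L (X x)) h3
  rw [h6, h7] at h9
  refine h9.trans (Eq.trans ?_ (congrArg₂ (· + ·) (h8 _ _) (h8 _ _)).symm)
  have h10 : ∀ a b c : E, bilinInChart I k x z₀ (a - b) c
      = bilinInChart I k x z₀ a c - bilinInChart I k x z₀ b c := by
    intro a b c; rw [map_sub]; rfl
  have h11 : ∀ a b c : E, bilinInChart I k x z₀ c (a - b)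
      = bilinInChart I k x z₀ c a - bilinInChart I k x z₀ c b := fun a b c => map_sub _ _ _
  refine Eq.trans ?_ (congrArg₂ (· + ·) (h10 _ _ _) (h11 _ _ _)).symm
  linear_combination h4

end ChartCalculus

/-! ### The exterior and Lie derivatives on a manifold -/

section ManifoldForms

variable {E : Type*} [NormedAddCommGroup E] [NormedSpace ℝ E] {H : Type*} [TopologicalSpace H]
  {I : ModelWithCorners ℝ E H} {M : Type*} [TopologicalSpace M] [ChartedSpace H M]

lemma eventually_mem_target [I.Boundaryless] (x : M) :
    ∀ᶠ z in 𝓝 (extChartAt I x x), z ∈ (extChartAt I x).target :=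
  (isOpen_extChartAt_target x).mem_nhds (mem_extChartAt_target x)

lemma eventually_inChart [I.Boundaryless] {x : M} {p : M → Prop} (h : ∀ᶠ y in 𝓝 x, p y) :
    ∀ᶠ z in 𝓝 (extChartAt I x x), p ((extChartAt I x).symm z) := by
  have h1 := continuousAt_extChartAt_symm (I := I) x
  refine h1.eventually ?_
  rwa [extChartAt_to_inv]

lemma form_ext_iff_zero {V : Type*} [AddCommGroup V] [Module ℝ V] [TopologicalSpace V] {k : ℕ}
    {α : V [⋀^Fin k]→L[ℝ] ℝ} : α = 0 ↔ ∀ v, α v = 0 :=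
  ⟨fun h v => by rw [h]; rfl, fun h => ContinuousAlternatingMap.ext fun v => h v⟩

set_option linter.unusedSectionVars false

variable [FiniteDimensional ℝ E] [I.Boundaryless] [IsManifold I ∞ M]

lemma formSmoothAt_add {k : ℕ} {α β : DForm I M k} {x : M} (hα : FormSmoothAt I α x)
    (hβ : FormSmoothAt I β x) : FormSmoothAt I (fun y => α y + β y) x :=
  ContDiffAt.add hα hβ

lemma formSmoothAt_smul {k : ℕ} {f : M → ℝ} {α : DForm I M k} {x : M}
    (hf : ContMDiffAt I 𝓘(ℝ, ℝ) ∞ f x) (hα : FormSmoothAt I α x) :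
    FormSmoothAt I (fun y => f y • α y) x :=
  ContDiffAt.smul (contMDiffAt_iff_inChart.1 hf) hα

lemma formSmoothAt_wedge {p q : ℕ} {α : DForm I M p} {β : DForm I M q}
    {x : M} (hα : FormSmoothAt I α x) (hβ : FormSmoothAt I β x) :
    FormSmoothAt I (fun y => wedge (α y) (β y)) x := by
  have h : formInChart I (fun y => wedge (α y) (β y)) x
      = fun z => wedge (formInChart I α x z) (formInChart I β x z) :=
    funext fun z => formInChart_wedge α β x z
  unfold FormSmoothAt
  rw [h]
  exact ContDiffAt.wedge hα hβ

lemma formSmoothAt_interiorProd {k : ℕ} {X : VField I M} {α : DForm I M (k + 1)}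
    {x : M} (hX : FieldSmoothAt I X x) (hα : FormSmoothAt I α x) :
    FormSmoothAt I (fun y => interiorProd (X y) (α y)) x := by
  have h : formInChart I (fun y => interiorProd (X y) (α y)) x =ᶠ[𝓝 (extChartAt I x x)]
      fun z => interiorProd (fieldInChart (E := E) I X x z) (formInChart I α x z) := by
    filter_upwards [eventually_mem_target (I := I) x] with z hz
    exact formInChart_interiorProd X α hz
  exact (ContDiffAt.interiorProd hα (fieldSmoothAt_iff.1 hX)).congr_of_eventuallyEq h

lemma contDiffAt_oneForm {X : Type*} [NormedAddCommGroup X] [NormedSpace ℝ X] {n : WithTop ℕ∞}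
    {γ : X → E →L[ℝ] ℝ} {x : X} (hγ : ContDiffAt ℝ n γ x) :
    ContDiffAt ℝ n (fun y => oneForm (γ y)) x :=
  contDiffAt_form_iff.2 fun v => by
    simp only [oneForm_apply]
    exact hγ.clm_apply contDiffAt_const

lemma formSmoothAt_dfun {f : M → ℝ} {x : M}
    (hf : ∀ᶠ y in 𝓝 x, ContMDiffAt I 𝓘(ℝ, ℝ) ∞ f y) :
    FormSmoothAt I (fun y => oneForm (dfun I f y)) x := by
  have h : formInChart I (fun y => oneForm (dfun I f y)) x =ᶠ[𝓝 (extChartAt I x x)]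
      fun z => oneForm (fderiv ℝ (fun u => f ((extChartAt I x).symm u)) z) := by
    filter_upwards [eventually_mem_target (I := I) x, eventually_inChart hf] with z hz hfz
    exact formInChart_oneForm_dfun hz hfz
  refine ContDiffAt.congr_of_eventuallyEq (contDiffAt_oneForm ?_) h
  exact (contMDiffAt_iff_inChart.1 hf.self_of_nhds).fderiv_right (m := ∞) le_rfl

lemma extD_dfun {f : M → ℝ} {x : M} (hf : ∀ᶠ y in 𝓝 x, ContMDiffAt I 𝓘(ℝ, ℝ) ∞ f y) :
    extD I (fun y => oneForm (dfun I f y)) x = 0 := by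
  have : IsManifold I 1 M := IsManifold.of_le (m := 1) (n := ∞) (by simp)
  have h : formInChart I (fun y => oneForm (dfun I f y)) x =ᶠ[𝓝 (extChartAt I x x)]
      fun z => oneForm (fderiv ℝ (fun u => f ((extChartAt I x).symm u)) z) := by
    filter_upwards [eventually_mem_target (I := I) x, eventually_inChart hf] with z hz hfz
    exact formInChart_oneForm_dfun hz hfz
  rw [extD_eq, h.extDeriv_eq]
  exact extDeriv_oneForm_fderiv ((contMDiffAt_iff_inChart.1 hf.self_of_nhds).of_le
    (WithTop.coe_le_coe.2 (le_top : (2 : ℕ∞) ≤ ⊤)))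

lemma extD_add {k : ℕ} {α β : DForm I M k} {x : M} (hα : FormSmoothAt I α x)
    (hβ : FormSmoothAt I β x) :
    extD I (fun y => α y + β y) x = extD I α x + extD I β x := by
  have : IsManifold I 1 M := IsManifold.of_le (m := 1) (n := ∞) (by simp)
  rw [extD_eq, extD_eq, extD_eq]
  exact extDeriv_add (ContDiffAt.differentiableAt hα (by simp))
    (ContDiffAt.differentiableAt hβ (by simp))

lemma extD_neg {k : ℕ} (α : DForm I M k) (x : M) :
    extD I (fun y => -α y) x = -extD I α x := by
  have : IsManifold I 1 M := IsManifold.of_le (m := 1) (n := ∞) (by simp)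
  have h1 : formInChart I (fun y => -α y) x = fun z => (-1 : ℝ) • formInChart I α x z := by
    funext z
    refine ContinuousAlternatingMap.ext fun v => ?_
    exact (neg_one_mul _).symm
  rw [extD_eq, extD_eq, h1]
  refine (extDeriv_fun_smul (-1 : ℝ) (formInChart I α x)).trans ?_
  rw [neg_one_smul]; rfl

lemma extD_smul_three {f : M → ℝ} {α : DForm I M 3} {x : M}
    (hf : ContMDiffAt I 𝓘(ℝ, ℝ) ∞ f x) (hα : FormSmoothAt I α x)
    (v : Fin 4 → TangentSpace I x) :
    extD I (fun y => f y • α y) x v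
      = wedge (oneForm (dfun I f x)) (α x) v + f x * extD I α x v := by
  have : IsManifold I 1 M := IsManifold.of_le (m := 1) (n := ∞) (by simp)
  have h := extDeriv_smul_three ((contMDiffAt_iff_inChart.1 hf).differentiableAt (by simp))
    (ContDiffAt.differentiableAt hα (by simp)) v
  rw [extD_eq, extD_eq, dfun_eq hf, ← formInChart_self α x]
  rw [extChartAt_to_inv] at h
  exact h

set_option maxRecDepth 4000 in
lemma extD_smul_four {f : M → ℝ} {α : DForm I M 4} {x : M}
    (hf : ContMDiffAt I 𝓘(ℝ, ℝ) ∞ f x) (hα : FormSmoothAt I α x)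
    (v : Fin 5 → TangentSpace I x) :
    extD I (fun y => f y • α y) x v
      = wedge (α x) (oneForm (dfun I f x)) v + f x * extD I α x v := by
  have : IsManifold I 1 M := IsManifold.of_le (m := 1) (n := ∞) (by simp)
  have h := extDeriv_smul_four ((contMDiffAt_iff_inChart.1 hf).differentiableAt (by simp))
    (ContDiffAt.differentiableAt hα (by simp)) v
  have hα' : formInChart I α x (extChartAt I x x) = α x := formInChart_self α x
  have hf' : (show E →L[ℝ] ℝ from dfun I f x)
    = fderiv ℝ (fun u => f ((extChartAt I x).symm u)) (extChartAt I x x) := dfun_eq hf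
  rw [extChartAt_to_inv, hα', ← hf'] at h
  rw [extD_eq, extD_eq]
  exact h

lemma extD_wedge_two_one {α : DForm I M 2} {β : DForm I M 1} {x : M}
    (hα : FormSmoothAt I α x) (hβ : FormSmoothAt I β x) (v : Fin 4 → TangentSpace I x) :
    extD I (fun y => wedge (α y) (β y)) x v
      = wedge (extD I α x) (β x) v + wedge (α x) (extD I β x) v := by
  have : IsManifold I 1 M := IsManifold.of_le (m := 1) (n := ∞) (by simp)
  have h := extDeriv_wedge_two_one (ContDiffAt.differentiableAt hα (by simp))
    (ContDiffAt.differentiableAt hβ (by simp)) v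
  have h1 : formInChart I (fun y => wedge (α y) (β y)) x
      = fun z => wedge (formInChart I α x z) (formInChart I β x z) :=
    funext fun z => formInChart_wedge α β x z
  rw [extD_eq, extD_eq, extD_eq, ← formInChart_self α x, ← formInChart_self β x, h1]
  exact h

set_option maxRecDepth 4000 in
lemma extD_wedge_three_one {α : DForm I M 3} {β : DForm I M 1} {x : M}
    (hα : FormSmoothAt I α x) (hβ : FormSmoothAt I β x) (v : Fin 5 → TangentSpace I x) :
    extD I (fun y => wedge (α y) (β y)) x v
      = wedge (extD I α x) (β x) v - wedge (α x) (extD I β x) v := by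
  have : IsManifold I 1 M := IsManifold.of_le (m := 1) (n := ∞) (by simp)
  have h := extDeriv_wedge_three_one (ContDiffAt.differentiableAt hα (by simp))
    (ContDiffAt.differentiableAt hβ (by simp)) v
  have h1 : formInChart I (fun y => wedge (α y) (β y)) x
      = fun z => wedge (formInChart I α x z) (formInChart I β x z) :=
    funext fun z => formInChart_wedge α β x z
  have hα' : formInChart I α x (extChartAt I x x) = α x := formInChart_self α x
  have hβ' : formInChart I β x (extChartAt I x x) = β x := formInChart_self β x
  rw [hα', hβ'] at h
  rw [extD_eq, extD_eq, extD_eq, h1]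
  exact h

/-- `d(α ∧ α) = 0` for a closed 2-form `α`. -/
lemma extD_wedge_self_of_closed {α : DForm I M 2} {x : M}
    (hα : FormSmoothAt I α x) (hd : extD I α x = 0) :
    extD I (fun y => wedge (α y) (α y)) x = 0 := by
  have : IsManifold I 1 M := IsManifold.of_le (m := 1) (n := ∞) (by simp)
  have h1 : formInChart I (fun y => wedge (α y) (α y)) x
      = fun z => wedge (formInChart I α x z) (formInChart I α x z) :=
    funext fun z => formInChart_wedge α α x z
  rw [extD_eq] at hd ⊢
  rw [h1]
  exact extDeriv_wedge_two_two_of_closed (ContDiffAt.differentiableAt hα (by simp)) hd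

/-- The Lie derivative in the preferred chart at `x`, by Cartan's formula. -/
lemma lieDerivForm_inChart {k : ℕ} {X : VField I M} {α : DForm I M (k + 1)} {x : M}
    (hX : FieldSmoothAt I X x) (hα : FormSmoothAt I α x) (v : Fin (k + 1) → E) :
    lieDerivForm I X α x v
      = fderiv ℝ (formInChart I α x) (extChartAt I x x) (X x) v
        + ∑ i : Fin (k + 1), (-1) ^ (i : ℕ) * formInChart I α x (extChartAt I x x)
          (Matrix.vecCons (fderiv ℝ (fieldInChart (E := E) I X x) (extChartAt I x x) (v i))
            (i.removeNth v)) := by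
  have : IsManifold I 1 M := IsManifold.of_le (m := 1) (n := ∞) (by simp)
  have h : formInChart I (fun y => interiorProd (X y) (α y)) x =ᶠ[𝓝 (extChartAt I x x)]
      fun z => interiorProd (fieldInChart (E := E) I X x z) (formInChart I α x z) := by
    filter_upwards [eventually_mem_target (I := I) x] with z hz
    exact formInChart_interiorProd X α hz
  have h1 := extDeriv_interiorProd_add (ContDiffAt.differentiableAt hα (by simp))
    ((fieldSmoothAt_iff.1 hX).differentiableAt (by simp)) v
  have h2 : fieldInChart (E := E) I X x (extChartAt I x x) = X x := fieldInChart_self X x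
  rw [h2] at h1
  refine Eq.trans ?_ h1
  show (extD I (fun x => interiorProd (X x) (α x)) x v + interiorProd (X x) (extD I α x) v) = _
  rw [extD_eq, extD_eq, h.extDeriv_eq]
  rfl

lemma lieDerivForm_three_inChart {X : VField I M} {α : DForm I M 3} {x : M}
    (hX : FieldSmoothAt I X x) (hα : FormSmoothAt I α x) (a b c : E) :
    lieDerivForm I X α x ![a, b, c]
      = fderiv ℝ (formInChart I α x) (extChartAt I x x) (X x) ![a, b, c]
        + formInChart I α x (extChartAt I x x)
          ![fderiv ℝ (fieldInChart (E := E) I X x) (extChartAt I x x) a, b, c]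
        - formInChart I α x (extChartAt I x x)
          ![fderiv ℝ (fieldInChart (E := E) I X x) (extChartAt I x x) b, a, c]
        + formInChart I α x (extChartAt I x x)
          ![fderiv ℝ (fieldInChart (E := E) I X x) (extChartAt I x x) c, a, b] := by
  refine (lieDerivForm_inChart hX hα ![a, b, c]).trans ?_
  have h0 : (0 : Fin 3).removeNth ![a, b, c] = ![b, c] := by funext i; fin_cases i <;> rfl
  have h1 : (1 : Fin 3).removeNth ![a, b, c] = ![a, c] := by funext i; fin_cases i <;> rfl
  have h2 : (2 : Fin 3).removeNth ![a, b, c] = ![a, b] := by funext i; fin_cases i <;> rfl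
  refine (congrArg (fun r : ℝ => _ + r) (Fin.sum_univ_three _)).trans ?_
  simp only [h0, h1, h2]
  simp
  ring

lemma lieDerivForm_two_inChart {X : VField I M} {α : DForm I M 2} {x : M}
    (hX : FieldSmoothAt I X x) (hα : FormSmoothAt I α x) (a b : E) :
    lieDerivForm I X α x ![a, b]
      = fderiv ℝ (formInChart I α x) (extChartAt I x x) (X x) ![a, b]
        + formInChart I α x (extChartAt I x x)
          ![fderiv ℝ (fieldInChart (E := E) I X x) (extChartAt I x x) a, b]
        - formInChart I α x (extChartAt I x x)
          ![fderiv ℝ (fieldInChart (E := E) I X x) (extChartAt I x x) b, a] := by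
  refine (lieDerivForm_inChart hX hα ![a, b]).trans ?_
  have h0 : (0 : Fin 2).removeNth ![a, b] = ![b] := by funext i; fin_cases i; rfl
  have h1 : (1 : Fin 2).removeNth ![a, b] = ![a] := by funext i; fin_cases i; rfl
  refine (congrArg (fun r : ℝ => _ + r) (Fin.sum_univ_two _)).trans ?_
  simp only [h0, h1]
  simp
  ring

lemma dfun_comp {g : ℝ → ℝ} {g' : ℝ} {f : M → ℝ} {x : M}
    (hg : HasDerivAt g g' (f x)) (hf : ContMDiffAt I 𝓘(ℝ, ℝ) ∞ f x) :
    dfun I (fun y => g (f y)) x = g' • dfun I f x := by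
  have h1 : HasMFDerivAt 𝓘(ℝ, ℝ) 𝓘(ℝ, ℝ) g (f x)
      (ContinuousLinearMap.toSpanSingleton ℝ g') := hg.hasFDerivAt.hasMFDerivAt
  have h2 := (h1.comp x (hf.mdifferentiableAt (by simp)).hasMFDerivAt).mfderiv
  refine h2.trans (ContinuousLinearMap.ext fun v => ?_)
  show (dfun I f x v) * g' = g' * dfun I f x v
  ring

end ManifoldForms

/-! ### `SU(3)` structures in a chart -/

section CoframePullback

variable {E F : Type*} [AddCommGroup E] [Module ℝ E] [TopologicalSpace E]
  [AddCommGroup F] [Module ℝ F] [TopologicalSpace F]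

lemma stdSigma_comp (e : Fin 6 → (F →L[ℝ] ℝ)) (L : E →L[ℝ] F) :
    stdSigma (fun i => (e i).comp L) = (stdSigma e).compContinuousLinearMap L := by
  simp only [stdSigma, ← oneForm_comp, ← wedge_comp]
  rfl

lemma wedge₃_comp (a b c : F →L[ℝ] ℝ) (L : E →L[ℝ] F) :
    wedge₃ (a.comp L) (b.comp L) (c.comp L) = (wedge₃ a b c).compContinuousLinearMap L := by
  simp only [wedge₃, ← oneForm_comp, ← wedge_comp]

lemma stdPsiPlus_comp (e : Fin 6 → (F →L[ℝ] ℝ)) (L : E →L[ℝ] F) :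
    stdPsiPlus (fun i => (e i).comp L) = (stdPsiPlus e).compContinuousLinearMap L := by
  simp only [stdPsiPlus, wedge₃_comp]
  rfl

lemma stdPsiMinus_comp (e : Fin 6 → (F →L[ℝ] ℝ)) (L : E →L[ℝ] F) :
    stdPsiMinus (fun i => (e i).comp L) = (stdPsiMinus e).compContinuousLinearMap L := by
  simp only [stdPsiMinus, wedge₃_comp]
  rfl

lemma linearIndependent_comp_of_surjective {ι : Type*} {e : ι → (F →L[ℝ] ℝ)}
    (he : LinearIndependent ℝ e) {L : E →L[ℝ] F} (hL : Function.Surjective L) :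
    LinearIndependent ℝ fun i => (e i).comp L := by
  have h := he.map' (ContinuousLinearMap.precomp ℝ L).toLinearMap (by
    rw [LinearMap.ker_eq_bot]
    intro a b hab
    ext v
    obtain ⟨u, rfl⟩ := hL v
    exact congrArg (fun γ : E →L[ℝ] ℝ => γ u) hab)
  exact h

lemma IsSU3Coframe.comp {e : Fin 6 → (F →L[ℝ] ℝ)} {h : F →L[ℝ] F →L[ℝ] ℝ}
    {σ : F [⋀^Fin 2]→L[ℝ] ℝ} {ψp ψm : F [⋀^Fin 3]→L[ℝ] ℝ} (he : IsSU3Coframe e h σ ψp ψm)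
    {L : E →L[ℝ] F} (hL : Function.Surjective L) :
    IsSU3Coframe (fun i => (e i).comp L) (pullbackBilin h L) (σ.compContinuousLinearMap L)
      (ψp.compContinuousLinearMap L) (ψm.compContinuousLinearMap L) := by
  refine ⟨linearIndependent_comp_of_surjective he.1 hL, fun u v => he.2.1 _ _, ?_, ?_, ?_⟩
  · rw [he.2.2.1, stdSigma_comp]
  · rw [he.2.2.2.1, stdPsiPlus_comp]
  · rw [he.2.2.2.2, stdPsiMinus_comp]

end CoframePullback

section LieSmul

variable {E : Type*} [NormedAddCommGroup E] [NormedSpace ℝ E] {H : Type*} [TopologicalSpace H]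
  {I : ModelWithCorners ℝ E H} {M : Type*} [TopologicalSpace M] [ChartedSpace H M]
  [FiniteDimensional ℝ E] [I.Boundaryless] [IsManifold I ∞ M]

lemma lieDerivForm_smul {k : ℕ} {X : VField I M} {f : M → ℝ} {α : DForm I M (k + 1)} {x : M}
    (hX : FieldSmoothAt I X x) (hf : ContMDiffAt I 𝓘(ℝ, ℝ) ∞ f x) (hα : FormSmoothAt I α x)
    (hfX : dfun I f x (X x) = 0) (v : Fin (k + 1) → E) :
    lieDerivForm I X (fun y => f y • α y) x v = f x * lieDerivForm I X α x v := by
  rw [lieDerivForm_inChart hX (formSmoothAt_smul hf hα), lieDerivForm_inChart hX hα]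
  have hf' := (contMDiffAt_iff_inChart.1 hf).differentiableAt (by simp)
  have h1 : formInChart I (fun y => f y • α y) x
      = fun z => f ((extChartAt I x).symm z) • formInChart I α x z :=
    funext fun z => formInChart_smul f α x z
  have h2 : fderiv ℝ (fun u => f ((extChartAt I x).symm u)) (extChartAt I x x) (X x) = 0 := by
    rw [← dfun_eq hf]; exact hfX
  have h3 := fderiv_smul_form hf' (ContDiffAt.differentiableAt hα (by simp)) (X x)
  rw [h2, zero_smul, extChartAt_to_inv, zero_add] at h3
  rw [h1]
  have hS : ∀ g h : Fin (k + 1) → ℝ, (∀ i, g i = f x * h i) → ∑ i, g i = f x * ∑ i, h i :=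
    fun g h hgh => by rw [Finset.mul_sum]; exact Finset.sum_congr rfl fun i _ => hgh i
  refine (congrArg₂ (· + ·) (congrArg (fun θ => θ v) h3) (hS _ _ fun i => ?_)).trans
    (mul_add (f x) _ _).symm
  beta_reduce
  rw [extChartAt_to_inv]
  exact mul_left_comm _ _ _

end LieSmul

lemma finrank_E6 : Module.finrank ℝ E6 = 6 := by simp

section SixChart

variable {N : Type*} [TopologicalSpace N] [ChartedSpace E6 N] [IsManifold I6 ∞ N]
  (S : SU3Structure N)

lemma SU3Structure.metricSmoothAt (x : N) : MetricSmoothAt I6 S.h.inner x := S.h.contMDiff x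

lemma SU3Structure.exists_coframe_inChart {x : N} {z : E6} (hz : z ∈ (extChartAt I6 x).target) :
    ∃ e, IsSU3Coframe e (bilinInChart I6 S.h.inner x z) (formInChart I6 S.σ x z)
      (formInChart I6 S.ψp x z) (formInChart I6 S.ψm x z) := by
  obtain ⟨e, he⟩ := S.coframe ((extChartAt I6 x).symm z)
  obtain ⟨L, hL⟩ := isInvertible_mfderiv_extChartAt_symm (I := I6) hz
  exact ⟨_, he.comp (L := mfderiv 𝓘(ℝ, E6) I6 (extChartAt I6 x).symm z)
    (by rw [← hL]; exact L.surjective)⟩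

lemma SU3Structure.h_J_inChart {x : N} {z : E6} (hz : z ∈ (extChartAt I6 x).target) (a b : E6) :
    bilinInChart I6 S.h.inner x z (endoInChart I6 S.J x z a) b = formInChart I6 S.σ x z ![a,
      b] := by
  rw [bilinInChart_apply, mfderiv_endoInChart S.J hz, S.h_J]
  refine congrArg _ ?_
  funext i
  fin_cases i <;> rfl

lemma SU3Structure.psiPlus_J_inChart {x : N} {z : E6} (hz : z ∈ (extChartAt I6 x).target)
    (a b c : E6) :
    formInChart I6 S.ψp x z ![endoInChart I6 S.J x z a, b, c]
      = -formInChart I6 S.ψm x z ![a, b, c] := by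
  obtain ⟨e, he⟩ := S.exists_coframe_inChart hz
  exact he.psiPlus_J_left (S.h_J_inChart hz) a b c

lemma SU3Structure.psiMinus_J_inChart {x : N} {z : E6} (hz : z ∈ (extChartAt I6 x).target)
    (a b c : E6) :
    formInChart I6 S.ψm x z ![endoInChart I6 S.J x z a, b, c]
      = formInChart I6 S.ψp x z ![a, b, c] := by
  obtain ⟨e, he⟩ := S.exists_coframe_inChart hz
  exact he.psiMinus_J_left (S.h_J_inChart hz) a b c

lemma SU3Structure.J_J_inChart {x : N} {z : E6} (hz : z ∈ (extChartAt I6 x).target) (a : E6) :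
    endoInChart I6 S.J x z (endoInChart I6 S.J x z a) = -a := by
  obtain ⟨e, he⟩ := S.exists_coframe_inChart hz
  exact he.J_J finrank_E6 (S.h_J_inChart hz) a

lemma SU3Structure.differentiableAt_J (x : N) :
    DifferentiableAt ℝ (endoInChart I6 S.J x) (extChartAt I6 x x) :=
  (contDiffAt_endoInChart (S.smooth_J x)).differentiableAt (by simp)

/-- The vector field with constant coefficients `a` in the preferred chart at `x`. -/
noncomputable def coordField (x : N) (a : E6) : VField I6 N :=
  fun y => mfderiv 𝓘(ℝ, E6) I6 (extChartAt I6 x).symm (extChartAt I6 x y) a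

lemma fieldInChart_coordField {x : N} {z : E6} (hz : z ∈ (extChartAt I6 x).target) (a : E6) :
    fieldInChart (E := E6) I6 (coordField x a) x z = a := by
  refine eq_fieldInChart hz ?_
  have h : ∀ w : E6, w = z → (show E6 from mfderiv 𝓘(ℝ, E6) I6 (extChartAt I6 x).symm z a)
      = (show E6 from mfderiv 𝓘(ℝ, E6) I6 (extChartAt I6 x).symm w a) := by
    rintro _ rfl; rfl
  exact h _ ((extChartAt I6 x).right_inv hz)

lemma fieldInChart_coordField_eventuallyEq (x : N) (a : E6) :
    fieldInChart (E := E6) I6 (coordField x a) x =ᶠ[𝓝 (extChartAt I6 x x)] fun _ => a := by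
  filter_upwards [eventually_mem_target (I := I6) x] with z hz
  exact fieldInChart_coordField hz a

lemma fieldSmoothAt_coordField (x : N) (a : E6) : FieldSmoothAt I6 (coordField x a) x :=
  fieldSmoothAt_iff.2 (contDiffAt_const.congr_of_eventuallyEq
    (fieldInChart_coordField_eventuallyEq x a))

lemma coordField_self (x : N) (a : E6) : coordField x a x = a :=
  (fieldInChart_self (coordField x a) x).symm.trans
    (fieldInChart_coordField (mem_extChartAt_target x) a)

lemma SU3Structure.fieldInChart_J_coordField (x : N) (a : E6) :
    fieldInChart (E := E6) I6 (fun y => S.J y (coordField x a y)) x =ᶠ[𝓝 (extChartAt I6 x x)]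
      fun z => endoInChart I6 S.J x z a := by
  filter_upwards [eventually_mem_target (I := I6) x] with z hz
  rw [endoInChart_fieldInChart S.J _ hz, fieldInChart_coordField hz]

/-- The vanishing of the Nijenhuis tensor in the preferred chart at `x`. -/
lemma SU3Structure.IsKaehler.nijenhuis_inChart {S : SU3Structure N} (hS : S.IsKaehler) (x : N)
    (a b : E6) :
    fderiv ℝ (endoInChart I6 S.J x) (extChartAt I6 x x)
        (endoInChart I6 S.J x (extChartAt I6 x x) a) b
      - fderiv ℝ (endoInChart I6 S.J x) (extChartAt I6 x x)
        (endoInChart I6 S.J x (extChartAt I6 x x) b) a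
      + endoInChart I6 S.J x (extChartAt I6 x x)
        (fderiv ℝ (endoInChart I6 S.J x) (extChartAt I6 x x) b a)
      - endoInChart I6 S.J x (extChartAt I6 x x)
        (fderiv ℝ (endoInChart I6 S.J x) (extChartAt I6 x x) a b) = 0 := by
  have h := hS.2 x (coordField x a) (coordField x b) (fieldSmoothAt_coordField x a)
    (fieldSmoothAt_coordField x b)
  have hJ : ∀ c : E6, (show E6 from S.J x c) = endoInChart I6 S.J x (extChartAt I6 x x) c :=
    fun c => (endoInChart_self S.J x c).symm
  have hD : ∀ c w : E6, fderiv ℝ (fieldInChart (E := E6) I6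
      (fun y => S.J y (coordField x c y)) x) (extChartAt I6 x x) w
      = fderiv ℝ (endoInChart I6 S.J x) (extChartAt I6 x x) w c := by
    intro c w
    rw [(S.fieldInChart_J_coordField x c).fderiv_eq,
      fderiv_clm_apply (S.differentiableAt_J x) (differentiableAt_const c)]
    simp
  have hC : ∀ c w : E6, fderiv ℝ (fieldInChart (E := E6) I6 (coordField x c) x)
      (extChartAt I6 x x) w = 0 := by
    intro c w
    rw [(fieldInChart_coordField_eventuallyEq x c).fderiv_eq]
    simp
  have e1 : ∀ c : E6, (show E6 from S.J x (coordField x c x))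
      = endoInChart I6 S.J x (extChartAt I6 x x) c := fun c => by
    rw [← hJ]; exact congrArg (fun w => S.J x w) (coordField_self x c)
  have b1 : (show E6 from VectorField.mlieBracket I6 (fun y => S.J y (coordField x a y))
      (fun y => S.J y (coordField x b y)) x)
      = fderiv ℝ (endoInChart I6 S.J x) (extChartAt I6 x x)
        (endoInChart I6 S.J x (extChartAt I6 x x) a) b
      - fderiv ℝ (endoInChart I6 S.J x) (extChartAt I6 x x)
        (endoInChart I6 S.J x (extChartAt I6 x x) b) a := by
    rw [← hD, ← hD, ← e1, ← e1]
    exact mlieBracket_eq _ _ x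
  have b2 : (show E6 from VectorField.mlieBracket I6 (fun y => S.J y (coordField x a y))
      (coordField x b) x) = -fderiv ℝ (endoInChart I6 S.J x) (extChartAt I6 x x) b a := by
    refine (mlieBracket_eq _ _ x).trans ?_
    refine (congrArg₂ (· - ·) (hC b _) (hD a _)).trans ?_
    refine (zero_sub (G := E6) _).trans ?_
    exact congrArg (fun w : E6 => -(fderiv ℝ (endoInChart I6 S.J x) (extChartAt I6 x x) w) a)
      (coordField_self x b)
  have b3 : (show E6 from VectorField.mlieBracket I6 (coordField x a)
      (fun y => S.J y (coordField x b y)) x)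
      = fderiv ℝ (endoInChart I6 S.J x) (extChartAt I6 x x) a b := by
    refine (mlieBracket_eq _ _ x).trans ?_
    refine (congrArg₂ (· - ·) (hD b _) (hC a _)).trans ?_
    refine (sub_zero (G := E6) _).trans ?_
    exact congrArg (fun w : E6 => (fderiv ℝ (endoInChart I6 S.J x) (extChartAt I6 x x) w) b)
      (coordField_self x a)
  have b4 : (show E6 from VectorField.mlieBracket I6 (coordField x a) (coordField x b) x) = 0 := by
    refine (mlieBracket_eq _ _ x).trans ?_
    exact (congrArg₂ (· - ·) (hC b _) (hC a _)).trans (sub_zero (G := E6) _)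
  have h' : (show E6 from VectorField.mlieBracket I6 (fun y => S.J y (coordField x a y))
      (fun y => S.J y (coordField x b y)) x)
      - (show E6 →L[ℝ] E6 from S.J x) (show E6 from VectorField.mlieBracket I6
        (fun y => S.J y (coordField x a y)) (coordField x b) x)
      - (show E6 →L[ℝ] E6 from S.J x) (show E6 from VectorField.mlieBracket I6 (coordField x a)
      (fun y => S.J y (coordField x b y)) x)
      - (show E6 from VectorField.mlieBracket I6 (coordField x a) (coordField x b) x) = 0 := h
  rw [b1, b2, b3, b4] at h'
  have hJ' : ∀ c : E6, (show E6 →L[ℝ] E6 from S.J x) c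
      = endoInChart I6 S.J x (extChartAt I6 x x) c := hJ
  rw [hJ', hJ', map_neg] at h'
  rw [← h']
  abel

variable {S}

/-- On a Kähler manifold, if `f ψ⁻` is closed then so is `f ψ⁺`: they are the real and imaginary
parts of a form of type `(3, 0)`. -/
lemma SU3Structure.IsKaehler.extD_smul_psiPlus (hS : S.IsKaehler) {f : N → ℝ} {x : N}
    (hf : ContMDiffAt I6 𝓘(ℝ, ℝ) ∞ f x) (hd : extD I6 (fun y => f y • S.ψm y) x = 0) :
    extD I6 (fun y => f y • S.ψp y) x = 0 := by
  have : IsManifold I6 1 N := IsManifold.of_le (m := 1) (n := ∞) (by simp)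
  rw [extD_eq] at hd ⊢
  have hp : FormSmoothAt I6 (fun y => f y • S.ψp y) x := formSmoothAt_smul hf (S.smooth_ψp x)
  have hm : FormSmoothAt I6 (fun y => f y • S.ψm y) x := formSmoothAt_smul hf (S.smooth_ψm x)
  refine extDeriv_psiPlus_eq_zero (J := endoInChart I6 S.J x)
    (ContDiffAt.differentiableAt hp (by simp)) (ContDiffAt.differentiableAt hm (by simp))
    (S.differentiableAt_J x) ?_ ?_ ?_ (hS.nijenhuis_inChart x) hd
  · filter_upwards [eventually_mem_target (I := I6) x] with z hz a
    exact S.J_J_inChart hz a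
  · filter_upwards [eventually_mem_target (I := I6) x] with z hz a b c
    rw [formInChart_smul, formInChart_smul]
    show _ * formInChart I6 S.ψp x z ![endoInChart I6 S.J x z a, b, c]
      = -(_ * formInChart I6 S.ψm x z ![a, b, c])
    rw [S.psiPlus_J_inChart hz, mul_neg]
  · filter_upwards [eventually_mem_target (I := I6) x] with z hz a b c
    rw [formInChart_smul, formInChart_smul]
    show _ * formInChart I6 S.ψm x z ![endoInChart I6 S.J x z a, b, c]
      = (_ * formInChart I6 S.ψp x z ![a, b, c])
    rw [S.psiMinus_J_inChart hz]

/-- A vector field that preserves `σ` and `ψ⁺` preserves the whole `SU(3)` structure: these two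
forms determine `J`, hence `h` and `ψ⁻`. -/
lemma SU3Structure.isKillingAt_and_lie_psiMinus {U : VField I6 N} {x : N}
    (hU : FieldSmoothAt I6 U x) (hσ : lieDerivForm I6 U S.σ x = 0)
    (hψ : lieDerivForm I6 U S.ψp x = 0) :
    IsKillingAt I6 U S.h.inner x ∧ lieDerivForm I6 U S.ψm x = 0 := by
  set z₀ := extChartAt I6 x x with hz₀
  have hz : z₀ ∈ (extChartAt I6 x).target := mem_extChartAt_target x
  set A := fderiv ℝ (fieldInChart (E := E6) I6 U x) z₀ with hA
  set J := endoInChart I6 S.J x with hJdef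
  have hσd : DifferentiableAt ℝ (formInChart I6 S.σ x) z₀ :=
    ContDiffAt.differentiableAt (S.smooth_σ x) (by simp)
  have hpd : DifferentiableAt ℝ (formInChart I6 S.ψp x) z₀ :=
    ContDiffAt.differentiableAt (S.smooth_ψp x) (by simp)
  have hmd : DifferentiableAt ℝ (formInChart I6 S.ψm x) z₀ :=
    ContDiffAt.differentiableAt (S.smooth_ψm x) (by simp)
  have hJd : DifferentiableAt ℝ J z₀ := S.differentiableAt_J x
  have hLσ : ∀ a b : E6, fderiv ℝ (formInChart I6 S.σ x) z₀ (U x) ![a, b]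
      + formInChart I6 S.σ x z₀ ![A a, b] - formInChart I6 S.σ x z₀ ![A b, a] = 0 := by
    intro a b
    rw [← lieDerivForm_two_inChart hU (S.smooth_σ x), hσ]; rfl
  have hLψ : ∀ a b c : E6, fderiv ℝ (formInChart I6 S.ψp x) z₀ (U x) ![a, b, c]
      + formInChart I6 S.ψp x z₀ ![A a, b, c] - formInChart I6 S.ψp x z₀ ![A b, a, c]
      + formInChart I6 S.ψp x z₀ ![A c, a, b] = 0 := by
    intro a b c
    rw [← lieDerivForm_three_inChart hU (S.smooth_ψp x), hψ]; rfl
  have hev := eventually_mem_target (I := I6) x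
  obtain ⟨e, he⟩ := S.exists_coframe_inChart hz
  have hDJ : ∀ a, fderiv ℝ J z₀ (U x) a + J z₀ (A a) - A (J z₀ a) = 0 := by
    refine fun a => fderiv_J_of_preserves_psiPlus hpd hJd ?_ ?_
      (fun u hu => he.eq_zero_of_psiPlus finrank_E6 hu) (U x) A hLψ a
    · filter_upwards [hev] with z hz a using S.J_J_inChart hz a
    · filter_upwards [hev] with z hz a b c
      rw [hJdef, S.psiPlus_J_inChart hz, S.psiPlus_J_inChart hz, form_three_swap_left]
  have hDJ' : ∀ a, fderiv ℝ J z₀ (U x) a = A (J z₀ a) - J z₀ (A a) := fun a => by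
    have := hDJ a
    rw [← sub_eq_zero, ← this]; abel
  constructor
  · refine isKillingAt_of_inChart (S.metricSmoothAt x) fun a b => ?_
    -- The metric is preserved since `h(a, b) = -σ(Ja, b)`.
    have hk : (fun z => bilinInChart I6 S.h.inner x z a b) =ᶠ[𝓝 z₀]
        fun z => -formInChart I6 S.σ x z ![J z a, b] := by
      filter_upwards [hev] with z hz
      obtain ⟨e, he⟩ := S.exists_coframe_inChart hz
      exact he.h_eq finrank_E6 (S.h_J_inChart hz) a b
    have hkd := (metricSmoothAt_iff.1 (S.metricSmoothAt x)).differentiableAt (by simp)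
    have h1 : fderiv ℝ (bilinInChart I6 S.h.inner x) z₀ (U x) a b
        = fderiv ℝ (fun z => bilinInChart I6 S.h.inner x z a b) z₀ (U x) := by
      have h2 := (hkd.hasFDerivAt.clm_apply (hasFDerivAt_const a z₀)).clm_apply
        (hasFDerivAt_const b z₀)
      rw [h2.fderiv]
      simp
      rfl
    obtain ⟨d1, d2⟩ := hasFDerivAt_form_endo hσd hJd a ![b] (U x)
    have h3 : fderiv ℝ (fun z => -formInChart I6 S.σ x z ![J z a, b]) z₀ (U x)
        = -(fderiv ℝ (formInChart I6 S.σ x) z₀ (U x) ![J z₀ a, b]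
          + formInChart I6 S.σ x z₀ ![fderiv ℝ J z₀ (U x) a, b]) := by
      rw [← d2, fderiv_fun_neg]; rfl
    have hh : ∀ a b, bilinInChart I6 S.h.inner x z₀ a b = -formInChart I6 S.σ x z₀ ![J z₀ a, b] :=
      fun a b => he.h_eq finrank_E6 (S.h_J_inChart hz) a b
    have h4 : formInChart I6 S.σ x z₀ ![A (J z₀ a) - J z₀ (A a), b]
        = formInChart I6 S.σ x z₀ ![A (J z₀ a), b] - formInChart I6 S.σ x z₀ ![J z₀ (A a), b] :=
      form_vecCons_sub _ _ _ _
    have h5 := hLσ (J z₀ a) b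
    rw [form_swap_two _ (J z₀ a) (A b)] at h5
    rw [h1, hk.fderiv_eq, h3, hDJ', hh, hh, h4]
    linear_combination -h5
  · refine form_ext_iff_zero.2 fun v => ?_
    have hv : v = ![v 0, v 1, v 2] := by funext i; fin_cases i <;> rfl
    suffices key : ∀ a b c : E6, lieDerivForm I6 U S.ψm x ![a, b, c] = 0 by
      rw [hv]; exact key _ _ _
    intro a b c
    refine (lieDerivForm_three_inChart hU (S.smooth_ψm x) a b c).trans ?_
    -- The form `ψ⁻` is preserved since `ψ⁻(a, b, c) = -ψ⁺(Ja, b, c)`.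
    have hm : ∀ᶠ z in 𝓝 z₀, ∀ a b c, formInChart I6 S.ψm x z ![a, b, c]
        = -formInChart I6 S.ψp x z ![J z a, b, c] := by
      filter_upwards [hev] with z hz a b c
      rw [S.psiPlus_J_inChart hz, neg_neg]
    have hm0 := hm.self_of_nhds
    have hmid : ∀ a b c, formInChart I6 S.ψp x z₀ ![J z₀ a, b, c]
        = -formInChart I6 S.ψp x z₀ ![J z₀ b, a, c] := by
      intro a b c
      rw [hJdef, S.psiPlus_J_inChart hz, S.psiPlus_J_inChart hz, form_three_swap_left]
    have hmid3 : ∀ a b c, formInChart I6 S.ψp x z₀ ![J z₀ c, a, b]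
        = formInChart I6 S.ψp x z₀ ![c, J z₀ a, b] := by
      intro a b c
      rw [hmid, form_three_swap_left, neg_neg]
    obtain ⟨d1, d2⟩ := hasFDerivAt_form_endo hpd hJd a ![b, c] (U x)
    have h3 : fderiv ℝ (formInChart I6 S.ψm x) z₀ (U x) ![a, b, c]
        = -(fderiv ℝ (formInChart I6 S.ψp x) z₀ (U x) ![J z₀ a, b, c]
          + formInChart I6 S.ψp x z₀ ![fderiv ℝ J z₀ (U x) a, b, c]) := by
      have h6 : (fun z => formInChart I6 S.ψm x z ![a, b, c]) =ᶠ[𝓝 z₀]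
          fun z => -formInChart I6 S.ψp x z ![J z a, b, c] := by
        filter_upwards [hm] with z hz using hz a b c
      refine (fderiv_form_apply hmd ![a, b, c] (show E6 from U x)).symm.trans ?_
      rw [h6.fderiv_eq, ← d2, fderiv_fun_neg]; rfl
    have h4 : formInChart I6 S.ψp x z₀ ![A (J z₀ a) - J z₀ (A a), b, c]
        = formInChart I6 S.ψp x z₀ ![A (J z₀ a), b, c]
          - formInChart I6 S.ψp x z₀ ![J z₀ (A a), b, c] :=
      form_vecCons_sub _ _ _ _
    have h5 := hLψ (J z₀ a) b c
    rw [h3, hDJ', h4, hm0, hm0, hm0, hmid3 a c (A b), hmid3 a b (A c)]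
    linear_combination -h5

end SixChart

/-! ### Hamiltonian vector fields and the closedness form of the criterion -/

section Hamiltonian

variable {N : Type*} [TopologicalSpace N] [ChartedSpace E6 N] [IsManifold I6 ∞ N]
  (S : SU3Structure N)

/-- The vector field `X` with `ι_X σ = df`, chosen pointwise; it is unique since `σ` is
nondegenerate. -/
noncomputable def SU3Structure.hamField (f : N → ℝ) : VField I6 N := fun x =>
  ((S.coframe x).choose_spec.exists_sigma_eq finrank_E6 (dfun I6 f x)).choose

lemma SU3Structure.interiorProd_hamField (f : N → ℝ) (x : N) :
    interiorProd (S.hamField f x) (S.σ x) = oneForm (dfun I6 f x) :=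
  ((S.coframe x).choose_spec.exists_sigma_eq finrank_E6 (dfun I6 f x)).choose_spec

variable {S}

/-- A vector field is smooth as soon as its contraction with `σ` is: `σ` is invertible as a smooth
map from vectors to covectors, and inversion is smooth. -/
lemma SU3Structure.fieldSmoothAt_of_interiorProd {X : VField I6 N} {x : N}
    (h : FormSmoothAt I6 (fun y => interiorProd (X y) (S.σ y)) x) : FieldSmoothAt I6 X x := by
  rw [fieldSmoothAt_iff]
  set z₀ := extChartAt I6 x x with hz₀
  set B : E6 → E6 →L[ℝ] E6 →L[ℝ] ℝ := fun z =>
    (bilinInChart I6 S.h.inner x z).comp (endoInChart I6 S.J x z) with hB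
  have hBσ : ∀ z ∈ (extChartAt I6 x).target, ∀ a b, B z a b = formInChart I6 S.σ x z ![a, b] :=
    fun z hz a b => S.h_J_inChart hz a b
  have hBs : ContDiffAt ℝ ∞ B z₀ :=
    (metricSmoothAt_iff.1 (S.metricSmoothAt x)).clm_comp
      (contDiffAt_endoInChart (S.smooth_J.contMDiffAt))
  have hinv : ∀ z ∈ (extChartAt I6 x).target, ∃ e : E6 ≃L[ℝ] (E6 →L[ℝ] ℝ),
      (e : E6 →L[ℝ] E6 →L[ℝ] ℝ) = B z := by
    intro z hz
    obtain ⟨e, he⟩ := S.exists_coframe_inChart hz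
    refine ⟨ContinuousLinearEquiv.ofBijective (B z) ?_ ?_,
      ContinuousLinearEquiv.coe_ofBijective _ _ _⟩
    · rw [LinearMap.ker_eq_bot']
      intro u hu
      refine he.eq_zero_of_sigma finrank_E6 fun a => ?_
      rw [← hBσ z hz]
      exact congrArg (fun γ : E6 →L[ℝ] ℝ => γ a) hu
    · rw [LinearMap.range_eq_top]
      intro γ
      obtain ⟨u, hu⟩ := he.exists_sigma_eq finrank_E6 γ
      refine ⟨u, ContinuousLinearMap.ext fun a => ?_⟩
      refine (hBσ z hz u a).trans ?_
      have := congrArg (fun θ => θ ![a]) hu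
      simpa using this
  set γ : E6 → E6 →L[ℝ] ℝ := fun z =>
    (ContinuousAlternatingMap.ofSubsingleton ℝ E6 ℝ (0 : Fin 1)).symm
      (formInChart I6 (fun y => interiorProd (X y) (S.σ y)) x z) with hγ
  have hγs : ContDiffAt ℝ ∞ γ z₀ := by
    exact (ContinuousAlternatingMap.ofSubsingletonLIE (𝕜 := ℝ) (ι := Fin 1) (E := E6) (F := ℝ)
      (0 : Fin 1)).symm.toContinuousLinearEquiv.contDiff.contDiffAt.comp z₀ h
  have hX : fieldInChart (E := E6) I6 X x =ᶠ[𝓝 z₀] fun z => (B z).inverse (γ z) := by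
    filter_upwards [eventually_mem_target (I := I6) x] with z hz
    obtain ⟨e, he⟩ := hinv z hz
    rw [← he, ContinuousLinearMap.inverse_equiv]
    refine (e.symm_apply_eq.2 ?_).symm
    refine ContinuousLinearMap.ext fun a => ?_
    have h1 : γ z a = formInChart I6 (fun y => interiorProd (X y) (S.σ y)) x z ![a] := by
      rw [show (![a] : Fin 1 → E6) = Function.const (Fin 1) a from Matrix.vec_single_eq_const a]
      rfl
    have h2 : e (fieldInChart (E := E6) I6 X x z) = B z (fieldInChart (E := E6) I6 X x z) := by
      rw [← he]; rfl
    rw [h1, h2, hBσ z hz, formInChart_interiorProd X S.σ hz]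
    rfl
  refine ContDiffAt.congr_of_eventuallyEq ?_ hX
  obtain ⟨e, he⟩ := hinv z₀ (mem_extChartAt_target x)
  have h3 : ContDiffAt ℝ ∞ (ContinuousLinearMap.inverse : (E6 →L[ℝ] E6 →L[ℝ] ℝ) → _) (B z₀) := by
    rw [← he]; exact contDiffAt_map_inverse e
  exact (h3.comp z₀ hBs).clm_apply hγs

lemma SU3Structure.fieldSmoothAt_hamField {f : N → ℝ} {x : N}
    (hf : ∀ᶠ y in 𝓝 x, ContMDiffAt I6 𝓘(ℝ, ℝ) ∞ f y) : FieldSmoothAt I6 (S.hamField f) x := by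
  refine SU3Structure.fieldSmoothAt_of_interiorProd (S := S) ?_
  simp only [S.interiorProd_hamField]
  exact formSmoothAt_dfun hf

/-- A function is constant along its Hamiltonian vector field. -/
lemma dfun_apply_of_interiorProd_sigma {f : N → ℝ} {X : VField I6 N} {x : N}
    (h : interiorProd (X x) (S.σ x) = oneForm (dfun I6 f x)) : dfun I6 f x (X x) = 0 := by
  have h1 := congrArg (fun θ => θ ![X x]) h
  have h2 := form_swap_two (S.σ x) (X x) (X x)
  simp at h1
  linarith

/-- Hamiltonian vector fields preserve `σ`. -/
lemma lieDerivForm_sigma_of_hamiltonian (hσ : ∀ x, extD I6 S.σ x = 0) {f : N → ℝ}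
    {X : VField I6 N} {x : N} (hf : ∀ᶠ y in 𝓝 x, ContMDiffAt I6 𝓘(ℝ, ℝ) ∞ f y)
    (h : ∀ᶠ y in 𝓝 x, interiorProd (X y) (S.σ y) = oneForm (dfun I6 f y)) :
    lieDerivForm I6 X S.σ x = 0 := by
  have h1 : extD I6 (fun y => interiorProd (X y) (S.σ y)) x = 0 := by
    rw [extD_congr (I := I6) h, extD_dfun hf]
  show extD I6 (fun y => interiorProd (X y) (S.σ y)) x + interiorProd (X x) (extD I6 S.σ x) = 0
  rw [h1, hσ, zero_add]
  rfl

end Hamiltonian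

section Criterion

variable {N : Type*} [TopologicalSpace N] [ChartedSpace E6 N] [IsManifold I6 ∞ N]
  {S : SU3Structure N} {t : N → ℝ} {x : N}

lemma contMDiffAt_rpow (ht : ContMDiffAt I6 𝓘(ℝ, ℝ) ∞ t x) (hpos : 0 < t x) (r : ℝ) :
    ContMDiffAt I6 𝓘(ℝ, ℝ) ∞ (fun y => t y ^ r) x := by
  rw [contMDiffAt_iff_inChart] at ht ⊢
  refine ht.rpow_const_of_ne ?_
  rw [extChartAt_to_inv]
  exact hpos.ne'

/-- `d(t^r) = r t^r d(log t)`. -/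
lemma dfun_rpow (ht : ContMDiffAt I6 𝓘(ℝ, ℝ) ∞ t x) (hpos : 0 < t x) (r : ℝ) :
    dfun I6 (fun y => t y ^ r) x = (r * t x ^ r * (t x)⁻¹) • dfun I6 t x := by
  rw [dfun_comp (Real.hasDerivAt_rpow_const (Or.inl hpos.ne')) ht, Real.rpow_sub_one hpos.ne',
    div_eq_mul_inv, mul_assoc]

lemma dc_log (ht : ContMDiffAt I6 𝓘(ℝ, ℝ) ∞ t x) (hpos : 0 < t x) :
    S.dc (fun y => Real.log (t y)) x = (t x)⁻¹ • -((dfun I6 t x).comp (S.J x)) := by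
  unfold SU3Structure.dc
  rw [dfun_comp (Real.hasDerivAt_log hpos.ne') ht, ContinuousLinearMap.smul_comp, smul_neg]

lemma wedge_oneForm_smul {V : Type*} [AddCommGroup V] [Module ℝ V] [TopologicalSpace V] {k : ℕ}
    (c : ℝ) (γ : V →L[ℝ] ℝ) (α : V [⋀^Fin k]→L[ℝ] ℝ) :
    wedge (oneForm (c • γ)) α = c • wedge (oneForm γ) α := by
  rw [← wedge_smul_left]; rfl

lemma form_eq_zero_iff_of_apply {V : Type*} [AddCommGroup V] [Module ℝ V] [TopologicalSpace V]
    {k : ℕ} {α β : V [⋀^Fin k]→L[ℝ] ℝ} {c : ℝ} (hc : c ≠ 0) (h : ∀ v, α v = c * β v) :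
    α = 0 ↔ β = 0 := by
  rw [form_ext_iff_zero, form_ext_iff_zero]
  simp [h, hc]

/-- The first structure equation says that `t^{1/2} ψ⁺` is closed. -/
lemma extD_psiPlus_iff (ht : ContMDiffAt I6 𝓘(ℝ, ℝ) ∞ t x) (hpos : 0 < t x) :
    extD I6 (fun y => t y ^ (1 / 2 : ℝ) • S.ψp y) x = 0 ↔
      extD I6 S.ψp x =
        -((1 / 2 : ℝ) • wedge (oneForm (S.dc (fun y => Real.log (t y)) x)) (S.ψm x)) := by
  obtain ⟨e, he⟩ := S.coframe x
  have h1 := he.wedge_psiPlus finrank_E6 (S.h_J x) (dfun I6 t x)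
  rw [eq_neg_iff_add_eq_zero]
  have hr : (t x ^ (1 / 2 : ℝ)) ≠ 0 := (Real.rpow_pos_of_pos hpos _).ne'
  refine form_eq_zero_iff_of_apply hr fun v => ?_
  rw [extD_smul_three (contMDiffAt_rpow ht hpos _) (S.smooth_ψp x), dfun_rpow ht hpos,
    dc_log ht hpos, wedge_oneForm_smul, wedge_oneForm_smul]
  refine (congrArg₂ (· + ·) (congrArg (fun θ : E6 [⋀^Fin (1 + 3)]→L[ℝ] ℝ =>
    _ * θ (show Fin (1 + 3) → E6 from v)) h1) rfl).trans ?_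
  have alg : ∀ r s a b : ℝ, 1 / 2 * r * s * a + r * b = r * (b + 1 / 2 * (s * a)) :=
    fun _ _ _ _ => by ring
  exact alg _ _ _ _

/-- The second structure equation says that `t^{1/2} ψ⁻` is closed. -/
lemma extD_psiMinus_iff (ht : ContMDiffAt I6 𝓘(ℝ, ℝ) ∞ t x) (hpos : 0 < t x) :
    extD I6 (fun y => t y ^ (1 / 2 : ℝ) • S.ψm y) x = 0 ↔
      extD I6 S.ψm x =
        (1 / 2 : ℝ) • wedge (oneForm (S.dc (fun y => Real.log (t y)) x)) (S.ψp x) := by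
  obtain ⟨e, he⟩ := S.coframe x
  have h1 := he.wedge_psiMinus finrank_E6 (S.h_J x) (dfun I6 t x)
  rw [← sub_eq_zero (a := extD I6 S.ψm x)]
  have hr : (t x ^ (1 / 2 : ℝ)) ≠ 0 := (Real.rpow_pos_of_pos hpos _).ne'
  refine form_eq_zero_iff_of_apply hr fun v => ?_
  rw [extD_smul_three (contMDiffAt_rpow ht hpos _) (S.smooth_ψm x), dfun_rpow ht hpos,
    dc_log ht hpos, wedge_oneForm_smul, wedge_oneForm_smul]
  refine (congrArg₂ (· + ·) (congrArg (fun θ : E6 [⋀^Fin (1 + 3)]→L[ℝ] ℝ =>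
    _ * θ (show Fin (1 + 3) → E6 from v)) h1) rfl).trans ?_
  have alg : ∀ r s a b : ℝ, 1 / 2 * r * s * -a + r * b = r * (b - 1 / 2 * (s * a)) :=
    fun _ _ _ _ => by ring
  exact alg _ _ _ _

/-- If `t^{1/2} ψ⁺` is closed, the Hamiltonian vector field of `-t` preserves `ψ⁺` precisely when
`t^{1/2} ι_U ψ⁺` is closed. -/
lemma lieDerivForm_psiPlus_iff {U : VField I6 N} (ht : ContMDiffAt I6 𝓘(ℝ, ℝ) ∞ t x)
    (hpos : 0 < t x) (hU : FieldSmoothAt I6 U x) (hUt : dfun I6 t x (U x) = 0)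
    (hd : extD I6 (fun y => t y ^ (1 / 2 : ℝ) • S.ψp y) x = 0) :
    extD I6 (fun y => t y ^ (1 / 2 : ℝ) • interiorProd (U y) (S.ψp y)) x = 0 ↔
      lieDerivForm I6 U S.ψp x = 0 := by
  have hr : (t x ^ (1 / 2 : ℝ)) ≠ 0 := (Real.rpow_pos_of_pos hpos _).ne'
  refine form_eq_zero_iff_of_apply hr fun v => ?_
  have h0 : dfun I6 (fun y => t y ^ (1 / 2 : ℝ)) x (U x) = 0 := by
    rw [dfun_rpow ht hpos]
    exact mul_eq_zero_of_right _ hUt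
  have h1 := lieDerivForm_smul hU (contMDiffAt_rpow ht hpos (1 / 2)) (S.smooth_ψp x) h0 v
  rw [← h1]
  show _ = extD I6 (fun y => interiorProd (U y) (t y ^ (1 / 2 : ℝ) • S.ψp y)) x v
    + interiorProd (U x) (extD I6 (fun y => t y ^ (1 / 2 : ℝ) • S.ψp y) x) v
  rw [hd]
  exact (add_zero _).symm

/-- The criterion for `t` and the Hamiltonian vector field of `-t` follows from the closedness of
`t^{1/2} ψ⁻` and `t^{1/2} ι_U ψ⁺`. -/
lemma SU3Structure.IsKaehler.criterionOn (hS : S.IsKaehler) {W : Set N} (hW : IsOpen W)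
    (ht : ContMDiffOn I6 𝓘(ℝ, ℝ) ∞ t W) (hpos : ∀ x ∈ W, 0 < t x)
    (hm : ∀ x ∈ W, extD I6 (fun y => t y ^ (1 / 2 : ℝ) • S.ψm y) x = 0)
    (hU : ∀ x ∈ W, extD I6 (fun y => t y ^ (1 / 2 : ℝ) •
      interiorProd (S.hamField (fun y => -t y) y) (S.ψp y)) x = 0) :
    S.CriterionOn W t (S.hamField fun y => -t y) := by
  have hta : ∀ x ∈ W, ContMDiffAt I6 𝓘(ℝ, ℝ) ∞ t x := fun x hx =>
    ht.contMDiffAt (hW.mem_nhds hx)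
  have hnt : ∀ x ∈ W, ∀ᶠ y in 𝓝 x, ContMDiffAt I6 𝓘(ℝ, ℝ) ∞ (fun y => -t y) y := fun x hx => by
    filter_upwards [hW.mem_nhds hx] with y hy using (hta y hy).neg
  have hp : ∀ x ∈ W, extD I6 (fun y => t y ^ (1 / 2 : ℝ) • S.ψp y) x = 0 := fun x hx =>
    hS.extD_smul_psiPlus (contMDiffAt_rpow (hta x hx) (hpos x hx) _) (hm x hx)
  have hXs : ∀ x ∈ W, FieldSmoothAt I6 (S.hamField fun y => -t y) x := fun x hx =>
    SU3Structure.fieldSmoothAt_hamField (hnt x hx)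
  refine ⟨ht, hpos, fun x hx => (extD_psiPlus_iff (hta x hx) (hpos x hx)).1 (hp x hx),
    fun x hx => (extD_psiMinus_iff (hta x hx) (hpos x hx)).1 (hm x hx),
    fun x hx => ⟨hXs x hx, S.interiorProd_hamField _ x⟩, fun x hx => ?_⟩
  have hUt : dfun I6 t x (S.hamField (fun y => -t y) x) = 0 := by
    have h1 := dfun_apply_of_interiorProd_sigma (S.interiorProd_hamField (fun y => -t y) x)
    have h2 : dfun I6 (fun y => -t y) x = (-1 : ℝ) • dfun I6 t x :=
      dfun_comp (hasDerivAt_neg (t x)) (hta x hx)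
    rw [h2] at h1
    exact neg_eq_zero.1 ((neg_one_mul _).symm.trans h1)
  have hψ : lieDerivForm I6 (S.hamField fun y => -t y) S.ψp x = 0 :=
    (lieDerivForm_psiPlus_iff (hta x hx) (hpos x hx) (hXs x hx) hUt (hp x hx)).1 (hU x hx)
  have hσ : lieDerivForm I6 (S.hamField fun y => -t y) S.σ x = 0 :=
    lieDerivForm_sigma_of_hamiltonian hS.1 (hnt x hx)
      (Filter.Eventually.of_forall fun y => S.interiorProd_hamField _ y)
  obtain ⟨h1, h2⟩ := S.isKillingAt_and_lie_psiMinus (hXs x hx) hσ hψ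
  exact ⟨h1, hσ, hψ, h2⟩

namespace SU3Structure.CriterionOn

variable {W : Set N} {U : VField I6 N}

lemma contMDiffAt (h : S.CriterionOn W t U) (hW : IsOpen W) (hx : x ∈ W) :
    ContMDiffAt I6 𝓘(ℝ, ℝ) ∞ t x :=
  h.smooth.contMDiffAt (hW.mem_nhds hx)

lemma interiorProd_sigma (h : S.CriterionOn W t U) (hW : IsOpen W) (hx : x ∈ W) :
    interiorProd (U x) (S.σ x) = -oneForm (dfun I6 t x) := by
  have h2 : dfun I6 (fun y => -t y) x = (-1 : ℝ) • dfun I6 t x :=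
    dfun_comp (hasDerivAt_neg (t x)) (h.contMDiffAt hW hx)
  rw [(h.hamiltonian x hx).2, h2, ← neg_one_smul ℝ (oneForm (dfun I6 t x))]
  rfl

lemma dfun_apply (h : S.CriterionOn W t U) (hW : IsOpen W) (hx : x ∈ W) :
    dfun I6 t x (U x) = 0 := by
  have h1 := congrArg (fun θ => θ ![U x]) (h.interiorProd_sigma hW hx)
  have h2 := form_swap_two (S.σ x) (U x) (U x)
  simp at h1
  linarith

lemma extD_psiPlus (h : S.CriterionOn W t U) (hW : IsOpen W) (hx : x ∈ W) :
    extD I6 (fun y => t y ^ (1 / 2 : ℝ) • S.ψp y) x = 0 :=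
  (extD_psiPlus_iff (h.contMDiffAt hW hx) (h.pos x hx)).2 (h.d_ψp x hx)

lemma extD_psiMinus (h : S.CriterionOn W t U) (hW : IsOpen W) (hx : x ∈ W) :
    extD I6 (fun y => t y ^ (1 / 2 : ℝ) • S.ψm y) x = 0 :=
  (extD_psiMinus_iff (h.contMDiffAt hW hx) (h.pos x hx)).2 (h.d_ψm x hx)

lemma extD_interiorProd (h : S.CriterionOn W t U) (hW : IsOpen W) (hx : x ∈ W) :
    extD I6 (fun y => t y ^ (1 / 2 : ℝ) • interiorProd (U y) (S.ψp y)) x = 0 :=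
  (lieDerivForm_psiPlus_iff (h.contMDiffAt hW hx) (h.pos x hx) (h.hamiltonian x hx).1
    (h.dfun_apply hW hx) (h.extD_psiPlus hW hx)).2 (h.isometry x hx).2.2.1

end SU3Structure.CriterionOn

end Criterion

/-! ### The coframe of the total space and the structure equations -/

section Contraction

variable {T : Type*} [AddCommGroup T] [Module ℝ T] [TopologicalSpace T]
  {E : Type*} [AddCommGroup E] [Module ℝ E] [TopologicalSpace E]

lemma interiorProd_zero_left {k : ℕ} (α : E [⋀^Fin (k + 1)]→L[ℝ] ℝ) : interiorProd 0 α = 0 :=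
  ContinuousAlternatingMap.ext fun _ => α.map_coord_zero 0 rfl

lemma interiorProd_comp_eq_zero {k : ℕ} (α : E [⋀^Fin (k + 1)]→L[ℝ] ℝ) {p : T →L[ℝ] E} {X : T}
    (hX : p X = 0) : interiorProd X (α.compContinuousLinearMap p) = 0 := by
  rw [interiorProd_comp, hX, interiorProd_zero_left]
  rfl

lemma interiorProd_add_right {k : ℕ} (X : T) (α β : T [⋀^Fin (k + 1)]→L[ℝ] ℝ) :
    interiorProd X (α + β) = interiorProd X α + interiorProd X β := rfl

lemma interiorProd_smul_right {k : ℕ} (X : T) (c : ℝ) (α : T [⋀^Fin (k + 1)]→L[ℝ] ℝ) :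
    interiorProd X (c • α) = c • interiorProd X α := rfl

/-- `ι_X(α ∧ γ) = α` if `ι_X α = 0` and `γ(X) = 1`. -/
lemma interiorProd_wedge_two_one {α : T [⋀^Fin 2]→L[ℝ] ℝ} {γ : T [⋀^Fin 1]→L[ℝ] ℝ} {X : T}
    (hα : interiorProd (k := 1) X α = 0) (hγ : γ ![X] = 1) :
    interiorProd (k := 2) X (wedge α γ) = α := by
  have h : ∀ a, α ![X, a] = 0 := fun a => by
    have := congrArg (fun θ => θ ![a]) hα
    simpa [interiorProd_two_apply] using this
  ext v
  refine (interiorProd_three_apply X (wedge α γ) v).trans ?_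
  refine (wedge_two_one α γ _).trans ?_
  have hv : ![v 0, v 1] = v := by funext i; fin_cases i <;> rfl
  simp only [Matrix.cons_val]
  rw [h, h, hγ, hv]
  ring

/-- `ι_X(α ∧ γ) = -α` if `ι_X α = 0` and `γ(X) = 1`. -/
lemma interiorProd_wedge_three_one {α : T [⋀^Fin 3]→L[ℝ] ℝ} {γ : T [⋀^Fin 1]→L[ℝ] ℝ} {X : T}
    (hα : interiorProd (k := 2) X α = 0) (hγ : γ ![X] = 1) :
    interiorProd (k := 3) X (wedge α γ) = -α := by
  have h : ∀ a b, α ![X, a, b] = 0 := fun a b => by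
    have := congrArg (fun θ => θ ![a, b]) hα
    simpa [interiorProd_three_apply] using this
  ext v
  refine (interiorProd_four_apply X (wedge α γ) v).trans ?_
  refine (wedge_three_one α γ _).trans ?_
  have hv : ![v 0, v 1, v 2] = v := by funext i; fin_cases i <;> rfl
  simp only [Matrix.cons_val]
  rw [h, h, h, hγ, hv]
  show _ = -α v
  ring

lemma interiorProd_wedge_two_two {α β : T [⋀^Fin 2]→L[ℝ] ℝ} {X : T}
    (hα : interiorProd (k := 1) X α = 0) (hβ : interiorProd (k := 1) X β = 0) :
    interiorProd (k := 3) X (wedge (p := 2) (q := 2) α β) = 0 := by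
  have h : ∀ a, α ![X, a] = 0 := fun a => by
    have := congrArg (fun θ => θ ![a]) hα
    simpa [interiorProd_two_apply] using this
  have h' : ∀ a, β ![X, a] = 0 := fun a => by
    have := congrArg (fun θ => θ ![a]) hβ
    simpa [interiorProd_two_apply] using this
  ext v
  refine (interiorProd_four_apply X (wedge α β) v).trans ?_
  refine (wedge_two_two α β _).trans ?_
  simp only [Matrix.cons_val]
  rw [h, h, h, h', h', h']
  show _ = (0 : ℝ)
  ring

end Contraction

section CoframeExtension

variable {T : Type*} [AddCommGroup T] [Module ℝ T] [TopologicalSpace T]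
  {E : Type*} [AddCommGroup E] [Module ℝ E] [TopologicalSpace E]

lemma oneForm_smul (c : ℝ) (γ : T →L[ℝ] ℝ) : oneForm (c • γ) = c • oneForm γ := rfl

lemma stdSigma_smul (c : ℝ) (e : Fin 6 → (T →L[ℝ] ℝ)) :
    stdSigma (fun i => c • e i) = c ^ 2 • stdSigma e := by
  simp only [stdSigma, oneForm_smul, wedge_smul_left, wedge_smul_right, smul_add, smul_smul, sq]

lemma wedge₃_smul (c : ℝ) (a b d : T →L[ℝ] ℝ) :
    wedge₃ (c • a) (c • b) (c • d) = c ^ 3 • wedge₃ a b d := by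
  simp only [wedge₃, oneForm_smul, wedge_smul_left, wedge_smul_right, smul_smul]
  congr 1
  ring

lemma stdPsiPlus_smul (c : ℝ) (e : Fin 6 → (T →L[ℝ] ℝ)) :
    stdPsiPlus (fun i => c • e i) = c ^ 3 • stdPsiPlus e := by
  simp only [stdPsiPlus, wedge₃_smul, smul_sub]

lemma stdPsiMinus_smul (c : ℝ) (e : Fin 6 → (T →L[ℝ] ℝ)) :
    stdPsiMinus (fun i => c • e i) = c ^ 3 • stdPsiMinus e := by
  simp only [stdPsiMinus, wedge₃_smul, smul_sub, smul_add]

/-- The coframe `t^{1/2} e₁, …, t^{1/2} e₆, t⁻¹ γ`, where `γ` is a covector on the total space of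
a projection `p`, is adapted to the `G₂` structure with `k = t h + t⁻² γ ⊗ γ`,
`φ = σ ∧ γ + t^{3/2} ψ⁺` and `*φ = t^{1/2} ψ⁻ ∧ γ + ½ t² σ ∧ σ`. -/
lemma IsSU3Coframe.exists_isG2Coframe {e : Fin 6 → (E →L[ℝ] ℝ)} {h : E →L[ℝ] E →L[ℝ] ℝ}
    {σ : E [⋀^Fin 2]→L[ℝ] ℝ} {ψp ψm : E [⋀^Fin 3]→L[ℝ] ℝ} (he : IsSU3Coframe e h σ ψp ψm)
    {p : T →L[ℝ] E} (hp : Function.Surjective p) {γ : T →L[ℝ] ℝ} {X : T} (hX : p X = 0)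
    (hγ : γ X = 1) {t : ℝ} (ht : 0 < t) :
    ∃ e' : Fin 7 → (T →L[ℝ] ℝ), IsG2Coframe e'
      (t • pullbackBilin h p + (t ^ 2)⁻¹ • sqCovector γ)
      (wedge (σ.compContinuousLinearMap p) (oneForm γ)
        + t ^ (3 / 2 : ℝ) • ψp.compContinuousLinearMap p)
      (t ^ (1 / 2 : ℝ) • wedge (ψm.compContinuousLinearMap p) (oneForm γ)
        + (1 / 2 * t ^ 2 : ℝ) •
          wedge (σ.compContinuousLinearMap p) (σ.compContinuousLinearMap p)) := by
  obtain ⟨hl, hh, hσ, hψp, hψm⟩ := he.comp hp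
  set c : ℝ := t ^ (1 / 2 : ℝ) with hc
  have hc0 : 0 < c := Real.rpow_pos_of_pos ht _
  have hc2 : c ^ 2 = t := by
    rw [hc, ← Real.rpow_natCast, ← Real.rpow_mul ht.le]; norm_num
  have hc3 : c ^ 3 = t ^ (3 / 2 : ℝ) := by
    rw [hc, ← Real.rpow_natCast, ← Real.rpow_mul ht.le]; norm_num
  set e₀ : Fin 6 → (T →L[ℝ] ℝ) := fun i => (e i).comp p with he₀
  set e' : Fin 7 → (T →L[ℝ] ℝ) := Fin.snoc (α := fun _ => T →L[ℝ] ℝ) (fun i => c • e₀ i)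
    (t⁻¹ • γ) with he'
  have hcast : (fun i : Fin 6 => e' i.castSucc) = fun i => c • e₀ i := by
    funext i; rw [he', Fin.snoc_castSucc]
  have hlast : e' 6 = t⁻¹ • γ := by
    rw [show (6 : Fin 7) = Fin.last 6 from rfl, he', Fin.snoc_last]
  refine ⟨e', ?_, fun u v => ?_, ?_, ?_⟩
  · rw [he', linearIndependent_finSnoc]
    refine ⟨hl.units_smul fun _ => Units.mk0 c hc0.ne', fun hmem => ?_⟩
    have hker : Submodule.span ℝ (range fun i => c • e₀ i) ≤
        LinearMap.ker ((ContinuousLinearMap.coeLMₛₗ (RingHom.id ℝ)).flip X :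
          (T →L[ℝ] ℝ) →ₗ[ℝ] ℝ) := by
      rw [Submodule.span_le]
      rintro _ ⟨i, rfl⟩
      show c * e i (p X) = 0
      rw [hX, map_zero, mul_zero]
    have h1 : t⁻¹ * γ X = 0 := hker hmem
    rw [hγ, mul_one] at h1
    exact inv_ne_zero ht.ne' h1
  · rw [Fin.sum_univ_castSucc]
    have h1 : ∀ i : Fin 6, e' i.castSucc u * e' i.castSucc v = t * (e₀ i u * e₀ i v) := by
      intro i
      rw [congrFun hcast i, ← hc2]
      show c * e₀ i u * (c * e₀ i v) = _
      ring
    have h2 : e' (Fin.last 6) = t⁻¹ • γ := hlast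
    rw [Finset.sum_congr rfl fun i _ => h1 i, ← Finset.mul_sum, ← hh, h2]
    show t * pullbackBilin h p u v + (t ^ 2)⁻¹ * (γ u * γ v) = _ + t⁻¹ * γ u * (t⁻¹ * γ v)
    field_simp
  · rw [hcast, hlast, stdSigma_smul, stdPsiPlus_smul, hc2, hc3, ← hσ, ← hψp, oneForm_smul,
      wedge_smul_left, wedge_smul_right, smul_smul, mul_inv_cancel₀ ht.ne', one_smul]
  · rw [hcast, hlast, stdSigma_smul, stdPsiMinus_smul, hc2, ← hσ, ← hψm, oneForm_smul,
      wedge_smul_left, wedge_smul_right, wedge_smul_left, wedge_smul_right, smul_smul, smul_smul,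
      smul_smul, show c ^ 3 * t⁻¹ = c by rw [pow_succ, hc2]; field_simp]
    congr 2
    ring

end CoframeExtension

section StructureEquations

variable {N : Type*} [TopologicalSpace N] [ChartedSpace E6 N] [IsManifold I6 ∞ N]
  {S : SU3Structure N} {t : N → ℝ} {x : N}

/-- If `t^{1/2} ψ⁺` is closed and `ι_U σ = -dt`, then
`d(t^{3/2} ψ⁺) = t^{1/2} dt ∧ ψ⁺ = t^{1/2} σ ∧ ι_U ψ⁺`. -/
lemma extD_rpow_smul_psiPlus {U : VField I6 N} (ht : ContMDiffAt I6 𝓘(ℝ, ℝ) ∞ t x)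
    (hpos : ∀ᶠ y in 𝓝 x, 0 < t y)
    (hd : extD I6 (fun y => t y ^ (1 / 2 : ℝ) • S.ψp y) x = 0)
    (hU : interiorProd (k := 1) (U x) (S.σ x) = -oneForm (dfun I6 t x))
    (v : Fin 4 → TangentSpace I6 x) :
    extD I6 (fun y => t y ^ (3 / 2 : ℝ) • S.ψp y) x v
      = t x ^ (1 / 2 : ℝ) * wedge (S.σ x) (interiorProd (k := 2) (U x) (S.ψp x)) v := by
  obtain ⟨e, he⟩ := S.coframe x
  have h1 : ∀ᶠ y in 𝓝 x, t y ^ (3 / 2 : ℝ) • S.ψp y = t y • (t y ^ (1 / 2 : ℝ) • S.ψp y) := by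
    filter_upwards [hpos] with y hy
    rw [smul_smul, ← Real.rpow_one_add' hy.le (by norm_num)]
    norm_num
  have h2 : FormSmoothAt I6 (fun y => t y ^ (1 / 2 : ℝ) • S.ψp y) x :=
    formSmoothAt_smul (contMDiffAt_rpow ht hpos.self_of_nhds _) (S.smooth_ψp x)
  rw [extD_congr (I := I6) h1, extD_smul_three ht h2, hd, he.sigma_wedge_interior_psiPlus, hU,
    wedge_smul_right, ← neg_one_smul ℝ (oneForm (dfun I6 t x)), wedge_smul_left]
  have alg : ∀ r a b : ℝ, b = 0 → r * a + b = r * -(-1 * a) := by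
    intro r a b hb; rw [hb]; ring
  exact alg _ _ _ (mul_zero _)

set_option maxRecDepth 4000 in
/-- If `ι_U σ = -dt` then `t^{1/2} ψ⁻ ∧ t^{1/2} ι_U ψ⁺ = -d(½ t² σ ∧ σ)`. -/
lemma extD_sq_smul_sigma_sigma (hσ : extD I6 S.σ x = 0) {U : VField I6 N}
    (ht : ContMDiffAt I6 𝓘(ℝ, ℝ) ∞ t x) (hpos : 0 < t x)
    (hU : interiorProd (k := 1) (U x) (S.σ x) = -oneForm (dfun I6 t x))
    (v : Fin 5 → TangentSpace I6 x) :
    extD I6 (fun y => (1 / 2 * t y ^ 2 : ℝ) • wedge (S.σ y) (S.σ y)) x v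
      = -wedge (t x ^ (1 / 2 : ℝ) • S.ψm x)
        (t x ^ (1 / 2 : ℝ) • interiorProd (k := 2) (U x) (S.ψp x)) v := by
  obtain ⟨e, he⟩ := S.coframe x
  have h1 : HasDerivAt (fun s : ℝ => 1 / 2 * s ^ 2) (t x) (t x) := by
    exact ((hasDerivAt_pow 2 (t x)).const_mul (1 / 2 : ℝ)).congr_deriv
      (by norm_num; ring)
  have h2 : ContMDiffAt I6 𝓘(ℝ, ℝ) ∞ (fun y => 1 / 2 * t y ^ 2) x := by
    rw [contMDiffAt_iff_inChart] at ht ⊢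
    exact contDiffAt_const.mul (ht.pow 2)
  have h3 : t x ^ (1 / 2 : ℝ) * t x ^ (1 / 2 : ℝ) = t x := by
    rw [← Real.rpow_add hpos]; norm_num
  have h4 : wedge (S.ψm x) (interiorProd (k := 2) (U x) (S.ψp x))
      = (-1 : ℝ) • wedge (p := 4) (wedge (S.σ x) (S.σ x)) (oneForm (dfun I6 t x)) := by
    refine (he.psiMinus_wedge_interior_psiPlus finrank_E6 (U x)).trans ?_
    exact (congrArg (wedge (p := 4) (q := 1) (wedge (S.σ x) (S.σ x)))
      (hU.trans (neg_one_smul ℝ _).symm)).trans (wedge_smul_right _ _ _)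
  have h5 : wedge (t x ^ (1 / 2 : ℝ) • S.ψm x)
      (t x ^ (1 / 2 : ℝ) • interiorProd (k := 2) (U x) (S.ψp x))
      = t x • wedge (S.ψm x) (interiorProd (k := 2) (U x) (S.ψp x)) := by
    rw [wedge_smul_left, wedge_smul_right, smul_smul, h3]
  rw [h5, h4]
  refine (extD_smul_four h2 (formSmoothAt_wedge (S.smooth_σ x) (S.smooth_σ x)) v).trans ?_
  rw [extD_wedge_self_of_closed (S.smooth_σ x) hσ, dfun_comp h1 ht, oneForm_smul]
  refine (congrArg₂ (· + ·) (congrArg (fun θ : E6 [⋀^Fin (4 + 1)]→L[ℝ] ℝ =>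
    θ (show Fin (4 + 1) → E6 from v)) (wedge_smul_right _ _ _)) (mul_zero _)).trans ?_
  have alg : ∀ r a : ℝ, r * a + 0 = -(r * (-1 * a)) := fun _ _ => by ring
  exact alg _ _

end StructureEquations

/-! ### The explicit metric on `ℝ × N` -/

section SmoothScalar

lemma contDiffAt_real_smul {X F : Type*} [NormedAddCommGroup X] [NormedSpace ℝ X]
    [NormedAddCommGroup F] [NormedSpace ℝ F] {n : WithTop ℕ∞} {f : X → ℝ} {g : X → F} {x : X}
    (hf : ContDiffAt ℝ n f x) (hg : ContDiffAt ℝ n g x) :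
    ContDiffAt ℝ n (fun y => f y • g y) x := hf.smul hg

end SmoothScalar

section ProductChart

set_option linter.unusedSectionVars false

variable {N : Type*} [TopologicalSpace N] [ChartedSpace E6 N] [IsManifold I6 ∞ N]

lemma extChartAt_prod_symm_eq (y : ℝ × N) :
    ((extChartAt I7 y).symm : ℝ × E6 → ℝ × N) = fun z => (z.1, (extChartAt I6 y.2).symm z.2) := by
  funext z
  rw [extChartAt_prod]
  rfl

lemma mem_target_snd {y : ℝ × N} {z : ℝ × E6} (hz : z ∈ (extChartAt I7 y).target) :
    z.2 ∈ (extChartAt I6 y.2).target := by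
  rw [extChartAt_prod] at hz
  exact hz.2

lemma mfderiv_extChartAt_prod_symm {y : ℝ × N} {z : ℝ × E6} (hz : z ∈ (extChartAt I7 y).target)
    (w : ℝ × E6) :
    (mfderiv 𝓘(ℝ, ℝ × E6) I7 (extChartAt I7 y).symm z w : ℝ × E6)
      = (w.1, (mfderiv 𝓘(ℝ, E6) I6 (extChartAt I6 y.2).symm z.2 w.2 : E6)) := by
  have : IsManifold I6 1 N := IsManifold.of_le (m := 1) (n := ∞) (by simp)
  have h1 : HasMFDerivAt 𝓘(ℝ, ℝ × E6) 𝓘(ℝ, ℝ) (fun z : ℝ × E6 => z.1) z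
      (ContinuousLinearMap.fst ℝ ℝ E6) := hasFDerivAt_fst.hasMFDerivAt
  have h2 : HasMFDerivAt 𝓘(ℝ, ℝ × E6) 𝓘(ℝ, E6) (fun z : ℝ × E6 => z.2) z
      (ContinuousLinearMap.snd ℝ ℝ E6) := hasFDerivAt_snd.hasMFDerivAt
  have h3 := (mdifferentiableAt_extChartAt_symm (I := I6) (mem_target_snd hz)).hasMFDerivAt
  have h4 := h1.prodMk (h3.comp z h2)
  have h5 : (show (ℝ × E6) →L[ℝ] (ℝ × E6) from
      mfderiv 𝓘(ℝ, ℝ × E6) I7 (extChartAt I7 y).symm z)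
      = mfderiv 𝓘(ℝ, ℝ × E6) I7 (fun z : ℝ × E6 => (z.1, (extChartAt I6 y.2).symm z.2)) z := by
    rw [extChartAt_prod_symm_eq]
  exact congrArg (fun L : (ℝ × E6) →L[ℝ] (ℝ × E6) => L w) (h5.trans h4.mfderiv)

lemma mfderiv_snd_apply (y : ℝ × N) (w : ℝ × E6) :
    (mfderiv I7 I6 (Prod.snd : ℝ × N → N) y w : E6) = w.2 := by
  rw [mfderiv_snd]
  rfl

lemma dfun_fst_apply (y : ℝ × N) (w : ℝ × E6) :
    dfun I7 (fun z : ℝ × N => z.1) y w = w.1 := by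
  unfold dfun
  rw [show (fun z : ℝ × N => z.1) = Prod.fst from rfl, mfderiv_fst]
  rfl

lemma fieldInChart_modelField {y : ℝ × N} {z : ℝ × E6} (hz : z ∈ (extChartAt I7 y).target) :
    fieldInChart (E := ℝ × E6) I7 (modelField : VField I7 (ℝ × N)) y z = (1, 0) := by
  refine eq_fieldInChart hz ?_
  refine (mfderiv_extChartAt_prod_symm hz (1, 0)).trans ?_
  exact Prod.ext rfl (map_zero (mfderiv 𝓘(ℝ, E6) I6 (extChartAt I6 y.2).symm z.2))

lemma fieldSmoothAt_modelField (y : ℝ × N) :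
    FieldSmoothAt I7 (modelField : VField I7 (ℝ × N)) y := by
  rw [fieldSmoothAt_iff]
  refine (contDiffAt_const (c := ((1, 0) : ℝ × E6))).congr_of_eventuallyEq ?_
  filter_upwards [eventually_mem_target (I := I7) y] with z hz using fieldInChart_modelField hz

end ProductChart

section ModelStructure

set_option linter.unusedSectionVars false

variable {N : Type*} [TopologicalSpace N] [ChartedSpace E6 N] [IsManifold I6 ∞ N]
  (S : SU3Structure N) (t : N → ℝ) (ηN : DForm I6 N 1)

/-- `dv + η_N` as a field of covectors. -/
noncomputable def modelCovector (y : ℝ × N) : TangentSpace I7 y →L[ℝ] ℝ :=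
  (ContinuousAlternatingMap.ofSubsingleton ℝ (TangentSpace I7 y) ℝ (0 : Fin 1)).symm
    (modelEta ηN y)

lemma oneForm_modelCovector (y : ℝ × N) : oneForm (modelCovector ηN y) = modelEta ηN y :=
  (ContinuousAlternatingMap.ofSubsingleton ℝ (TangentSpace I7 y) ℝ (0 : Fin 1)).apply_symm_apply _

lemma modelCovector_apply (y : ℝ × N) (w : ℝ × E6) :
    modelCovector ηN y w = w.1 + ηN y.2 ![w.2] := by
  have h1 : modelCovector ηN y w = modelEta ηN y ![w] := by
    rw [← oneForm_modelCovector, oneForm_apply]; rfl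
  rw [h1]
  refine congrArg₂ (· + ·) (dfun_fst_apply y w) ?_
  refine congrArg (ηN y.2) ?_
  funext i
  fin_cases i
  exact mfderiv_snd_apply y w

lemma modelCovector_modelField (y : ℝ × N) : modelCovector ηN y (modelField y) = 1 := by
  refine (modelCovector_apply ηN y (1, 0)).trans ?_
  have : ηN y.2 ![(0 : E6)] = 0 := (ηN y.2).map_coord_zero 0 rfl
  show (1 : ℝ) + ηN y.2 ![(0 : E6)] = 1
  rw [this, add_zero]

lemma mfderiv_snd_modelField (y : ℝ × N) :
    mfderiv I7 I6 (Prod.snd : ℝ × N → N) y (modelField y) = 0 :=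
  mfderiv_snd_apply y (1, 0)

lemma mfderiv_snd_surjective (y : ℝ × N) :
    Function.Surjective (mfderiv I7 I6 (Prod.snd : ℝ × N → N) y) :=
  fun u => ⟨((0, u) : ℝ × E6), mfderiv_snd_apply y (0, u)⟩

lemma modelMetric_apply (y : ℝ × N) (u v : TangentSpace I7 y) :
    modelMetric S t ηN y u v
      = t y.2 * S.h.inner y.2 (mfderiv I7 I6 (Prod.snd : ℝ × N → N) y u)
          (mfderiv I7 I6 (Prod.snd : ℝ × N → N) y v)
        + (t y.2 ^ 2)⁻¹ * (modelCovector ηN y u * modelCovector ηN y v) := rfl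

lemma modelMetric_modelField (y : ℝ × N) :
    modelMetric S t ηN y (modelField y) = (t y.2 ^ 2)⁻¹ • modelCovector ηN y := by
  ext v
  rw [modelMetric_apply, mfderiv_snd_modelField, modelCovector_modelField, map_zero]
  show t y.2 * 0 + (t y.2 ^ 2)⁻¹ * (1 * modelCovector ηN y v)
    = (t y.2 ^ 2)⁻¹ * modelCovector ηN y v
  ring

variable {S t ηN}

/-- For the explicit metric, `η = k(·, t²V)` is `dv + η_N`. -/
lemma connectionForm_model {y : ℝ × N} (ht : 0 < t y.2) :
    connectionForm (modelMetric S t ηN) modelField y = modelCovector ηN y := by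
  unfold connectionForm
  have h := modelMetric_modelField S t ηN y
  have h1 : modelMetric S t ηN y (modelField y) (modelField y) = (t y.2 ^ 2)⁻¹ := by
    rw [h]
    show (t y.2 ^ 2)⁻¹ * modelCovector ηN y (modelField y) = _
    rw [modelCovector_modelField, mul_one]
  rw [h1, h, smul_smul, inv_inv, mul_inv_cancel₀ (by positivity), one_smul]

lemma exists_isG2Coframe_model {y : ℝ × N} (ht : 0 < t y.2) :
    ∃ e, IsG2Coframe e (modelMetric S t ηN y) (modelPhi S t ηN y) (modelStarPhi S t ηN y) := by
  obtain ⟨e, he⟩ := S.coframe y.2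
  obtain ⟨e', he'⟩ := he.exists_isG2Coframe (mfderiv_snd_surjective y) (mfderiv_snd_modelField y)
    (modelCovector_modelField ηN y) ht
  rw [oneForm_modelCovector] at he'
  exact ⟨e', he'⟩

/-- The coefficients of the explicit metric in a product chart. They do not depend on `v`. -/
noncomputable def modelMetricCoeff (S : SU3Structure N) (t : N → ℝ) (ηN : DForm I6 N 1) (x : N)
    (w : E6) : (ℝ × E6) →L[ℝ] (ℝ × E6) →L[ℝ] ℝ :=
  let γ : (ℝ × E6) →L[ℝ] ℝ := ContinuousLinearMap.fst ℝ ℝ E6 +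
    ((ContinuousAlternatingMap.ofSubsingletonLIE (𝕜 := ℝ) (ι := Fin 1) (E := E6) (F := ℝ)
      (0 : Fin 1)).symm (formInChart I6 ηN x w)).comp (ContinuousLinearMap.snd ℝ ℝ E6)
  (ContinuousLinearMap.precomp ℝ (ContinuousLinearMap.snd ℝ ℝ E6)).comp
      ((t ((extChartAt I6 x).symm w) • bilinInChart I6 S.h.inner x w).comp
        (ContinuousLinearMap.snd ℝ ℝ E6))
    + γ.smulRight ((t ((extChartAt I6 x).symm w) ^ 2)⁻¹ • γ)

lemma bilinInChart_modelMetric {y : ℝ × N} {z : ℝ × E6} (hz : z ∈ (extChartAt I7 y).target) :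
    bilinInChart I7 (modelMetric S t ηN) y z = modelMetricCoeff S t ηN y.2 z.2 := by
  have hs : (extChartAt I7 y).symm z = (z.1, (extChartAt I6 y.2).symm z.2) :=
    congrFun (extChartAt_prod_symm_eq y) z
  have h2 : ∀ a : ℝ × E6, (mfderiv I7 I6 (Prod.snd : ℝ × N → N) ((extChartAt I7 y).symm z)
      (mfderiv 𝓘(ℝ, ℝ × E6) I7 (extChartAt I7 y).symm z a) : E6)
      = (mfderiv 𝓘(ℝ, E6) I6 (extChartAt I6 y.2).symm z.2 a.2 : E6) := fun a =>
    (mfderiv_snd_apply _ _).trans (congrArg Prod.snd (mfderiv_extChartAt_prod_symm hz a))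
  have h3 : ∀ a : ℝ × E6, modelCovector ηN ((extChartAt I7 y).symm z)
      (mfderiv 𝓘(ℝ, ℝ × E6) I7 (extChartAt I7 y).symm z a)
      = a.1 + formInChart I6 ηN y.2 z.2 ![a.2] := by
    intro a
    refine (modelCovector_apply _ _ _).trans ?_
    have h4 : ∀ p q : N, p = q → ∀ u v : E6, u = v → ηN p ![u] = ηN q ![v] := by
      rintro p _ rfl u _ rfl; rfl
    have e1 := congrArg (Prod.fst : ℝ × E6 → ℝ) (mfderiv_extChartAt_prod_symm hz a)
    refine congrArg₂ (· + ·) e1 ((h4 _ _ (congrArg Prod.snd hs) _ _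
      (congrArg (Prod.snd : ℝ × E6 → E6) (mfderiv_extChartAt_prod_symm hz a))).trans ?_)
    refine congrArg (ηN ((extChartAt I6 y.2).symm z.2)) ?_
    funext i
    fin_cases i
    rfl
  have h5 : ∀ p q : N, p = q → ∀ u u' v v' : E6, u = u' → v = v' →
      t p * S.h.inner p u v = t q * S.h.inner q u' v' := by
    rintro p _ rfl u _ v _ rfl rfl; rfl
  have h6 : ∀ p q : N, p = q → (t p ^ 2)⁻¹ = (t q ^ 2)⁻¹ := by
    rintro p _ rfl; rfl
  have h7 : ∀ a : E6, (ContinuousAlternatingMap.ofSubsingletonLIE (𝕜 := ℝ)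
      (ι := Fin 1) (E := E6) (F := ℝ) (0 : Fin 1)).symm (formInChart I6 ηN y.2 z.2) a
      = formInChart I6 ηN y.2 z.2 ![a] := by
    intro a
    rw [show (![a] : Fin 1 → E6) = Function.const (Fin 1) a from Matrix.vec_single_eq_const a]
    rfl
  refine ContinuousLinearMap.ext fun a => ContinuousLinearMap.ext fun b => ?_
  refine (congrArg₂ (· + ·) (h5 _ _ (congrArg Prod.snd hs) _ _ _ _ (h2 a) (h2 b))
    (congrArg₂ (· * ·) (h6 _ _ (congrArg Prod.snd hs)) (congrArg₂ (· * ·)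
      ((h3 a).trans (congrArg (fun r => a.1 + r) (h7 a.2).symm))
      ((h3 b).trans (congrArg (fun r => b.1 + r) (h7 b.2).symm))))).trans ?_
  refine congrArg₂ (· + ·) rfl ?_
  exact mul_left_comm _ _ _

set_option synthInstance.maxHeartbeats 200000 in
lemma contDiffAt_modelMetricCoeff {x : N} (ht : ContMDiffAt I6 𝓘(ℝ, ℝ) ∞ t x) (hpos : 0 < t x)
    (hη : FormSmoothAt I6 ηN x) :
    ContDiffAt ℝ ∞ (modelMetricCoeff S t ηN x) (extChartAt I6 x x) := by
  have ht' := contMDiffAt_iff_inChart.1 ht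
  have hh := metricSmoothAt_iff.1 (S.metricSmoothAt x)
  have hη' : ContDiffAt ℝ ∞ (fun w => ContinuousLinearMap.fst ℝ ℝ E6 +
      ((ContinuousAlternatingMap.ofSubsingletonLIE (𝕜 := ℝ)
        (ι := Fin 1) (E := E6) (F := ℝ) (0 : Fin 1)).symm
        (formInChart I6 ηN x w)).comp (ContinuousLinearMap.snd ℝ ℝ E6)) (extChartAt I6 x x) := by
    refine contDiffAt_const.add (ContDiffAt.clm_comp ?_ contDiffAt_const)
    exact (ContinuousAlternatingMap.ofSubsingletonLIE (𝕜 := ℝ) (ι := Fin 1) (E := E6) (F := ℝ)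
      (0 : Fin 1)).symm.toContinuousLinearEquiv.contDiff.contDiffAt.comp _ hη
  refine ContDiffAt.add (contDiffAt_const.clm_comp ((contDiffAt_real_smul ht' hh).clm_comp
    contDiffAt_const))
    (ContDiffAt.smulRight hη' (contDiffAt_real_smul ?_ hη'))
  refine (ht'.pow 2).inv ?_
  rw [extChartAt_to_inv]
  positivity

set_option synthInstance.maxHeartbeats 200000 in
lemma metricSmoothAt_modelMetric {y : ℝ × N} (ht : ContMDiffAt I6 𝓘(ℝ, ℝ) ∞ t y.2)
    (hpos : 0 < t y.2) (hη : FormSmoothAt I6 ηN y.2) :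
    MetricSmoothAt I7 (modelMetric S t ηN) y := by
  rw [metricSmoothAt_iff]
  have h : ContDiffAt ℝ ∞ (fun z : ℝ × E6 => modelMetricCoeff S t ηN y.2 z.2)
      (extChartAt I7 y y) :=
    ContDiffAt.comp (extChartAt I7 y y) (g := modelMetricCoeff S t ηN y.2)
      (contDiffAt_modelMetricCoeff ht hpos hη) contDiffAt_snd
  refine h.congr_of_eventuallyEq ?_
  filter_upwards [eventually_mem_target (I := I7) y] with z hz using bilinInChart_modelMetric hz

set_option synthInstance.maxHeartbeats 200000 in
lemma isKillingAt_modelField {y : ℝ × N} (ht : ContMDiffAt I6 𝓘(ℝ, ℝ) ∞ t y.2)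
    (hpos : 0 < t y.2) (hη : FormSmoothAt I6 ηN y.2) :
    IsKillingAt I7 modelField (modelMetric S t ηN) y := by
  refine isKillingAt_of_inChart (metricSmoothAt_modelMetric ht hpos hη) fun a b => ?_
  have h1 : bilinInChart I7 (modelMetric S t ηN) y =ᶠ[𝓝 (extChartAt I7 y y)]
      fun z => modelMetricCoeff S t ηN y.2 z.2 := by
    filter_upwards [eventually_mem_target (I := I7) y] with z hz using bilinInChart_modelMetric hz
  have h2 : fieldInChart (E := ℝ × E6) I7 (modelField : VField I7 (ℝ × N)) y
      =ᶠ[𝓝 (extChartAt I7 y y)] fun _ => (1, 0) := by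
    filter_upwards [eventually_mem_target (I := I7) y] with z hz using fieldInChart_modelField hz
  have h3 : HasFDerivAt (modelMetricCoeff S t ηN y.2) _ (extChartAt I7 y y).2 :=
    ((contDiffAt_modelMetricCoeff (S := S) ht hpos hη).differentiableAt (by simp)).hasFDerivAt
  have h4 := (h3.comp (extChartAt I7 y y) hasFDerivAt_snd).fderiv
  have h5 : fderiv ℝ (bilinInChart I7 (modelMetric S t ηN) y) (extChartAt I7 y y)
      ((1, 0) : ℝ × E6) = 0 := by
    rw [h1.fderiv_eq]
    refine (congrArg (fun L : (ℝ × E6) →L[ℝ] (ℝ × E6) →L[ℝ] (ℝ × E6) →L[ℝ] ℝ =>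
      L ((1, 0) : ℝ × E6)) h4).trans ?_
    exact map_zero (fderiv ℝ (modelMetricCoeff S t ηN y.2) (extChartAt I7 y y).2)
  have h6 : fderiv ℝ (fieldInChart (E := ℝ × E6) I7 (modelField : VField I7 (ℝ × N)) y)
      (extChartAt I7 y y) = 0 := by
    rw [h2.fderiv_eq, fderiv_fun_const]
    rfl
  rw [h6]
  refine (congrArg₂ (· + ·) (congrArg₂ (· + ·) (congrArg
    (fun L : (ℝ × E6) →L[ℝ] (ℝ × E6) →L[ℝ] ℝ => L a b) h5) ?_) ?_).trans
    (show (0 : ℝ) + 0 + 0 = 0 by norm_num)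
  · exact congrArg (fun L : (ℝ × E6) →L[ℝ] ℝ => L b)
      (map_zero (bilinInChart I7 (modelMetric S t ηN) y (extChartAt I7 y y)))
  · exact map_zero (bilinInChart I7 (modelMetric S t ηN) y (extChartAt I7 y y) a)

end ModelStructure

/-! ### Orbits of `∂/∂v` and exterior derivatives of the explicit forms -/

section Orbits

/-- A curve in a manifold with zero derivative on an interval is constant there. -/
lemma eqOn_of_hasMFDerivWithinAt_zero {E : Type*} [NormedAddCommGroup E] [NormedSpace ℝ E]
    {H : Type*} [TopologicalSpace H] {I : ModelWithCorners ℝ E H} {M : Type*} [TopologicalSpace M]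
    [ChartedSpace H M] [IsManifold I 1 M] {c : ℝ → M} {K : Set ℝ} (hK : Convex ℝ K)
    (hc : ∀ s ∈ K, HasMFDerivWithinAt 𝓘(ℝ, ℝ) I c K s 0) {a b : ℝ} (ha : a ∈ K) (hb : b ∈ K) :
    c a = c b := by
  refine hK.isPreconnected.induction₂ (fun x y => c x = c y) (fun s hs => ?_)
    (fun x y z _ _ _ hxy hyz => hxy.trans hyz) (fun x y _ _ h => h.symm) ha hb
  have h1 : ∀ᶠ r in 𝓝[K] s, c r ∈ (extChartAt I (c s)).source :=
    (hc s hs).continuousWithinAt.eventually_mem (extChartAt_source_mem_nhds (c s))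
  obtain ⟨ε, hε, hεK⟩ := Metric.mem_nhdsWithin_iff.1 h1
  filter_upwards [inter_mem_nhdsWithin K (Metric.ball_mem_nhds s hε)] with r hr
  have hL : Convex ℝ (K ∩ Metric.ball s ε) := hK.inter (convex_ball s ε)
  have hd : ∀ x ∈ K ∩ Metric.ball s ε,
      HasFDerivWithinAt (fun r => extChartAt I (c s) (c r)) (0 : ℝ →L[ℝ] E)
        (K ∩ Metric.ball s ε) x := by
    intro x hx
    have hxs : c x ∈ (extChartAt I (c s)).source := hεK ⟨hx.2, hx.1⟩
    have h2 : HasMFDerivAt I 𝓘(ℝ, E) (extChartAt I (c s)) (c x) _ :=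
      (mdifferentiableAt_extChartAt (by rw [← extChartAt_source I]; exact hxs)).hasMFDerivAt
    have h3 := (h2.comp_hasMFDerivWithinAt x (hc x hx.1)).mono
      (inter_subset_left (s := K) (t := Metric.ball s ε))
    rw [ContinuousLinearMap.comp_zero] at h3
    exact hasMFDerivWithinAt_iff_hasFDerivWithinAt.1 h3
  have h4 := hL.norm_image_sub_le_of_norm_hasFDerivWithin_le hd (C := 0)
    (fun x _ => norm_zero.le) ⟨hr.1, hr.2⟩ ⟨hs, Metric.mem_ball_self hε⟩
  rw [zero_mul, norm_le_zero_iff, sub_eq_zero] at h4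
  exact (extChartAt I (c s)).injOn (mem_extChartAt_source (c s)) (hεK ⟨hr.2, hr.1⟩) h4

end Orbits

section ModelQuotient

variable {N : Type*} [TopologicalSpace N] [ChartedSpace E6 N] [IsManifold I6 ∞ N]
  {S : SU3Structure N} {t : N → ℝ} {ηN : DForm I6 N 1}

set_option linter.unusedSectionVars false

/-- Two points of `ℝ × N` lie on the same orbit of `∂/∂v` if and only if they have the same
projection. -/
lemma sameOrbit_modelField_iff {W : Set N} {y y' : ℝ × N} (hy : y ∈ (univ ×ˢ W : Set (ℝ × N))) :
    y.2 = y'.2 ↔ SameOrbit I7 (modelField : VField I7 (ℝ × N)) (univ ×ˢ W) y y' := by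
  have : IsManifold I6 1 N := IsManifold.of_le (m := 1) (n := ∞) (by simp)
  constructor
  · intro h
    refine ⟨fun s => (s, y.2), y.1, y'.1, rfl, Prod.ext rfl h, fun s _ => ⟨mem_univ _, hy.2⟩, ?_⟩
    intro s _
    have h1 : HasMFDerivAt 𝓘(ℝ, ℝ) I7 (fun s : ℝ => (s, y.2)) s _ :=
      (hasMFDerivAt_id s).prodMk (hasMFDerivAt_const (I := 𝓘(ℝ, ℝ)) (I' := I6) y.2 s)
    refine (h1.congr_mfderiv ?_).hasMFDerivWithinAt
    refine ContinuousLinearMap.ext fun r => ?_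
    exact Prod.ext (mul_one (show ℝ from r)).symm (smul_zero (A := E6) (show ℝ from r)).symm
  · rintro ⟨γ, a, b, rfl, rfl, -, hγ⟩
    refine eqOn_of_hasMFDerivWithinAt_zero (I := I6) (c := fun s => (γ s).2) (convex_uIcc a b)
      (fun s hs => ?_) left_mem_uIcc right_mem_uIcc
    have h1 := (hasMFDerivAt_snd (γ s)).comp_hasMFDerivWithinAt (I := 𝓘(ℝ, ℝ)) (I' := I7)
      (I'' := I6) s (hγ s hs)
    refine h1.congr_mfderiv ?_
    refine ContinuousLinearMap.ext fun r => ?_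
    exact smul_zero (A := E6) (show ℝ from r)

variable (S t ηN)

lemma interiorProd_modelPhi (y : ℝ × N) :
    interiorProd (k := 2) (modelField y) (modelPhi S t ηN y)
      = pullbackForm I7 I6 (Prod.snd : ℝ × N → N) S.σ y := by
  have hη : modelEta ηN y ![modelField y] = 1 := by
    rw [← oneForm_modelCovector, oneForm_apply]; exact modelCovector_modelField ηN y
  have h1 : interiorProd (k := 1) (modelField y)
      (pullbackForm I7 I6 (Prod.snd : ℝ × N → N) S.σ y) = 0 :=
    interiorProd_comp_eq_zero _ (mfderiv_snd_modelField y)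
  unfold modelPhi
  rw [interiorProd_add_right, interiorProd_wedge_two_one h1 hη, interiorProd_smul_right]
  have h : interiorProd (k := 2) (modelField y)
      (pullbackForm I7 I6 (Prod.snd : ℝ × N → N) S.ψp y) = 0 :=
    interiorProd_comp_eq_zero _ (mfderiv_snd_modelField y)
  rw [h, smul_zero, add_zero]

lemma interiorProd_modelStarPhi (y : ℝ × N) :
    interiorProd (k := 3) (modelField y) (modelStarPhi S t ηN y)
      = -(t y.2 ^ (1 / 2 : ℝ) • pullbackForm I7 I6 (Prod.snd : ℝ × N → N) S.ψm y) := by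
  have hη : modelEta ηN y ![modelField y] = 1 := by
    rw [← oneForm_modelCovector, oneForm_apply]; exact modelCovector_modelField ηN y
  have h1 : interiorProd (k := 1) (modelField y)
      (pullbackForm I7 I6 (Prod.snd : ℝ × N → N) S.σ y) = 0 :=
    interiorProd_comp_eq_zero _ (mfderiv_snd_modelField y)
  have h2 : interiorProd (k := 2) (modelField y)
      (pullbackForm I7 I6 (Prod.snd : ℝ × N → N) S.ψm y) = 0 :=
    interiorProd_comp_eq_zero _ (mfderiv_snd_modelField y)
  unfold modelStarPhi
  rw [interiorProd_add_right, interiorProd_smul_right, interiorProd_smul_right,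
    interiorProd_wedge_three_one h2 hη]
  refine (congrArg₂ (· + ·) (smul_neg _ _) ((congrArg (fun θ => _ • θ)
    (interiorProd_wedge_two_two h1 h1)).trans (smul_zero _))).trans (add_zero _)

variable {S t ηN}

lemma formSmoothAt_modelEta {y : ℝ × N} (hη : FormSmoothAt I6 ηN y.2) :
    FormSmoothAt I7 (modelEta ηN) y :=
  formSmoothAt_add (formSmoothAt_dfun (Filter.Eventually.of_forall fun _ => contMDiffAt_fst))
    (formSmoothAt_pullbackForm contMDiffAt_snd hη)

lemma extD_modelEta {y : ℝ × N} (hη : FormSmoothAt I6 ηN y.2) :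
    extD I7 (modelEta ηN) y = pullbackForm I7 I6 (Prod.snd : ℝ × N → N) (extD I6 ηN) y := by
  have h1 : ∀ z : ℝ × N, ContMDiffAt I7 𝓘(ℝ, ℝ) ∞ (fun z : ℝ × N => z.1) z :=
    fun _ => contMDiffAt_fst
  have h2 := extD_add (I := I7) (formSmoothAt_dfun (x := y) (Filter.Eventually.of_forall h1))
    (formSmoothAt_pullbackForm (f := (Prod.snd : ℝ × N → N)) contMDiffAt_snd hη)
  refine h2.trans ?_
  rw [extD_dfun (Filter.Eventually.of_forall h1), zero_add, extD_pullbackForm contMDiffAt_snd hη]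

lemma wedge_zero_left {V : Type*} [AddCommGroup V] [Module ℝ V] [TopologicalSpace V] {p q : ℕ}
    (β : V [⋀^Fin q]→L[ℝ] ℝ) : wedge (0 : V [⋀^Fin p]→L[ℝ] ℝ) β = 0 := by
  rw [← zero_smul ℝ (0 : V [⋀^Fin p]→L[ℝ] ℝ), wedge_smul_left, zero_smul]

/-- `dφ` is the pullback of `σ ∧ dη_N + d(t^{3/2} ψ⁺)`. -/
lemma extD_modelPhi (hσ : ∀ x, extD I6 S.σ x = 0) {y : ℝ × N}
    (ht : ContMDiffAt I6 𝓘(ℝ, ℝ) ∞ t y.2) (hpos : 0 < t y.2) (hη : FormSmoothAt I6 ηN y.2)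
    (v : Fin 4 → ℝ × E6) :
    extD I7 (modelPhi S t ηN) y v
      = wedge (S.σ y.2) (extD I6 ηN y.2) (fun i => (v i).2)
        + extD I6 (fun x => t x ^ (3 / 2 : ℝ) • S.ψp x) y.2 (fun i => (v i).2) := by
  have hsnd : ContMDiffAt I7 I6 ∞ (Prod.snd : ℝ × N → N) y := contMDiffAt_snd
  have hs : FormSmoothAt I7 (pullbackForm I7 I6 (Prod.snd : ℝ × N → N) S.σ) y :=
    formSmoothAt_pullbackForm hsnd (S.smooth_σ _)
  have hp : FormSmoothAt I6 (fun x => t x ^ (3 / 2 : ℝ) • S.ψp x) y.2 :=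
    formSmoothAt_smul (contMDiffAt_rpow ht hpos _) (S.smooth_ψp _)
  have hv : (fun i => (mfderiv I7 I6 (Prod.snd : ℝ × N → N) y (v i) : E6)) = fun i => (v i).2 :=
    funext fun i => mfderiv_snd_apply y (v i)
  have h0 : pullbackForm I7 I6 (Prod.snd : ℝ × N → N) (extD I6 S.σ) y = 0 := by
    unfold pullbackForm
    rw [hσ]; rfl
  have h1 := extD_add (I := I7) (x := y) (formSmoothAt_wedge hs (formSmoothAt_modelEta hη))
    (formSmoothAt_pullbackForm hsnd hp)
  refine (congrArg (fun θ : (ℝ × E6) [⋀^Fin 4]→L[ℝ] ℝ => θ v) h1).trans ?_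
  refine congrArg₂ (fun a b : ℝ => a + b) ?_ ?_
  · refine (extD_wedge_two_one hs (formSmoothAt_modelEta hη) v).trans ?_
    rw [extD_pullbackForm hsnd (S.smooth_σ _), extD_modelEta hη, h0, wedge_zero_left]
    refine (zero_add _).trans ?_
    refine (congrArg (fun θ : (ℝ × E6) [⋀^Fin 4]→L[ℝ] ℝ => θ v) (wedge_comp (S.σ y.2)
      (extD I6 ηN y.2) (mfderiv I7 I6 (Prod.snd : ℝ × N → N) y)).symm).trans ?_
    exact congrArg (wedge (p := 2) (q := 2) (S.σ y.2) (extD I6 ηN y.2)) hv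
  · rw [extD_pullbackForm hsnd hp]
    exact congrArg (extD I6 (fun x => t x ^ (3 / 2 : ℝ) • S.ψp x) y.2) hv

set_option maxRecDepth 4000 in
/-- `d*φ` is the sum of `d(t^{1/2} ψ⁻) ∧ η` and the pullback of
`d(½ t² σ ∧ σ) - t^{1/2} ψ⁻ ∧ dη_N`. -/
lemma extD_modelStarPhi {y : ℝ × N}
    (ht : ContMDiffAt I6 𝓘(ℝ, ℝ) ∞ t y.2) (hpos : 0 < t y.2) (hη : FormSmoothAt I6 ηN y.2)
    (v : Fin 5 → ℝ × E6) :
    extD I7 (modelStarPhi S t ηN) y v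
      = wedge (pullbackForm I7 I6 (Prod.snd : ℝ × N → N)
          (extD I6 fun x => t x ^ (1 / 2 : ℝ) • S.ψm x) y) (modelEta ηN y) v
        - wedge (t y.2 ^ (1 / 2 : ℝ) • S.ψm y.2) (extD I6 ηN y.2) (fun i => (v i).2)
        + extD I6 (fun x => (1 / 2 * t x ^ 2 : ℝ) • wedge (S.σ x) (S.σ x)) y.2
            (fun i => (v i).2) := by
  have hsnd : ContMDiffAt I7 I6 ∞ (Prod.snd : ℝ × N → N) y := contMDiffAt_snd
  have hm : FormSmoothAt I6 (fun x => t x ^ (1 / 2 : ℝ) • S.ψm x) y.2 :=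
    formSmoothAt_smul (contMDiffAt_rpow ht hpos _) (S.smooth_ψm _)
  have hm' := formSmoothAt_pullbackForm hsnd hm
  have hss : FormSmoothAt I6 (fun x => (1 / 2 * t x ^ 2 : ℝ) • wedge (S.σ x) (S.σ x)) y.2 := by
    refine formSmoothAt_smul ?_ (formSmoothAt_wedge (S.smooth_σ _) (S.smooth_σ _))
    rw [contMDiffAt_iff_inChart] at ht ⊢
    exact contDiffAt_const.mul (ht.pow 2)
  have hv : (fun i => (mfderiv I7 I6 (Prod.snd : ℝ × N → N) y (v i) : E6)) = fun i => (v i).2 :=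
    funext fun i => mfderiv_snd_apply y (v i)
  have h2 : modelStarPhi S t ηN = fun y => wedge (pullbackForm I7 I6 (Prod.snd : ℝ × N → N)
      (fun x => t x ^ (1 / 2 : ℝ) • S.ψm x) y) (modelEta ηN y)
      + pullbackForm I7 I6 (Prod.snd : ℝ × N → N)
        (fun x => (1 / 2 * t x ^ 2 : ℝ) • wedge (S.σ x) (S.σ x)) y := by
    funext y
    refine congrArg₂ (fun a b : (ℝ × E6) [⋀^Fin 4]→L[ℝ] ℝ => a + b)
      (wedge_smul_left _ _ _).symm ?_
    exact congrArg (fun θ : (ℝ × E6) [⋀^Fin 4]→L[ℝ] ℝ => (1 / 2 * t y.2 ^ 2 : ℝ) • θ)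
      (wedge_comp (S.σ y.2) (S.σ y.2) (mfderiv I7 I6 (Prod.snd : ℝ × N → N) y)).symm
  have h1 := extD_add (I := I7) (x := y) (formSmoothAt_wedge hm' (formSmoothAt_modelEta hη))
    (formSmoothAt_pullbackForm hsnd hss)
  rw [h2]
  refine (congrArg (fun θ : (ℝ × E6) [⋀^Fin 5]→L[ℝ] ℝ => θ v) h1).trans ?_
  refine congrArg₂ (fun a b : ℝ => a + b) ?_ ?_
  · refine (extD_wedge_three_one hm' (formSmoothAt_modelEta hη) v).trans ?_
    rw [extD_pullbackForm hsnd hm, extD_modelEta hη]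
    refine congrArg₂ (fun a b : ℝ => a - b) rfl ?_
    refine (congrArg (fun θ : (ℝ × E6) [⋀^Fin 5]→L[ℝ] ℝ => θ v)
      (wedge_comp (p := 3) (q := 2) (t y.2 ^ (1 / 2 : ℝ) • S.ψm y.2)
      (extD I6 ηN y.2) (mfderiv I7 I6 (Prod.snd : ℝ × N → N) y)).symm).trans ?_
    exact congrArg (wedge (p := 3) (q := 2) (t y.2 ^ (1 / 2 : ℝ) • S.ψm y.2) (extD I6 ηN y.2)) hv
  · rw [extD_pullbackForm hsnd hss]
    exact congrArg (extD I6 (fun x => (1 / 2 * t x ^ 2 : ℝ) • wedge (S.σ x) (S.σ x)) y.2) hv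

end ModelQuotient

/-! ### The explicit quotient and local connection forms -/

section ModelTheorem

variable {N : Type*} [TopologicalSpace N] [ChartedSpace E6 N] [IsManifold I6 ∞ N]
  {S : SU3Structure N} {t : N → ℝ} {ηN : DForm I6 N 1} {W : Set N} {U : VField I6 N}

lemma wedge_neg_right {V : Type*} [AddCommGroup V] [Module ℝ V] [TopologicalSpace V] {p q : ℕ}
    (α : V [⋀^Fin p]→L[ℝ] ℝ) (β : V [⋀^Fin q]→L[ℝ] ℝ) : wedge α (-β) = -wedge α β := by
  rw [← neg_one_smul ℝ β, wedge_smul_right]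
  exact neg_one_smul ℝ (wedge α β)

set_option maxRecDepth 4000 in
/-- The explicit structure is torsion-free: with `dη_N = -t^{1/2} ι_U ψ⁺`, the two summands in each
of `dφ = σ ∧ dη_N + d(t^{3/2} ψ⁺)` and `d*φ = -t^{1/2} ψ⁻ ∧ dη_N + ½ d(t² σ ∧ σ)` cancel. -/
lemma SU3Structure.CriterionOn.isTorsionFreeG2On_model (hσ : ∀ x, extD I6 S.σ x = 0)
    (hc : S.CriterionOn W t U) (hW : IsOpen W) {W' : Set N} (hW' : W' ⊆ W)
    (hη : S.IsConnectionOn t ηN W' U) :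
    IsTorsionFreeG2On (univ ×ˢ W' : Set (ℝ × N)) (modelMetric S t ηN) (modelPhi S t ηN)
      (modelStarPhi S t ηN) := by
  have hta : ∀ x ∈ W', ContMDiffAt I6 𝓘(ℝ, ℝ) ∞ t x := fun x hx => hc.contMDiffAt hW (hW' hx)
  have hpos : ∀ x ∈ W', 0 < t x := fun x hx => hc.pos x (hW' hx)
  have hsnd : ∀ y : ℝ × N, ContMDiffAt I7 I6 ∞ (Prod.snd : ℝ × N → N) y := fun y => contMDiffAt_snd
  have hσs : ∀ y, FormSmoothAt I7 (pullbackForm I7 I6 (Prod.snd : ℝ × N → N) S.σ) y := fun y =>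
    formSmoothAt_pullbackForm (hsnd y) (S.smooth_σ _)
  have hts : ∀ y ∈ (univ ×ˢ W' : Set (ℝ × N)), ContMDiffAt I7 𝓘(ℝ, ℝ) ∞ (fun y => t y.2) y :=
    fun y hy => ContMDiffAt.comp y (hta y.2 hy.2) (hsnd y)
  refine ⟨fun y hy => metricSmoothAt_modelMetric (hta _ hy.2) (hpos _ hy.2) (hη _ hy.2).1,
    fun y hy => ?_, fun y hy => ?_, fun y hy => exists_isG2Coframe_model (hpos _ hy.2),
    fun y hy => ?_, fun y hy => ?_⟩
  · exact formSmoothAt_add (formSmoothAt_wedge (hσs y) (formSmoothAt_modelEta (hη _ hy.2).1))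
      (formSmoothAt_pullbackForm (hsnd y) (α := fun x => t x ^ (3 / 2 : ℝ) • S.ψp x)
        (formSmoothAt_smul (contMDiffAt_rpow (hta _ hy.2) (hpos _ hy.2) _) (S.smooth_ψp _)))
  · have h2 : ContMDiffAt I6 𝓘(ℝ, ℝ) ∞ (fun x => t x ^ (1 / 2 : ℝ)) y.2 :=
      contMDiffAt_rpow (hta _ hy.2) (hpos _ hy.2) _
    have h3 : ContMDiffAt I6 𝓘(ℝ, ℝ) ∞ (fun x => 1 / 2 * t x ^ 2) y.2 := by
      have ht := hta _ hy.2
      rw [contMDiffAt_iff_inChart] at ht ⊢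
      exact contDiffAt_const.mul (ht.pow 2)
    refine formSmoothAt_add (formSmoothAt_smul
      (f := fun y : ℝ × N => t y.2 ^ (1 / 2 : ℝ)) (ContMDiffAt.comp y h2 (hsnd y))
      (formSmoothAt_wedge (formSmoothAt_pullbackForm (hsnd y) (S.smooth_ψm _))
        (formSmoothAt_modelEta (hη _ hy.2).1)))
      (formSmoothAt_smul (f := fun y : ℝ × N => 1 / 2 * t y.2 ^ 2)
        (ContMDiffAt.comp (g := fun x => 1 / 2 * t x ^ 2) y h3 (hsnd y))
        (formSmoothAt_wedge (hσs y) (hσs y)))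
  · suffices key : ∀ v : Fin 4 → ℝ × E6, extD I7 (modelPhi S t ηN) y v = 0 from
      form_ext_iff_zero.2 key
    intro v
    refine (extD_modelPhi hσ (hta _ hy.2) (hpos _ hy.2) (hη _ hy.2).1 v).trans ?_
    have h1 := extD_rpow_smul_psiPlus (S := S) (hta _ hy.2)
      (by filter_upwards [hW.mem_nhds (hW' hy.2)] with x hx using hc.pos x hx)
      (hc.extD_psiPlus hW (hW' hy.2)) (hc.interiorProd_sigma hW (hW' hy.2)) (fun i => (v i).2)
    have h2 : wedge (S.σ y.2) (extD I6 ηN y.2) = -(t y.2 ^ (1 / 2 : ℝ) •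
        wedge (S.σ y.2) (interiorProd (k := 2) (U y.2) (S.ψp y.2))) := by
      rw [(hη _ hy.2).2, wedge_neg_right, wedge_smul_right]
    refine (congrArg₂ (fun a b : ℝ => a + b) (congrArg (fun θ : E6 [⋀^Fin 4]→L[ℝ] ℝ =>
      θ fun i => (v i).2) h2) h1).trans ?_
    exact neg_add_cancel _
  · suffices key : ∀ v : Fin 5 → ℝ × E6, extD I7 (modelStarPhi S t ηN) y v = 0 from
      form_ext_iff_zero.2 key
    intro v
    refine (extD_modelStarPhi (hta _ hy.2) (hpos _ hy.2) (hη _ hy.2).1 v).trans ?_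
    have h0 : wedge (pullbackForm I7 I6 (Prod.snd : ℝ × N → N)
        (extD I6 fun x => t x ^ (1 / 2 : ℝ) • S.ψm x) y) (modelEta ηN y) = 0 := by
      unfold pullbackForm
      rw [hc.extD_psiMinus hW (hW' hy.2)]
      exact wedge_zero_left _
    have h1 := extD_sq_smul_sigma_sigma (hσ _) (hta _ hy.2) (hpos _ hy.2)
      (hc.interiorProd_sigma hW (hW' hy.2)) (fun i => (v i).2)
    have h2 : wedge (t y.2 ^ (1 / 2 : ℝ) • S.ψm y.2) (extD I6 ηN y.2)
        = -wedge (t y.2 ^ (1 / 2 : ℝ) • S.ψm y.2)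
          (t y.2 ^ (1 / 2 : ℝ) • interiorProd (k := 2) (U y.2) (S.ψp y.2)) := by
      rw [(hη _ hy.2).2, wedge_neg_right]
    refine (congrArg₂ (fun a b : ℝ => a + b) (congrArg₂ (fun a b : ℝ => a - b)
      (congrArg (fun θ : (ℝ × E6) [⋀^Fin 5]→L[ℝ] ℝ => θ v) h0)
      (congrArg (fun θ : E6 [⋀^Fin 5]→L[ℝ] ℝ => θ fun i => (v i).2) h2)) h1).trans ?_
    have alg : ∀ a : ℝ, 0 - -a + -a = 0 := fun a => by ring
    exact alg _

/-- The explicit structure on `ℝ × W'` is a torsion-free `G₂` structure whose quotient by `∂/∂v`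
is the given `SU(3)` structure. -/
lemma SU3Structure.CriterionOn.isG2QuotientOn_model (hσ : ∀ x, extD I6 S.σ x = 0)
    (hc : S.CriterionOn W t U) (hW : IsOpen W) {W' : Set N} (hWo : IsOpen W') (hW' : W' ⊆ W)
    (hη : S.IsConnectionOn t ηN W' U) :
    S.IsG2QuotientOn W' t (univ ×ˢ W' : Set (ℝ × N)) (modelMetric S t ηN) (modelPhi S t ηN)
      (modelStarPhi S t ηN) modelField Prod.snd := by
  have hpos : ∀ x ∈ W', 0 < t x := fun x hx => hc.pos x (hW' hx)
  have htf := hc.isTorsionFreeG2On_model hσ hW hW' hη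
  have hkV : ∀ y : ℝ × N, modelMetric S t ηN y (modelField y) (modelField y) = (t y.2 ^ 2)⁻¹ := by
    intro y
    rw [modelMetric_modelField]
    show (t y.2 ^ 2)⁻¹ * modelCovector ηN y (modelField y) = _
    rw [modelCovector_modelField, mul_one]
  refine ⟨isOpen_univ.prod hWo, htf, fun y _ => fieldSmoothAt_modelField y, fun y _ h => ?_,
    fun y hy => isKillingAt_modelField (hc.contMDiffAt hW (hW' hy.2)) (hpos _ hy.2)
      (hη _ hy.2).1, fun y hy => ?_, contMDiff_snd.contMDiffOn,
    fun y _ => mfderiv_snd_surjective y, ?_, fun y hy y' _ => sameOrbit_modelField_iff hy,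
    fun y hy => ?_, fun y hy u v => ?_, fun y hy => ?_, fun y hy => ?_, fun y hy => ?_⟩
  · exact one_ne_zero (congrArg (Prod.fst : ℝ × E6 → ℝ) h)
  · have h1 : extD I7 (fun y => interiorProd (k := 2) (modelField y) (modelPhi S t ηN y)) y
        = 0 := by
      simp only [interiorProd_modelPhi]
      refine (extD_pullbackForm contMDiffAt_snd (S.smooth_σ _)).trans ?_
      unfold pullbackForm
      rw [hσ]; rfl
    show extD I7 (fun y => interiorProd (k := 2) (modelField y) (modelPhi S t ηN y)) y
      + interiorProd (k := 3) (modelField y) (extD I7 (modelPhi S t ηN) y) = 0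
    rw [h1, htf.closed y hy, zero_add]
    rfl
  · rw [univ_prod]
    exact Set.image_preimage_eq _ Prod.snd_surjective
  · rw [hkV, ← inv_pow, Real.sqrt_sq (inv_nonneg.2 (hpos _ hy.2).le), inv_inv]
  · rw [connectionForm_model (hpos _ hy.2)]
    rfl
  · exact (interiorProd_modelPhi S t ηN y).symm
  · rw [interiorProd_modelPhi, connectionForm_model (hpos _ hy.2), oneForm_modelCovector]
    have h1 : modelPhi S t ηN y - wedge (pullbackForm I7 I6 (Prod.snd : ℝ × N → N) S.σ y)
        (modelEta ηN y)
        = t y.2 ^ (3 / 2 : ℝ) • pullbackForm I7 I6 (Prod.snd : ℝ × N → N) S.ψp y :=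
      add_sub_cancel_left _ _
    rw [h1, smul_smul, smul_smul, Real.sqrt_eq_rpow, ← Real.rpow_neg_one (t y.2),
      ← Real.rpow_neg (hpos _ hy.2).le, ← Real.rpow_add (hpos _ hy.2),
      ← Real.rpow_add (hpos _ hy.2)]
    norm_num
  · rw [interiorProd_modelStarPhi, neg_neg, smul_smul, Real.sqrt_eq_rpow,
      inv_mul_cancel₀ (Real.rpow_pos_of_pos (hpos _ hy.2) _).ne', one_smul]

/-- Since `t^{1/2} ι_U ψ⁺` is closed, a connection form exists locally by the Poincaré lemma. -/
lemma SU3Structure.CriterionOn.exists_isConnectionOn (hc : S.CriterionOn W t U) (hW : IsOpen W)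
    {p : N} (hp : p ∈ W) : ∃ W' : Set N, IsOpen W' ∧ p ∈ W' ∧ W' ⊆ W ∧
      ∃ ηN : DForm I6 N 1, S.IsConnectionOn t ηN W' U := by
  have : IsManifold I6 1 N := IsManifold.of_le (m := 1) (n := ∞) (by simp)
  set F : DForm I6 N 2 := fun x => -(t x ^ (1 / 2 : ℝ) • interiorProd (k := 2) (U x) (S.ψp x))
    with hF
  have hFs : ∀ x ∈ W, FormSmoothAt I6 F x := fun x hx =>
    ContDiffAt.neg (formSmoothAt_smul (contMDiffAt_rpow (hc.contMDiffAt hW hx) (hc.pos x hx) _)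
      (formSmoothAt_interiorProd (hc.hamiltonian x hx).1 (S.smooth_ψp x)))
  have hFd : ∀ x ∈ W, extD I6 F x = 0 := fun x hx => by
    have h1 := extD_neg (I := I6)
      (fun x => t x ^ (1 / 2 : ℝ) • interiorProd (k := 2) (U x) (S.ψp x)) x
    rw [hF, h1, hc.extD_interiorProd hW hx, neg_zero]
  set φ := extChartAt I6 p with hφ
  have hs : IsOpen (φ.target ∩ φ.symm ⁻¹' W) :=
    (continuousOn_extChartAt_symm p).isOpen_inter_preimage (isOpen_extChartAt_target p) hW
  have hps : φ p ∈ φ.target ∩ φ.symm ⁻¹' W :=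
    ⟨mem_extChartAt_target p, by rw [mem_preimage, extChartAt_to_inv]; exact hp⟩
  obtain ⟨r, hr, hrs, η, hη, hηF⟩ := exists_extDeriv_eq hs hps (F := formInChart I6 F p)
    (fun z hz => contDiffAt_formInChart hz.1 (hFs _ hz.2))
    (fun z hz => by
      rw [← formInChart_extD hz.1 (hFs _ hz.2)]
      unfold formInChart
      rw [hFd _ hz.2]; rfl)
  refine ⟨φ.source ∩ φ ⁻¹' Metric.ball (φ p) r,
    (continuousOn_extChartAt p).isOpen_inter_preimage (isOpen_extChartAt_source p)
      Metric.isOpen_ball, ⟨mem_extChartAt_source p, Metric.mem_ball_self hr⟩, ?_,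
    pullbackForm I6 𝓘(ℝ, E6) φ η, ?_⟩
  · rintro x ⟨hx, hxr⟩
    have := (hrs hxr).2
    rwa [mem_preimage, φ.left_inv hx] at this
  · rintro x ⟨hx, hxr⟩
    have hφs : ContMDiffAt I6 𝓘(ℝ, E6) ∞ φ x :=
      contMDiffAt_extChartAt' (by rwa [← extChartAt_source I6])
    have hηs : FormSmoothAt 𝓘(ℝ, E6) (M := E6) η (φ x) :=
      formSmoothAt_iff_of_modelSpace.2 hη.contDiffAt
    refine ⟨formSmoothAt_pullbackForm hφs hηs, ?_⟩
    rw [extD_pullbackForm hφs hηs]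
    have h1 : pullbackForm I6 𝓘(ℝ, E6) φ (extD 𝓘(ℝ, E6) (M := E6) η) x
        = pullbackForm I6 𝓘(ℝ, E6) φ (pullbackForm 𝓘(ℝ, E6) I6 φ.symm F) x := by
      unfold pullbackForm
      rw [extD_modelSpace, hηF _ hxr]
      rfl
    rw [h1, ← pullbackForm_comp (mdifferentiableAt_extChartAt_symm (φ.map_source hx))
      (hφs.mdifferentiableAt (by simp))]
    have h2 : φ.symm ∘ φ =ᶠ[𝓝 x] id := by
      filter_upwards [(isOpen_extChartAt_source (I := I6) p).mem_nhds hx] with z hz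
      exact φ.left_inv hz
    rw [pullbackForm_congr h2, pullbackForm_id]

end ModelTheorem

/-! ### The inverse function theorem on manifolds -/

section InverseFunction

/-- The inverse function theorem for smooth maps, with a smooth inverse on the whole target. -/
lemma exists_openPartialHomeomorph_of_bijective {E F : Type*} [NormedAddCommGroup E]
    [NormedSpace ℝ E] [CompleteSpace E] [NormedAddCommGroup F] [NormedSpace ℝ F] [CompleteSpace F]
    {f : E → F} {s : Set E} (hs : IsOpen s) {a : E} (ha : a ∈ s)
    (hf : ∀ z ∈ s, ContDiffAt ℝ ∞ f z) (hb : Function.Bijective (fderiv ℝ f a)) :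
    ∃ G : OpenPartialHomeomorph E F, a ∈ G.source ∧ G.source ⊆ s ∧ (∀ z, G z = f z) ∧
      ∀ y ∈ G.target, ContDiffAt ℝ ∞ G.symm y := by
  have hne : (∞ : WithTop ℕ∞) ≠ 0 := by simp
  let f' : E ≃L[ℝ] F := ContinuousLinearEquiv.ofBijective (fderiv ℝ f a)
    (LinearMap.ker_eq_bot.2 hb.1) (LinearMap.range_eq_top.2 hb.2)
  have hf' : HasFDerivAt f (f' : E →L[ℝ] F) a := by
    rw [ContinuousLinearEquiv.coe_ofBijective]
    exact ((hf a ha).differentiableAt hne).hasFDerivAt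
  set G₀ := (hf a ha).toOpenPartialHomeomorph f hf' hne with hG₀
  have hG₀f : ∀ z, G₀ z = f z := fun z => rfl
  set T : Set E := s ∩ {z | fderiv ℝ f z ∈ range ((↑) : (E ≃L[ℝ] F) → E →L[ℝ] F)} with hT
  have hTo : IsOpen T := by
    rw [isOpen_iff_mem_nhds]
    rintro z ⟨hz, hz'⟩
    have hc : ContinuousAt (fderiv ℝ f) z :=
      ((hf z hz).fderiv_right (m := 0) (by simp)).continuousAt
    exact Filter.inter_mem (hs.mem_nhds hz)
      (hc.preimage_mem_nhds (ContinuousLinearEquiv.isOpen.mem_nhds hz'))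
  refine ⟨G₀.restrOpen T hTo, ⟨(hf a ha).mem_toOpenPartialHomeomorph_source hf' hne, ha,
    f', hf'.fderiv.symm⟩, fun z hz => hz.2.1, fun z => rfl, fun y hy => ?_⟩
  have hz := (G₀.restrOpen T hTo).map_target hy
  obtain ⟨e, he⟩ := hz.2.2
  refine (G₀.restrOpen T hTo).contDiffAt_symm (f₀' := e) hy ?_ (hf _ hz.2.1)
  rw [he]
  exact ((hf _ hz.2.1).differentiableAt hne).hasFDerivAt

variable {E : Type*} [NormedAddCommGroup E] [NormedSpace ℝ E] [CompleteSpace E] {H : Type*}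
  [TopologicalSpace H] {I : ModelWithCorners ℝ E H} {M : Type*} [TopologicalSpace M]
  [ChartedSpace H M]
  {E' : Type*} [NormedAddCommGroup E'] [NormedSpace ℝ E'] [CompleteSpace E'] {H' : Type*}
  [TopologicalSpace H'] {I' : ModelWithCorners ℝ E' H'} {M' : Type*} [TopologicalSpace M']
  [ChartedSpace H' M']

/-- The inverse function theorem for smooth maps between manifolds without boundary. -/
lemma exists_localDiffeo_of_bijective [I.Boundaryless] [I'.Boundaryless] [IsManifold I ∞ M]
    [IsManifold I' ∞ M'] {f : M → M'} {O : Set M} (hO : IsOpen O) {x : M} (hx : x ∈ O)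
    (hf : ∀ y ∈ O, ContMDiffAt I I' ∞ f y) (hb : Function.Bijective (mfderiv I I' f x)) :
    ∃ F : OpenPartialHomeomorph M M', x ∈ F.source ∧ F.source ⊆ O ∧ (∀ y ∈ F.source, F y = f y) ∧
      ContMDiffOn I I' ∞ F F.source ∧ ContMDiffOn I' I ∞ F.symm F.target := by
  set c : OpenPartialHomeomorph M E := (chartAt H x).transHomeomorph I.toHomeomorph with hc
  set c' : OpenPartialHomeomorph M' E' := (chartAt H' (f x)).transHomeomorph I'.toHomeomorph
    with hc'
  have e1 : extChartAt I x = c.toPartialEquiv := by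
    refine PartialEquiv.ext (fun _ => rfl) (fun _ => rfl) ?_
    rw [extChartAt_source]; rfl
  have e1' : extChartAt I' (f x) = c'.toPartialEquiv := by
    refine PartialEquiv.ext (fun _ => rfl) (fun _ => rfl) ?_
    rw [extChartAt_source]; rfl
  set s : Set E := (extChartAt I x).target ∩ (extChartAt I x).symm ⁻¹'
    (O ∩ f ⁻¹' (extChartAt I' (f x)).source) with hs
  have hcont : ContinuousOn f O := fun y hy => (hf y hy).continuousAt.continuousWithinAt
  have hO1 : IsOpen (O ∩ f ⁻¹' (extChartAt I' (f x)).source) :=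
    hcont.isOpen_inter_preimage hO (isOpen_extChartAt_source (f x))
  have hso : IsOpen s :=
    (continuousOn_extChartAt_symm x).isOpen_inter_preimage (isOpen_extChartAt_target x) hO1
  have hxs : extChartAt I x x ∈ s := by
    refine ⟨mem_extChartAt_target x, ?_⟩
    rw [mem_preimage, extChartAt_to_inv]
    exact ⟨hx, mem_extChartAt_source (f x)⟩
  have hfs : ∀ z ∈ s, ContDiffAt ℝ ∞ (writtenInExtChartAt I I' x f) z := by
    intro z hz
    have h1 : ContMDiffAt I' 𝓘(ℝ, E') ∞ (extChartAt I' (f x)) (f ((extChartAt I x).symm z)) :=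
      contMDiffAt_extChartAt' (by rw [← extChartAt_source I']; exact hz.2.2)
    exact (h1.comp z ((hf _ hz.2.1).comp z (contMDiffAt_extChartAt_symm_apply hz.1))).contDiffAt
  have hder : mfderiv I I' f x = fderiv ℝ (writtenInExtChartAt I I' x f) (extChartAt I x x) := by
    rw [((hf x hx).mdifferentiableAt (by simp)).mfderiv, I.range_eq_univ, fderivWithin_univ]
  rw [hder] at hb
  obtain ⟨G, hG1, hG2, hG3, hG4⟩ := exists_openPartialHomeomorph_of_bijective hso hxs hfs hb
  have hF : ∀ y ∈ ((c.trans G).trans c'.symm).source,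
      y ∈ (extChartAt I x).source ∧ extChartAt I x y ∈ s ∧ y ∈ O ∧
        f y ∈ (extChartAt I' (f x)).source := by
    rintro y ⟨⟨hy1, hy2⟩, -⟩
    have hy1' : y ∈ (extChartAt I x).source := by rw [e1]; exact hy1
    have hy3 : extChartAt I x y ∈ s := by
      rw [e1]; exact hG2 hy2
    have hy4 := hy3.2
    rw [mem_preimage, (extChartAt I x).left_inv hy1'] at hy4
    exact ⟨hy1', hy3, hy4⟩
  have hFf : ∀ y ∈ ((c.trans G).trans c'.symm).source, ((c.trans G).trans c'.symm) y = f y := by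
    intro y hy
    obtain ⟨h1, h2, h3, h4⟩ := hF y hy
    have h5 : ((c.trans G).trans c'.symm) y
        = (extChartAt I' (f x)).symm (G (extChartAt I x y)) := by
      rw [e1, e1']; rfl
    rw [h5, hG3]
    show (extChartAt I' (f x)).symm (extChartAt I' (f x)
      (f ((extChartAt I x).symm (extChartAt I x y)))) = f y
    rw [(extChartAt I x).left_inv h1, (extChartAt I' (f x)).left_inv h4]
  refine ⟨(c.trans G).trans c'.symm, ?_, fun y hy => (hF y hy).2.2.1, hFf, ?_, ?_⟩
  · have h1 : x ∈ c.source := by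
      rw [← e1]; exact mem_extChartAt_source x
    have h2 : c x = extChartAt I x x := by rw [e1]; rfl
    have h3 : f x ∈ c'.source := by
      rw [← e1']; exact mem_extChartAt_source (f x)
    have h4 : G (c x) = c' (f x) := by
      rw [h2, hG3]
      show extChartAt I' (f x) (f ((extChartAt I x).symm (extChartAt I x x))) = c' (f x)
      rw [extChartAt_to_inv, e1']; rfl
    refine ⟨⟨h1, ?_⟩, ?_⟩
    · show c x ∈ G.source
      rw [h2]; exact hG1
    · show G (c x) ∈ c'.target
      rw [h4]; exact c'.map_source h3
  · exact fun y hy => ((hf y (hF y hy).2.2.1).contMDiffWithinAt).congr hFf (hFf y hy)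
  · intro y hy
    obtain ⟨⟨hy1, hy2⟩, hy3⟩ : (y ∈ c'.source ∧ c' y ∈ G.target) ∧ G.symm (c' y) ∈ c.target := by
      have hy' : y ∈ ((c.trans G).trans c'.symm).symm.source := hy
      simpa [OpenPartialHomeomorph.trans_source, and_assoc] using hy'
    have k1 : y ∈ (chartAt H' (f x)).source := by
      rw [← extChartAt_source I', e1']; exact hy1
    have k3 : G.symm (c' y) ∈ (extChartAt I x).target := by rw [e1]; exact hy3
    have h1 : ContMDiffAt I' 𝓘(ℝ, E') ∞ (extChartAt I' (f x)) y := contMDiffAt_extChartAt' k1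
    have h2 : ContMDiffAt 𝓘(ℝ, E') 𝓘(ℝ, E) ∞ G.symm (extChartAt I' (f x) y) := by
      rw [e1']; exact (hG4 _ hy2).contMDiffAt
    have h3 : ContMDiffAt 𝓘(ℝ, E) I ∞ (extChartAt I x).symm (G.symm (extChartAt I' (f x) y)) := by
      refine contMDiffAt_extChartAt_symm_apply ?_
      rw [e1']; exact k3
    have h4 := h3.comp y (h2.comp y h1)
    rw [e1, e1'] at h4
    exact h4.contMDiffWithinAt

end InverseFunction

/-! ### Pointwise geometry of a quotient -/

section Quotient

variable {Y : Type*} [TopologicalSpace Y] [ChartedSpace (ModelProd ℝ E6) Y] [IsManifold I7 ∞ Y]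
  {k : BForm I7 Y} {V : VField I7 Y}

lemma finrank_real_prod_E6 : Module.finrank ℝ (ℝ × E6) = 7 := by
  rw [Module.finrank_prod, finrank_E6, Module.finrank_self]

/-- The metric of a `G₂` structure is definite. -/
lemma IsG2Coframe.eq_zero_of_apply_self {e : Fin 7 → (ℝ × E6) →L[ℝ] ℝ}
    {k : (ℝ × E6) →L[ℝ] (ℝ × E6) →L[ℝ] ℝ} {φ : (ℝ × E6) [⋀^Fin 3]→L[ℝ] ℝ}
    {χ : (ℝ × E6) [⋀^Fin 4]→L[ℝ] ℝ} (he : IsG2Coframe e k φ χ) {u : ℝ × E6} (hu : k u u = 0) :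
    u = 0 := by
  rw [he.2.1] at hu
  refine coframe_ext he.1 finrank_real_prod_E6 fun i => ?_
  have h1 := (Finset.sum_eq_zero_iff_of_nonneg fun i _ => mul_self_nonneg (e i u)).1 hu i
    (Finset.mem_univ i)
  rw [mul_self_eq_zero.1 h1, map_zero]

lemma formSmoothAt_connectionForm {y : Y} (hk : MetricSmoothAt I7 k y) (hV : FieldSmoothAt I7 V y)
    (h0 : k y (V y) (V y) ≠ 0) :
    FormSmoothAt I7 (fun z => oneForm (connectionForm k V z)) y := by
  have hf := contMDiffAt_iff_inChart.1 (contMDiffAt_bilin_apply hk hV hV)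
  have hk' := metricSmoothAt_iff.1 hk
  have hV' := fieldSmoothAt_iff.1 hV
  have h0' : (fun u => k ((extChartAt I7 y).symm u) (V ((extChartAt I7 y).symm u))
      (V ((extChartAt I7 y).symm u))) (extChartAt I7 y y) ≠ 0 := by
    show k ((extChartAt I7 y).symm (extChartAt I7 y y)) _ _ ≠ 0
    rw [extChartAt_to_inv]; exact h0
  have key : ContDiffAt ℝ ∞ (fun z => oneForm
      ((k ((extChartAt I7 y).symm z) (V ((extChartAt I7 y).symm z))
        (V ((extChartAt I7 y).symm z)))⁻¹ •
        bilinInChart I7 k y z (fieldInChart (E := ℝ × E6) I7 V y z))) (extChartAt I7 y y) :=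
    contDiffAt_oneForm (contDiffAt_real_smul (hf.inv h0') (hk'.clm_apply hV'))
  refine key.congr_of_eventuallyEq ?_
  filter_upwards [eventually_mem_target (I := I7) y] with z hz
  ext v
  have h1 := mfderiv_fieldInChart V hz
  exact congrArg (fun w => (k ((extChartAt I7 y).symm z) (V ((extChartAt I7 y).symm z))
    (V ((extChartAt I7 y).symm z)))⁻¹ * k ((extChartAt I7 y).symm z) w
      (mfderiv 𝓘(ℝ, ℝ × E6) I7 (extChartAt I7 y).symm z (v 0))) h1.symm

variable {N : Type*} [TopologicalSpace N] [ChartedSpace E6 N] [IsManifold I6 ∞ N]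
  {S : SU3Structure N} {W : Set N} {t : N → ℝ} {O : Set Y} {φ : DForm I7 Y 3} {χ : DForm I7 Y 4}
  {pr : Y → N}

namespace SU3Structure.IsG2QuotientOn

variable (hq : S.IsG2QuotientOn W t O k φ χ V pr) {y : Y} (hy : y ∈ O)

include hq hy

lemma metric_V_pos : 0 < k y (V y) (V y) := by
  obtain ⟨e, he⟩ := hq.torsionFree.coframe y hy
  have h0 := hq.V_ne_zero y hy
  rw [he.2.1]
  refine lt_of_le_of_ne (Finset.sum_nonneg fun i _ => mul_self_nonneg _) fun h => h0 ?_
  exact IsG2Coframe.eq_zero_of_apply_self he ((he.2.1 _ _).trans h.symm)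

lemma t_pos : 0 < t (pr y) := by
  rw [hq.t_eq y hy]
  exact inv_pos.2 (Real.sqrt_pos.2 (hq.metric_V_pos hy))

lemma inv_sq_t : (t (pr y) ^ 2)⁻¹ = k y (V y) (V y) := by
  rw [hq.t_eq y hy, inv_pow, inv_inv, Real.sq_sqrt (hq.metric_V_pos hy).le]

lemma connectionForm_V : connectionForm k V y (V y) = 1 :=
  inv_mul_cancel₀ (hq.metric_V_pos hy).ne'

/-- The field `V` is tangent to the fibres: `k(V, V) = t⁻²` leaves no room for
`t h(d pr V, d pr V)`. -/
lemma mfderiv_pr_V : mfderiv I7 I6 pr y (V y) = 0 := by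
  have h := hq.k_eq y hy (V y) (V y)
  rw [hq.connectionForm_V hy, hq.inv_sq_t hy, mul_one, mul_one] at h
  by_contra h0
  have h1 := mul_pos (hq.t_pos hy) (S.h.pos (pr y) _ h0)
  linarith

/-- The kernel of `d pr` is spanned by `V`: on this kernel `k` is `t⁻² η ⊗ η`, so the difference of
the two sides has length zero. -/
lemma eq_smul_V {u : TangentSpace I7 y} (hu : mfderiv I7 I6 pr y u = 0) :
    u = connectionForm k V y u • V y := by
  obtain ⟨e, he⟩ := hq.torsionFree.coframe y hy
  set c := connectionForm k V y u with hc
  have h1 : mfderiv I7 I6 pr y (u - c • V y) = 0 := by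
    rw [map_sub, map_smul, hu, hq.mfderiv_pr_V hy, smul_zero, sub_zero]
  have h2 : connectionForm k V y (u - c • V y) = 0 := by
    rw [map_sub, map_smul, hq.connectionForm_V hy, smul_eq_mul, mul_one, sub_self]
  have h3 := hq.k_eq y hy (u - c • V y) (u - c • V y)
  rw [h1, h2, map_zero, mul_zero, mul_zero, mul_zero, add_zero] at h3
  exact sub_eq_zero.1 (IsG2Coframe.eq_zero_of_apply_self he h3)

/-- The function `t ∘ pr` is smooth. -/
lemma contMDiffAt_t_pr : ContMDiffAt I7 𝓘(ℝ, ℝ) ∞ (fun z => t (pr z)) y := by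
  have h1 := contMDiffAt_bilin_apply (hq.torsionFree.smooth_k y hy) (hq.smooth_V y hy)
    (hq.smooth_V y hy)
  have h2 : ContDiffAt ℝ ∞ (fun s : ℝ => (Real.sqrt s)⁻¹) (k y (V y) (V y)) :=
    (Real.contDiffAt_sqrt (hq.metric_V_pos hy).ne').inv
      (Real.sqrt_pos.2 (hq.metric_V_pos hy)).ne'
  refine (h2.contMDiffAt.comp y h1).congr_of_eventuallyEq ?_
  filter_upwards [hq.isOpen.mem_nhds hy] with z hz
  exact hq.t_eq z hz

lemma contMDiffAt_pr : ContMDiffAt I7 I6 ∞ pr y :=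
  (hq.smooth_pr y hy).contMDiffAt (hq.isOpen.mem_nhds hy)

/-- The `3`-form of the total space in terms of the quotient structure. -/
lemma phi_eq : φ y = wedge (pullbackForm I7 I6 pr S.σ y) (oneForm (connectionForm k V y))
    + t (pr y) ^ (3 / 2 : ℝ) • pullbackForm I7 I6 pr S.ψp y := by
  have ht := hq.t_pos hy
  have h1 : t (pr y) ^ (3 / 2 : ℝ) * (Real.sqrt (t (pr y)))⁻¹ * (t (pr y))⁻¹ = 1 := by
    rw [Real.sqrt_eq_rpow, ← Real.rpow_neg_one (t (pr y)), ← Real.rpow_neg ht.le,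
      ← Real.rpow_add ht, ← Real.rpow_add ht]
    norm_num
  rw [hq.σ_eq y hy, hq.ψp_eq y hy, smul_smul, smul_smul, h1, one_smul, add_sub_cancel]

/-- The dual `4`-form of the total space in terms of the quotient structure: the Hodge star is
determined by the metric and the `3`-form. -/
lemma chi_eq : χ y = t (pr y) ^ (1 / 2 : ℝ) •
      wedge (pullbackForm I7 I6 pr S.ψm y) (oneForm (connectionForm k V y))
    + (1 / 2 * t (pr y) ^ 2 : ℝ) •
      wedge (pullbackForm I7 I6 pr S.σ y) (pullbackForm I7 I6 pr S.σ y) := by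
  obtain ⟨e, he⟩ := hq.torsionFree.coframe y hy
  obtain ⟨e₀, he₀⟩ := S.coframe (pr y)
  obtain ⟨e', he'⟩ := he₀.exists_isG2Coframe (hq.submersion y hy) (hq.mfderiv_pr_V hy)
    (hq.connectionForm_V hy) (hq.t_pos hy)
  refine IsG2Coframe.star_unique finrank_real_prod_E6 he (e' := e') ?_
  have hk : k y = t (pr y) • pullbackBilin (S.h.inner (pr y)) (mfderiv I7 I6 pr y)
      + (t (pr y) ^ 2)⁻¹ • sqCovector (connectionForm k V y) := by
    ext u : 1
    ext v : 1
    exact hq.k_eq y hy u v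
  have hφ := hq.phi_eq hy
  rw [hk, hφ]
  exact he'

end SU3Structure.IsG2QuotientOn

end Quotient

/-! ### Straightening the vector field -/

section Straightening

variable {Y : Type*} [TopologicalSpace Y] [ChartedSpace (ModelProd ℝ E6) Y] [IsManifold I7 ∞ Y]
  {k : BForm I7 Y} {V : VField I7 Y}
  {N : Type*} [TopologicalSpace N] [ChartedSpace E6 N] [IsManifold I6 ∞ N]
  {S : SU3Structure N} {W : Set N} {t : N → ℝ} {O : Set Y} {φ : DForm I7 Y 3} {χ : DForm I7 Y 4}
  {pr : Y → N}

set_option linter.unusedSectionVars false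

lemma contMDiffAt_dfun_apply {E : Type*} [NormedAddCommGroup E] [NormedSpace ℝ E]
    [FiniteDimensional ℝ E] {H : Type*} [TopologicalSpace H] {I : ModelWithCorners ℝ E H}
    [I.Boundaryless] {M : Type*} [TopologicalSpace M] [ChartedSpace H M] [IsManifold I ∞ M]
    {f : M → ℝ} {X : VField I M} {x : M}
    (hf : ∀ᶠ y in 𝓝 x, ContMDiffAt I 𝓘(ℝ, ℝ) ∞ f y) (hX : FieldSmoothAt I X x) :
    ContMDiffAt I 𝓘(ℝ, ℝ) ∞ (fun y => dfun I f y (X y)) x := by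
  rw [contMDiffAt_iff_inChart]
  have h1 : ContDiffAt ℝ ∞ (fderiv ℝ fun u => f ((extChartAt I x).symm u)) (extChartAt I x x) :=
    (contMDiffAt_iff_inChart.1 hf.self_of_nhds).fderiv_right (by simp)
  refine (h1.clm_apply (fieldSmoothAt_iff.1 hX)).congr_of_eventuallyEq ?_
  filter_upwards [eventually_mem_target (I := I) x, eventually_inChart hf] with z hz hz'
  rw [fderiv_comp_extChartAt_symm hz hz']
  exact congrArg (dfun I f ((extChartAt I x).symm z)) (mfderiv_fieldInChart X hz).symm

lemma mfderiv_prodMk_apply {τ : Y → ℝ} {y : Y} (hτ : ContMDiffAt I7 𝓘(ℝ, ℝ) ∞ τ y)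
    (hpr : ContMDiffAt I7 I6 ∞ pr y) (u : ℝ × E6) :
    (mfderiv I7 I7 (fun z => (τ z, pr z)) y u : ℝ × E6)
      = (dfun I7 τ y u, (mfderiv I7 I6 pr y u : E6)) := by
  have h := mfderiv_prodMk (hτ.mdifferentiableAt (by simp)) (hpr.mdifferentiableAt (by simp))
  exact congrArg (fun L : (ℝ × E6) →L[ℝ] ℝ × E6 => L u) h

namespace SU3Structure.IsG2QuotientOn

/-- A function that is not stationary along `V` and the projection are local coordinates. -/
lemma exists_localDiffeo (hq : S.IsG2QuotientOn W t O k φ χ V pr) {O' : Set Y} (hO' : IsOpen O')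
    (hOO : O' ⊆ O) {y : Y} (hy : y ∈ O') {τ : Y → ℝ}
    (hτ : ∀ z ∈ O', ContMDiffAt I7 𝓘(ℝ, ℝ) ∞ τ z) (hV : dfun I7 τ y (V y) ≠ 0) :
    ∃ F : OpenPartialHomeomorph Y (ℝ × N), y ∈ F.source ∧ F.source ⊆ O' ∧
      (∀ z ∈ F.source, F z = (τ z, pr z)) ∧ ContMDiffOn I7 I7 ∞ F F.source ∧
      ContMDiffOn I7 I7 ∞ F.symm F.target := by
  refine exists_localDiffeo_of_bijective hO' hy (f := fun z => (τ z, pr z))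
    (fun z hz => (hτ z hz).prodMk (hq.contMDiffAt_pr (hOO hz))) ?_
  set L : (ℝ × E6) →L[ℝ] ℝ × E6 := mfderiv I7 I7 (fun z => (τ z, pr z)) y with hL
  have hLu : ∀ u, L u = (dfun I7 τ y u, (mfderiv I7 I6 pr y u : E6)) :=
    mfderiv_prodMk_apply (hτ y hy) (hq.contMDiffAt_pr (hOO hy))
  have hinj : Function.Injective L := by
    refine (injective_iff_map_eq_zero L).2 fun u hu => ?_
    replace hu := Prod.mk_eq_zero.1 ((hLu u).symm.trans hu)
    have h1 : u = connectionForm k V y u • V y := hq.eq_smul_V (hOO hy) hu.2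
    have h2 : dfun I7 τ y u = connectionForm k V y u * dfun I7 τ y (V y) := by
      conv_lhs => rw [h1]
      exact map_smul (dfun I7 τ y) _ _
    rw [hu.1] at h2
    rcases mul_eq_zero.1 h2.symm with h | h
    · rw [h1, h]; exact zero_smul ℝ (V y)
    · exact absurd h hV
  exact ⟨hinj, (LinearMap.injective_iff_surjective (f := L.toLinearMap)).1 hinj⟩

/-- Near every point there is a smooth function whose derivative along `V` is `1`. -/
lemma exists_time (hq : S.IsG2QuotientOn W t O k φ χ V pr) {y : Y} (hy : y ∈ O) :
    ∃ O' : Set Y, IsOpen O' ∧ O' ⊆ O ∧ y ∈ O' ∧ ∃ τ : Y → ℝ,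
      (∀ z ∈ O', ContMDiffAt I7 𝓘(ℝ, ℝ) ∞ τ z) ∧ ∀ z ∈ O', dfun I7 τ z (V z) = 1 := by
  have : IsManifold I7 1 Y := IsManifold.of_le (m := 1) (n := ∞) (by simp)
  have : IsManifold I7 1 (ℝ × N) := IsManifold.of_le (m := 1) (n := ∞) (by simp)
  -- A function `τ₀` with `dτ₀(V) = 1` at `y`, linear in a chart.
  set L₀ : (ℝ × E6) →L[ℝ] ℝ := connectionForm k V y with hL₀
  set τ₀ : Y → ℝ := fun z => L₀ (extChartAt I7 y z) with hτ₀
  have hO1 : IsOpen (O ∩ (extChartAt I7 y).source) :=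
    hq.isOpen.inter (isOpen_extChartAt_source y)
  have hτs : ∀ z ∈ O ∩ (extChartAt I7 y).source, ContMDiffAt I7 𝓘(ℝ, ℝ) ∞ τ₀ z := by
    intro z hz
    have h1 : ContMDiffAt I7 𝓘(ℝ, ℝ × E6) ∞ (extChartAt I7 y) z :=
      contMDiffAt_extChartAt' (by rw [← extChartAt_source I7]; exact hz.2)
    exact L₀.contMDiff.contMDiffAt.comp z h1
  have hyO1 : y ∈ O ∩ (extChartAt I7 y).source := ⟨hy, mem_extChartAt_source y⟩
  have hτy : dfun I7 τ₀ y (V y) = 1 := by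
    rw [dfun_eq (hτs y hyO1)]
    have h1 : (fun u => τ₀ ((extChartAt I7 y).symm u)) =ᶠ[𝓝 (extChartAt I7 y y)] L₀ := by
      filter_upwards [eventually_mem_target (I := I7) y] with u hu
      exact congrArg L₀ ((extChartAt I7 y).right_inv hu)
    rw [h1.fderiv_eq, L₀.fderiv]
    exact hq.connectionForm_V hy
  set f : Y → ℝ := fun z => dfun I7 τ₀ z (V z) with hf
  have hfs : ∀ z ∈ O ∩ (extChartAt I7 y).source, ContMDiffAt I7 𝓘(ℝ, ℝ) ∞ f z := by
    intro z hz
    refine contMDiffAt_dfun_apply ?_ (hq.smooth_V z hz.1)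
    filter_upwards [hO1.mem_nhds hz] with w hw
    exact hτs w hw
  have hA : IsOpen ((O ∩ (extChartAt I7 y).source) ∩ f ⁻¹' {0}ᶜ) := by
    have hc : ContinuousOn f (O ∩ (extChartAt I7 y).source) := fun z hz =>
      (hfs z hz).continuousAt.continuousWithinAt
    exact hc.isOpen_inter_preimage hO1 isOpen_compl_singleton
  have hyA : y ∈ (O ∩ (extChartAt I7 y).source) ∩ f ⁻¹' {0}ᶜ :=
    ⟨hyO1, by show ¬ dfun I7 τ₀ y (V y) = 0; rw [hτy]; exact one_ne_zero⟩
  obtain ⟨F, hyF, hFA, hF, hFs, hFs'⟩ := hq.exists_localDiffeo hA (fun z hz => hz.1.1) hyA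
    (fun z hz => hτs z hz.1) (by rw [hτy]; exact one_ne_zero)
  -- In the coordinates `(τ₀, pr)`, `V = f ∂/∂s`, and a primitive of `1 / f` in `s` has derivative
  -- `1` along `V`.
  set C := extChartAt I7 (F y) with hC
  have hso : IsOpen (C.target ∩ C.symm ⁻¹' F.target) :=
    (continuousOn_extChartAt_symm (F y)).isOpen_inter_preimage
      (isOpen_extChartAt_target (F y)) F.open_target
  have hps : C (F y) ∈ C.target ∩ C.symm ⁻¹' F.target :=
    ⟨mem_extChartAt_target (F y), by
      rw [mem_preimage, extChartAt_to_inv]; exact F.map_source hyF⟩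
  obtain ⟨r, hr, hrs, v, hv, hvg⟩ := exists_primitive hso hps
    (g := fun p => (f (F.symm (C.symm p)))⁻¹) (fun p hp => by
      have h1 : ContMDiffAt 𝓘(ℝ, ℝ × E6) I7 ∞ C.symm p :=
        contMDiffAt_extChartAt_symm_apply hp.1
      have h2 : ContMDiffAt I7 I7 ∞ F.symm (C.symm p) :=
        (hFs' _ hp.2).contMDiffAt (F.open_target.mem_nhds hp.2)
      have h3 := hFA (F.map_target hp.2)
      have h4 : ContDiffAt ℝ ∞ (fun p => f (F.symm (C.symm p))) p :=
        (ContMDiffAt.comp (g := f) p (hfs _ h3.1) (h2.comp p h1)).contDiffAt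
      exact h4.inv h3.2)
  set w : ℝ × N → ℝ := fun q => v (C q) with hw
  have hws : ∀ q ∈ C.source, ContMDiffAt I7 𝓘(ℝ, ℝ) ∞ w q := by
    intro q hq
    have h1 : ContMDiffAt I7 𝓘(ℝ, ℝ × E6) ∞ C q :=
      contMDiffAt_extChartAt' (by rw [← extChartAt_source I7]; exact hq)
    exact hv.contMDiff.contMDiffAt.comp q h1
  have hdw : ∀ q ∈ C.source, C q ∈ Metric.ball (C (F y)) r →
      dfun I7 w q (modelField q) = (f (F.symm q))⁻¹ := by
    intro q hq hqr
    have h1 := hvg _ hqr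
    have h2 : (fun u => w (C.symm u)) =ᶠ[𝓝 (C q)] v := by
      filter_upwards [(isOpen_extChartAt_target (I := I7) (F y)).mem_nhds (C.map_source hq)]
        with u hu
      exact congrArg v (C.right_inv hu)
    have h3 := fderiv_comp_extChartAt_symm (I := I7) (f := w) (x := F y) (z := C q)
      (C.map_source hq) (by
        have h4 := hws q hq
        rw [← C.left_inv hq] at h4; exact h4) ((1, 0) : ℝ × E6)
    rw [← hC, h2.fderiv_eq, h1] at h3
    have h5 : (mfderiv 𝓘(ℝ, ℝ × E6) I7 C.symm (C q) ((1, 0) : ℝ × E6) : ℝ × E6) = (1, 0) := by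
      refine (mfderiv_extChartAt_prod_symm (C.map_source hq) _).trans ?_
      exact congrArg (fun a : E6 => ((1 : ℝ), a)) (map_zero _)
    have h6 : ∀ (q' : ℝ × N), C.symm (C q) = q' → ∀ X : ℝ × E6, X = (1, 0) →
        (f (F.symm (C.symm (C q))))⁻¹ = dfun I7 w (C.symm (C q)) X →
        dfun I7 w q' (modelField q') = (f (F.symm q'))⁻¹ := by
      rintro q' rfl X rfl h; exact h.symm
    exact h6 q (C.left_inv hq) _ h5 h3
  have hFc : ContinuousOn F F.source := F.continuousOn
  have hB : IsOpen (C.source ∩ C ⁻¹' Metric.ball (C (F y)) r) :=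
    (continuousOn_extChartAt (F y)).isOpen_inter_preimage (isOpen_extChartAt_source (F y))
      Metric.isOpen_ball
  refine ⟨F.source ∩ F ⁻¹' (C.source ∩ C ⁻¹' Metric.ball (C (F y)) r),
    hFc.isOpen_inter_preimage F.open_source hB, fun z hz => (hFA hz.1).1.1,
    ⟨hyF, mem_extChartAt_source (F y), Metric.mem_ball_self hr⟩, fun z => w (F z), ?_, ?_⟩
  · rintro z ⟨hz, hz'⟩
    exact (hws _ hz'.1).comp z ((hFs z hz).contMDiffAt (F.open_source.mem_nhds hz))
  · rintro z ⟨hz, hz'⟩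
    have hzA := hFA hz
    have hFz := (hFs z hz).contMDiffAt (F.open_source.mem_nhds hz)
    have h1 : mfderiv I7 I7 F z (V z) = f z • (modelField (F z) : TangentSpace I7 (F z)) := by
      have h2 : (F : Y → ℝ × N) =ᶠ[𝓝 z] fun z => (τ₀ z, pr z) := by
        filter_upwards [F.open_source.mem_nhds hz] with z' hz'
        exact hF z' hz'
      have h3 := congrArg (fun L : (ℝ × E6) →L[ℝ] ℝ × E6 => L (V z))
        (h2.mfderiv_eq (I := I7) (I' := I7))
      refine h3.trans ((mfderiv_prodMk_apply (hτs z hzA.1) (hq.contMDiffAt_pr hzA.1.1) _).trans ?_)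
      refine (congrArg (fun a : E6 => (f z, a)) (hq.mfderiv_pr_V hzA.1.1)).trans ?_
      show (f z, (0 : E6)) = f z • ((1, 0) : ℝ × E6)
      rw [Prod.smul_mk, smul_eq_mul, mul_one, smul_zero]
    have h4 : dfun I7 (fun z => w (F z)) z (V z) = dfun I7 w (F z) (mfderiv I7 I7 F z (V z)) := by
      have h5 := mfderiv_comp z ((hws _ hz'.1).mdifferentiableAt (by simp))
        (hFz.mdifferentiableAt (by simp))
      exact congrArg (fun L : (ℝ × E6) →L[ℝ] ℝ => L (V z)) h5
    rw [h4, h1, map_smul, hdw _ hz'.1 hz'.2, F.left_inv hz]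
    exact mul_inv_cancel₀ hzA.2

/-- Near every point, `V` and the projection are straightened to `∂/∂v` and the projection of a
product `(a, b) × W'`. -/
lemma exists_box (hq : S.IsG2QuotientOn W t O k φ χ V pr) {y : Y} (hy : y ∈ O) :
    ∃ (F : OpenPartialHomeomorph Y (ℝ × N)) (a b : ℝ) (W' : Set N),
      y ∈ F.source ∧ F.source ⊆ O ∧ IsOpen W' ∧ F.target = Ioo a b ×ˢ W' ∧
      ContMDiffOn I7 I7 ∞ F F.source ∧ ContMDiffOn I7 I7 ∞ F.symm F.target ∧
      ∀ z ∈ F.source, (F z).2 = pr z ∧ mfderiv I7 I7 F z (V z) = modelField (F z) := by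
  obtain ⟨O', hO', hOO, hyO, τ, hτ, hτV⟩ := hq.exists_time hy
  obtain ⟨F, hyF, hFO, hF, hFs, hFs'⟩ := hq.exists_localDiffeo hO' hOO hyO hτ
    (by rw [hτV y hyO]; exact one_ne_zero)
  obtain ⟨A, B, hA, hB, hyA, hyB, hAB⟩ := isOpen_prod_iff.1 F.open_target (F y).1 (F y).2
    (F.map_source hyF)
  obtain ⟨a, b, hyab, hab⟩ := mem_nhds_iff_exists_Ioo_subset.1 (hA.mem_nhds hyA)
  have hbox : IsOpen (Ioo a b ×ˢ B) := isOpen_Ioo.prod hB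
  have hsub : Ioo a b ×ˢ B ⊆ F.target := fun q hq => hAB ⟨hab hq.1, hq.2⟩
  have hsrc : ∀ z, z ∈ (F.symm.restrOpen _ hbox).symm.source
      ↔ z ∈ F.source ∧ F z ∈ Ioo a b ×ˢ B := by
    intro z
    simp [OpenPartialHomeomorph.restrOpen]
  have htgt : (F.symm.restrOpen _ hbox).symm.target = Ioo a b ×ˢ B := by
    ext q
    exact ⟨fun h => h.2, fun h => ⟨hsub h, h⟩⟩
  refine ⟨(F.symm.restrOpen _ hbox).symm, a, b, B, (hsrc y).2 ⟨hyF, hyab, hyB⟩,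
    fun z hz => hOO (hFO ((hsrc z).1 hz).1), hB, htgt,
    hFs.mono fun z hz => ((hsrc z).1 hz).1, hFs'.mono (by rw [htgt]; exact hsub), ?_⟩
  intro z hz
  have hzF := ((hsrc z).1 hz).1
  have hzO := hFO hzF
  have h1 : (F.symm.restrOpen _ hbox).symm z = F z := rfl
  refine ⟨by rw [h1, hF z hzF], ?_⟩
  have h2 : (F : Y → ℝ × N) =ᶠ[𝓝 z] fun z => (τ z, pr z) := by
    filter_upwards [F.open_source.mem_nhds hzF] with z' hz'
    exact hF z' hz'
  have h3 := congrArg (fun L : (ℝ × E6) →L[ℝ] ℝ × E6 => L (V z))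
    (h2.mfderiv_eq (I := I7) (I' := I7))
  refine h3.trans ((mfderiv_prodMk_apply (hτ z hzO) (hq.contMDiffAt_pr (hOO hzO)) _).trans ?_)
  exact congrArg₂ (fun (r : ℝ) (a : E6) => (r, a)) (hτV z hzO) (hq.mfderiv_pr_V (hOO hzO))

end SU3Structure.IsG2QuotientOn

end Straightening

/-! ### Connection forms that are invariant under `∂/∂v` -/

section SigmaWedge

variable {E : Type*} [NormedAddCommGroup E] [NormedSpace ℝ E] [FiniteDimensional ℝ E]

/-- The wedge product with `σ` is injective on `1`-forms. -/
lemma IsSU3Coframe.eq_zero_of_sigma_wedge_one {e : Fin 6 → (E →L[ℝ] ℝ)} {h : E →L[ℝ] E →L[ℝ] ℝ}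
    {σ : E [⋀^Fin 2]→L[ℝ] ℝ} {ψp ψm : E [⋀^Fin 3]→L[ℝ] ℝ} (hE : Module.finrank ℝ E = 6)
    (he : IsSU3Coframe e h σ ψp ψm) {β : E [⋀^Fin 1]→L[ℝ] ℝ}
    (hβ : ∀ a b c : E, wedge σ β ![a, b, c] = 0) (a : E) : β ![a] = 0 := by
  obtain ⟨f, hf⟩ := exists_dual_vectors he.1
  have H : ∀ i j k : Fin 6, wedge σ β ![f i, f j, f k] = 0 := fun i j k => hβ _ _ _
  simp only [wedge_two_one, he.2.2.1, stdSigma_apply, Matrix.cons_val, hf] at H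
  have a0 := H 2 3 0
  have a1 := H 2 3 1
  have a2 := H 0 1 2
  have a3 := H 0 1 3
  have a4 := H 0 1 4
  have a5 := H 0 1 5
  simp at a0 a1 a2 a3 a4 a5
  obtain ⟨b, hb⟩ := exists_basis_of_dual he.1 hE hf
  set γ : E →L[ℝ] ℝ := (ContinuousAlternatingMap.ofSubsingleton ℝ E ℝ (0 : Fin 1)).symm β
  have hγ : ∀ u, γ u = β ![u] := fun u => congrArg β (Matrix.vec_single_eq_const u).symm
  have h0 : γ.toLinearMap = 0 := by
    refine b.ext fun i => ?_
    rw [hb]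
    refine (hγ _).trans ?_
    fin_cases i <;> assumption
  rw [← hγ]
  exact congrArg (fun L : E →ₗ[ℝ] ℝ => L a) h0

end SigmaWedge

section Invariance

variable {N : Type*} [TopologicalSpace N] [ChartedSpace E6 N] [IsManifold I6 ∞ N]

set_option linter.unusedSectionVars false

/-- The charts of `ℝ × N` are products with the identity of `ℝ`, and do not depend on the first
coordinate of their centre. -/
lemma formInChart_prod_eq {k : ℕ} (Θ : DForm I7 (ℝ × N) k) (r s : ℝ) (x : N) :
    formInChart I7 Θ (r, x) = formInChart I7 Θ (s, x) := by
  have h : ((extChartAt I7 (r, x)).symm : ℝ × E6 → ℝ × N) = (extChartAt I7 (s, x)).symm := by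
    rw [extChartAt_prod_symm_eq, extChartAt_prod_symm_eq]
  exact congrArg (fun e : ℝ × E6 → ℝ × N => fun u => (Θ (e u)).compContinuousLinearMap
    (mfderiv 𝓘(ℝ, ℝ × E6) I7 e u)) h

/-- A `1`-form `Θ` on `(a, b) × W` with `Θ(∂/∂v) = 1` and `ι_{∂/∂v} dΘ = 0` has the form
`dv + η_N`. -/
lemma eq_modelEta {Θ : DForm I7 (ℝ × N) 1} {a b : ℝ} {W : Set N} (hW : IsOpen W)
    (hs : ∀ q ∈ Ioo a b ×ˢ W, FormSmoothAt I7 Θ q)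
    (h1 : ∀ q ∈ Ioo a b ×ˢ W, Θ q ![modelField q] = 1)
    (hd : ∀ q ∈ Ioo a b ×ˢ W, ∀ w, extD I7 Θ q ![modelField q, w] = 0) {v₀ : ℝ}
    (hv₀ : v₀ ∈ Ioo a b) {q : ℝ × N} (hq : q ∈ Ioo a b ×ˢ W) :
    Θ q = modelEta (pullbackForm I6 I7 (fun x => (v₀, x)) Θ) q := by
  have : IsManifold I7 1 (ℝ × N) := IsManifold.of_le (m := 1) (n := ∞) (by simp)
  have hB : IsOpen (Ioo a b ×ˢ W) := isOpen_Ioo.prod hW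
  obtain ⟨s₀, x⟩ := q
  set u := extChartAt I6 x x with hu
  set θ := formInChart I7 Θ (v₀, x) with hθ
  have hθs : ∀ s, θ (s, u) = Θ (s, x) := fun s => by
    rw [hθ, formInChart_prod_eq Θ v₀ s x]
    exact formInChart_self Θ (s, x)
  have hder : ∀ s ∈ Ioo a b, HasDerivAt (fun s => θ (s, u)) 0 s := by
    intro s hs'
    have hsB : (s, x) ∈ Ioo a b ×ˢ W := ⟨hs', hq.2⟩
    have hθ' : θ = formInChart I7 Θ (s, x) := formInChart_prod_eq Θ v₀ s x
    have hc : ContDiffAt ℝ ∞ θ (s, u) := by rw [hθ']; exact hs _ hsB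
    have hdiff := hc.differentiableAt (by simp)
    -- In a product chart `(ι_{∂/∂v} dθ)(w) = ∂θ(w)/∂v - w(θ(∂/∂v))`, and `θ(∂/∂v)` is constant.
    have hone : ∀ᶠ z in 𝓝 ((s, u) : ℝ × E6), θ z ![((1 : ℝ), (0 : E6))] = 1 := by
      have h2 := eventually_inChart (I := I7) (hB.mem_nhds hsB)
      filter_upwards [h2, eventually_mem_target (I := I7) (s, x)] with z hz hz'
      rw [hθ']
      refine Eq.trans ?_ (h1 _ hz)
      refine congrArg (Θ ((extChartAt I7 (s, x)).symm z)) ?_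
      funext i
      fin_cases i
      refine (mfderiv_extChartAt_prod_symm hz' _).trans ?_
      exact congrArg (fun a : E6 => ((1 : ℝ), a))
        (map_zero (mfderiv 𝓘(ℝ, E6) I6 (extChartAt I6 x).symm z.2))
    have h0 : fderiv ℝ θ (s, u) (1, 0) = 0 := by
      refine form_ext_iff_zero.2 fun w => ?_
      have h3 := hd _ hsB (w 0)
      rw [extD_eq, ← hθ'] at h3
      have h4 := (extDeriv_one_apply θ (s, u) ![((1 : ℝ), (0 : E6)), w 0]).symm.trans h3
      have h5 : fderiv ℝ θ (s, u) (w 0) ![((1 : ℝ), (0 : E6))] = 0 := by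
        have h9 := fderiv_form_apply hdiff ![((1 : ℝ), (0 : E6))] (w 0)
        rw [← h9, Filter.EventuallyEq.fderiv_eq hone, fderiv_fun_const]
        rfl
      have h6 : w = ![w 0] := by funext i; fin_cases i; rfl
      rw [h6]
      have h7 : fderiv ℝ θ (s, u) (1, 0) ![w 0] - fderiv ℝ θ (s, u) (w 0) ![((1 : ℝ), (0 : E6))]
        = 0 := h4
      rw [h5, sub_zero] at h7
      exact h7
    have h8 := hdiff.hasFDerivAt.comp_hasDerivAt s
      ((hasDerivAt_id s).prodMk (hasDerivAt_const s u))
    rw [h0] at h8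
    exact h8
  have hconst : Θ (s₀, x) = (show (ℝ × E6) [⋀^Fin 1]→L[ℝ] ℝ from Θ (v₀, x)) := by
    rw [← hθs s₀, ← hθs v₀]
    refine isOpen_Ioo.is_const_of_fderiv_eq_zero isPreconnected_Ioo (𝕜 := ℝ)
      (f := fun s => θ (s, u))
      (fun s hs => (hder s hs).differentiableAt.differentiableWithinAt) (fun s hs => ?_) hq.1 hv₀
    rw [(hder s hs).hasFDerivAt.fderiv]
    ext; simp
  suffices key : ∀ w : Fin 1 → ℝ × E6, Θ (s₀, x) w
      = modelEta (pullbackForm I6 I7 (fun x => (v₀, x)) Θ) (s₀, x) w from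
    ContinuousAlternatingMap.ext key
  intro w
  have e1 : w = ![w 0] := by funext i; fin_cases i; rfl
  have e2 : mfderiv I6 I7 (fun x : N => (v₀, x)) x = ContinuousLinearMap.inr ℝ ℝ E6 :=
    mfderiv_prod_right
  have e3 : modelEta (pullbackForm I6 I7 (fun x => (v₀, x)) Θ) (s₀, x) w
      = (w 0).1 + Θ (v₀, x) ![((0 : ℝ), (w 0).2)] := by
    rw [← oneForm_modelCovector]
    refine (modelCovector_apply _ _ (w 0)).trans ?_
    refine congrArg (fun r => (w 0).1 + r) (congrArg (Θ (v₀, x)) ?_)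
    funext i
    fin_cases i
    exact congrArg (fun L : E6 →L[ℝ] ℝ × E6 => L (w 0).2) e2
  rw [e3]
  set γ : (ℝ × E6) →L[ℝ] ℝ :=
    (ContinuousAlternatingMap.ofSubsingleton ℝ (ℝ × E6) ℝ (0 : Fin 1)).symm (Θ (v₀, x)) with hγ
  have hγ' : ∀ u : ℝ × E6, γ u = Θ (v₀, x) ![u] := fun u =>
    congrArg (Θ (v₀, x)) (Matrix.vec_single_eq_const u).symm
  have e4 : γ (1, 0) = 1 := (hγ' _).trans (h1 _ ⟨hv₀, hq.2⟩)
  have e5 : w 0 = (w 0).1 • ((1 : ℝ), (0 : E6)) + (0, (w 0).2) := by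
    ext <;> simp
  have e6 : Θ (s₀, x) w = γ (w 0) :=
    (congrArg (fun α : (ℝ × E6) [⋀^Fin 1]→L[ℝ] ℝ => α w) hconst).trans
      ((congrArg (Θ (v₀, x)) e1).trans (hγ' (w 0)).symm)
  rw [e6]
  conv_lhs => rw [e5]
  rw [map_add, map_smul, e4, smul_eq_mul, mul_one]
  exact congrArg (fun r => (w 0).1 + r) (hγ' _)

end Invariance

/-! ### The forms of a quotient in straightened coordinates -/

section Contraction

variable {T : Type*} [AddCommGroup T] [Module ℝ T] [TopologicalSpace T]

lemma wedge_cons_of_interiorProd_eq_zero {α β : T [⋀^Fin 2]→L[ℝ] ℝ} {X a b c : T}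
    (hα : interiorProd (k := 1) X α = 0) :
    wedge α β ![X, a, b, c] = wedge α (interiorProd (k := 1) X β) ![a, b, c] := by
  have h : ∀ u, α ![X, u] = 0 := fun u =>
    congrArg (fun θ : T [⋀^Fin 1]→L[ℝ] ℝ => θ ![u]) hα
  rw [wedge_two_two, wedge_two_one]
  simp only [Matrix.cons_val, interiorProd_two_apply, h]
  ring

/-- If `σ ∧ Ω` vanishes on all `(∂/∂v, ·, ·, ·)`, where `σ` is pulled back from the second factor,
then `ι_{∂/∂v} Ω = 0`. -/
lemma IsSU3Coframe.eq_zero_of_sigma_wedge_prod {E : Type*} [NormedAddCommGroup E]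
    [NormedSpace ℝ E] [FiniteDimensional ℝ E] {e : Fin 6 → (E →L[ℝ] ℝ)} {h : E →L[ℝ] E →L[ℝ] ℝ}
    {σ : E [⋀^Fin 2]→L[ℝ] ℝ} {ψp ψm : E [⋀^Fin 3]→L[ℝ] ℝ} (hE : Module.finrank ℝ E = 6)
    (he : IsSU3Coframe e h σ ψp ψm) {Ω : (ℝ × E) [⋀^Fin 2]→L[ℝ] ℝ}
    (hΩ : ∀ v : Fin 4 → ℝ × E, (v 0).2 = 0 →
      wedge (σ.compContinuousLinearMap (ContinuousLinearMap.snd ℝ ℝ E)) Ω v = 0) (w : ℝ × E) :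
    Ω ![((1 : ℝ), (0 : E)), w] = 0 := by
  have h1 : ∀ c : E, Ω ![((1 : ℝ), (0 : E)), ((0 : ℝ), c)] = 0 := by
    set β : E [⋀^Fin 1]→L[ℝ] ℝ := (interiorProd (k := 1) ((1 : ℝ), (0 : E))
      Ω).compContinuousLinearMap (ContinuousLinearMap.inr ℝ ℝ E) with hβ
    have hβ' : ∀ c : E, β ![c] = Ω ![((1 : ℝ), (0 : E)), ((0 : ℝ), c)] := by
      intro c
      refine congrArg Ω ?_
      funext i
      fin_cases i <;> rfl
    intro c
    rw [← hβ']
    refine he.eq_zero_of_sigma_wedge_one hE (fun a b c => ?_) c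
    have h2 := hΩ ![((1 : ℝ), (0 : E)), (0, a), (0, b), (0, c)] rfl
    rw [wedge_cons_of_interiorProd_eq_zero (interiorProd_comp_eq_zero _ rfl)] at h2
    have h3 : σ = (σ.compContinuousLinearMap
        (ContinuousLinearMap.snd ℝ ℝ E)).compContinuousLinearMap
          (ContinuousLinearMap.inr ℝ ℝ E) := rfl
    rw [h3, hβ, ← wedge_comp]
    have h6 : (⇑(ContinuousLinearMap.inr ℝ ℝ E) ∘ ![a, b, c])
        = ![((0 : ℝ), a), (0, b), (0, c)] := by
      funext i
      fin_cases i <;> rfl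
    rw [ContinuousAlternatingMap.compContinuousLinearMap_apply, h6]
    exact h2
  have h4 : Ω ![((1 : ℝ), (0 : E)), ((1 : ℝ), (0 : E))] = 0 :=
    Ω.map_eq_zero_of_eq _ (i := 0) (j := 1) rfl (by simp)
  set γ : (ℝ × E) →L[ℝ] ℝ := (ContinuousAlternatingMap.ofSubsingleton ℝ (ℝ × E) ℝ
    (0 : Fin 1)).symm (interiorProd (k := 1) ((1 : ℝ), (0 : E)) Ω) with hγ
  have hγ' : ∀ u : ℝ × E, γ u = Ω ![((1 : ℝ), (0 : E)), u] := fun u =>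
    congrArg (interiorProd (k := 1) ((1 : ℝ), (0 : E)) Ω) (Matrix.vec_single_eq_const u).symm
  have h5 : w = w.1 • ((1 : ℝ), (0 : E)) + (0, w.2) := by
    ext <;> simp
  rw [← hγ', h5, map_add, map_smul, hγ', hγ', h4, h1, smul_zero, add_zero]

end Contraction

section Box

variable {Y : Type*} [TopologicalSpace Y] [ChartedSpace (ModelProd ℝ E6) Y] [IsManifold I7 ∞ Y]
  {N : Type*} [TopologicalSpace N] [ChartedSpace E6 N] [IsManifold I6 ∞ N]

set_option linter.unusedSectionVars false

/-- The diffeomorphism `F` from an open subset of `O` to a product `(a, b) × W'` takes the vector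
field `V` to `∂/∂v` and the map `pr` to the projection to `W'`. -/
structure Straightens (F : OpenPartialHomeomorph Y (ℝ × N)) (O : Set Y) (V : VField I7 Y)
    (pr : Y → N) (a b : ℝ) (W' : Set N) : Prop where
  source_subset : F.source ⊆ O
  isOpen : IsOpen W'
  target_eq : F.target = Ioo a b ×ˢ W'
  smooth : ContMDiffOn I7 I7 ∞ F F.source
  smooth_symm : ContMDiffOn I7 I7 ∞ F.symm F.target
  snd_eq : ∀ z ∈ F.source, (F z).2 = pr z
  map_V : ∀ z ∈ F.source, mfderiv I7 I7 F z (V z) = modelField (F z)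

variable {F : OpenPartialHomeomorph Y (ℝ × N)} {O : Set Y} {V : VField I7 Y} {pr : Y → N} {a b : ℝ}
  {W' : Set N}

namespace Straightens

section Diffeo

variable (hF : Straightens F O V pr a b W')

include hF

lemma contMDiffAt {z : Y} (hz : z ∈ F.source) : ContMDiffAt I7 I7 ∞ F z :=
  (hF.smooth z hz).contMDiffAt (F.open_source.mem_nhds hz)

variable {q : ℝ × N} (hq : q ∈ Ioo a b ×ˢ W')

lemma box_mem_nhds {q : ℝ × N} (hq : q ∈ Ioo a b ×ˢ W') : Ioo a b ×ˢ W' ∈ 𝓝 q :=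
  (isOpen_Ioo.prod hF.isOpen).mem_nhds hq

include hq

lemma mem_target : q ∈ F.target := hF.target_eq ▸ hq

lemma symm_mem_source : F.symm q ∈ F.source := F.map_target (hF.mem_target hq)

lemma symm_mem : F.symm q ∈ O := hF.source_subset (hF.symm_mem_source hq)

lemma contMDiffAt_symm : ContMDiffAt I7 I7 ∞ F.symm q :=
  (hF.smooth_symm q (hF.mem_target hq)).contMDiffAt (F.open_target.mem_nhds (hF.mem_target hq))

lemma pr_symm : pr (F.symm q) = q.2 := by
  rw [← hF.snd_eq _ (hF.symm_mem_source hq), F.right_inv (hF.mem_target hq)]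

omit hq in
lemma mfderiv_symm_mfderiv {z : Y} (hz : z ∈ F.source) (u : ℝ × E6) :
    (mfderiv I7 I7 F.symm (F z) (mfderiv I7 I7 F z u) : ℝ × E6) = u := by
  have hFz : F z ∈ Ioo a b ×ˢ W' := hF.target_eq ▸ F.map_source hz
  have h1 := mfderiv_comp z ((hF.contMDiffAt_symm hFz).mdifferentiableAt (by simp))
    ((hF.contMDiffAt hz).mdifferentiableAt (by simp))
  have h2 : (F.symm ∘ F : Y → Y) =ᶠ[𝓝 z] id := by
    filter_upwards [F.open_source.mem_nhds hz] with z' hz'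
    exact F.left_inv hz'
  have h3 := (h2.mfderiv_eq (I := I7) (I' := I7)).trans mfderiv_id
  exact congrArg (fun L : (ℝ × E6) →L[ℝ] ℝ × E6 => L u) (h1.symm.trans h3)

lemma mfderiv_symm_modelField : mfderiv I7 I7 F.symm q (modelField q) = V (F.symm q) := by
  obtain ⟨z, hz, rfl⟩ : ∃ z ∈ F.source, F z = q :=
    ⟨F.symm q, hF.symm_mem_source hq, F.right_inv (hF.mem_target hq)⟩
  rw [← hF.map_V z hz, F.left_inv hz]
  exact hF.mfderiv_symm_mfderiv hz (V z)

lemma pullbackForm_symm_pr {m : ℕ} (α : DForm I6 N m) (hpr : ContMDiffAt I7 I6 ∞ pr (F.symm q)) :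
    pullbackForm I7 I7 F.symm (pullbackForm I7 I6 pr α) q
      = pullbackForm I7 I6 (Prod.snd : ℝ × N → N) α q := by
  rw [← pullbackForm_comp (hpr.mdifferentiableAt (by simp))
    ((hF.contMDiffAt_symm hq).mdifferentiableAt (by simp))]
  refine pullbackForm_congr ?_ α
  filter_upwards [hF.box_mem_nhds hq] with q' hq'
  exact hF.pr_symm hq'

omit hq in
lemma pullbackForm_pullbackForm_symm {m : ℕ} (α : DForm I7 Y m) {z : Y} (hz : z ∈ F.source) :
    pullbackForm I7 I7 F (pullbackForm I7 I7 F.symm α) z = α z := by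
  have hFz : F z ∈ Ioo a b ×ˢ W' := hF.target_eq ▸ F.map_source hz
  have h2 : (F.symm ∘ F : Y → Y) =ᶠ[𝓝 z] id := by
    filter_upwards [F.open_source.mem_nhds hz] with z' hz'
    exact F.left_inv hz'
  rw [← pullbackForm_comp ((hF.contMDiffAt_symm hFz).mdifferentiableAt (by simp))
    ((hF.contMDiffAt hz).mdifferentiableAt (by simp)), pullbackForm_congr h2, pullbackForm_id]

end Diffeo

variable {k : BForm I7 Y} {S : SU3Structure N} {W : Set N} {t : N → ℝ} {φ : DForm I7 Y 3}
  {χ : DForm I7 Y 4} (hF : Straightens F O V pr a b W') (hQ : S.IsG2QuotientOn W t O k φ χ V pr)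
  {q : ℝ × N} (hq : q ∈ Ioo a b ×ˢ W')

include hF hQ hq

lemma subset_base : q.2 ∈ W := by
  rw [← hF.pr_symm hq, ← hQ.image]
  exact mem_image_of_mem pr (hF.symm_mem hq)

lemma t_pos : 0 < t q.2 := by
  rw [← hF.pr_symm hq]
  exact hQ.t_pos (hF.symm_mem hq)

lemma contMDiffAt_t : ContMDiffAt I6 𝓘(ℝ, ℝ) ∞ t q.2 := by
  have h1 : ContMDiffAt I6 I7 ∞ (fun x : N => (q.1, x)) q.2 :=
    contMDiffAt_const.prodMk contMDiffAt_id
  have h2 := (hQ.contMDiffAt_t_pr (hF.symm_mem hq)).comp q.2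
    (ContMDiffAt.comp (g := F.symm) q.2 (hF.contMDiffAt_symm hq) h1)
  refine h2.congr_of_eventuallyEq ?_
  filter_upwards [hF.isOpen.mem_nhds hq.2] with x hx
  exact congrArg t (hF.pr_symm (q := (q.1, x)) ⟨hq.1, hx⟩).symm

omit hF hq in
lemma formSmoothAt_connectionForm {z : Y} (hz : z ∈ O) :
    FormSmoothAt I7 (fun z => oneForm (connectionForm k V z)) z :=
  _root_.formSmoothAt_connectionForm (hQ.torsionFree.smooth_k z hz) (hQ.smooth_V z hz)
    (hQ.metric_V_pos hz).ne'

lemma formSmoothAt_pullback :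
    FormSmoothAt I7 (pullbackForm I7 I7 F.symm fun z => oneForm (connectionForm k V z)) q :=
  formSmoothAt_pullbackForm (hF.contMDiffAt_symm hq)
    (formSmoothAt_connectionForm hQ (hF.symm_mem hq))

lemma pullback_connectionForm_modelField :
    pullbackForm I7 I7 F.symm (fun z => oneForm (connectionForm k V z)) q ![modelField q] = 1 := by
  refine Eq.trans ?_ (hQ.connectionForm_V (hF.symm_mem hq))
  exact congrArg (connectionForm k V (F.symm q)) (hF.mfderiv_symm_modelField hq)

lemma pullback_phi : pullbackForm I7 I7 F.symm φ q
    = wedge (pullbackForm I7 I6 (Prod.snd : ℝ × N → N) S.σ q)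
        (pullbackForm I7 I7 F.symm (fun z => oneForm (connectionForm k V z)) q)
      + t q.2 ^ (3 / 2 : ℝ) • pullbackForm I7 I6 (Prod.snd : ℝ × N → N) S.ψp q := by
  have hO := hF.symm_mem hq
  have hpr := hQ.contMDiffAt_pr hO
  rw [← hF.pullbackForm_symm_pr hq S.σ hpr, ← hF.pullbackForm_symm_pr hq S.ψp hpr]
  have h1 := hQ.phi_eq hO
  rw [hF.pr_symm hq] at h1
  unfold pullbackForm at h1 ⊢
  rw [h1]
  rfl

lemma pullback_chi : pullbackForm I7 I7 F.symm χ q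
    = t q.2 ^ (1 / 2 : ℝ) • wedge (pullbackForm I7 I6 (Prod.snd : ℝ × N → N) S.ψm q)
        (pullbackForm I7 I7 F.symm (fun z => oneForm (connectionForm k V z)) q)
      + (1 / 2 * t q.2 ^ 2 : ℝ) • wedge (pullbackForm I7 I6 (Prod.snd : ℝ × N → N) S.σ q)
        (pullbackForm I7 I6 (Prod.snd : ℝ × N → N) S.σ q) := by
  have hO := hF.symm_mem hq
  have hpr := hQ.contMDiffAt_pr hO
  rw [← hF.pullbackForm_symm_pr hq S.σ hpr, ← hF.pullbackForm_symm_pr hq S.ψm hpr]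
  have h1 := hQ.chi_eq hO
  rw [hF.pr_symm hq] at h1
  unfold pullbackForm at h1 ⊢
  rw [h1]
  rfl

lemma extD_pullback_phi : extD I7 (pullbackForm I7 I7 F.symm φ) q = 0 := by
  have hO := hF.symm_mem hq
  rw [extD_pullbackForm (hF.contMDiffAt_symm hq) (hQ.torsionFree.smooth_φ _ hO)]
  unfold pullbackForm
  rw [hQ.torsionFree.closed _ hO]; rfl

lemma extD_pullback_chi : extD I7 (pullbackForm I7 I7 F.symm χ) q = 0 := by
  have hO := hF.symm_mem hq
  rw [extD_pullbackForm (hF.contMDiffAt_symm hq) (hQ.torsionFree.smooth_χ _ hO)]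
  unfold pullbackForm
  rw [hQ.torsionFree.coclosed _ hO]; rfl

/-- The curvature of the connection form is horizontal: contracting `dφ = 0` with `∂/∂v` gives
`σ ∧ ι_{∂/∂v} dη = 0`. -/
lemma extD_connectionForm_modelField (hσ : ∀ x, extD I6 S.σ x = 0) (w : TangentSpace I7 q) :
    extD I7 (pullbackForm I7 I7 F.symm fun z => oneForm (connectionForm k V z)) q
      ![modelField q, w] = 0 := by
  set Θ := pullbackForm I7 I7 F.symm fun z => oneForm (connectionForm k V z) with hΘ
  have ht := hF.contMDiffAt_t hQ hq
  have hpos := hF.t_pos hQ hq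
  have hsnd : ContMDiffAt I7 I6 ∞ (Prod.snd : ℝ × N → N) q := contMDiffAt_snd
  have hΘs : FormSmoothAt I7 Θ q := hF.formSmoothAt_pullback hQ hq
  have hs : FormSmoothAt I7 (pullbackForm I7 I6 (Prod.snd : ℝ × N → N) S.σ) q :=
    formSmoothAt_pullbackForm hsnd (S.smooth_σ _)
  have hp : FormSmoothAt I6 (fun x => t x ^ (3 / 2 : ℝ) • S.ψp x) q.2 :=
    formSmoothAt_smul (contMDiffAt_rpow ht hpos _) (S.smooth_ψp _)
  have h0 : pullbackForm I7 I6 (Prod.snd : ℝ × N → N) (extD I6 S.σ) q = 0 := by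
    unfold pullbackForm
    rw [hσ]; rfl
  have h1 := extD_add (I := I7) (x := q) (formSmoothAt_wedge hs hΘs)
    (formSmoothAt_pullbackForm hsnd hp)
  have h2 : extD I7 (fun y => wedge (pullbackForm I7 I6 (Prod.snd : ℝ × N → N) S.σ y) (Θ y)
      + pullbackForm I7 I6 (Prod.snd : ℝ × N → N) (fun x => t x ^ (3 / 2 : ℝ) • S.ψp x) y) q
      = 0 := by
    rw [← hF.extD_pullback_phi hQ hq]
    refine extD_congr ?_
    filter_upwards [hF.box_mem_nhds hq] with q' hq'
    exact (hF.pullback_phi hQ hq').symm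
  rw [h1] at h2
  set dΘ : (ℝ × E6) [⋀^Fin 2]→L[ℝ] ℝ := extD I7 Θ q with hdΘ
  have h3 : ∀ v : Fin 4 → ℝ × E6, (v 0).2 = 0 → wedge (p := 2) (q := 2)
      (pullbackForm I7 I6 (Prod.snd : ℝ × N → N) S.σ q : (ℝ × E6) [⋀^Fin 2]→L[ℝ] ℝ) dΘ v = 0 := by
    intro v hv
    have h4 := congrArg (fun θ : (ℝ × E6) [⋀^Fin 4]→L[ℝ] ℝ => θ v) h2
    have h5 : pullbackForm I7 I6 (Prod.snd : ℝ × N → N)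
        (extD I6 (fun x => t x ^ (3 / 2 : ℝ) • S.ψp x)) q v = 0 :=
      (extD I6 (fun x => t x ^ (3 / 2 : ℝ) • S.ψp x) q.2).map_coord_zero (0 : Fin 4)
        ((mfderiv_snd_apply q (v 0)).trans hv)
    have h6 := extD_wedge_two_one hs hΘs v
    rw [extD_pullbackForm hsnd (S.smooth_σ _), h0, wedge_zero_left] at h6
    rw [← extD_pullbackForm hsnd hp] at h5
    have h7 := (congrArg₂ (fun a b : ℝ => a + b) h6 h5).symm.trans h4
    have alg : ∀ r s : ℝ, r = 0 → (r + s) + 0 = 0 → s = 0 := fun r s h h' => by linarith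
    exact alg _ _ rfl h7
  obtain ⟨e, he⟩ := S.coframe q.2
  have hcomp : (pullbackForm I7 I6 (Prod.snd : ℝ × N → N) S.σ q : (ℝ × E6) [⋀^Fin 2]→L[ℝ] ℝ)
      = (show E6 [⋀^Fin 2]→L[ℝ] ℝ from S.σ q.2).compContinuousLinearMap
        (ContinuousLinearMap.snd ℝ ℝ E6) := by
    refine ContinuousAlternatingMap.ext fun v => congrArg (S.σ q.2) ?_
    exact funext fun i => mfderiv_snd_apply q (v i)
  rw [hcomp] at h3
  exact IsSU3Coframe.eq_zero_of_sigma_wedge_prod (E := E6) finrank_E6 he h3 w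

end Straightens

end Box

/-! ### Structure equations of the connection form on the base -/

section DD

variable {E : Type*} [NormedAddCommGroup E] [NormedSpace ℝ E]
  {H : Type*} [TopologicalSpace H] {I : ModelWithCorners ℝ E H} [I.Boundaryless]
  {M : Type*} [TopologicalSpace M] [ChartedSpace H M] [IsManifold I ∞ M]

/-- `d² = 0` on a manifold. -/
lemma extD_extD {k : ℕ} {α : DForm I M k} {x : M} (hα : ∀ᶠ y in 𝓝 x, FormSmoothAt I α y) :
    extD I (extD I α) x = 0 := by
  have : IsManifold I 1 M := IsManifold.of_le (m := 1) (n := ∞) (by simp)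
  have h1 : formInChart I (extD I α) x =ᶠ[𝓝 (extChartAt I x x)] extDeriv (formInChart I α x) := by
    filter_upwards [eventually_inChart hα, eventually_mem_target (I := I) x] with z hz hz'
    exact formInChart_extD hz' hz
  rw [extD_eq, h1.extDeriv_eq]
  exact extDeriv_extDeriv_apply (r := ∞) hα.self_of_nhds
    (by rw [minSmoothness_of_isRCLikeNormedField]
        exact WithTop.coe_le_coe.2 (le_top : (2 : ℕ∞) ≤ ⊤))

end DD

section Contraction

variable {T : Type*} [AddCommGroup T] [Module ℝ T] [TopologicalSpace T]

lemma wedge_four_one_cons {α : T [⋀^Fin 4]→L[ℝ] ℝ} {γ : T [⋀^Fin 1]→L[ℝ] ℝ} {X : T}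
    (hα : ∀ a b c, α ![X, a, b, c] = 0) (hγ : γ ![X] = 1) (a b c d : T) :
    wedge α γ ![X, a, b, c, d] = α ![a, b, c, d] := by
  rw [wedge_four_one]
  simp only [Matrix.cons_val, hα, hγ]
  ring

end Contraction

section NormalForm

variable {Y : Type*} [TopologicalSpace Y] [ChartedSpace (ModelProd ℝ E6) Y] [IsManifold I7 ∞ Y]
  {N : Type*} [TopologicalSpace N] [ChartedSpace E6 N] [IsManifold I6 ∞ N]

set_option linter.unusedSectionVars false

/-- The 1-form `η_N` on the base: the restriction to the slice `v = v₀` of the connection form in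
straightened coordinates. -/
noncomputable def baseConnection (F : OpenPartialHomeomorph Y (ℝ × N)) (k : BForm I7 Y)
    (V : VField I7 Y) (v₀ : ℝ) : DForm I6 N 1 :=
  pullbackForm I6 I7 (fun x => (v₀, x))
    (pullbackForm I7 I7 F.symm fun z => oneForm (connectionForm k V z))

variable {F : OpenPartialHomeomorph Y (ℝ × N)} {O : Set Y} {V : VField I7 Y} {pr : Y → N} {a b : ℝ}
  {W' : Set N} {k : BForm I7 Y} {S : SU3Structure N} {W : Set N} {t : N → ℝ} {φ : DForm I7 Y 3}
  {χ : DForm I7 Y 4} (hF : Straightens F O V pr a b W') (hQ : S.IsG2QuotientOn W t O k φ χ V pr)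
  (hS : S.IsKaehler) {v₀ : ℝ} (hv₀ : v₀ ∈ Ioo a b)

namespace Straightens

section

variable {q : ℝ × N} (hq : q ∈ Ioo a b ×ˢ W')

include hF hQ hS hv₀ hq

/-- In straightened coordinates, the connection form is `dv + η_N`. -/
lemma pullback_connectionForm :
    pullbackForm I7 I7 F.symm (fun z => oneForm (connectionForm k V z)) q
      = modelEta (baseConnection F k V v₀) q :=
  eq_modelEta hF.isOpen (fun _ hq => hF.formSmoothAt_pullback hQ hq)
    (fun _ hq => hF.pullback_connectionForm_modelField hQ hq)
    (fun _ hq => hF.extD_connectionForm_modelField hQ hq hS.1) hv₀ hq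

lemma modelPhi_eq : modelPhi S t (baseConnection F k V v₀) q = pullbackForm I7 I7 F.symm φ q := by
  rw [hF.pullback_phi hQ hq, hF.pullback_connectionForm hQ hS hv₀ hq]
  rfl

lemma modelStarPhi_eq :
    modelStarPhi S t (baseConnection F k V v₀) q = pullbackForm I7 I7 F.symm χ q := by
  rw [hF.pullback_chi hQ hq, hF.pullback_connectionForm hQ hS hv₀ hq]
  rfl

/-- In straightened coordinates `φ` is the explicit form, so the latter is closed. -/
lemma extD_modelPhi_eq_zero : extD I7 (modelPhi S t (baseConnection F k V v₀)) q = 0 := by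
  rw [← hF.extD_pullback_phi hQ hq]
  refine extD_congr ?_
  filter_upwards [hF.box_mem_nhds hq] with q' hq'
  exact hF.modelPhi_eq hQ hS hv₀ hq'

lemma extD_modelStarPhi_eq_zero : extD I7 (modelStarPhi S t (baseConnection F k V v₀)) q = 0 := by
  rw [← hF.extD_pullback_chi hQ hq]
  refine extD_congr ?_
  filter_upwards [hF.box_mem_nhds hq] with q' hq'
  exact hF.modelStarPhi_eq hQ hS hv₀ hq'

end

section

variable {x : N} (hx : x ∈ W')

include hF hQ hv₀ hx

lemma formSmoothAt_baseConnection : FormSmoothAt I6 (baseConnection F k V v₀) x :=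
  formSmoothAt_pullbackForm (f := fun x : N => (v₀, x)) (contMDiffAt_const.prodMk contMDiffAt_id)
    (hF.formSmoothAt_pullback hQ (q := (v₀, x)) ⟨hv₀, hx⟩)

include hS

set_option maxRecDepth 4000 in
/-- Contraction of `d*φ = 0` with `∂/∂v` shows that `t^{1/2} ψ⁻` is closed. -/
lemma extD_psiMinus : extD I6 (fun y => t y ^ (1 / 2 : ℝ) • S.ψm y) x = 0 := by
  have hq : ((v₀, x) : ℝ × N) ∈ Ioo a b ×ˢ W' := ⟨hv₀, hx⟩
  have ht := hF.contMDiffAt_t hQ hq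
  have hpos := hF.t_pos hQ hq
  have hη := hF.formSmoothAt_baseConnection hQ hv₀ hx
  suffices key : ∀ v : Fin 4 → E6, extD I6 (fun y => t y ^ (1 / 2 : ℝ) • S.ψm y) x v = 0 from
    form_ext_iff_zero.2 key
  intro v
  have h1 := (extD_modelStarPhi (y := (v₀, x)) ht hpos hη
    ![((1 : ℝ), (0 : E6)), (0, v 0), (0, v 1), (0, v 2), (0, v 3)]).symm.trans
    (congrArg (fun θ : (ℝ × E6) [⋀^Fin 5]→L[ℝ] ℝ =>
      θ ![((1 : ℝ), (0 : E6)), (0, v 0), (0, v 1), (0, v 2), (0, v 3)])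
      (hF.extD_modelStarPhi_eq_zero hQ hS hv₀ hq))
  set A : DForm I6 N 4 := extD I6 fun y => t y ^ (1 / 2 : ℝ) • S.ψm y with hA
  have h2 : wedge (p := 3) (q := 2) (t x ^ (1 / 2 : ℝ) • S.ψm x)
      (extD I6 (baseConnection F k V v₀) x) ![(0 : E6), v 0, v 1, v 2, v 3] = 0 :=
    ContinuousAlternatingMap.map_coord_zero _ (0 : Fin 5) rfl
  have h3 : extD I6 (fun x => (1 / 2 * t x ^ 2 : ℝ) • wedge (S.σ x) (S.σ x)) x
      ![(0 : E6), v 0, v 1, v 2, v 3] = 0 :=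
    ContinuousAlternatingMap.map_coord_zero _ (0 : Fin 5) rfl
  have h4 := wedge_four_one_cons (T := ℝ × E6)
    (α := pullbackForm I7 I6 (Prod.snd : ℝ × N → N) A (v₀, x))
    (γ := modelEta (baseConnection F k V v₀) (v₀, x)) (X := ((1 : ℝ), (0 : E6)))
    (fun u₁ u₂ u₃ => (A x).map_coord_zero (0 : Fin 4) (mfderiv_snd_modelField (v₀, x)))
    (modelCovector_modelField (baseConnection F k V v₀) (v₀, x))
    ((0 : ℝ), v 0) (0, v 1) (0, v 2) (0, v 3)
  have h5 : pullbackForm I7 I6 (Prod.snd : ℝ × N → N) A (v₀, x)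
      ![((0 : ℝ), v 0), (0, v 1), (0, v 2), (0, v 3)] = A x v := by
    refine congrArg (A x) ?_
    funext i
    refine (mfderiv_snd_apply (v₀, x) _).trans ?_
    fin_cases i <;> rfl
  have hV : (fun i => ((![((1 : ℝ), (0 : E6)), (0, v 0), (0, v 1), (0, v 2), (0, v 3)] :
      Fin 5 → ℝ × E6) i).2) = ![(0 : E6), v 0, v 1, v 2, v 3] := by
    funext i
    fin_cases i <;> rfl
  rw [hV] at h1
  have alg : ∀ r r' s u : ℝ, s = 0 → u = 0 → r = r' → r - s + u = 0 → r' = 0 :=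
    fun r r' s u hs hu hr h => by rw [← hr, ← h, hs, hu]; ring
  exact alg _ _ _ _ h2 h3 (h4.trans h5) h1

lemma extD_psiPlus : extD I6 (fun y => t y ^ (1 / 2 : ℝ) • S.ψp y) x = 0 := by
  have hq : ((v₀, x) : ℝ × N) ∈ Ioo a b ×ˢ W' := ⟨hv₀, hx⟩
  exact hS.extD_smul_psiPlus (contMDiffAt_rpow (hF.contMDiffAt_t hQ hq) (hF.t_pos hQ hq) _)
    (hF.extD_psiMinus hQ hS hv₀ hx)

/-- The horizontal part of `dφ = 0` is `σ ∧ (dη_N + t^{1/2} ι_U ψ⁺) = 0`, and `σ ∧ ·` is injective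
on 2-forms. -/
lemma extD_baseConnection : extD I6 (baseConnection F k V v₀) x
    = -(t x ^ (1 / 2 : ℝ) • interiorProd (S.hamField (fun y => -t y) x) (S.ψp x)) := by
  have hq : ((v₀, x) : ℝ × N) ∈ Ioo a b ×ˢ W' := ⟨hv₀, hx⟩
  have ht := hF.contMDiffAt_t hQ hq
  have hpos := hF.t_pos hQ hq
  have hη := hF.formSmoothAt_baseConnection hQ hv₀ hx
  have hpos' : ∀ᶠ y in 𝓝 x, 0 < t y := by
    filter_upwards [hF.isOpen.mem_nhds hx] with y hy
    exact hF.t_pos hQ (q := (v₀, y)) ⟨hv₀, hy⟩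
  have hU : interiorProd (k := 1) (S.hamField (fun y => -t y) x) (S.σ x)
      = -oneForm (dfun I6 t x) := by
    have h2 : dfun I6 (fun y => -t y) x = (-1 : ℝ) • dfun I6 t x :=
      dfun_comp (hasDerivAt_neg (t x)) ht
    rw [S.interiorProd_hamField, h2, ← neg_one_smul ℝ (oneForm (dfun I6 t x))]
    rfl
  obtain ⟨e, he⟩ := S.coframe x
  set G : E6 [⋀^Fin 2]→L[ℝ] ℝ := t x ^ (1 / 2 : ℝ) •
    interiorProd (k := 2) (S.hamField (fun y => -t y) x) (S.ψp x) with hG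
  set D : E6 [⋀^Fin 2]→L[ℝ] ℝ := extD I6 (baseConnection F k V v₀) x with hD
  have key : D + G = 0 := by
    refine IsSU3Coframe.eq_zero_of_sigma_wedge (E := E6) finrank_E6 he ?_
    refine form_ext_iff_zero.2 fun v => ?_
    refine (congrArg (fun θ : E6 [⋀^Fin 4]→L[ℝ] ℝ => θ v)
      (wedge_add_right (show E6 [⋀^Fin 2]→L[ℝ] ℝ from S.σ x) D G)).trans ?_
    have h1 := (extD_modelPhi (y := (v₀, x)) hS.1 ht hpos hη fun i => ((0 : ℝ), v i)).symm.trans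
      (congrArg (fun θ : (ℝ × E6) [⋀^Fin 4]→L[ℝ] ℝ => θ fun i => ((0 : ℝ), v i))
        (hF.extD_modelPhi_eq_zero hQ hS hv₀ hq))
    have h2 := extD_rpow_smul_psiPlus ht hpos' (hF.extD_psiPlus hQ hS hv₀ hx) hU v
    have h3 : wedge (p := 2) (q := 2) (S.σ x) G v
        = t x ^ (1 / 2 : ℝ) * wedge (p := 2) (q := 2) (S.σ x)
          (interiorProd (k := 2) (S.hamField (fun y => -t y) x) (S.ψp x)) v := by
      rw [hG]
      exact congrArg (fun θ : E6 [⋀^Fin 4]→L[ℝ] ℝ => θ v) (wedge_smul_right (t x ^ (1 / 2 : ℝ))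
        (show E6 [⋀^Fin 2]→L[ℝ] ℝ from S.σ x)
        (interiorProd (k := 2) (S.hamField (fun y => -t y) x) (S.ψp x)))
    exact (congrArg (fun r : ℝ => wedge (p := 2) (q := 2) (S.σ x) D v + r)
      (h3.trans h2.symm)).trans h1
  exact eq_neg_of_add_eq_zero_left key

/-- The form `t^{1/2} ι_U ψ⁺ = -dη_N` is closed. -/
lemma extD_smul_interiorProd : extD I6 (fun y => t y ^ (1 / 2 : ℝ) •
    interiorProd (S.hamField (fun y => -t y) y) (S.ψp y)) x = 0 := by
  have h1 : ∀ᶠ y in 𝓝 x, FormSmoothAt I6 (baseConnection F k V v₀) y := by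
    filter_upwards [hF.isOpen.mem_nhds hx] with y hy
    exact hF.formSmoothAt_baseConnection hQ hv₀ hy
  have h2 := extD_neg (I := I6) (extD I6 (baseConnection F k V v₀)) x
  rw [extD_extD h1, neg_zero] at h2
  rw [← h2]
  refine extD_congr ?_
  filter_upwards [hF.isOpen.mem_nhds hx] with y hy
  rw [hF.extD_baseConnection hQ hS hv₀ hy, neg_neg]

end

end Straightens

end NormalForm

/-! ### The normal form of a quotient -/

section Conclusion

variable {Y : Type*} [TopologicalSpace Y] [ChartedSpace (ModelProd ℝ E6) Y] [IsManifold I7 ∞ Y]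
  {N : Type*} [TopologicalSpace N] [ChartedSpace E6 N] [IsManifold I6 ∞ N]
  {F : OpenPartialHomeomorph Y (ℝ × N)} {O : Set Y} {V : VField I7 Y} {pr : Y → N} {a b : ℝ}
  {W' : Set N} {k : BForm I7 Y} {S : SU3Structure N} {W : Set N} {t : N → ℝ} {φ : DForm I7 Y 3}
  {χ : DForm I7 Y 4}

lemma SU3Structure.IsG2QuotientOn.exists_straightens (hQ : S.IsG2QuotientOn W t O k φ χ V pr)
    {y : Y} (hy : y ∈ O) : ∃ (F : OpenPartialHomeomorph Y (ℝ × N)) (a b : ℝ) (W' : Set N),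
      y ∈ F.source ∧ Straightens F O V pr a b W' := by
  obtain ⟨F, a, b, W', h1, h2, h3, h4, h5, h6, h7⟩ := hQ.exists_box hy
  exact ⟨F, a, b, W', h1, h2, h3, h4, h5, h6, fun z hz => (h7 z hz).1, fun z hz => (h7 z hz).2⟩

/-- The metric in straightened coordinates is the explicit one. -/
lemma Straightens.metric_eq (hF : Straightens F O V pr a b W')
    (hQ : S.IsG2QuotientOn W t O k φ χ V pr) (hS : S.IsKaehler) {v₀ : ℝ} (hv₀ : v₀ ∈ Ioo a b)
    {z : Y} (hz : z ∈ F.source) (u v : TangentSpace I7 z) :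
    k z u v = modelMetric S t (baseConnection F k V v₀) (F z) (mfderiv I7 I7 F z u)
      (mfderiv I7 I7 F z v) := by
  have hFz : F z ∈ Ioo a b ×ˢ W' := hF.target_eq ▸ F.map_source hz
  have hη : ∀ u : ℝ × E6, modelCovector (baseConnection F k V v₀) (F z) (mfderiv I7 I7 F z u)
      = connectionForm k V z u := by
    intro u
    have h1 := hF.pullbackForm_pullbackForm_symm (fun z => oneForm (connectionForm k V z)) hz
    have h2 := hF.pullback_connectionForm hQ hS hv₀ hFz
    have h3 := congrArg (fun θ : (ℝ × E6) [⋀^Fin 1]→L[ℝ] ℝ => θ ![u]) h1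
    refine Eq.trans ?_ h3
    rw [← oneForm_modelCovector] at h2
    exact congrArg (fun θ : (ℝ × E6) [⋀^Fin 1]→L[ℝ] ℝ =>
      θ fun _ => (mfderiv I7 I7 F z u : ℝ × E6)) h2.symm
  have hp : ∀ u : ℝ × E6, (mfderiv I7 I6 (Prod.snd : ℝ × N → N) (F z) (mfderiv I7 I7 F z u) : E6)
      = mfderiv I7 I6 pr z u := by
    intro u
    have h1 := mfderiv_comp z ((contMDiffAt_snd (n := ∞)).mdifferentiableAt (by simp) :
      MDifferentiableAt I7 I6 (Prod.snd : ℝ × N → N) (F z))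
      ((hF.contMDiffAt hz).mdifferentiableAt (by simp))
    have h2 : (Prod.snd ∘ F : Y → N) =ᶠ[𝓝 z] pr := by
      filter_upwards [F.open_source.mem_nhds hz] with z' hz'
      exact hF.snd_eq z' hz'
    have h3 := h1.symm.trans (h2.mfderiv_eq (I := I7) (I' := I6))
    exact congrArg (fun L : (ℝ × E6) →L[ℝ] E6 => L u) h3
  have gen : ∀ (x : N) (c d c' d' : E6) (r s r' s' : ℝ), x = pr z → c = c' → d = d' → r = r' →
      s = s' → t (pr z) * S.h.inner (pr z) c' d' + (t (pr z) ^ 2)⁻¹ * (r' * s')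
        = t x * S.h.inner x c d + (t x ^ 2)⁻¹ * (r * s) := by
    rintro x c d c' d' r s r' s' rfl rfl rfl rfl rfl
    rfl
  rw [hQ.k_eq z (hF.source_subset hz), modelMetric_apply]
  exact gen _ _ _ _ _ _ _ _ _ (hF.snd_eq z hz) (hp u) (hp v) (hη u) (hη v)

/-- A quotient presentation is locally the explicit structure on a product. -/
lemma Straightens.hasNormalFormAt (hF : Straightens F O V pr a b W')
    (hQ : S.IsG2QuotientOn W t O k φ χ V pr) (hS : S.IsKaehler) {y : Y} (hy : y ∈ F.source) :
    S.HasNormalFormAt t (S.hamField fun x => -t x) O k φ χ V pr y := by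
  have hFy : F y ∈ Ioo a b ×ˢ W' := hF.target_eq ▸ F.map_source hy
  have hv₀ := hFy.1
  refine ⟨F, a, b, W', baseConnection F k V (F y).1, hy, hF.source_subset, hF.isOpen, hF.target_eq,
    hF.smooth, hF.smooth_symm, fun x hx => ⟨hF.formSmoothAt_baseConnection hQ hv₀ hx,
      hF.extD_baseConnection hQ hS hv₀ hx⟩, fun z hz => ?_⟩
  have hFz : F z ∈ Ioo a b ×ˢ W' := hF.target_eq ▸ F.map_source hz
  refine ⟨hF.snd_eq z hz, hF.map_V z hz, hF.metric_eq hQ hS hv₀ hz, ?_, ?_⟩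
  · rw [← hF.pullbackForm_pullbackForm_symm φ hz]
    exact congrArg (fun θ : (ℝ × E6) [⋀^Fin 3]→L[ℝ] ℝ => θ.compContinuousLinearMap
      (mfderiv I7 I7 F z : (ℝ × E6) →L[ℝ] ℝ × E6)) (hF.modelPhi_eq hQ hS hv₀ hFz).symm
  · rw [← hF.pullbackForm_pullbackForm_symm χ hz]
    exact congrArg (fun θ : (ℝ × E6) [⋀^Fin 4]→L[ℝ] ℝ => θ.compContinuousLinearMap
      (mfderiv I7 I7 F z : (ℝ × E6) →L[ℝ] ℝ × E6)) (hF.modelStarPhi_eq hQ hS hv₀ hFz).symm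

/-- At every point of the base of a quotient presentation, `t` is smooth and positive, and the two
forms `t^{1/2} ψ⁻` and `t^{1/2} ι_U ψ⁺` are closed. -/
lemma SU3Structure.IsG2QuotientOn.closed_at (hQ : S.IsG2QuotientOn W t O k φ χ V pr)
    (hS : S.IsKaehler) {x : N} (hx : x ∈ W) :
    W ∈ 𝓝 x ∧ ContMDiffAt I6 𝓘(ℝ, ℝ) ∞ t x ∧ 0 < t x ∧
      extD I6 (fun y => t y ^ (1 / 2 : ℝ) • S.ψm y) x = 0 ∧
      extD I6 (fun y => t y ^ (1 / 2 : ℝ) •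
        interiorProd (S.hamField (fun y => -t y) y) (S.ψp y)) x = 0 := by
  obtain ⟨y, hy, rfl⟩ := hQ.image.symm ▸ hx
  obtain ⟨F, a, b, W', hyF, hF⟩ := hQ.exists_straightens hy
  have hFy : F y ∈ Ioo a b ×ˢ W' := hF.target_eq ▸ F.map_source hyF
  have hp : pr y ∈ W' := hF.snd_eq y hyF ▸ hFy.2
  have hq : ((F y).1, pr y) ∈ Ioo a b ×ˢ W' := ⟨hFy.1, hp⟩
  refine ⟨Filter.mem_of_superset (hF.isOpen.mem_nhds hp) fun x' hx' => ?_, hF.contMDiffAt_t hQ hq,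
    hF.t_pos hQ hq, hF.extD_psiMinus hQ hS hFy.1 hp, hF.extD_smul_interiorProd hQ hS hFy.1 hp⟩
  exact hF.subset_base hQ (q := ((F y).1, x')) ⟨hFy.1, hx'⟩

end Conclusion

theorem proposition1 {N : Type u} [TopologicalSpace N] [T2Space N] [SecondCountableTopology N]
    [ChartedSpace E6 N] [IsManifold I6 ∞ N] (S : SU3Structure N) (hS : S.IsKaehler) :
    -- the criterion, on `N` and on every open subset of `N`
    (∀ (W : Set N) (t : N → ℝ), IsOpen W →
      (S.IsLocallyG2Quotient W t ↔ ∃ U : VField I6 N, S.CriterionOn W t U)) ∧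
    -- every quotient presentation satisfies the conditions and is locally the explicit one
    (∀ (W : Set N) (t : N → ℝ) (Y : Type w) [TopologicalSpace Y] [T2Space Y]
      [SecondCountableTopology Y] [ChartedSpace (ModelProd ℝ E6) Y] [IsManifold I7 ∞ Y]
      (O : Set Y) (k : BForm I7 Y) (φ : DForm I7 Y 3) (χ : DForm I7 Y 4) (V : VField I7 Y)
      (pr : Y → N), S.IsG2QuotientOn W t O k φ χ V pr →
        ∃ U : VField I6 N, S.CriterionOn W t U ∧
          ∀ y ∈ O, S.HasNormalFormAt t U O k φ χ V pr y) ∧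
    -- the explicit structure exists locally and is a quotient presentation
    (∀ (W : Set N) (t : N → ℝ) (U : VField I6 N), IsOpen W → S.CriterionOn W t U →
      (∀ p ∈ W, ∃ W' : Set N, IsOpen W' ∧ p ∈ W' ∧ W' ⊆ W ∧
        ∃ ηN : DForm I6 N 1, S.IsConnectionOn t ηN W' U) ∧
      ∀ (W' : Set N) (ηN : DForm I6 N 1), IsOpen W' → W' ⊆ W → S.IsConnectionOn t ηN W' U →
        S.IsG2QuotientOn W' t (univ ×ˢ W' : Set (ℝ × N)) (modelMetric S t ηN) (modelPhi S t ηN)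
          (modelStarPhi S t ηN) modelField Prod.snd) := by
  refine ⟨fun W t hW => ⟨fun h => ⟨S.hamField fun x => -t x, ?_⟩, ?_⟩, ?_, ?_⟩
  · have key : ∀ x ∈ W, ContMDiffAt I6 𝓘(ℝ, ℝ) ∞ t x ∧ 0 < t x ∧
        extD I6 (fun y => t y ^ (1 / 2 : ℝ) • S.ψm y) x = 0 ∧
        extD I6 (fun y => t y ^ (1 / 2 : ℝ) •
          interiorProd (S.hamField (fun y => -t y) y) (S.ψp y)) x = 0 := by
      intro x hx
      obtain ⟨W', -, hxW', -, Y, _, _, _, _, _, O, k, φ, χ, V, pr, hQ⟩ := h x hx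
      exact (hQ.closed_at hS hxW').2
    exact hS.criterionOn hW (fun x hx => (key x hx).1.contMDiffWithinAt)
      (fun x hx => (key x hx).2.1) (fun x hx => (key x hx).2.2.1) (fun x hx => (key x hx).2.2.2)
  · rintro ⟨U, hU⟩ p hp
    obtain ⟨W', hW', hpW', hWW', ηN, hη⟩ := hU.exists_isConnectionOn hW hp
    exact ⟨W', hW', hpW', hWW', ℝ × N, inferInstance, inferInstance, inferInstance, inferInstance,
      inferInstance, _, _, _, _, _, _, hU.isG2QuotientOn_model hS.1 hW hW' hWW' hη⟩
  · intro W t Y _ _ _ _ _ O k φ χ V pr hQ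
    have hW : IsOpen W := isOpen_iff_mem_nhds.2 fun x hx => (hQ.closed_at hS hx).1
    refine ⟨S.hamField fun x => -t x,
      hS.criterionOn hW (fun x hx => (hQ.closed_at hS hx).2.1.contMDiffWithinAt)
        (fun x hx => (hQ.closed_at hS hx).2.2.1) (fun x hx => (hQ.closed_at hS hx).2.2.2.1)
        (fun x hx => (hQ.closed_at hS hx).2.2.2.2), fun y hy => ?_⟩
    obtain ⟨F, a, b, W', hyF, hF⟩ := hQ.exists_straightens hy
    exact hF.hasNormalFormAt hQ hS hyF
  · intro W t U hW hU
    exact ⟨fun p hp => hU.exists_isConnectionOn hW hp, fun W' ηN hW' hWW' hη =>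
      hU.isG2QuotientOn_model hS.1 hW hW' hWW' hη⟩
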